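/- **Setting.** For $f:\mathbb R\to\mathbb C$ let $\mathbb Hf(\alpha)=\frac1{\pi i}\,\mathrm{p.v.}\!\int\frac{f(\beta)}{\alpha-\beta}\,d\beta$, $\mathbb P_H=\frac12(I+\mathbb H)$; write $f_\alpha=\partial_\alpha f$, $[f,\mathbb H]g=f\,\mathbb Hg-\mathbb H(fg)$, and $f\in C^\infty(I;H^\infty)$ if $f$ is smooth on $I\times\mathbb R$ and all its derivatives $\partial_t^k\partial_\alpha^mf(t,\cdot)$ are bounded in $L^2(\mathbb R)$ locally uniformly for $t\in I$, $I$ an open set of times. Let $(Z,Z_t,\psi)$ be a smooth decaying solution for $t\in I$ of the two-dimensional infinite depth gravity water wave system in the Riemann mapping variable $\alpha$: $Z$ is the interface, $Z_t$ the velocity of the fluid particles on it, $\psi$ the (real) trace of the velocity potential, $Z-\alpha,\ Z_t,\ \psi\in C^\infty(I;H^\infty)$, $Z_\alpha\neq0$, and with $$b=\Re(I-\mathbb H)\Big(\frac{Z_t}{Z_\alpha}\Big),\qquad A_1=1-\Im[Z_t,\mathbb H]\partial_\alpha\bar Z_t,\qquad D_t=\partial_t+b\,\partial_\alpha,$$ $$Z_t=D_tZ,\qquad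 \overline{D_tZ_t}-i=-i\frac{A_1}{Z_\alpha},\qquad \bar Z_t=\mathbb H\bar Z_t,\quad \tfrac1{Z_\alpha}-1=\mathbb H\big(\tfrac1{Z_\alpha}-1\big),\quad Z-\alpha=\mathbb H(Z-\alpha),\qquad \psi_\alpha=\Re(\bar Z_tZ_\alpha).$$ **Energies.** Let $\Theta^{(j)}=(\mathbb P_HD_t)^j(I+\mathbb H)\psi$, $\;G^{(j)}=D_t\mathbb P_HD_t\Theta^{(j)}+\frac{i}{|Z_\alpha|^2}\partial_\alpha\Theta^{(j)}$, and $$E_j=\Re\Big(\int i\,\partial_\alpha\Theta^{(j+1)}\overline{\Theta^{(j+1)}}\,d\alpha-\int i\,\partial_\alpha\Theta^{(j)}\overline{\Theta^{(j+2)}}\,d\alpha\Big).$$ For functions of $(t,\alpha,\beta)$ put $a=A_1/|Z_\alpha|^2$, $\langle F\rangle=\iint\frac{F(\alpha,\beta)}{(\alpha-\beta)^2}\,d\alpha\,d\beta$, and $$\mathfrak D_t=\partial_t+b(\alpha)\partial_\alpha+b(\beta)\partial_\beta,\quad \mathcal P=\mathfrak D_t^2+i\,a(\alpha)\partial_\alpha+i\,a(\beta)\partial_\beta,\quad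 \theta=\bar Z_t(\alpha)-\bar Z_t(\beta),\quad \theta_k=\mathfrak D_t^k\theta,\quad \bar\theta_k=\mathfrak D_t^k\bar\theta,$$ $$v_k=D_t^kZ_t(\alpha),\qquad \kappa[c]=c_\alpha(\alpha)+c_\beta(\beta)-2\,\frac{c(\alpha)-c(\beta)}{\alpha-\beta}\quad(c=b,a).$$ For $j\ge0$ (empty sums being $0$, and each operator $v_j\mathfrak D_t-v_{j+1}$, $\theta\mathfrak D_t-\theta_1$, $v_j\mathfrak D_t-\mathfrak D_tv_j$ acting on the whole product to its right, the subtracted term by multiplication) let $$C_{1,j}=\frac1{2\pi}\sum_{l=0}^{j-1}\sum_{k=0}^{l}\big\langle(v_j\mathfrak D_t-v_{j+1})\mathfrak D_t^{l-k}(\theta_k\bar\theta\,\theta_{j-l-1})\big\rangle+\frac1{4\pi}\sum_{l=0}^{j-2}\sum_{k=0}^{j-l-2}(-1)^k\big\langle(v_j\mathfrak D_t-v_{j+1})(\theta_{1+l}\bar\theta_k\theta_{j-l-2-k})\big\rangle$$ $$-\frac1{8\pi}\sum_{l=0}^{j-2}\sum_{k=0}^{j-l-2}(-1)^k\big\langle(\theta\,\mathfrak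 D_t-\theta_1)(\bar\theta_{j-l-1}\theta_{j-k-1}\bar\theta_{k+l+1})\big\rangle+\frac1{2\pi}\sum_{l=0}^{j-1}\big\langle v_j\,\theta_{j-l-1}\bar\theta\,\theta_{1+l}\big\rangle,$$ $$C_{2,j}=\frac1{4\pi}\sum_{k=0}^{j-1}(-1)^k\big\langle(v_j\mathfrak D_t-v_{j+1})(\theta\,\bar\theta_k\theta_{j-k-1})\big\rangle+\frac{(-1)^j}{4\pi}\big\langle v_j\,\theta\,\bar\theta_j\,\theta\big\rangle,$$ $$\mathfrak E_j=E_j-\Re\Big(\int i\,\partial_\alpha\Theta^{(j)}\,\overline{\mathbb P_HG^{(j)}}\,d\alpha+C_{1,j}+C_{2,j}\Big).$$ **Remainder.** Let $$I_{1,j}=\frac1\pi\Re\sum_{l=0}^{j-1}\big\langle v_j\,\mathfrak D_t^{l+1}\{\mathfrak D_t(\theta\bar\theta)\,\theta_{j-l-1}\}\big\rangle,\qquad I_{2,j}=\frac1{2\pi}\Re\big\langle v_j\,\mathfrak D_t(\theta\bar\theta)\,\theta_j\big\rangle,$$ $$R^{(m)}_{\bar j;l,\bar i,k}=\big\langle v_j[\mathcal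 P,\mathfrak D_t^m](\theta_l\bar\theta_i\theta_k)\big\rangle+\big\langle v_j\mathfrak D_t^m\{(\mathcal P\theta_l)\bar\theta_i\theta_k-\theta_l\overline{(\mathcal P\theta_i)}\theta_k+\theta_l\bar\theta_i(\mathcal P\theta_k)\}\big\rangle-\big\langle\overline{(\mathcal P\bar v_j)}\,\mathfrak D_t^m(\theta_l\bar\theta_i\theta_k)\big\rangle$$ $$+\big\langle\kappa[b]\,(v_j\mathfrak D_t-\mathfrak D_tv_j)\mathfrak D_t^m(\theta_l\bar\theta_i\theta_k)\big\rangle+i\big\langle\kappa[a]\,v_j\mathfrak D_t^m(\theta_l\bar\theta_i\theta_k)\big\rangle,$$ $$R_{IC,j}=-\frac1{2\pi}\sum_{l=0}^{j-1}\Re\big\langle\kappa[b]\,v_j\theta_{j-l-1}\bar\theta\,\theta_{l+1}\big\rangle-\frac{(-1)^j}{4\pi}\Re\big\langle\kappa[b]\,v_j\theta\,\bar\theta_j\theta\big\rangle-\frac1{4\pi}\Re\sum_{k=0}^{j-1}(-1)^kR^{(0)}_{\bar j;0,\bar k,j-k-1}$$ $$-\frac1{4\pi}\Re\Big(2\sum_{l=0}^{j-1}\sum_{k=0}^{l}R^{(l-k)}_{\bar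 j;k,\bar0,j-l-1}+\sum_{l=0}^{j-2}\sum_{k=0}^{j-l-2}(-1)^k\big(R^{(0)}_{\bar j;1+l,\bar k,j-l-2-k}-\overline{R^{(0)}_{\bar0;j-l-1,\overline{j-k-1},l+k+1}}\big)\Big),$$ $$\mathfrak R_j=\Big(2\Re\sum_{l=0}^{j-1}\int i\,\partial_\alpha\bar\Theta^{(j)}(\mathbb P_HD_t)^{l+1}\mathbb P_H\big(G^{(j-l)}-D_t\mathbb P_HG^{(j-1-l)}\big)d\alpha-I_{1,j}\Big)$$ $$+\Big(\Re\int i\,\partial_\alpha\bar\Theta^{(j)}\,\mathbb P_H\big(G^{(j+1)}-D_t\mathbb P_HG^{(j)}\big)d\alpha-I_{2,j}\Big)+R_{IC,j}.$$ **Theorem.** For every $j\ge0$ and every solution as above, $\mathfrak E_j$ is differentiable on $I$ and $$\frac{d}{dt}\mathfrak E_j(t)=\mathfrak R_j(t),\qquad t\in I.$$ Moreover $\mathfrak R_j$ is quintic: there is a finite list, depending only on $j$, of expressions $F_1,\dots,F_N$, each homogeneous of some degree $\ge5$ in $Z_t$, $\frac1{Z_\alpha}-1$ and their derivatives, such that for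 every solution and every $t\in I$ the functions $F_i$ evaluated at the solution at time $t$ are integrable and $\mathfrak R_j(t)=\sum_{i=1}^N\Re\int F_i\,d\alpha$. Here expressions are generated from $Z_t$ and $\frac1{Z_\alpha}-1$ (degree $1$) and the constant $1$ (degree $0$) by linear combinations of expressions of the same degree, products (degrees add), complex conjugation, $\partial_\alpha$, $\mathbb H$, and the multilinear singular integrals $\int\prod_{i}\frac{f_i(\alpha)-f_i(\beta)}{\alpha-\beta}\,g(\beta)\,d\beta$ (degrees add). -/

import Mathlib

open MeasureTheory Filter Topology
open scoped ContDiff NNReal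

noncomputable section

namespace WaterWave

/-- The Hilbert transform of the lower half plane,
`ℍ f (x) = (1 / π i) p.v. ∫ f y / (x - y) dy`, the principal value being taken at `y = x`. -/
def hilbert (f : ℝ → ℂ) (x : ℝ) : ℂ :=
  1 / (Real.pi * Complex.I) *
    limUnder (𝓝[>] (0 : ℝ)) (fun ε : ℝ => ∫ y in {y : ℝ | ε < |x - y|}, f y / ((x : ℂ) - y))

/-! Functions of time and one space variable are written `f t x`. -/

/-- Time derivative. -/
def dt (f : ℝ → ℝ → ℂ) (t x : ℝ) : ℂ := deriv (fun s => f s x) t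

/-- Space derivative. -/
def dx (f : ℝ → ℝ → ℂ) (t x : ℝ) : ℂ := deriv (fun y => f t y) x

/-- `ℙ_H = (I + ℍ) / 2`, the projection onto boundary values of holomorphic functions. -/
def projH (f : ℝ → ℝ → ℂ) (t x : ℝ) : ℂ := (f t x + hilbert (f t) x) / 2

/-- Smooth functions on `I × ℝ` all of whose derivatives are square integrable in space, locally
uniformly in time, i.e. functions in `C^∞(I; H^∞(ℝ))`. -/
def SmoothDecaying (I : Set ℝ) (f : ℝ → ℝ → ℂ) : Prop :=
  ContDiffOn ℝ ∞ (fun p : ℝ × ℝ => f p.1 p.2) (I ×ˢ Set.univ) ∧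
    ∀ k m : ℕ, ∀ K : Set ℝ, K ⊆ I → IsCompact K →
      ∃ C : ℝ≥0, ∀ t ∈ K, eLpNorm ((dt^[k] (dx^[m] f)) t) 2 volume ≤ C

/-- The unknowns in the Riemann mapping variable: the interface `Z`, the velocity `V = Z_t` of the
fluid particles on the interface, and the trace `ψ` of the velocity potential. -/
structure Wave where
  Z : ℝ → ℝ → ℂ
  V : ℝ → ℝ → ℂ
  ψ : ℝ → ℝ → ℝ

namespace Wave

variable (S : Wave)

/-- `1 / Z_{,α'} - 1`. -/
def W (t x : ℝ) : ℂ := 1 / dx S.Z t x - 1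

/-- `b = Re (I - ℍ) (Z_t / Z_{,α'})`. -/
def b (t x : ℝ) : ℝ :=
  (S.V t x / dx S.Z t x - hilbert (fun y => S.V t y / dx S.Z t y) x).re

/-- `A₁ = 1 - Im [Z_t, ℍ] ∂_{α'} (conj Z_t)`. -/
def A₁ (t x : ℝ) : ℝ :=
  1 - (S.V t x * hilbert (dx (star S.V) t) x -
    hilbert (fun y => S.V t y * dx (star S.V) t y) x).im

/-- The material derivative `D_t = ∂_t + b ∂_{α'}`. -/
def D (f : ℝ → ℝ → ℂ) (t x : ℝ) : ℂ := dt f t x + S.b t x * dx f t x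

/-- Smooth decaying solutions, for times in `I`, of the two-dimensional water wave system (infinite
depth, gravity one) in the Riemann mapping variable. -/
structure IsSolution (I : Set ℝ) : Prop where
  smooth_Z : SmoothDecaying I (fun t x => S.Z t x - x)
  smooth_V : SmoothDecaying I S.V
  smooth_ψ : SmoothDecaying I (fun t x => (S.ψ t x : ℂ))
  /-- the interface is a regular curve -/
  regular : ∀ t ∈ I, ∀ x, dx S.Z t x ≠ 0
  /-- `V` is the velocity of the particles on the interface: `Z_t = D_t Z` -/
  velocity : ∀ t ∈ I, ∀ x, S.D S.Z t x = S.V t x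
  /-- `conj Z_tt - i = - i A₁ / Z_{,α'}` -/
  momentum : ∀ t ∈ I, ∀ x,
    star (S.D S.V t x) - Complex.I = -Complex.I * S.A₁ t x / dx S.Z t x
  /-- the conjugate velocity is the boundary value of a holomorphic function -/
  hol_V : ∀ t ∈ I, ∀ x, star (S.V t x) = hilbert (fun y => star (S.V t y)) x
  /-- the derivative of the Riemann mapping, minus one, is holomorphic -/
  hol_W : ∀ t ∈ I, ∀ x, S.W t x = hilbert (S.W t) x
  /-- `Z` is the boundary value of the inverse of the Riemann mapping -/
  hol_Z : ∀ t ∈ I, ∀ x, S.Z t x - x = hilbert (fun y => S.Z t y - y) x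
  /-- `ψ` is the trace of the potential: its tangential derivative is that of the velocity -/
  potential : ∀ t ∈ I, ∀ x, deriv (S.ψ t) x = (star (S.V t x) * dx S.Z t x).re

/-! ### The basic energies -/

/-- `Q = (I + ℍ) ψ`. -/
def Q (t x : ℝ) : ℂ := S.ψ t x + hilbert (fun y => (S.ψ t y : ℂ)) x

/-- The operator `ℙ_H D_t`. -/
def HD (f : ℝ → ℝ → ℂ) : ℝ → ℝ → ℂ := projH (S.D f)

/-- `Θ^{(j)} = (ℙ_H D_t)^j Q`. -/
def Θ (j : ℕ) : ℝ → ℝ → ℂ := S.HD^[j] S.Q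

/-- `G^{(j)} = D_t ℙ_H D_t Θ^{(j)} + i |Z_{,α'}|⁻² ∂_{α'} Θ^{(j)}`. -/
def G (j : ℕ) (t x : ℝ) : ℂ :=
  S.D (projH (S.D (S.Θ j))) t x + Complex.I * (1 / (‖dx S.Z t x‖ : ℂ) ^ 2) * dx (S.Θ j) t x

/-- `E_j = Re (∫ i ∂Θ^{(j+1)} conj Θ^{(j+1)} - ∫ i ∂Θ^{(j)} conj Θ^{(j+2)})`. -/
def E (j : ℕ) (t : ℝ) : ℝ :=
  ((∫ x, Complex.I * dx (S.Θ (j + 1)) t x * star (S.Θ (j + 1) t x)) -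
    ∫ x, Complex.I * dx (S.Θ j) t x * star (S.Θ (j + 2) t x)).re

/-! ### Functions of time and two space variables, written `F t α β` -/

/-- `𝔇_t = ∂_t + b(α) ∂_α + b(β) ∂_β`. -/
def DD (F : ℝ → ℝ → ℝ → ℂ) (t α β : ℝ) : ℂ :=
  deriv (fun s => F s α β) t + S.b t α * deriv (fun x => F t x β) α +
    S.b t β * deriv (fun y => F t α y) β

/-- `A₁ / |Z_{,α'}|²`. -/
def a (t x : ℝ) : ℝ := S.A₁ t x / ‖dx S.Z t x‖ ^ 2

/-- `𝒫 = 𝔇_t² + i a(α) ∂_α + i a(β) ∂_β` with `a = A₁ / |Z_{,α'}|²`. -/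
def P (F : ℝ → ℝ → ℝ → ℂ) (t α β : ℝ) : ℂ :=
  S.DD (S.DD F) t α β + Complex.I * S.a t α * deriv (fun x => F t x β) α +
    Complex.I * S.a t β * deriv (fun y => F t α y) β

/-- `θ = conj Z_t(α) - conj Z_t(β)`. -/
def θ (t α β : ℝ) : ℂ := star (S.V t α) - star (S.V t β)

/-- `𝔇_t^j θ`. -/
def θD (j : ℕ) : ℝ → ℝ → ℝ → ℂ := S.DD^[j] S.θ

/-- `𝔇_t^j (conj θ)`. -/
def θbarD (j : ℕ) : ℝ → ℝ → ℝ → ℂ := S.DD^[j] (star S.θ)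

/-- `D_t^j Z_t (α)`, as a function of `(t, α, β)`. -/
def VD (j : ℕ) (t α _β : ℝ) : ℂ := (S.D^[j] S.V) t α

/-- `(F 𝔇_t - F') M`, where `F'` stands for `𝔇_t F`. -/
def skew (F F' M : ℝ → ℝ → ℝ → ℂ) : ℝ → ℝ → ℝ → ℂ := F * S.DD M - F' * M

/-- `b_α + b_β - 2 (b(α) - b(β)) / (α - β)`. -/
def κb (t α β : ℝ) : ℂ :=
  ((deriv (S.b t) α + deriv (S.b t) β - 2 * ((S.b t α - S.b t β) / (α - β)) : ℝ) : ℂ)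

/-- `∂_α a(α) + ∂_β a(β) - 2 (a(α) - a(β)) / (α - β)` with `a = A₁ / |Z_{,α'}|²`. -/
def κa (t α β : ℝ) : ℂ :=
  ((deriv (S.a t) α + deriv (S.a t) β - 2 * ((S.a t α - S.a t β) / (α - β)) : ℝ) : ℂ)

end Wave

/-- `∬ F(t, α, β) / (α - β)² dα dβ`. -/
def pairInt (F : ℝ → ℝ → ℝ → ℂ) (t : ℝ) : ℂ :=
  ∫ p : ℝ × ℝ, F t p.1 p.2 / ((p.1 : ℂ) - p.2) ^ 2

namespace Wave

variable (S : Wave)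

/-! ### The correcting functionals -/

def C₁ (j : ℕ) (t : ℝ) : ℂ :=
  1 / (2 * Real.pi) * ∑ l ∈ Finset.range j, ∑ k ∈ Finset.range (l + 1),
      pairInt (S.skew (S.VD j) (S.VD (j + 1))
        (S.DD^[l - k] (S.θD k * S.θbarD 0 * S.θD (j - l - 1)))) t
  + 1 / (4 * Real.pi) * ∑ l ∈ Finset.range (j - 1), ∑ k ∈ Finset.range (j - l - 1),
      (-1) ^ k * pairInt (S.skew (S.VD j) (S.VD (j + 1))
        (S.θD (1 + l) * S.θbarD k * S.θD (j - l - 2 - k))) t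
  - 1 / (8 * Real.pi) * ∑ l ∈ Finset.range (j - 1), ∑ k ∈ Finset.range (j - l - 1),
      (-1) ^ k * pairInt (S.skew S.θ (S.DD S.θ)
        (S.θbarD (j - l - 1) * S.θD (j - k - 1) * S.θbarD (k + l + 1))) t
  + 1 / (2 * Real.pi) * ∑ l ∈ Finset.range j,
      pairInt (S.VD j * (S.θD (j - l - 1) * S.θbarD 0 * S.θD (1 + l))) t

def C₂ (j : ℕ) (t : ℝ) : ℂ :=
  1 / (4 * Real.pi) * ∑ k ∈ Finset.range j,
      (-1) ^ k * pairInt (S.skew (S.VD j) (S.VD (j + 1))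
        (S.θ * S.θbarD k * S.θD (j - k - 1))) t
  + 1 / (4 * Real.pi) * (-1) ^ j * pairInt (S.VD j * (S.θ * S.θbarD j * S.θ)) t

/-- The corrected energy
`𝔈_j = E_j - Re (∫ i ∂Θ^{(j)} conj (ℙ_H G^{(j)}) + C_{1,j} + C_{2,j})`. -/
def correctedEnergy (j : ℕ) (t : ℝ) : ℝ :=
  S.E j t -
    ((∫ x, Complex.I * dx (S.Θ j) t x * star (projH (S.G j) t x)) + S.C₁ j t + S.C₂ j t).re

/-! ### The remainder -/

def I₁ (j : ℕ) (t : ℝ) : ℝ :=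
  1 / Real.pi * (∑ l ∈ Finset.range j, pairInt (S.VD j *
    S.DD^[l + 1] (S.DD (S.θ * star S.θ) * S.θD (j - l - 1))) t).re

def I₂ (j : ℕ) (t : ℝ) : ℝ :=
  1 / (2 * Real.pi) * (pairInt (S.VD j * (S.DD (S.θ * star S.θ) * S.θD j)) t).re

/-- `R^{(m)}_{j̄; l, ī, k}`. -/
def R (m j l i k : ℕ) (t : ℝ) : ℂ :=
  pairInt (S.VD j * (S.P (S.DD^[m] (S.θD l * S.θbarD i * S.θD k)) -
      S.DD^[m] (S.P (S.θD l * S.θbarD i * S.θD k)))) t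
  + pairInt (S.VD j * S.DD^[m] (S.P (S.θD l) * S.θbarD i * S.θD k
      - S.θD l * star (S.P (S.θD i)) * S.θD k
      + S.θD l * S.θbarD i * S.P (S.θD k))) t
  - pairInt (star (S.P (star (S.VD j))) * S.DD^[m] (S.θD l * S.θbarD i * S.θD k)) t
  + pairInt (S.κb * S.skew (S.VD j) (S.DD (S.VD j))
      (S.DD^[m] (S.θD l * S.θbarD i * S.θD k))) t
  + Complex.I * pairInt (S.κa * (S.VD j * S.DD^[m] (S.θD l * S.θbarD i * S.θD k))) t

/-- `R_{IC,j}`. -/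
def RIC (j : ℕ) (t : ℝ) : ℝ :=
  - (1 / (2 * Real.pi)) * ∑ l ∈ Finset.range j,
      (pairInt (S.κb * (S.VD j * S.θD (j - l - 1) * S.θbarD 0 * S.θD (l + 1))) t).re
  - 1 / (4 * Real.pi) *
      (2 * ∑ l ∈ Finset.range j, ∑ k ∈ Finset.range (l + 1), S.R (l - k) j k 0 (j - l - 1) t
        + ∑ l ∈ Finset.range (j - 1), ∑ k ∈ Finset.range (j - l - 1),
            (-1) ^ k * (S.R 0 j (1 + l) k (j - l - 2 - k) t
              - star (S.R 0 0 (j - l - 1) (j - k - 1) (l + k + 1) t))).re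
  - (-1) ^ j * (1 / (4 * Real.pi)) *
      (pairInt (S.κb * (S.VD j * S.θ * S.θbarD j * S.θ)) t).re
  - 1 / (4 * Real.pi) *
      (∑ k ∈ Finset.range j, (-1) ^ k * S.R 0 j 0 k (j - k - 1) t).re

/-- `ℙ_H (G^{(n+1)} - D_t ℙ_H G^{(n)})`. -/
def K (n : ℕ) : ℝ → ℝ → ℂ := projH (S.G (n + 1) - S.D (projH (S.G n)))

/-- The remainder `ℜ_j`. In the sum, `K (j - 1 - l) = ℙ_H (G^{(j-l)} - D_t ℙ_H G^{(j-1-l)})`. -/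
def remainder (j : ℕ) (t : ℝ) : ℝ :=
  (2 * (∑ l ∈ Finset.range j,
      ∫ x, Complex.I * dx (star (S.Θ j)) t x * (S.HD^[l + 1] (S.K (j - 1 - l))) t x).re
    - S.I₁ j t)
  + ((∫ x, Complex.I * dx (star (S.Θ j)) t x * S.K j t x).re - S.I₂ j t)
  + S.RIC j t

end Wave

/-! ### Degree -/

/-- `IsForm n F`: the function `F v w` is an expression homogeneous of degree `n` in the functions
`v`, `w` and their derivatives. The expressions are generated from `v` and `w`, each of degree one,
and the constant `1`, of degree zero, by linear combinations of expressions of equal degree,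
products, complex conjugation, differentiation, the Hilbert transform, and the singular integrals
`x ↦ ∫ ∏ᵢ (fᵢ(x) - fᵢ(y)) / (x - y) · g(y) dy`. -/
inductive IsForm : ℕ → ((ℝ → ℂ) → (ℝ → ℂ) → ℝ → ℂ) → Prop
  | one : IsForm 0 (fun _ _ _ => 1)
  | fst : IsForm 1 (fun v _ x => v x)
  | snd : IsForm 1 (fun _ w x => w x)
  | smul {n : ℕ} {F : (ℝ → ℂ) → (ℝ → ℂ) → ℝ → ℂ} (c : ℂ) (hF : IsForm n F) :
      IsForm n (fun v w x => c * F v w x)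
  | add {n : ℕ} {F G : (ℝ → ℂ) → (ℝ → ℂ) → ℝ → ℂ} (hF : IsForm n F) (hG : IsForm n G) :
      IsForm n (fun v w x => F v w x + G v w x)
  | mul {m n : ℕ} {F G : (ℝ → ℂ) → (ℝ → ℂ) → ℝ → ℂ} (hF : IsForm m F) (hG : IsForm n G) :
      IsForm (m + n) (fun v w x => F v w x * G v w x)
  | conj {n : ℕ} {F : (ℝ → ℂ) → (ℝ → ℂ) → ℝ → ℂ} (hF : IsForm n F) :
      IsForm n (fun v w x => star (F v w x))
  | diff {n : ℕ} {F : (ℝ → ℂ) → (ℝ → ℂ) → ℝ → ℂ} (hF : IsForm n F) :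
      IsForm n (fun v w x => deriv (F v w) x)
  | hilb {n : ℕ} {F : (ℝ → ℂ) → (ℝ → ℂ) → ℝ → ℂ} (hF : IsForm n F) :
      IsForm n (fun v w x => hilbert (F v w) x)
  | sing {p n : ℕ} {d : Fin p → ℕ} {F : Fin p → (ℝ → ℂ) → (ℝ → ℂ) → ℝ → ℂ}
      {G : (ℝ → ℂ) → (ℝ → ℂ) → ℝ → ℂ} (hF : ∀ i, IsForm (d i) (F i)) (hG : IsForm n G) :
      IsForm ((∑ i, d i) + n)
        (fun v w x => ∫ y, (∏ i, (F i v w x - F i v w y) / ((x : ℂ) - y)) * G v w y)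

/-- `X` is quintic: for all solutions it is one and the same finite sum of (real parts of) integrals
of expressions homogeneous of degree at least five in `Z_t`, `1 / Z_{,α'} - 1` and their
derivatives. -/
def IsQuintic (X : Wave → ℝ → ℝ) : Prop :=
  ∃ (N : ℕ) (d : Fin N → ℕ) (F : Fin N → (ℝ → ℂ) → (ℝ → ℂ) → ℝ → ℂ),
    (∀ i, 5 ≤ d i ∧ IsForm (d i) (F i)) ∧
    ∀ (S : Wave) (I : Set ℝ), IsOpen I → S.IsSolution I → ∀ t ∈ I,
      (∀ i, Integrable (F i (S.V t) (S.W t))) ∧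
      X S t = ∑ i, (∫ x, F i (S.V t) (S.W t) x).re

end WaterWave

end

open MeasureTheory Filter Topology
open scoped ContDiff NNReal

noncomputable section

namespace WaterWave

/-! Energy identity. On boundary values of holomorphic functions, the Hermitian form pr(f, g) = ∫ i
f_α ḡ obeys the product rule d/dt pr(f, g) = pr(ℙ_H D_t f, g) + pr(f, ℙ_H D_t g): the transport
terms cancel because b is real (`hasDerivAt_pr`). Put φ_n = ∂Θ^{(n)}/Z_α. Since ℙ_H G^{(n)} =
Θ^{(n+2)} + i ℙ_H(Θ^{(n)}_α/|Z_α|²), replacing Θ^{(m+2)} by ℙ_H G^{(m)} in pr(Θ^{(n)}, Θ^{(m+2)})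
costs exactly ∫ φ_n φ̄_m (`pr_Θ`). In dE_j/dt these costs occur as ∫ φ_{j+1} φ̄_j and ∫ φ_j
φ̄_{j+1}, whose real parts agree, so only pairings with ℙ_H G survive. As ℙ_H G^{(0)} = 0
(`projH_G_zero`) and ℙ_H G^{(n+1)} = K_n + ℙ_H D_t ℙ_H G^{(n)}, they become pairings of Θ^{(j)} with
(ℙ_H D_t)^m K_n (`hasDerivAt_energy`).

Leading part. The map f ↦ ℙ_H(Z̄_α f), called `sharp`, turns ℙ_H D_t into D_t up to terms with one
more factor (`sharp_HD`), and `sharp (K n)` is a projected trilinear singular integral of 1/Z_α − 1,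
Z_t, φ_n and their conjugates (`sharp_K`). By the momentum equation 1/Z_α − 1 is i D_t Z̄_t up to
quadratic terms, and φ_n is D_t^n Z̄_t up to quadratic terms. Hence the pairings equal (1/2π)⟨v_j
𝔇_t^m(𝔇_t(θθ̄) θ_n)⟩ up to degree five (`IsQuintic.integral_iterate_HD_K`); these quartic
expressions make up I_{1,j} and I_{2,j}.

Normal form. It remains to see that I_{1,j} + I_{2,j} is the derivative of Re(C_{1,j} + C_{2,j}) up
to R_{IC,j} (`hasDerivAt_C`). Differentiating ⟨F⟩ gives ⟨𝔇_t F⟩ + ⟨κ[b]F⟩. In the derivative of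
⟨(v_j 𝔇_t − v_{j+1})X⟩ the two second derivatives are traded for 𝒫, which is quadratically small on
each θ_k and on each v̄_j (`Deg.q`); what Leibniz' rule for 𝒫 leaves is an explicit combination of
the quantities Re⟨v_c 𝔇_t^m(θ_l θ̄_i θ_k)⟩ (`hasDerivAt_skew`). That these combinations add up to
I_{1,j} + I_{2,j} is a telescoping identity (`Pairing.sum_identity`), using only Leibniz' rule and
the symmetries of a product of four differences.

Degree. `Deg n` records functions of the solution that are sums of terms of degree at least n. The
class is closed under D_t, because the equations remove all time derivatives (`Deg.D`), so every
discarded term is an expression of the required kind and carries an additional factor.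

Analysis. All L² facts about ℍ come from one relation: two functions of the form f + ℍf have product
of integral zero (`Reg.integral_bdry_mul_bdry`). It is obtained from Plemelj's formula and the
vanishing of ∫ dx/((x−z)(x−w)) for z, w in the upper half plane. Double integrals over (α−β)² are
reduced to one dimension by `rowInt_dprod`, which computes the inner integral in terms of ℍ. -/

/-! ### Smooth functions with square integrable derivatives -/

/-- Smooth functions on the line all of whose derivatives are square integrable. -/
def Hinf (f : ℝ → ℂ) : Prop :=
  ∀ m, Differentiable ℝ (deriv^[m] f) ∧ MemLp (deriv^[m] f) 2

/-- A class closed under differentiation has to be checked at order zero only. With a suitable 𝒞 no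
formula for higher derivatives is ever needed. -/
theorem Hinf.of_class {𝒞 : Set (ℝ → ℂ)}
    (h : ∀ g ∈ 𝒞, Differentiable ℝ g ∧ MemLp g 2 ∧ deriv g ∈ 𝒞) {f : ℝ → ℂ} (hf : f ∈ 𝒞) :
    Hinf f := by
  have key : ∀ m, deriv^[m] f ∈ 𝒞 := by
    intro m
    induction m with
    | zero => exact hf
    | succ m ih => rw [Function.iterate_succ_apply']; exact (h _ ih).2.2
  exact fun m => ⟨(h _ (key m)).1, (h _ (key m)).2.1⟩

namespace Hinf

variable {f g : ℝ → ℂ}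

theorem differentiable (hf : Hinf f) : Differentiable ℝ f := (hf 0).1

theorem continuous (hf : Hinf f) : Continuous f := hf.differentiable.continuous

theorem memLp (hf : Hinf f) : MemLp f 2 := (hf 0).2

theorem deriv (hf : Hinf f) : Hinf (deriv f) := fun m => hf (m + 1)

theorem hasDerivAt (hf : Hinf f) (x : ℝ) : HasDerivAt f (_root_.deriv f x) x :=
  (hf.differentiable x).hasDerivAt

end Hinf

theorem integrable_mul_of_L2 {f g : ℝ → ℂ} (hf : MemLp f 2) (hg : MemLp g 2) :
    Integrable (fun x => f x * g x) := hf.integrable_mul hg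

theorem integrable_normSq_of_L2 {f : ℝ → ℂ} (hf : MemLp f 2) :
    Integrable (fun x => ‖f x‖ ^ 2) := by
  simpa using hf.integrable_norm_pow (by norm_num)

/-- A function which is square integrable together with its derivative is bounded. -/
theorem norm_sq_le_of_L2 {f : ℝ → ℂ} (hd : Differentiable ℝ f) (hf : MemLp f 2)
    (hf' : MemLp (deriv f) 2) (x : ℝ) :
    ‖f x‖ ^ 2 ≤ (∫ y, ‖f y‖ ^ 2) + ∫ y, ‖deriv f y‖ ^ 2 := by
  -- The square without conjugation is enough, since |f·f| = |f|². Its derivative is integrable, so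
  -- it tends to 0 at −∞ and is the integral of its derivative from there.
  have h1 : ∀ y, HasDerivAt (fun y => f y * f y) (deriv f y * f y + f y * deriv f y) y :=
    fun y => (hd y).hasDerivAt.mul (hd y).hasDerivAt
  have i1 : Integrable (fun y => deriv f y * f y + f y * deriv f y) :=
    (integrable_mul_of_L2 hf' hf).add (integrable_mul_of_L2 hf hf')
  have i2 := integrable_mul_of_L2 hf hf
  have h2 := tendsto_zero_of_hasDerivAt_of_integrableOn_Iic (a := x) (fun y _ => h1 y)
    i1.integrableOn i2.integrableOn
  have h3 := integral_Iic_of_hasDerivAt_of_tendsto' (a := x) (fun y _ => h1 y) i1.integrableOn h2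
  have h4 : ‖f x‖ ^ 2 = ‖∫ y in Set.Iic x, (deriv f y * f y + f y * deriv f y)‖ := by
    rw [h3]; simp [pow_two]
  have i3 := integrable_normSq_of_L2 hf
  have i4 := integrable_normSq_of_L2 hf'
  rw [h4, ← integral_add i3 i4]
  calc _ ≤ ∫ y in Set.Iic x, ‖deriv f y * f y + f y * deriv f y‖ :=
        norm_integral_le_integral_norm _
    _ ≤ ∫ y, ‖deriv f y * f y + f y * deriv f y‖ :=
        setIntegral_le_integral i1.norm (Eventually.of_forall fun _ => norm_nonneg _)
    _ ≤ _ := by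
        refine integral_mono i1.norm (i3.add i4) fun y => ?_
        have := norm_add_le (deriv f y * f y) (f y * deriv f y)
        simp only [norm_mul] at this ⊢
        nlinarith [sq_nonneg (‖f y‖ - ‖deriv f y‖)]

/-! ### The algebra of functions with square integrable derivatives -/

namespace Hinf

variable {f g : ℝ → ℂ}

theorem bounded (hf : Hinf f) : ∃ C, ∀ x, ‖f x‖ ≤ C :=
  ⟨_, fun x => Real.le_sqrt_of_sq_le (norm_sq_le_of_L2 hf.differentiable hf.memLp hf.deriv.memLp x)⟩

theorem integrable_mul (hf : Hinf f) (hg : Hinf g) : Integrable (fun x => f x * g x) :=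
  integrable_mul_of_L2 hf.memLp hg.memLp

theorem zero : Hinf (fun _ => 0) :=
  of_class (𝒞 := {fun _ => 0}) (by rintro _ rfl; simp) rfl

/-- The algebra generated by `Hinf` functions. -/
inductive Gen : (ℝ → ℂ) → Prop
  | of {f : ℝ → ℂ} (hf : Hinf f) : Gen f
  | smul {f : ℝ → ℂ} (c : ℂ) (hf : Gen f) : Gen (fun x => c * f x)
  | star {f : ℝ → ℂ} (hf : Gen f) : Gen (fun x => star (f x))
  | add {f g : ℝ → ℂ} (hf : Gen f) (hg : Gen g) : Gen (fun x => f x + g x)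
  | mul {f g : ℝ → ℂ} (hf : Gen f) (hg : Gen g) : Gen (fun x => f x * g x)

/-- Boundedness is carried along because a product of two square integrable functions is square
integrable once one factor is bounded. The Leibniz rule keeps derivatives in the algebra, which is
what `of_class` asks for. -/
theorem Gen.spec (hf : Gen f) : Differentiable ℝ f ∧ MemLp f 2 ∧ (∃ C, ∀ x, ‖f x‖ ≤ C) ∧
    Gen (_root_.deriv f) := by
  induction hf with
  | of hf => exact ⟨hf.differentiable, hf.memLp, hf.bounded, .of hf.deriv⟩
  | smul c _ ih =>
    obtain ⟨h1, h2, ⟨C, hC⟩, h4⟩ := ih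
    refine ⟨h1.const_mul c, h2.const_mul c, ⟨‖c‖ * C, fun x => ?_⟩, ?_⟩
    · rw [norm_mul]; gcongr; exact hC x
    · convert! h4.smul c using 1
      ext x; exact deriv_const_mul c (h1 x)
  | star _ ih =>
    obtain ⟨h1, h2, ⟨C, hC⟩, h4⟩ := ih
    refine ⟨h1.star, h2.star, ⟨C, fun x => by rw [norm_star]; exact hC x⟩, ?_⟩
    convert! h4.star using 1
    ext x; exact _root_.deriv.star
  | add _ _ ih ih' =>
    obtain ⟨h1, h2, ⟨C, hC⟩, h4⟩ := ih
    obtain ⟨h1', h2', ⟨C', hC'⟩, h4'⟩ := ih'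
    refine ⟨h1.add h1', h2.add h2', ⟨C + C', fun x => norm_add_le_of_le (hC x) (hC' x)⟩, ?_⟩
    convert! h4.add h4' using 1
    ext x; exact deriv_add (h1 x) (h1' x)
  | mul p q ih ih' =>
    obtain ⟨h1, h2, ⟨C, hC⟩, h4⟩ := ih
    obtain ⟨h1', h2', ⟨C', hC'⟩, h4'⟩ := ih'
    refine ⟨h1.mul h1', ?_, ⟨C * C', fun x => norm_mul_le_of_le (hC x) (hC' x)⟩, ?_⟩
    · refine (h2'.norm.const_mul C).mono (h2.1.mul h2'.1) (Eventually.of_forall fun x => ?_)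
      have := (norm_nonneg _).trans (hC x)
      rw [norm_mul, norm_mul, norm_norm, Real.norm_of_nonneg this]
      gcongr; exact hC x
    · convert! (h4.mul q).add (p.mul h4') using 1
      ext x; exact deriv_mul (h1 x) (h1' x)

theorem Gen.hinf (hf : Gen f) : Hinf f :=
  of_class (𝒞 := {f | Gen f}) (fun _ hg => ⟨hg.spec.1, hg.spec.2.1, hg.spec.2.2.2⟩) hf

theorem add (hf : Hinf f) (hg : Hinf g) : Hinf (fun x => f x + g x) := ((Gen.of hf).add (.of hg)).hinf

theorem mul (hf : Hinf f) (hg : Hinf g) : Hinf (fun x => f x * g x) := ((Gen.of hf).mul (.of hg)).hinf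

theorem smul (c : ℂ) (hf : Hinf f) : Hinf (fun x => c * f x) := ((Gen.of hf).smul c).hinf

protected theorem star (hf : Hinf f) : Hinf (fun x => star (f x)) := (Gen.of hf).star.hinf

theorem neg (hf : Hinf f) : Hinf (fun x => -f x) := by simpa using hf.smul (-1)

theorem sub (hf : Hinf f) (hg : Hinf g) : Hinf (fun x => f x - g x) := by
  simpa [sub_eq_add_neg] using hf.add hg.neg

/-- Integration by parts. -/
theorem integral_deriv_mul (hf : Hinf f) (hg : Hinf g) :
    ∫ x, _root_.deriv f x * g x = -∫ x, f x * _root_.deriv g x := by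
  rw [integral_mul_deriv_eq_deriv_mul_of_integrable (fun x _ => hf.hasDerivAt x)
    (fun x _ => hg.hasDerivAt x)
    (hf.integrable_mul hg.deriv) (hf.deriv.integrable_mul hg) (hf.integrable_mul hg), neg_neg]

/-- A square integrable constant on the line vanishes. This fixes the constant of integration when
Θ^{(1)} is identified. -/
theorem eq_zero_of_deriv (hf : Hinf f) (h : ∀ x, _root_.deriv f x = 0) (x : ℝ) : f x = 0 := by
  have h1 : ∀ y, f y = f x := fun y => is_const_of_deriv_eq_zero hf.differentiable h y x
  have h2 : f = fun _ => f x := funext h1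
  have h3 := hf.memLp
  rw [h2, memLp_const_iff (by norm_num) (by norm_num)] at h3
  simpa using h3

/-- Test against the conjugate of f − g; continuity upgrades equality almost everywhere to equality
everywhere. -/
theorem eq_of_integral_mul_eq (hf : Hinf f) (hg : Hinf g)
    (h : ∀ k, Hinf k → ∫ x, f x * k x = ∫ x, g x * k x) (x : ℝ) : f x = g x := by
  have h1 := h _ (hf.sub hg).star
  rw [← sub_eq_zero, ← integral_sub (hf.integrable_mul (hf.sub hg).star)
    (hg.integrable_mul (hf.sub hg).star)] at h1
  have h2 : ∫ x, ‖f x - g x‖ ^ 2 = 0 := by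
    have : ∫ x, ((‖f x - g x‖ ^ 2 : ℝ) : ℂ) = 0 := by
      rw [← h1]
      congr 1; ext x
      rw [← sub_mul, Complex.star_def, Complex.mul_conj, Complex.normSq_eq_norm_sq]
    rw [integral_complex_ofReal] at this
    exact_mod_cast this
  rw [integral_eq_zero_iff_of_nonneg (fun _ => by positivity)
    (integrable_normSq_of_L2 (hf.sub hg).memLp)] at h2
  have h3 := (Continuous.ae_eq_iff_eq volume (by have := (hf.sub hg).continuous; fun_prop)
    continuous_const).1 h2
  have : ‖f x - g x‖ ^ 2 = 0 := congrFun h3 x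
  simpa [sub_eq_zero] using this

end Hinf

/-! ### The Hilbert transform of regular functions -/

/-- Bounded square integrable functions with bounded derivative. -/
structure Reg (f : ℝ → ℂ) : Prop where
  diff : Differentiable ℝ f
  memLp : MemLp f 2
  bdd : ∃ C, ∀ x, ‖f x‖ ≤ C ∧ ‖deriv f x‖ ≤ C

theorem Hinf.reg {f : ℝ → ℂ} (hf : Hinf f) : Reg f := by
  obtain ⟨C, hC⟩ := hf.bounded
  obtain ⟨C', hC'⟩ := hf.deriv.bounded
  exact ⟨hf.differentiable, hf.memLp, max C C',
    fun x => ⟨(hC x).trans (le_max_left _ _), (hC' x).trans (le_max_right _ _)⟩⟩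

theorem lipschitz_of_deriv_bound {f : ℝ → ℂ} (hd : Differentiable ℝ f) {C : ℝ}
    (hC : ∀ x, ‖deriv f x‖ ≤ C) (x y : ℝ) : ‖f x - f y‖ ≤ C * |x - y| :=
  Convex.norm_image_sub_le_of_norm_deriv_le (fun x _ => hd x) (fun x _ => hC x) convex_univ
    (Set.mem_univ y) (Set.mem_univ x)

/-- Folding the line at 0 pairs u with −u, which is what turns principal values into absolutely
convergent integrals. -/
theorem integral_eq_half_line {g : ℝ → ℂ} (hg : Integrable g) :
    ∫ u, g u = ∫ u in Set.Ioi (0 : ℝ), (g u + g (-u)) := by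
  have h : IntegrableOn (fun u => g (-u)) (Set.Ioi 0) := hg.comp_neg.integrableOn
  rw [integral_add hg.integrableOn h, integral_comp_neg_Ioi, neg_zero, add_comm,
    ← setIntegral_union (Set.Iic_disjoint_Ioi le_rfl) measurableSet_Ioi hg.integrableOn
      hg.integrableOn]
  simp

/-- The majorant of the symmetrized Hilbert kernel. -/
def hilbMaj (C : ℝ) (Φ : ℝ → ℝ) (x u : ℝ) : ℝ :=
  (4 * C + 2) * (1 + u ^ 2)⁻¹ + (Φ (x - u) ^ 2 + Φ (x + u) ^ 2)

theorem integrable_sq_comp {Φ : ℝ → ℝ} (h : MemLp Φ 2) (x : ℝ) :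
    Integrable (fun u => Φ (x - u) ^ 2) ∧ Integrable (fun u => Φ (x + u) ^ 2) :=
  ⟨h.integrable_sq.comp_sub_left x, h.integrable_sq.comp_add_left x⟩

theorem integrable_hilbMaj {Φ : ℝ → ℝ} (h : MemLp Φ 2) (C x : ℝ) :
    Integrable (hilbMaj C Φ x) :=
  (integrable_inv_one_add_sq.const_mul _).add
    ((integrable_sq_comp h x).1.add (integrable_sq_comp h x).2)

/-- For u ≤ 1 the Lipschitz bound cancels the factor 1/u. For u ≥ 1 one splits (a + b)/u into a² +
b² and u⁻² ≤ 2/(1 + u²). -/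
theorem norm_le_hilbMaj {C a b u : ℝ} {w : ℂ} (hu : 0 < u) (hC : 0 ≤ C)
    (h1 : ‖w‖ ≤ 2 * C * u) (h2 : ‖w‖ ≤ a + b) :
    ‖w / u‖ ≤ (4 * C + 2) * (1 + u ^ 2)⁻¹ + (a ^ 2 + b ^ 2) := by
  rw [norm_div, Complex.norm_real, Real.norm_of_nonneg hu.le, div_le_iff₀ hu]
  rcases le_total u 1 with h | h
  · refine h1.trans ?_
    have : 2 * C ≤ (4 * C + 2) * (1 + u ^ 2)⁻¹ := by
      rw [← div_eq_mul_inv, le_div_iff₀ (by positivity)]; nlinarith [mul_nonneg hC (sub_nonneg.2 h)]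
    gcongr
    nlinarith [sq_nonneg a, sq_nonneg b]
  · refine h2.trans ?_
    have : u⁻¹ ^ 2 ≤ 2 * (1 + u ^ 2)⁻¹ := by
      rw [← div_eq_mul_inv, le_div_iff₀ (by positivity), inv_pow, inv_mul_le_iff₀ (by positivity)]
      nlinarith
    have h3 : a + b = (a * u⁻¹ + b * u⁻¹) * u := by field_simp
    rw [h3]
    refine mul_le_mul_of_nonneg_right ?_ hu.le
    have h4 : 0 ≤ C * (1 + u ^ 2)⁻¹ := by positivity
    nlinarith [sq_nonneg (a - u⁻¹), sq_nonneg (b - u⁻¹), sq_nonneg a, sq_nonneg b]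

theorem symm_le_hilbMaj {f : ℝ → ℂ} {C : ℝ} {Φ : ℝ → ℝ} (hd : Differentiable ℝ f)
    (hC : ∀ x, ‖deriv f x‖ ≤ C) (hΦ : ∀ x, ‖f x‖ ≤ Φ x) (x : ℝ) {u : ℝ} (hu : 0 < u) :
    ‖(f (x - u) - f (x + u)) / u‖ ≤ hilbMaj C Φ x u := by
  refine norm_le_hilbMaj hu ((norm_nonneg _).trans (hC 0)) ?_ ?_
  · refine (lipschitz_of_deriv_bound hd hC _ _).trans (le_of_eq ?_)
    rw [show x - u - (x + u) = -(2 * u) by ring, abs_neg, abs_of_pos (by positivity)]; ring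
  · exact (norm_sub_le _ _).trans (add_le_add (hΦ _) (hΦ _))

namespace Reg

variable {f g : ℝ → ℂ}

theorem continuous (hf : Reg f) : Continuous f := hf.diff.continuous

theorem measurable_symm (hf : Reg f) (x : ℝ) (s : Set ℝ) :
    AEStronglyMeasurable (fun u : ℝ => (f (x - u) - f (x + u)) / u) (volume.restrict s) := by
  have := hf.continuous.measurable
  exact Measurable.aestronglyMeasurable (by fun_prop)

theorem integrableOn_symm (hf : Reg f) (x : ℝ) :
    IntegrableOn (fun u : ℝ => (f (x - u) - f (x + u)) / u) (Set.Ioi 0) := by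
  obtain ⟨C, hC⟩ := hf.bdd
  refine (integrable_hilbMaj hf.memLp.norm C x).integrableOn.mono' (hf.measurable_symm x _) ?_
  filter_upwards [self_mem_ae_restrict measurableSet_Ioi] with u hu
  exact symm_le_hilbMaj hf.diff (fun x => (hC x).2) (fun x => le_rfl) x hu

theorem memLp_sub (hf : Reg f) (x : ℝ) : MemLp (fun u => f (x - u)) 2 :=
  hf.memLp.comp_measurePreserving (Measure.measurePreserving_sub_left volume x)

/-- The truncated integrals fold to the symmetrized kernel on u > ε, and dominated convergence
removes the truncation. Thus the `limUnder` in the definition is a genuine limit, and from here on ℍ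
is an absolutely convergent integral. -/
theorem hilbert_eq (hf : Reg f) (x : ℝ) :
    hilbert f x = 1 / (Real.pi * Complex.I) *
      ∫ u in Set.Ioi (0 : ℝ), (f (x - u) - f (x + u)) / u := by
  unfold hilbert
  congr 1
  apply Tendsto.limUnder_eq
  have key : ∀ ε : ℝ, 0 < ε → ∫ y in {y : ℝ | ε < |x - y|}, f y / ((x : ℂ) - y) =
      ∫ u in Set.Ioi (0 : ℝ), (Set.Ioi ε).indicator (fun u => (f (x - u) - f (x + u)) / u) u := by
    intro ε hε
    have hm : MeasurableSet {u : ℝ | ε < |u|} := measurableSet_lt measurable_const (by fun_prop)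
    have h1 : ∫ y in {y : ℝ | ε < |x - y|}, f y / ((x : ℂ) - y) =
        ∫ u, {u : ℝ | ε < |u|}.indicator (fun u : ℝ => f (x - u) / (u : ℂ)) u := by
      rw [← integral_indicator (measurableSet_lt measurable_const (by fun_prop)),
        ← integral_sub_left_eq_self _ _ x]
      congr 1; ext u
      simp [Set.indicator]
    rw [h1, integral_eq_half_line]
    · refine setIntegral_congr_fun measurableSet_Ioi fun u hu => ?_
      have hu : 0 < u := hu
      simp only [Set.indicator, Set.mem_ofPred_eq, abs_of_pos hu, abs_neg, Set.mem_Ioi]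
      split_ifs
      · push_cast; rw [sub_neg_eq_add, div_neg, sub_div]; ring
      · simp
    · rw [integrable_indicator_iff hm]
      refine ((integrable_inv_one_add_sq.const_mul (1 + ε⁻¹ ^ 2)).add
        (integrable_normSq_of_L2 (hf.memLp_sub x))).integrableOn.mono' ?_ ?_
      · have := hf.continuous.measurable
        exact Measurable.aestronglyMeasurable (by fun_prop)
      · filter_upwards [self_mem_ae_restrict hm] with u hu
        have hu : ε < |u| := hu
        have hu0 : 0 < |u| := hε.trans hu
        rw [norm_div, Complex.norm_real, Real.norm_eq_abs]
        have h3 : |u|⁻¹ ^ 2 ≤ (1 + ε⁻¹ ^ 2) * (1 + u ^ 2)⁻¹ := by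
          rw [← div_eq_mul_inv, le_div_iff₀ (by positivity), ← sq_abs u]
          have : |u|⁻¹ ≤ ε⁻¹ := by gcongr
          have h4 : |u|⁻¹ ^ 2 * |u| ^ 2 = 1 := by field_simp
          have : |u|⁻¹ ^ 2 ≤ ε⁻¹ ^ 2 := by gcongr
          nlinarith
        rw [div_eq_mul_inv]
        simp only [Pi.add_apply]
        nlinarith [sq_nonneg (‖f (x - u)‖ - |u|⁻¹), sq_nonneg (‖f (x - u)‖)]
  have hev : ∀ᶠ ε in 𝓝[>] (0 : ℝ), ∫ u in Set.Ioi (0 : ℝ),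
      (Set.Ioi ε).indicator (fun u => (f (x - u) - f (x + u)) / u) u =
      ∫ y in {y : ℝ | ε < |x - y|}, f y / ((x : ℂ) - y) := by
    filter_upwards [self_mem_nhdsWithin] with ε hε using (key ε hε).symm
  refine Tendsto.congr' hev ?_
  refine tendsto_integral_filter_of_dominated_convergence
    (fun u => ‖(f (x - u) - f (x + u)) / u‖) ?_ ?_ (hf.integrableOn_symm x).norm ?_
  · exact Eventually.of_forall fun ε => (hf.measurable_symm x _).indicator measurableSet_Ioi
  · exact Eventually.of_forall fun ε => Eventually.of_forall fun u => norm_indicator_le_norm_self _ _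
  · filter_upwards [self_mem_ae_restrict measurableSet_Ioi] with u hu
    refine tendsto_const_nhds.congr' ?_
    filter_upwards [mem_nhdsWithin_of_mem_nhds (Iio_mem_nhds hu)] with ε hε
    rw [Set.indicator_of_mem]; exact hε

theorem hilbert_add (hf : Reg f) (hg : Reg g) (hfg : Reg (fun x => f x + g x)) (x : ℝ) :
    hilbert (fun x => f x + g x) x = hilbert f x + hilbert g x := by
  rw [hf.hilbert_eq, hg.hilbert_eq, hfg.hilbert_eq, ← mul_add,
    ← integral_add (hf.integrableOn_symm x) (hg.integrableOn_symm x)]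
  congr 1
  refine integral_congr_ae (ae_of_all _ fun u => ?_)
  simp only; ring

theorem hilbert_smul (c : ℂ) (hf : Reg f) (hcf : Reg (fun x => c * f x)) (x : ℝ) :
    hilbert (fun x => c * f x) x = c * hilbert f x := by
  have h : ∀ u : ℝ, (c * f (x - u) - c * f (x + u)) / u = c * ((f (x - u) - f (x + u)) / u) :=
    fun u => by ring
  simp only [hf.hilbert_eq, hcf.hilbert_eq, h, integral_const_mul]
  ring

theorem hilbert_star (hf : Reg f) (hf' : Reg (fun x => star (f x))) (x : ℝ) :
    hilbert (fun x => star (f x)) x = -star (hilbert f x) := by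
  rw [hf.hilbert_eq, hf'.hilbert_eq]
  simp only [Complex.star_def, map_mul, map_div₀, map_one, Complex.conj_ofReal, Complex.conj_I]
  rw [← integral_conj]
  simp only [map_div₀, map_sub, Complex.conj_ofReal]
  ring

/-! ### Boundary values of the Cauchy integral -/

/-- After y = x − u the kernel is 1/(u − iε) = u/(u² + ε²) + iε/(u² + ε²). The odd part is folded at
0 and the Poisson part is rescaled by u = εv. -/
theorem cauchy_eq (hf : Reg f) (x : ℝ) {ε : ℝ} (hε : 0 < ε) :
    ∫ y, f y / ((x : ℂ) - y - ε * Complex.I) =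
      (∫ u in Set.Ioi (0 : ℝ), (f (x - u) - f (x + u)) / u * ((u ^ 2 / (u ^ 2 + ε ^ 2) : ℝ) : ℂ)) +
        Complex.I * ∫ v : ℝ, f (x - ε * v) * (((1 + v ^ 2)⁻¹ : ℝ) : ℂ) := by
  obtain ⟨C, hC⟩ := hf.bdd
  have hmeas := hf.continuous.measurable
  have i1 : Integrable (fun u : ℝ => f (x - u) * ((u / (u ^ 2 + ε ^ 2) : ℝ) : ℂ)) := by
    refine ((integrable_inv_one_add_sq.const_mul (1 + ε⁻¹ ^ 2)).add
      (integrable_normSq_of_L2 (hf.memLp_sub x))).mono' ?_ (Eventually.of_forall fun u => ?_)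
    · exact Measurable.aestronglyMeasurable (by fun_prop)
    · rw [norm_mul, Complex.norm_real, Real.norm_eq_abs]
      have h3 : |u / (u ^ 2 + ε ^ 2)| ^ 2 ≤ (1 + ε⁻¹ ^ 2) * (1 + u ^ 2)⁻¹ := by
        rw [sq_abs, ← div_eq_mul_inv, div_pow, div_le_div_iff₀ (by positivity) (by positivity)]
        have h4 : ε⁻¹ ^ 2 * ε ^ 2 = 1 := by field_simp
        have h5 : 0 ≤ ε⁻¹ ^ 2 * u ^ 4 := by positivity
        have h6 : (1 + ε⁻¹ ^ 2) * (u ^ 2 + ε ^ 2) ^ 2 = u ^ 2 * (1 + u ^ 2) + u ^ 2 +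
          (2 * u ^ 2 * ε ^ 2 + ε ^ 4 + ε⁻¹ ^ 2 * u ^ 4 + (ε⁻¹ ^ 2 * ε ^ 2) * ε ^ 2) +
          (ε⁻¹ ^ 2 * ε ^ 2 - 1) * (2 * u ^ 2) := by ring
        rw [h6, h4]
        nlinarith [sq_nonneg u, sq_nonneg ε, sq_nonneg (ε ^ 2), mul_nonneg (sq_nonneg u) (sq_nonneg ε)]
      simp only [Pi.add_apply]
      nlinarith [sq_nonneg (‖f (x - u)‖ - |u / (u ^ 2 + ε ^ 2)|), sq_nonneg (‖f (x - u)‖)]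
  have i2 : Integrable (fun u : ℝ => f (x - u) * ((ε / (u ^ 2 + ε ^ 2) : ℝ) : ℂ)) := by
    refine (integrable_inv_one_add_sq.const_mul (C * (ε + ε⁻¹))).mono' ?_
      (Eventually.of_forall fun u => ?_)
    · exact Measurable.aestronglyMeasurable (by fun_prop)
    · rw [norm_mul, Complex.norm_real, Real.norm_of_nonneg (by positivity), mul_assoc]
      have := (norm_nonneg _).trans (hC 0).1
      gcongr
      · exact (hC _).1
      · rw [← div_eq_mul_inv, div_le_div_iff₀ (by positivity) (by positivity)]
        have h4 : ε⁻¹ * ε = 1 := by field_simp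
        have h6 : (ε + ε⁻¹) * (u ^ 2 + ε ^ 2) = ε * u ^ 2 + ε ^ 3 + ε⁻¹ * u ^ 2 + (ε⁻¹ * ε) * ε := by
          ring
        rw [h6, h4]
        have : 0 ≤ ε ^ 3 + ε⁻¹ * u ^ 2 := by positivity
        linarith
  have h1 : ∫ y, f y / ((x : ℂ) - y - ε * Complex.I) =
      (∫ u, f (x - u) * ((u / (u ^ 2 + ε ^ 2) : ℝ) : ℂ)) +
        Complex.I * ∫ u, f (x - u) * ((ε / (u ^ 2 + ε ^ 2) : ℝ) : ℂ) := by
    rw [← integral_const_mul, ← integral_add i1 (i2.const_mul _),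
      ← integral_sub_left_eq_self _ _ x]
    congr 1; ext u
    have h0 : (u : ℂ) ^ 2 + (ε : ℂ) ^ 2 ≠ 0 := by
      have : u ^ 2 + ε ^ 2 ≠ 0 := by positivity
      exact_mod_cast this
    have h1 : (u : ℂ) - ε * Complex.I ≠ 0 := by
      intro h
      have := congrArg Complex.im h
      simp at this; exact hε.ne' this
    push_cast
    rw [show (x : ℂ) - (x - u) - ε * Complex.I = u - ε * Complex.I by ring]
    field_simp
    linear_combination (f (x - u)) * ((ε : ℂ) ^ 2) * Complex.I_sq
  rw [h1]
  congr 1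
  · rw [integral_eq_half_line i1]
    refine setIntegral_congr_fun measurableSet_Ioi fun u hu => ?_
    have hu : (u : ℂ) ≠ 0 := by exact_mod_cast (ne_of_gt hu)
    have h0 : (u : ℂ) ^ 2 + (ε : ℂ) ^ 2 ≠ 0 := by
      have : u ^ 2 + ε ^ 2 ≠ 0 := by positivity
      exact_mod_cast this
    push_cast
    rw [sub_neg_eq_add, neg_sq]
    field_simp
    ring
  · congr 1
    have := Measure.integral_comp_mul_left
      (fun u : ℝ => f (x - u) * ((ε / (u ^ 2 + ε ^ 2) : ℝ) : ℂ)) ε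
    rw [abs_of_pos (by positivity), eq_inv_smul_iff₀ hε.ne'] at this
    rw [← this, ← integral_smul]
    congr 1; ext v
    have h0 : (1 : ℂ) + (v : ℂ) ^ 2 ≠ 0 := by
      have : 1 + v ^ 2 ≠ 0 := by positivity
      exact_mod_cast this
    have h2 : ((ε : ℂ) * v) ^ 2 + (ε : ℂ) ^ 2 = ε ^ 2 * (1 + v ^ 2) := by ring
    have h3 : (ε : ℂ) ≠ 0 := by exact_mod_cast hε.ne'
    rw [Complex.real_smul]
    push_cast
    rw [h2]
    field_simp

/-- Plemelj's formula: the odd part of the kernel converges to the Hilbert transform, and the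
Poisson part gives π i f(x) because ∫ dv/(1 + v²) = π. -/
theorem cauchy_tendsto (hf : Reg f) (x : ℝ) :
    Tendsto (fun ε : ℝ => ∫ y, f y / ((x : ℂ) - y - ε * Complex.I)) (𝓝[>] 0)
      (𝓝 (Real.pi * Complex.I * (f x + hilbert f x))) := by
  obtain ⟨C, hC⟩ := hf.bdd
  have hmeas := hf.continuous.measurable
  refine (tendsto_congr' (l₁ := 𝓝[>] (0 : ℝ)) (eventually_nhdsWithin_of_forall fun ε hε => hf.cauchy_eq x hε)).2 ?_
  have e2 : Real.pi * Complex.I * (f x + hilbert f x) =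
      (∫ u in Set.Ioi (0 : ℝ), (f (x - u) - f (x + u)) / u) +
        Complex.I * ∫ v : ℝ, f x * (((1 + v ^ 2)⁻¹ : ℝ) : ℂ) := by
    rw [hf.hilbert_eq, integral_const_mul, integral_complex_ofReal, integral_univ_inv_one_add_sq]
    have : (Real.pi : ℂ) ≠ 0 := by exact_mod_cast Real.pi_ne_zero
    field_simp
    ring
  rw [e2]
  have hid : Tendsto (fun ε : ℝ => ε) (𝓝[>] 0) (𝓝 0) := tendsto_nhdsWithin_of_tendsto_nhds tendsto_id
  refine Tendsto.add ?_ (Tendsto.const_mul _ ?_)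
  · refine tendsto_integral_filter_of_dominated_convergence
      (fun u => ‖(f (x - u) - f (x + u)) / u‖) ?_ ?_ (hf.integrableOn_symm x).norm ?_
    · exact Eventually.of_forall fun ε => (hf.measurable_symm x _).mul
        (Measurable.aestronglyMeasurable (by fun_prop))
    · refine Eventually.of_forall fun ε => Eventually.of_forall fun u => ?_
      rw [norm_mul, Complex.norm_real, Real.norm_of_nonneg (by positivity)]
      refine mul_le_of_le_one_right (norm_nonneg _) (div_le_one_of_le₀ ?_ (by positivity))
      nlinarith [sq_nonneg ε]
    · filter_upwards [self_mem_ae_restrict measurableSet_Ioi] with u hu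
      have hu : 0 < u := hu
      have h1 : Tendsto (fun ε : ℝ => u ^ 2 / (u ^ 2 + ε ^ 2)) (𝓝[>] 0) (𝓝 1) := by
        have : Tendsto (fun ε : ℝ => u ^ 2 / (u ^ 2 + ε ^ 2)) (𝓝[>] 0)
            (𝓝 (u ^ 2 / (u ^ 2 + 0 ^ 2))) :=
          tendsto_const_nhds.div (tendsto_const_nhds.add (hid.pow 2)) (by positivity)
        rwa [zero_pow two_ne_zero, add_zero, div_self (by positivity)] at this
      have h2 := ((Complex.continuous_ofReal.tendsto 1).comp h1).const_mul
        ((f (x - u) - f (x + u)) / (u : ℂ))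
      simpa using h2
  · refine tendsto_integral_filter_of_dominated_convergence
      (fun v => C * (1 + v ^ 2)⁻¹) ?_ ?_ (integrable_inv_one_add_sq.const_mul _) ?_
    · exact Eventually.of_forall fun ε => Measurable.aestronglyMeasurable (by fun_prop)
    · refine Eventually.of_forall fun ε => Eventually.of_forall fun v => ?_
      rw [norm_mul, Complex.norm_real, Real.norm_of_nonneg (by positivity)]
      gcongr; exact (hC _).1
    · refine Eventually.of_forall fun v => Tendsto.mul_const _ ?_
      have h1 : Tendsto (fun ε : ℝ => x - ε * v) (𝓝[>] 0) (𝓝 (x - 0 * v)) :=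
        tendsto_const_nhds.sub (hid.mul_const v)
      rw [zero_mul, sub_zero] at h1
      exact (hf.continuous.tendsto x).comp h1

end Reg

/-! ### Cauchy kernels -/

theorem sub_ne_zero_of_im {z : ℂ} (hz : z.im ≠ 0) (x : ℝ) : (x : ℂ) - z ≠ 0 := by
  intro h
  have := congrArg Complex.im h
  simp at this; exact hz this

theorem normSq_inv_sub_le {z : ℂ} (hz : z.im ≠ 0) (x : ℝ) :
    ‖((x : ℂ) - z)⁻¹‖ ^ 2 ≤ (1 + z.im⁻¹ ^ 2) * (1 + (x - z.re) ^ 2)⁻¹ := by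
  have h2 : 0 < z.im ^ 2 := by positivity
  have h : ‖(x : ℂ) - z‖ ^ 2 = (x - z.re) ^ 2 + z.im ^ 2 := by
    rw [← Complex.normSq_eq_norm_sq, Complex.normSq_apply]; simp; ring
  rw [norm_inv, inv_pow, h, ← div_eq_mul_inv, ← one_div,
    div_le_div_iff₀ (by positivity) (by positivity)]
  have h4 : z.im⁻¹ ^ 2 * z.im ^ 2 = 1 := by field_simp
  have : 0 ≤ z.im⁻¹ ^ 2 * (x - z.re) ^ 2 := by positivity
  nlinarith

theorem memLp_inv_sub {z : ℂ} (hz : z.im ≠ 0) : MemLp (fun x : ℝ => ((x : ℂ) - z)⁻¹) 2 := by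
  have hm : Measurable (fun x : ℝ => ((x : ℂ) - z)⁻¹) := by fun_prop
  rw [memLp_two_iff_integrable_sq_norm hm.aestronglyMeasurable]
  refine ((integrable_inv_one_add_sq.comp_sub_right z.re).const_mul (1 + z.im⁻¹ ^ 2)).mono'
    (by fun_prop) (Eventually.of_forall fun x => ?_)
  rw [Real.norm_of_nonneg (by positivity)]
  exact normSq_inv_sub_le hz x

theorem hinf_inv_sub {z : ℂ} (hz : z.im ≠ 0) : Hinf (fun x : ℝ => ((x : ℂ) - z)⁻¹) := by
  refine Hinf.of_class (𝒞 := {g | ∃ (n : ℕ) (c : ℂ), g = fun x : ℝ => c * ((x : ℂ) - z)⁻¹ ^ (n + 1)})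
    ?_ ⟨0, 1, by simp⟩
  rintro _ ⟨n, c, rfl⟩
  have hd : ∀ x : ℝ, HasDerivAt (fun x : ℝ => c * ((x : ℂ) - z)⁻¹ ^ (n + 1))
      (-c * (n + 1) * ((x : ℂ) - z)⁻¹ ^ (n + 1 + 1)) x := by
    intro x
    have h0 := sub_ne_zero_of_im hz x
    have h1 : HasDerivAt (fun x : ℝ => (x : ℂ) - z) 1 x :=
      (Complex.ofRealCLM.hasDerivAt (x := x)).sub_const z
    convert! ((h1.inv h0).pow (n + 1)).const_mul c using 1
    simp; field_simp; ring
  refine ⟨fun x => (hd x).differentiableAt, ?_, n + 1, -c * (n + 1), funext fun x => (hd x).deriv⟩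
  refine (memLp_inv_sub hz).of_le_mul (c := ‖c‖ * (|z.im|⁻¹) ^ n)
    (Measurable.aestronglyMeasurable (by fun_prop)) (Eventually.of_forall fun x => ?_)
  rw [norm_mul, norm_pow, pow_succ, mul_assoc]
  gcongr
  rw [norm_inv]
  have : |z.im| ≤ ‖(x : ℂ) - z‖ := by simpa using Complex.abs_im_le_norm ((x : ℂ) - z)
  gcongr

theorem Hinf.tendsto_zero {f : ℝ → ℂ} (hf : Hinf f) :
    Tendsto f atBot (𝓝 0) ∧ Tendsto f atTop (𝓝 0) := by
  have hd := fun x (_ : True) => (hf.mul hf).hasDerivAt x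
  have i1 := hf.integrable_mul hf
  have i2 : Integrable (_root_.deriv fun x => f x * f x) := by
    refine ((hf.deriv.integrable_mul hf).add (hf.integrable_mul hf.deriv)).congr
      (Eventually.of_forall fun x => ?_)
    exact (deriv_mul (hf.differentiable x) (hf.differentiable x)).symm
  have key : ∀ l : Filter ℝ, Tendsto (fun x => f x * f x) l (𝓝 0) → Tendsto f l (𝓝 0) := by
    intro l h
    rw [tendsto_zero_iff_norm_tendsto_zero] at h ⊢
    have := (Real.continuous_sqrt.tendsto 0).comp h
    simpa [Function.comp_def] using this
  exact ⟨key _ (tendsto_zero_of_hasDerivAt_of_integrableOn_Iic (a := 0) (fun x _ => hd x trivial)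
    i2.integrableOn i1.integrableOn), key _ (tendsto_zero_of_hasDerivAt_of_integrableOn_Ioi (a := 0)
    (fun x _ => hd x trivial) i2.integrableOn i1.integrableOn)⟩

/-- Both poles are on the same side of the line, so the contour may be closed on the other side.
Explicit primitives replace the contour: −1/(x − z) for a double pole, and otherwise the logarithm
of (x − z)/(x − w). -/
theorem integral_inv_sub_mul_inv_sub {z w : ℂ} (hz : 0 < z.im) (hw : 0 < w.im) :
    ∫ x : ℝ, ((x : ℂ) - z)⁻¹ * ((x : ℂ) - w)⁻¹ = 0 := by
  have hz0 := sub_ne_zero_of_im hz.ne'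
  have hw0 := sub_ne_zero_of_im hw.ne'
  have tz := (hinf_inv_sub hz.ne').tendsto_zero
  have tw := (hinf_inv_sub hw.ne').tendsto_zero
  have hi := (hinf_inv_sub hz.ne').integrable_mul (hinf_inv_sub hw.ne')
  have dz : ∀ x : ℝ, HasDerivAt (fun x : ℝ => (x : ℂ) - z) 1 x :=
    fun x => (Complex.ofRealCLM.hasDerivAt (x := x)).sub_const z
  have dw : ∀ x : ℝ, HasDerivAt (fun x : ℝ => (x : ℂ) - w) 1 x :=
    fun x => (Complex.ofRealCLM.hasDerivAt (x := x)).sub_const w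
  rcases eq_or_ne z w with rfl | hne
  · have hd : ∀ x : ℝ, HasDerivAt (fun x : ℝ => -((x : ℂ) - z)⁻¹)
        (((x : ℂ) - z)⁻¹ * ((x : ℂ) - z)⁻¹) x := by
      intro x
      convert! ((dz x).inv (hz0 x)).neg using 1
      have := hz0 x
      field_simp
    rw [integral_of_hasDerivAt_of_tendsto hd hi tz.1.neg tz.2.neg]; simp
  -- If the quotient q were real and ≤ 0, the imaginary part of x − z = q(x − w) would read Im z = q
  -- Im w, which is impossible for positive imaginary parts.
  · have hs : ∀ x : ℝ, ((x : ℂ) - z) / ((x : ℂ) - w) ∈ Complex.slitPlane := by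
      intro x
      rw [Complex.mem_slitPlane_iff_not_le_zero]
      intro h
      rw [Complex.le_def] at h
      obtain ⟨h1, h2⟩ := h
      set q := ((x : ℂ) - z) / ((x : ℂ) - w) with hq
      have h3 : (x : ℂ) - z = q * ((x : ℂ) - w) := by rw [hq, div_mul_cancel₀ _ (hw0 x)]
      have h4 := congrArg Complex.im h3
      simp only [Complex.sub_im, Complex.ofReal_im, Complex.mul_im, Complex.zero_re,
        Complex.zero_im] at h4 h1 h2
      rw [h2] at h4
      nlinarith
    have hd : ∀ x : ℝ, HasDerivAt (fun x : ℝ => Complex.log (((x : ℂ) - z) / ((x : ℂ) - w)))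
        ((z - w) * (((x : ℂ) - z)⁻¹ * ((x : ℂ) - w)⁻¹)) x := by
      intro x
      convert! ((dz x).div (dw x) (hw0 x)).clog_real (hs x) using 1
      have h1 := hz0 x
      have h2 := hw0 x
      rw [Pi.div_apply]
      field_simp
      ring
    have ht : ∀ l : Filter ℝ, Tendsto (fun x : ℝ => ((x : ℂ) - w)⁻¹) l (𝓝 0) →
        Tendsto (fun x : ℝ => Complex.log (((x : ℂ) - z) / ((x : ℂ) - w))) l (𝓝 0) := by
      intro l h
      have h1 : Tendsto (fun x : ℝ => ((x : ℂ) - z) / ((x : ℂ) - w)) l (𝓝 1) := by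
        have h2 := (h.const_mul (w - z)).const_add 1
        rw [mul_zero, add_zero] at h2
        refine h2.congr fun x => ?_
        have := hw0 x
        field_simp
        ring
      rw [← Complex.log_one]
      exact h1.clog (by simp)
    have h1 := integral_of_hasDerivAt_of_tendsto hd (hi.const_mul _) (ht _ tw.1) (ht _ tw.2)
    rw [integral_const_mul, sub_zero, mul_eq_zero, sub_eq_zero] at h1
    exact h1.resolve_left hne

/-! ### The Cauchy integral of rapidly decaying functions -/

/-- The Cauchy integral, up to a constant factor, on the line at height `-ε`. -/
def cauchy (ε : ℝ) (f : ℝ → ℂ) (x : ℝ) : ℂ := ∫ y, f y / ((x : ℂ) - y - ε * Complex.I)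

theorem div_sub_eq (ε x y : ℝ) (c : ℂ) :
    c / ((x : ℂ) - y - ε * Complex.I) = c * ((x : ℂ) - (y + ε * Complex.I))⁻¹ := by
  rw [div_eq_mul_inv, sub_sub]

/-- Regular functions with one additional order of decay. -/
structure Dec (f : ℝ → ℂ) : Prop where
  reg : Reg f
  reg_mul : Reg (fun y => y * f y)
  integrable : Integrable f

theorem integrable_cauchy_prod {f h : ℝ → ℂ} (hf : Integrable f) (hh : MemLp h 2) {ε : ℝ}
    (hε : 0 < ε) : Integrable (fun p : ℝ × ℝ => f p.2 / ((p.1 : ℂ) - p.2 - ε * Complex.I) * h p.1)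
      (volume.prod volume) := by
  have i1 : Integrable (fun p : ℝ × ℝ => ‖f p.2‖ * ((1 + ε⁻¹ ^ 2) * (1 + (p.1 - p.2) ^ 2)⁻¹))
      (volume.prod volume) := by
    exact hf.norm.convolution_integrand (ContinuousLinearMap.mul ℝ ℝ)
      (integrable_inv_one_add_sq.const_mul (1 + ε⁻¹ ^ 2))
  have i2 : Integrable (fun p : ℝ × ℝ => ‖h p.1‖ ^ 2 * ‖f p.2‖) (volume.prod volume) :=
    (integrable_normSq_of_L2 hh).mul_prod hf.norm
  refine (i1.add i2).mono' ?_ (Eventually.of_forall fun p => ?_)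
  · simp only [div_eq_mul_inv]
    refine (hf.1.comp_snd.mul ?_).mul hh.1.comp_fst
    exact Measurable.aestronglyMeasurable (by fun_prop)
  · rw [div_sub_eq, norm_mul, norm_mul]
    have h1 := normSq_inv_sub_le (z := p.2 + ε * Complex.I) (by simpa using hε.ne') p.1
    have h3 : ((p.2 : ℂ) + ε * Complex.I).re = p.2 := by simp
    have h4 : ((p.2 : ℂ) + ε * Complex.I).im = ε := by simp
    rw [h3, h4] at h1
    simp only [Pi.add_apply]
    set r := ‖((p.1 : ℂ) - (p.2 + ε * Complex.I))⁻¹‖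
    have h2 : r * ‖h p.1‖ ≤ (1 + ε⁻¹ ^ 2) * (1 + (p.1 - p.2) ^ 2)⁻¹ + ‖h p.1‖ ^ 2 := by
      nlinarith [sq_nonneg (r - ‖h p.1‖), sq_nonneg r, sq_nonneg ‖h p.1‖]
    nlinarith [norm_nonneg (f p.2)]

/-- Fubini moves the Cauchy kernel from f onto h, where it appears as a simple pole at y + iε. -/
theorem integral_cauchy_mul {f h : ℝ → ℂ} (hf : Integrable f) (hh : MemLp h 2) {ε : ℝ}
    (hε : 0 < ε) : ∫ x, cauchy ε f x * h x =
      ∫ y, f y * ∫ x : ℝ, ((x : ℂ) - (y + ε * Complex.I))⁻¹ * h x := by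
  simp only [cauchy, ← integral_mul_const, ← integral_const_mul]
  rw [integral_integral_swap (integrable_cauchy_prod hf hh hε)]
  simp only [div_sub_eq, mul_assoc]

namespace Dec

variable {f g : ℝ → ℂ}

/-- Multiplying by x costs only harmless terms: x·C_ε f = ∫ f + C_ε(y f) + iε C_ε f. The bounds for
f and y f are uniform in ε, so the decay (1 + |x|)⁻¹ is uniform too and dominates the passage ε → 0.
-/
theorem norm_cauchy_le (hf : Dec f) :
    ∃ M, ∀ ε : ℝ, 0 < ε → ε ≤ 1 → ∀ x, ‖cauchy ε f x‖ * (1 + |x|) ≤ M := by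
  have key : ∀ {f : ℝ → ℂ}, Reg f → ∃ M, ∀ ε : ℝ, 0 < ε → ∀ x, ‖cauchy ε f x‖ ≤ M := by
    intro f hf
    obtain ⟨C, hC⟩ := hf.bdd
    have hC0 := (norm_nonneg _).trans (hC 0).1
    refine ⟨(∫ u, ((4 * C + 2) * (1 + u ^ 2)⁻¹)) + (∫ u, ‖f u‖ ^ 2) + (∫ u, ‖f u‖ ^ 2) +
      ∫ v : ℝ, C * (1 + v ^ 2)⁻¹, fun ε hε x => ?_⟩
    rw [cauchy, hf.cauchy_eq x hε]
    refine norm_add_le_of_le ?_ ?_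
    · refine (norm_integral_le_integral_norm _).trans ?_
      have i0 := integrable_hilbMaj hf.memLp.norm C x
      have h1 : ∫ u, hilbMaj C (fun y => ‖f y‖) x u =
          (∫ u, ((4 * C + 2) * (1 + u ^ 2)⁻¹)) + (∫ u, ‖f u‖ ^ 2) + (∫ u, ‖f u‖ ^ 2) := by
        have i1 := integrable_sq_comp hf.memLp.norm x
        have i2 := integral_sub_left_eq_self (fun u => ‖f u‖ ^ 2) volume x
        have i3 := integral_add_left_eq_self (μ := volume) (fun u => ‖f u‖ ^ 2) x
        simp only [hilbMaj]
        have i4 : Integrable (fun u => ‖f (x - u)‖ ^ 2 + ‖f (x + u)‖ ^ 2) := i1.1.add i1.2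
        rw [integral_add (integrable_inv_one_add_sq.const_mul _) i4,
          integral_add i1.1 i1.2, i2, i3]
        ring
      rw [← h1]
      refine (integral_mono_of_nonneg (Eventually.of_forall fun _ => norm_nonneg _)
        i0.integrableOn ?_).trans (setIntegral_le_integral i0 (Eventually.of_forall fun u => ?_))
      · filter_upwards [self_mem_ae_restrict measurableSet_Ioi] with u hu
        have h2 : ‖((u ^ 2 / (u ^ 2 + ε ^ 2) : ℝ) : ℂ)‖ ≤ 1 := by
          rw [Complex.norm_real, Real.norm_of_nonneg (by positivity)]
          exact div_le_one_of_le₀ (by nlinarith [sq_nonneg ε]) (by positivity)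
        rw [norm_mul]
        exact (mul_le_of_le_one_right (norm_nonneg _) h2).trans
          (symm_le_hilbMaj hf.diff (fun x => (hC x).2) (fun x => le_rfl) x hu)
      · simp only [hilbMaj, Pi.zero_apply]; positivity
    · rw [norm_mul, Complex.norm_I, one_mul]
      refine norm_integral_le_of_norm_le (integrable_inv_one_add_sq.const_mul _)
        (Eventually.of_forall fun v => ?_)
      rw [norm_mul, Complex.norm_real, Real.norm_of_nonneg (by positivity)]
      gcongr; exact (hC _).1
  obtain ⟨M, hM⟩ := key hf.reg
  obtain ⟨M', hM'⟩ := key hf.reg_mul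
  have hM0 := (norm_nonneg _).trans (hM 1 one_pos 0)
  refine ⟨M + ((∫ y, ‖f y‖) + M' + M), fun ε hε hε1 x => ?_⟩
  have int : ∀ {f : ℝ → ℂ}, Reg f → Integrable (fun y : ℝ => f y / ((x : ℂ) - y - ε * Complex.I)) := by
    intro f hf
    have h1 := integrable_mul_of_L2 hf.memLp
      (memLp_inv_sub (z := (x : ℂ) - ε * Complex.I) (by simpa using hε.ne'))
    refine h1.neg.congr (Eventually.of_forall fun y => ?_)
    simp only [Pi.neg_apply, div_eq_mul_inv]
    rw [show (x : ℂ) - y - ε * Complex.I = -(y - (x - ε * Complex.I)) by ring, inv_neg]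
    ring
  have h1 : x * cauchy ε f x =
      (∫ y, f y) + cauchy ε (fun y => y * f y) x + ε * Complex.I * cauchy ε f x := by
    have i1 : Integrable (fun y : ℝ => f y + y * f y / ((x : ℂ) - y - ε * Complex.I)) :=
      hf.integrable.add (int hf.reg_mul)
    simp only [cauchy]
    rw [← integral_const_mul, ← integral_const_mul, ← integral_add hf.integrable (int hf.reg_mul),
      ← integral_add i1 ((int hf.reg).const_mul _)]
    congr 1; ext y
    have h0 : (x : ℂ) - y - ε * Complex.I ≠ 0 := by
      intro h
      have := congrArg Complex.im h
      simp at this; exact hε.ne' this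
    field_simp
    ring
  have h2 : ‖cauchy ε f x‖ * |x| ≤ (∫ y, ‖f y‖) + M' + M := by
    rw [mul_comm, ← Real.norm_eq_abs, ← Complex.norm_real, ← norm_mul, h1]
    refine norm_add_le_of_le (norm_add_le_of_le (norm_integral_le_integral_norm _) (hM' ε hε x)) ?_
    rw [norm_mul, norm_mul, Complex.norm_I, mul_one, Complex.norm_real, Real.norm_of_nonneg hε.le]
    nlinarith [hM ε hε x, norm_nonneg (cauchy ε f x)]
  rw [mul_add, mul_one]
  exact add_le_add (hM ε hε x) h2

theorem measurable_cauchy (hf : Dec f) (ε : ℝ) : AEStronglyMeasurable (cauchy ε f) := by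
  have := hf.reg.continuous.measurable
  have h : StronglyMeasurable (Function.uncurry
    fun x y : ℝ => f y / ((x : ℂ) - y - ε * Complex.I)) := Measurable.stronglyMeasurable (by fun_prop)
  exact h.integral_prod_right.aestronglyMeasurable

theorem sq_le_inv {a b M N x : ℝ} (ha : 0 ≤ a) (hb : 0 ≤ b) (h : a * (1 + |x|) ≤ M)
    (h' : b * (1 + |x|) ≤ N) : a * b ≤ M * N * (1 + x ^ 2)⁻¹ := by
  rw [← div_eq_mul_inv, le_div_iff₀ (by positivity)]
  have h1 : (a * (1 + |x|)) * (b * (1 + |x|)) ≤ M * N :=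
    mul_le_mul h h' (by positivity) ((by positivity : 0 ≤ a * (1 + |x|)).trans h)
  refine le_trans ?_ h1
  have : 1 + x ^ 2 ≤ (1 + |x|) * (1 + |x|) := by nlinarith [sq_abs x, abs_nonneg x]
  nlinarith [mul_nonneg ha hb, mul_le_mul_of_nonneg_left this (mul_nonneg ha hb)]

theorem memLp_cauchy (hf : Dec f) {ε : ℝ} (hε : 0 < ε) (hε1 : ε ≤ 1) : MemLp (cauchy ε f) 2 := by
  obtain ⟨M, hM⟩ := hf.norm_cauchy_le
  rw [memLp_two_iff_integrable_sq_norm (hf.measurable_cauchy ε)]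
  refine (integrable_inv_one_add_sq.const_mul (M * M)).mono'
    ((hf.measurable_cauchy ε).norm.pow 2) (Eventually.of_forall fun x => ?_)
  rw [Real.norm_of_nonneg (by positivity), pow_two]
  exact sq_le_inv (norm_nonneg _) (norm_nonneg _) (hM ε hε hε1 x) (hM ε hε hε1 x)

/-- Two applications of Fubini leave the product of two Cauchy kernels with poles y + iε and y' +
iε. -/
theorem integral_cauchy_mul_cauchy (hf : Dec f) (hg : Dec g) {ε : ℝ} (hε : 0 < ε) (hε1 : ε ≤ 1) :
    ∫ x, cauchy ε f x * cauchy ε g x = 0 := by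
  rw [integral_cauchy_mul hf.integrable (hg.memLp_cauchy hε hε1) hε]
  have h : ∀ y : ℝ, ∫ x : ℝ, ((x : ℂ) - (y + ε * Complex.I))⁻¹ * cauchy ε g x = 0 := by
    intro y
    have hy : 0 < ((y : ℂ) + ε * Complex.I).im := by simpa using hε
    have h1 := integral_cauchy_mul hg.integrable (memLp_inv_sub hy.ne') hε
    simp only [mul_comm _ (cauchy ε g _)]
    rw [h1]
    have h2 : ∀ y' : ℝ, ∫ x : ℝ, ((x : ℂ) - (y' + ε * Complex.I))⁻¹ *
        ((x : ℂ) - (y + ε * Complex.I))⁻¹ = 0 := fun y' =>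
      integral_inv_sub_mul_inv_sub (by simpa using hε) hy
    simp [h2]
  simp [h]

theorem bdry (hf : Dec f) : ∃ M, ∀ x, ‖f x + hilbert f x‖ * (1 + |x|) ≤ M := by
  obtain ⟨M, hM⟩ := hf.norm_cauchy_le
  refine ⟨M * Real.pi⁻¹, fun x => ?_⟩
  have h1 := ((hf.reg.cauchy_tendsto x).norm.mul_const (1 + |x|))
  have h2 : ‖(Real.pi * Complex.I * (f x + hilbert f x) : ℂ)‖ * (1 + |x|) ≤ M := by
    refine le_of_tendsto h1 ?_
    filter_upwards [self_mem_nhdsWithin, mem_nhdsWithin_of_mem_nhds (Iio_mem_nhds one_pos)]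
      with ε hε hε1 using hM ε hε (le_of_lt hε1) x
  rw [norm_mul, norm_mul, Complex.norm_I, mul_one, Complex.norm_real,
    Real.norm_of_nonneg Real.pi_pos.le] at h2
  rw [← div_eq_mul_inv, le_div_iff₀ Real.pi_pos]
  linarith

/-- Limit ε → 0 of the previous identity, with both factors dominated by (1 + |x|)⁻¹. Isometry,
skew-adjointness and ℍ² = I are all deduced from this relation. -/
theorem integral_bdry_mul_bdry (hf : Dec f) (hg : Dec g) :
    ∫ x, (f x + hilbert f x) * (g x + hilbert g x) = 0 := by
  obtain ⟨M, hM⟩ := hf.norm_cauchy_le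
  obtain ⟨N, hN⟩ := hg.norm_cauchy_le
  have h : Tendsto (fun ε : ℝ => ∫ x, cauchy ε f x * cauchy ε g x) (𝓝[>] 0)
      (𝓝 (∫ x, (Real.pi * Complex.I * (f x + hilbert f x)) *
        (Real.pi * Complex.I * (g x + hilbert g x)))) := by
    refine tendsto_integral_filter_of_dominated_convergence
      (fun x => M * N * (1 + x ^ 2)⁻¹) ?_ ?_ (integrable_inv_one_add_sq.const_mul _) ?_
    · exact Eventually.of_forall fun ε => (hf.measurable_cauchy ε).mul (hg.measurable_cauchy ε)
    · filter_upwards [self_mem_nhdsWithin, mem_nhdsWithin_of_mem_nhds (Iio_mem_nhds one_pos)]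
        with ε hε hε1
      refine Eventually.of_forall fun x => ?_
      rw [norm_mul]
      exact sq_le_inv (norm_nonneg _) (norm_nonneg _) (hM ε hε (le_of_lt hε1) x)
        (hN ε hε (le_of_lt hε1) x)
    · exact Eventually.of_forall fun x => (hf.reg.cauchy_tendsto x).mul (hg.reg.cauchy_tendsto x)
  have h0 : Tendsto (fun ε : ℝ => ∫ x, cauchy ε f x * cauchy ε g x) (𝓝[>] 0) (𝓝 0) := by
    refine tendsto_const_nhds.congr' ?_
    filter_upwards [self_mem_nhdsWithin, mem_nhdsWithin_of_mem_nhds (Iio_mem_nhds one_pos)]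
      with ε hε hε1 using (integral_cauchy_mul_cauchy hf hg hε (le_of_lt hε1)).symm
  have h1 := tendsto_nhds_unique h h0
  have h2 : ∀ x, (Real.pi * Complex.I * (f x + hilbert f x)) *
        (Real.pi * Complex.I * (g x + hilbert g x)) =
      -(Real.pi : ℂ) ^ 2 * ((f x + hilbert f x) * (g x + hilbert g x)) := by
    intro x; linear_combination (Real.pi : ℂ) ^ 2 * (f x + hilbert f x) * (g x + hilbert g x) * Complex.I_sq
  simp only [h2, integral_const_mul] at h1
  have h3 : (Real.pi : ℂ) ≠ 0 := by exact_mod_cast Real.pi_ne_zero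
  simpa [h3] using h1

end Dec

/-! ### Cut-offs -/

theorem Reg.ofReal_mul {f : ℝ → ℂ} (hf : Reg f) {χ : ℝ → ℝ} (hχ : Differentiable ℝ χ) {A B : ℝ}
    (hA : ∀ x, |χ x| ≤ A) (hB : ∀ x, |deriv χ x| ≤ B) : Reg (fun x => (χ x : ℂ) * f x) := by
  obtain ⟨C, hC⟩ := hf.bdd
  have hA0 := (abs_nonneg _).trans (hA 0)
  have hB0 := (abs_nonneg _).trans (hB 0)
  have hC0 := (norm_nonneg _).trans (hC 0).1
  have hd : ∀ x, HasDerivAt (fun x => (χ x : ℂ) * f x) (deriv χ x * f x + χ x * deriv f x) x :=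
    fun x => (hχ x).hasDerivAt.ofReal_comp.mul (hf.diff x).hasDerivAt
  have hm := hχ.continuous.measurable
  have hm' := hf.continuous.measurable
  refine ⟨fun x => (hd x).differentiableAt, ?_, A * C + B * C, fun x => ⟨?_, ?_⟩⟩
  · refine hf.memLp.of_le_mul (c := A) (Measurable.aestronglyMeasurable (by fun_prop))
      (Eventually.of_forall fun x => ?_)
    rw [norm_mul, Complex.norm_real]
    gcongr; exact hA x
  · rw [norm_mul, Complex.norm_real]
    have : ‖χ x‖ * ‖f x‖ ≤ A * C := mul_le_mul (hA x) (hC x).1 (norm_nonneg _) hA0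
    have : 0 ≤ B * C := by positivity
    linarith
  · rw [(hd x).deriv, add_comm]
    refine norm_add_le_of_le ?_ ?_ <;> rw [norm_mul, Complex.norm_real]
    · exact mul_le_mul (hA x) (hC x).2 (norm_nonneg _) hA0
    · exact mul_le_mul (hB x) (hC x).1 (norm_nonneg _) hB0

theorem Reg.add {f g : ℝ → ℂ} (hf : Reg f) (hg : Reg g) : Reg (fun x => f x + g x) := by
  obtain ⟨C, hC⟩ := hf.bdd
  obtain ⟨C', hC'⟩ := hg.bdd
  refine ⟨hf.diff.add hg.diff, hf.memLp.add hg.memLp, C + C', fun x =>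
    ⟨norm_add_le_of_le (hC x).1 (hC' x).1, ?_⟩⟩
  rw [deriv_fun_add (hf.diff x) (hg.diff x)]
  exact norm_add_le_of_le (hC x).2 (hC' x).2

theorem Reg.smul {f : ℝ → ℂ} (c : ℂ) (hf : Reg f) : Reg (fun x => c * f x) := by
  obtain ⟨C, hC⟩ := hf.bdd
  refine ⟨hf.diff.const_mul c, hf.memLp.const_mul c, ‖c‖ * C, fun x => ⟨?_, ?_⟩⟩
  · rw [norm_mul]; gcongr; exact (hC x).1
  · rw [deriv_const_mul c (hf.diff x), norm_mul]; gcongr; exact (hC x).2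

theorem Reg.sub {f g : ℝ → ℂ} (hf : Reg f) (hg : Reg g) : Reg (fun x => f x - g x) := by
  simpa [sub_eq_add_neg] using hf.add (hg.smul (-1))

protected theorem Reg.star {f : ℝ → ℂ} (hf : Reg f) : Reg (fun x => star (f x)) := by
  obtain ⟨C, hC⟩ := hf.bdd
  refine ⟨hf.diff.star, hf.memLp.star, C, fun x => ⟨?_, ?_⟩⟩
  · rw [norm_star]; exact (hC x).1
  · rw [deriv.star, norm_star]; exact (hC x).2

theorem Reg.hilbert_add' {f g : ℝ → ℂ} (hf : Reg f) (hg : Reg g) (x : ℝ) :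
    hilbert (fun x => f x + g x) x = hilbert f x + hilbert g x := hf.hilbert_add hg (hf.add hg) x

theorem Reg.hilbert_sub {f g : ℝ → ℂ} (hf : Reg f) (hg : Reg g) (x : ℝ) :
    hilbert (fun x => f x - g x) x = hilbert f x - hilbert g x := by
  have := hf.hilbert_add' (hg.smul (-1)) x
  rw [hg.hilbert_smul _ (hg.smul (-1))] at this
  simpa [sub_eq_add_neg] using this

theorem integrable_star {f : ℝ → ℂ} (hf : Integrable f) : Integrable (fun x => star (f x)) :=
  hf.mono hf.1.star (ae_of_all _ fun x => by simp)

/-- A rational cut-off function. -/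
def cut (δ : ℝ) (y : ℝ) : ℝ := (1 + δ * y ^ 2)⁻¹

section cut

variable {δ : ℝ}

theorem cut_pos (hδ : 0 < δ) (y : ℝ) : 0 < 1 + δ * y ^ 2 := by positivity

theorem abs_cut_le (hδ : 0 < δ) (y : ℝ) : |cut δ y| ≤ 1 := by
  have := cut_pos hδ y
  rw [cut, abs_of_pos (by positivity)]
  exact inv_le_one_of_one_le₀ (by nlinarith [mul_nonneg hδ.le (sq_nonneg y)])

theorem hasDerivAt_cut (hδ : 0 < δ) (y : ℝ) :
    HasDerivAt (cut δ) (-(2 * δ * y) * (1 + δ * y ^ 2)⁻¹ ^ 2) y := by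
  have := (cut_pos hδ y).ne'
  convert! ((((hasDerivAt_id y).pow 2).const_mul δ).const_add 1).inv this using 1
  simp; field_simp

theorem hasDerivAt_mul_cut (hδ : 0 < δ) (y : ℝ) :
    HasDerivAt (fun y => y * cut δ y) ((1 - δ * y ^ 2) * (1 + δ * y ^ 2)⁻¹ ^ 2) y := by
  have := (cut_pos hδ y).ne'
  convert! (hasDerivAt_id y).mul (hasDerivAt_cut hδ y) using 1
  simp [cut]; field_simp; ring

theorem abs_deriv_cut_le (hδ : 0 < δ) (hδ1 : δ ≤ 1) (y : ℝ) : |deriv (cut δ) y| ≤ 1 := by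
  have := cut_pos hδ y
  rw [(hasDerivAt_cut hδ y).deriv, abs_mul, inv_pow, abs_inv, abs_of_pos (by positivity : 0 < (1 + δ * y ^ 2) ^ 2),
    ← div_eq_mul_inv, div_le_one (by positivity), abs_le]
  have h1 : 0 ≤ δ * y ^ 2 := by positivity
  have h2 : 0 ≤ δ * (y - 1) ^ 2 := by positivity
  have h3 : 0 ≤ δ * (y + 1) ^ 2 := by positivity
  constructor <;> nlinarith

theorem abs_deriv_mul_cut_le (hδ : 0 < δ) (y : ℝ) : |deriv (fun y => y * cut δ y) y| ≤ 1 := by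
  have := cut_pos hδ y
  rw [(hasDerivAt_mul_cut hδ y).deriv, abs_mul, inv_pow, abs_inv, abs_of_pos (by positivity : 0 < (1 + δ * y ^ 2) ^ 2),
    ← div_eq_mul_inv, div_le_one (by positivity), abs_le]
  have h1 : 0 ≤ δ * y ^ 2 := by positivity
  constructor <;> nlinarith

theorem abs_mul_cut_le (hδ : 0 < δ) (y : ℝ) : |y * cut δ y| ≤ δ⁻¹ + 1 := by
  have := cut_pos hδ y
  rw [cut, ← div_eq_mul_inv, abs_div, abs_of_pos this, div_le_iff₀ this, abs_le]
  have h0 : δ⁻¹ * δ = 1 := by field_simp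
  have h1 : (δ⁻¹ + 1) * (1 + δ * y ^ 2) = δ⁻¹ + 1 + (δ⁻¹ * δ) * y ^ 2 + δ * y ^ 2 := by ring
  have h2 : 0 ≤ δ * y ^ 2 := by positivity
  have h3 : 0 < δ⁻¹ := by positivity
  rw [h1, h0]
  constructor <;> nlinarith [sq_nonneg (y - 1), sq_nonneg (y + 1)]

theorem Reg.cut {f : ℝ → ℂ} (hf : Reg f) (hδ : 0 < δ) (hδ1 : δ ≤ 1) :
    Reg (fun y => (cut δ y : ℂ) * f y) :=
  hf.ofReal_mul (fun y => (hasDerivAt_cut hδ y).differentiableAt) (abs_cut_le hδ)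
    (abs_deriv_cut_le hδ hδ1)

theorem Reg.dec_cut {f : ℝ → ℂ} (hf : Reg f) (hδ : 0 < δ) (hδ1 : δ ≤ 1) :
    Dec (fun y => (WaterWave.cut δ y : ℂ) * f y) := by
  obtain ⟨C, hC⟩ := hf.bdd
  have hm := (hf.cut hδ hδ1).continuous
  refine ⟨hf.cut hδ hδ1, ?_, ?_⟩
  · have := hf.ofReal_mul (fun y => (hasDerivAt_mul_cut hδ y).differentiableAt) (abs_mul_cut_le hδ)
      (abs_deriv_mul_cut_le hδ)
    simpa only [Complex.ofReal_mul, mul_assoc] using this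
  · refine (integrable_inv_one_add_sq.const_mul ((1 + δ⁻¹) * C)).mono' hm.aestronglyMeasurable
      (Eventually.of_forall fun y => ?_)
    have h0 := cut_pos hδ y
    rw [norm_mul, Complex.norm_real, WaterWave.cut, Real.norm_of_nonneg (by positivity), mul_right_comm]
    refine mul_le_mul ?_ (hC y).1 (norm_nonneg _) (by positivity)
    rw [← div_eq_mul_inv, ← one_div, div_le_div_iff₀ h0 (by positivity)]
    have h1 : δ⁻¹ * δ = 1 := by field_simp
    have h2 : (1 + δ⁻¹) * (1 + δ * y ^ 2) = 1 + δ⁻¹ + (δ⁻¹ * δ) * y ^ 2 + δ * y ^ 2 := by ring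
    have h3 : 0 ≤ δ * y ^ 2 := by positivity
    have h4 : 0 < δ⁻¹ := by positivity
    rw [h2, h1]; linarith

theorem tendsto_cut (y : ℝ) : Tendsto (fun n : ℕ => cut (1 / ((n : ℝ) + 1)) y) atTop (𝓝 1) := by
  have h := tendsto_one_div_add_atTop_nhds_zero_nat (𝕜 := ℝ)
  have h1 := ((h.mul_const (y ^ 2)).const_add 1).inv₀ (by norm_num)
  simpa [cut] using h1

end cut

/-! ### The Hilbert transform on square integrable functions -/

namespace Reg

variable {f g : ℝ → ℂ}

theorem measurable_hilbert (hf : Reg f) : AEStronglyMeasurable (hilbert f) := by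
  have := hf.continuous.measurable
  have h : StronglyMeasurable (Function.uncurry
    fun x u : ℝ => (f (x - u) - f (x + u)) / (u : ℂ)) := Measurable.stronglyMeasurable (by fun_prop)
  rw [funext hf.hilbert_eq]
  exact (h.integral_prod_right.aestronglyMeasurable).const_mul _

end Reg

theorem Dec.memLp_hilbert {f : ℝ → ℂ} (hf : Dec f) : MemLp (hilbert f) 2 := by
  obtain ⟨M, hM⟩ := hf.bdry
  have hm : AEStronglyMeasurable (fun x => f x + hilbert f x) :=
    hf.reg.memLp.1.add hf.reg.measurable_hilbert
  have h1 : MemLp (fun x => f x + hilbert f x) 2 := by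
    rw [memLp_two_iff_integrable_sq_norm hm]
    refine (integrable_inv_one_add_sq.const_mul (M * M)).mono' (hm.norm.pow 2)
      (Eventually.of_forall fun x => ?_)
    rw [Real.norm_of_nonneg (by positivity), pow_two]
    exact Dec.sq_le_inv (norm_nonneg _) (norm_nonneg _) (hM x) (hM x)
  convert! h1.sub hf.reg.memLp using 1
  ext x; simp

theorem eLpNorm_two_eq {f : ℝ → ℂ} (hf : MemLp f 2) :
    eLpNorm f 2 = ENNReal.ofReal (√(∫ x, ‖f x‖ ^ 2)) := by
  rw [hf.eLpNorm_eq_integral_rpow_norm (by norm_num) (by norm_num), Real.sqrt_eq_rpow]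
  simp

/-- Take g = f̄ in `integral_bdry_mul_bdry`. As ℍf̄ is minus the conjugate of ℍf, the integrand is
|f|² − |ℍf|² plus a purely imaginary term. -/
theorem Dec.eLpNorm_hilbert {f : ℝ → ℂ} (hf : Dec f) : eLpNorm (hilbert f) 2 = eLpNorm f 2 := by
  have hs : Dec (fun x => star (f x)) := by
    refine ⟨hf.reg.star, ?_, integrable_star hf.integrable⟩
    have := hf.reg_mul.star
    simpa only [star_mul', Complex.star_def, Complex.conj_ofReal] using this
  have h1 := hf.integral_bdry_mul_bdry hs
  have h2 : ∀ x, (f x + hilbert f x) * (star (f x) + hilbert (fun x => star (f x)) x) =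
      ((‖f x‖ ^ 2 - ‖hilbert f x‖ ^ 2 : ℝ) : ℂ) +
      (hilbert f x * star (f x) - star (hilbert f x * star (f x))) := by
    intro x
    rw [hf.reg.hilbert_star hs.reg]
    have e1 : ∀ z : ℂ, ((‖z‖ ^ 2 : ℝ) : ℂ) = z * star z := fun z => by
      rw [Complex.star_def, Complex.mul_conj, Complex.normSq_eq_norm_sq]
    rw [Complex.ofReal_sub, e1, e1, star_mul', star_star]
    ring
  have i1 := integrable_mul_of_L2 hf.memLp_hilbert hf.reg.memLp.star
  have i2 := (integrable_normSq_of_L2 hf.reg.memLp).sub (integrable_normSq_of_L2 hf.memLp_hilbert)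
  have i3 : Integrable (fun x => ((‖f x‖ ^ 2 - ‖hilbert f x‖ ^ 2 : ℝ) : ℂ)) := i2.ofReal
  have i4 : Integrable (fun x => hilbert f x * star (f x) - star (hilbert f x * star (f x))) :=
    i1.sub (integrable_star i1)
  simp only [h2] at h1
  rw [integral_add i3 i4, integral_complex_ofReal] at h1
  have h3 := congrArg Complex.re h1
  have h4 : (∫ x, (hilbert f x * star (f x) - star (hilbert f x * star (f x)))).re = 0 := by
    have := Complex.reCLM.integral_comp_comm i4
    have e : ∀ z : ℂ, (z - star z).re = 0 := fun z => by simp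
    simpa [e] using this.symm
  rw [Complex.add_re, h4, add_zero, Complex.ofReal_re, Complex.zero_re,
    integral_sub (integrable_normSq_of_L2 hf.reg.memLp) (integrable_normSq_of_L2 hf.memLp_hilbert),
    sub_eq_zero] at h3
  rw [eLpNorm_two_eq hf.memLp_hilbert, eLpNorm_two_eq hf.reg.memLp, h3]

namespace Reg

variable {f g : ℝ → ℂ}

theorem tendsto_hilbert_cut (hf : Reg f) (x : ℝ) :
    Tendsto (fun n : ℕ => hilbert (fun y => (WaterWave.cut (1 / ((n : ℝ) + 1)) y : ℂ) * f y) x) atTop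
      (𝓝 (hilbert f x)) := by
  obtain ⟨C, hC⟩ := hf.bdd
  have hpos : ∀ n : ℕ, 0 < 1 / ((n : ℝ) + 1) := fun n => by positivity
  have hle : ∀ n : ℕ, 1 / ((n : ℝ) + 1) ≤ 1 := fun n => by
    rw [div_le_one (by positivity)]; linarith [Nat.cast_nonneg (α := ℝ) n]
  simp only [fun n => (hf.cut (hpos n) (hle n)).hilbert_eq, hf.hilbert_eq]
  refine Tendsto.const_mul _ (tendsto_integral_of_dominated_convergence
    (hilbMaj (2 * C) (fun x => ‖f x‖) x) (fun n => (hf.cut (hpos n) (hle n)).measurable_symm x _)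
    (integrable_hilbMaj hf.memLp.norm _ _).integrableOn (fun n => ?_) ?_)
  · filter_upwards [self_mem_ae_restrict measurableSet_Ioi] with u hu
    refine symm_le_hilbMaj (hf.cut (hpos n) (hle n)).diff (fun y => ?_) (fun y => ?_) x hu
    · have hd : HasDerivAt (fun x => (WaterWave.cut (1 / ((n : ℝ) + 1)) x : ℂ) * f x) _ y :=
        (hasDerivAt_cut (hpos n) y).differentiableAt.hasDerivAt.ofReal_comp.mul
          (hf.diff y).hasDerivAt
      rw [hd.deriv, two_mul]
      refine norm_add_le_of_le ?_ ?_ <;> rw [norm_mul, Complex.norm_real]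
      · exact (mul_le_of_le_one_left (norm_nonneg _) (abs_deriv_cut_le (hpos n) (hle n) y)).trans (hC y).1
      · exact (mul_le_of_le_one_left (norm_nonneg _) (abs_cut_le (hpos n) y)).trans (hC y).2
    · rw [norm_mul, Complex.norm_real]
      exact mul_le_of_le_one_left (norm_nonneg _) (abs_cut_le (hpos n) y)
  · refine Eventually.of_forall fun u => ?_
    have h : ∀ y, Tendsto (fun n : ℕ => (WaterWave.cut (1 / ((n : ℝ) + 1)) y : ℂ) * f y) atTop
        (𝓝 (f y)) := by
      intro y
      simpa using ((Complex.continuous_ofReal.tendsto 1).comp (tendsto_cut y)).mul_const (f y)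
    exact ((h _).sub (h _)).div_const _

/-- The Hilbert transform is a contraction in the mean square norm. -/
theorem eLpNorm_hilbert_le (hf : Reg f) : eLpNorm (hilbert f) 2 ≤ eLpNorm f 2 := by
  have hpos : ∀ n : ℕ, 0 < 1 / ((n : ℝ) + 1) := fun n => by positivity
  have hle : ∀ n : ℕ, 1 / ((n : ℝ) + 1) ≤ 1 := fun n => by
    rw [div_le_one (by positivity)]; linarith [Nat.cast_nonneg (α := ℝ) n]
  -- Fatou along the cut-offs: their Hilbert transforms converge pointwise, and the isometry is
  -- known for each of them.
  refine (Lp.eLpNorm_lim_le_liminf_eLpNorm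
    (fun n => (hf.cut (hpos n) (hle n)).measurable_hilbert) _
    (Eventually.of_forall fun x => hf.tendsto_hilbert_cut x)).trans ?_
  refine liminf_le_of_frequently_le' (Frequently.of_forall fun n => ?_)
  rw [(hf.dec_cut (hpos n) (hle n)).eLpNorm_hilbert]
  refine eLpNorm_mono fun x => ?_
  rw [norm_mul, Complex.norm_real]
  exact mul_le_of_le_one_left (norm_nonneg _) (abs_cut_le (hpos n) x)

theorem memLp_hilbert (hf : Reg f) : MemLp (hilbert f) 2 :=
  ⟨hf.measurable_hilbert, hf.eLpNorm_hilbert_le.trans_lt hf.memLp.2⟩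

end Reg

theorem norm_integral_mul_le {f g : ℝ → ℂ} (hf : MemLp f 2) (hg : MemLp g 2) :
    ‖∫ x, f x * g x‖ ≤ (eLpNorm f 2).toReal * (eLpNorm g 2).toReal := by
  have h := integral_mul_norm_le_Lp_mul_Lq (μ := volume) (f := f) (g := g) Real.HolderConjugate.two_two
    (by simpa using hf) (by simpa using hg)
  rw [eLpNorm_two_eq hf, eLpNorm_two_eq hg, ENNReal.toReal_ofReal (Real.sqrt_nonneg _),
    ENNReal.toReal_ofReal (Real.sqrt_nonneg _), Real.sqrt_eq_rpow, Real.sqrt_eq_rpow]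
  refine (norm_integral_le_integral_norm _).trans ?_
  simpa using h

namespace Reg

variable {f g : ℝ → ℂ}

/-- The pairing is continuous in f for the L² norm, by the contraction property, and the cut-offs of
f converge to f in L². Stated for one slot, so that it can be applied to the two slots in turn. -/
theorem integral_bdry_mul_of_dec {φ : ℝ → ℂ} (hφ : MemLp φ 2)
    (h : ∀ f, Dec f → ∫ x, (f x + hilbert f x) * φ x = 0) (hf : Reg f) :
    ∫ x, (f x + hilbert f x) * φ x = 0 := by
  have hpos : ∀ n : ℕ, 0 < 1 / ((n : ℝ) + 1) := fun n => by positivity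
  have hle : ∀ n : ℕ, 1 / ((n : ℝ) + 1) ≤ 1 := fun n => by
    rw [div_le_one (by positivity)]; linarith [Nat.cast_nonneg (α := ℝ) n]
  set F : ℕ → ℝ → ℂ := fun n y => (WaterWave.cut (1 / ((n : ℝ) + 1)) y : ℂ) * f y with hF
  have hFr : ∀ n, Reg (F n) := fun n => hf.cut (hpos n) (hle n)
  have hdiff : ∀ n, Reg (fun x => f x - F n x) := fun n => hf.sub (hFr n)
  have h0 : Tendsto (fun n => eLpNorm (fun x => f x - F n x) 2) atTop (𝓝 0) := by
    have h1 : Tendsto (fun n => ∫ x, ‖f x - F n x‖ ^ 2) atTop (𝓝 (∫ x, ‖f x - f x‖ ^ 2)) := by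
      refine tendsto_integral_of_dominated_convergence (fun x => 4 * ‖f x‖ ^ 2) (fun n => ?_)
        ((integrable_normSq_of_L2 hf.memLp).const_mul 4) (fun n => ?_) ?_
      · exact ((hdiff n).memLp.1.norm.pow 2)
      · refine Eventually.of_forall fun x => ?_
        rw [Real.norm_of_nonneg (by positivity)]
        have h2 : ‖F n x‖ ≤ ‖f x‖ := by
          rw [hF, norm_mul, Complex.norm_real]
          exact mul_le_of_le_one_left (norm_nonneg _) (abs_cut_le (hpos n) x)
        have := norm_sub_le (f x) (F n x)
        nlinarith [norm_nonneg (f x - F n x), norm_nonneg (f x)]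
      · refine Eventually.of_forall fun x => ?_
        refine ((tendsto_const_nhds.sub ?_).norm).pow 2
        simpa [hF] using ((Complex.continuous_ofReal.tendsto 1).comp (tendsto_cut x)).mul_const (f x)
    simp only [sub_self, norm_zero, ne_eq, OfNat.ofNat_ne_zero, not_false_eq_true, zero_pow,
      integral_zero] at h1
    have h2 := ENNReal.tendsto_ofReal ((Real.continuous_sqrt.tendsto 0).comp h1)
    simp only [Real.sqrt_zero, ENNReal.ofReal_zero] at h2
    refine h2.congr fun n => ?_
    rw [eLpNorm_two_eq (hdiff n).memLp]; rfl
  have h1 : ∀ n, ‖∫ x, (f x + hilbert f x) * φ x‖ ≤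
      (2 * eLpNorm (fun x => f x - F n x) 2).toReal * (eLpNorm φ 2).toReal := by
    intro n
    have i1 := integrable_mul_of_L2 (hf.memLp.add hf.memLp_hilbert) hφ
    have i2 := integrable_mul_of_L2 ((hFr n).memLp.add (hFr n).memLp_hilbert) hφ
    have e1 : ∫ x, (f x + hilbert f x) * φ x =
        ∫ x, ((f x - F n x) + hilbert (fun x => f x - F n x) x) * φ x := by
      rw [← sub_zero (∫ x, (f x + hilbert f x) * φ x), ← h _ (hf.dec_cut (hpos n) (hle n))]
      refine (integral_sub i1 i2).symm.trans ?_
      congr 1; ext x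
      rw [hf.hilbert_sub (hFr n)]
      simp only [Pi.add_apply]
      ring
    rw [e1]
    refine (norm_integral_mul_le ((hdiff n).memLp.add (hdiff n).memLp_hilbert) hφ).trans ?_
    gcongr
    · exact ENNReal.mul_ne_top (by norm_num) (hdiff n).memLp.2.ne
    · refine (eLpNorm_add_le (hdiff n).memLp.1 (hdiff n).measurable_hilbert (by norm_num)).trans ?_
      rw [two_mul]
      gcongr
      exact (hdiff n).eLpNorm_hilbert_le
  have h2 : Tendsto (fun n => (2 * eLpNorm (fun x => f x - F n x) 2).toReal * (eLpNorm φ 2).toReal)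
      atTop (𝓝 0) := by
    have h3 := ENNReal.Tendsto.const_mul h0 (a := 2) (Or.inr (by norm_num))
    rw [mul_zero] at h3
    have h4 := ((ENNReal.tendsto_toReal ENNReal.zero_ne_top).comp h3).mul_const (eLpNorm φ 2).toReal
    simpa using h4
  exact norm_le_zero_iff.1 (ge_of_tendsto' h2 h1)

theorem integral_bdry_mul_bdry (hf : Reg f) (hg : Reg g) :
    ∫ x, (f x + hilbert f x) * (g x + hilbert g x) = 0 := by
  refine integral_bdry_mul_of_dec (hg.memLp.add hg.memLp_hilbert) (fun f hf => ?_) hf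
  simp only [mul_comm (f _ + _)]
  exact integral_bdry_mul_of_dec (hf.reg.memLp.add hf.memLp_hilbert)
    (fun g hg => hg.integral_bdry_mul_bdry hf) hg

theorem integral_bdry_mul_bdry' (hf : Reg f) (hg : Reg g) :
    ∫ x, (f x - hilbert f x) * (g x - hilbert g x) = 0 := by
  have h := hf.star.integral_bdry_mul_bdry hg.star
  have e : ∀ x, (star (f x) + hilbert (fun x => star (f x)) x) *
      (star (g x) + hilbert (fun x => star (g x)) x) =
      (starRingEnd ℂ) ((f x - hilbert f x) * (g x - hilbert g x)) := by
    intro x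
    rw [hf.hilbert_star hf.star, hg.hilbert_star hg.star]
    simp [sub_eq_add_neg]
  simp only [e] at h
  rw [integral_conj] at h
  simpa using h

/-- Subtract the relations for I + ℍ and I − ℍ; adding them instead gives
`integral_hilbert_mul_hilbert`. -/
theorem integral_hilbert_mul (hf : Reg f) (hg : Reg g) :
    ∫ x, hilbert f x * g x = -∫ x, f x * hilbert g x := by
  have i1 := integrable_mul_of_L2 hf.memLp_hilbert hg.memLp
  have i2 := integrable_mul_of_L2 hf.memLp hg.memLp_hilbert
  have i3 := integrable_mul_of_L2 (hf.memLp.add hf.memLp_hilbert) (hg.memLp.add hg.memLp_hilbert)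
  have i4 := integrable_mul_of_L2 (hf.memLp.sub hf.memLp_hilbert) (hg.memLp.sub hg.memLp_hilbert)
  have h : (∫ x, (f x + hilbert f x) * (g x + hilbert g x)) -
      (∫ x, (f x - hilbert f x) * (g x - hilbert g x)) =
      2 * ((∫ x, hilbert f x * g x) + ∫ x, f x * hilbert g x) := by
    rw [← integral_add i1 i2, ← integral_const_mul]
    refine (integral_sub i3 i4).symm.trans ?_
    congr 1; ext x
    simp only [Pi.add_apply, Pi.sub_apply]
    ring
  rw [hf.integral_bdry_mul_bdry hg, hf.integral_bdry_mul_bdry' hg] at h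
  rw [eq_neg_iff_add_eq_zero]
  simpa using h

theorem integral_hilbert_mul_hilbert (hf : Reg f) (hg : Reg g) :
    ∫ x, hilbert f x * hilbert g x = -∫ x, f x * g x := by
  have i1 := integrable_mul_of_L2 hf.memLp_hilbert hg.memLp_hilbert
  have i2 := integrable_mul_of_L2 hf.memLp hg.memLp
  have i3 := integrable_mul_of_L2 (hf.memLp.add hf.memLp_hilbert) (hg.memLp.add hg.memLp_hilbert)
  have i4 := integrable_mul_of_L2 (hf.memLp.sub hf.memLp_hilbert) (hg.memLp.sub hg.memLp_hilbert)
  have h : (∫ x, (f x + hilbert f x) * (g x + hilbert g x)) +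
      (∫ x, (f x - hilbert f x) * (g x - hilbert g x)) =
      2 * ((∫ x, hilbert f x * hilbert g x) + ∫ x, f x * g x) := by
    rw [← integral_add i1 i2, ← integral_const_mul]
    refine (integral_add i3 i4).symm.trans ?_
    congr 1; ext x
    simp only [Pi.add_apply, Pi.sub_apply]
    ring
  rw [hf.integral_bdry_mul_bdry hg, hf.integral_bdry_mul_bdry' hg] at h
  rw [eq_neg_iff_add_eq_zero]
  simpa using h

/-! ### Holomorphic functions -/

/-- Plemelj's formula for f̄: the hypothesis, conjugated, makes its limit vanish, that is f − ℍf =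
0. Only heights below δ matter for the limit, which leaves room for a pole at height δ in
`Hinf.hilbert_mul_of_hol`. -/
theorem hilbert_eq_self_of_cauchy (hf : Reg f) {δ : ℝ} (hδ : 0 < δ)
    (h : ∀ z : ℂ, 0 < z.im → z.im < δ → ∫ y : ℝ, f y * ((y : ℂ) - z)⁻¹ = 0) (x : ℝ) : hilbert f x = f x := by
  have h1 := hf.star.cauchy_tendsto x
  have h2 : Tendsto (fun ε : ℝ => ∫ y, star (f y) / ((x : ℂ) - y - ε * Complex.I)) (𝓝[>] 0) (𝓝 0) := by
    refine tendsto_const_nhds.congr' ?_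
    filter_upwards [self_mem_nhdsWithin, mem_nhdsWithin_of_mem_nhds (Iio_mem_nhds hδ)] with ε hε hε1
    have h3 := congrArg (fun z => -(starRingEnd ℂ) z)
      (h (x + ε * Complex.I) (by simpa using hε) (by simpa using hε1))
    simp only [← integral_conj, map_zero, neg_zero, ← integral_neg] at h3
    rw [← h3]
    congr 1; ext y
    simp only [map_mul, map_inv₀, map_sub, map_add, Complex.conj_ofReal, Complex.conj_I,
      div_eq_mul_inv, Complex.star_def]
    rw [← mul_neg, ← inv_neg]
    ring
  have h3 := tendsto_nhds_unique h1 h2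
  have hpi : (Real.pi : ℂ) ≠ 0 := by exact_mod_cast Real.pi_ne_zero
  rw [hf.hilbert_star hf.star, ← sub_eq_add_neg, ← star_sub] at h3
  have h4 : f x - hilbert f x = 0 :=
    star_eq_zero.1 ((mul_eq_zero.1 h3).resolve_left (by simp [hpi]))
  exact (sub_eq_zero.1 h4).symm

theorem integral_mul_of_hol (hf : Reg f) (hg : Reg g) (hHf : ∀ x, hilbert f x = f x)
    (hHg : ∀ x, hilbert g x = g x) : ∫ x, f x * g x = 0 := by
  have := hf.integral_hilbert_mul hg
  simp only [hHf, hHg] at this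
  exact self_eq_neg.1 this

end Reg

theorem hilbert_inv_sub {z : ℂ} (hz : 0 < z.im) (x : ℝ) :
    hilbert (fun y : ℝ => ((y : ℂ) - z)⁻¹) x = ((x : ℂ) - z)⁻¹ :=
  (hinf_inv_sub hz.ne').reg.hilbert_eq_self_of_cauchy one_pos
    (fun _ hw _ => integral_inv_sub_mul_inv_sub hz hw) x

/-- The product of two holomorphic functions is holomorphic. -/
theorem Hinf.hilbert_mul_of_hol {f g : ℝ → ℂ} (hf : Hinf f) (hg : Hinf g)
    (hHf : ∀ x, hilbert f x = f x) (hHg : ∀ x, hilbert g x = g x) (x : ℝ) :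
    hilbert (fun x => f x * g x) x = f x * g x := by
  refine (hf.mul hg).reg.hilbert_eq_self_of_cauchy one_pos (fun z hz _ => ?_) x
  have hfz := hf.mul (hinf_inv_sub hz.ne')
  have h0 : ∀ w : ℂ, 0 < w.im → ∫ y : ℝ, f y * ((y : ℂ) - w)⁻¹ = 0 := fun w hw =>
    hf.reg.integral_mul_of_hol (hinf_inv_sub hw.ne').reg hHf (hilbert_inv_sub hw)
  -- First f/(· − z) is shown to be holomorphic, by partial fractions in z and w with Im w < Im z,
  -- so that z ≠ w. Its pairing with g is then the Cauchy integral of fg at z, and it vanishes.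
  have key : ∀ x, hilbert (fun y => f y * ((y : ℂ) - z)⁻¹) x = f x * ((x : ℂ) - z)⁻¹ := by
    refine hfz.reg.hilbert_eq_self_of_cauchy hz fun w hw hwz => ?_
    have hne : z - w ≠ 0 := by
      intro h
      rw [sub_eq_zero.1 h] at hwz
      exact lt_irrefl _ hwz
    have h1 : ∀ y : ℝ, f y * ((y : ℂ) - z)⁻¹ * ((y : ℂ) - w)⁻¹ =
        (z - w)⁻¹ * (f y * ((y : ℂ) - z)⁻¹ - f y * ((y : ℂ) - w)⁻¹) := by
      intro y
      have hy := sub_ne_zero_of_im hz.ne' y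
      have hy' := sub_ne_zero_of_im hw.ne' y
      field_simp
      ring
    simp only [h1]
    rw [integral_const_mul, integral_sub (hf.integrable_mul (hinf_inv_sub hz.ne'))
      (hf.integrable_mul (hinf_inv_sub hw.ne')), h0 z hz, h0 w hw]
    simp
  have := hfz.reg.integral_mul_of_hol hg.reg key hHg
  simpa only [mul_right_comm] using this

/-! ### Smooth decaying functions of time and space -/

/-- Equality for times in `I`. -/
def EqI (I : Set ℝ) (f g : ℝ → ℝ → ℂ) : Prop := ∀ t ∈ I, ∀ x, f t x = g t x

/-- Differentiable functions of time and space, square integrable in space locally uniformly in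
time. -/
structure Good (I : Set ℝ) (f : ℝ → ℝ → ℂ) : Prop where
  diff_t : ∀ t ∈ I, ∀ x, DifferentiableAt ℝ (fun s => f s x) t
  diff_x : ∀ t ∈ I, Differentiable ℝ (f t)
  l2 : ∀ t₀ ∈ I, ∃ C : ℝ≥0, ∀ᶠ t in 𝓝 t₀, eLpNorm (f t) 2 ≤ C

/-- Functions in `C^∞(I; H^∞)`, described by their derivatives. -/
def SDec (I : Set ℝ) (f : ℝ → ℝ → ℂ) : Prop :=
  ∃ 𝒞 : Set (ℝ → ℝ → ℂ), f ∈ 𝒞 ∧ ∀ g ∈ 𝒞, Good I g ∧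
    (∃ h ∈ 𝒞, EqI I (dt g) h) ∧ ∃ h ∈ 𝒞, EqI I (dx g) h

section EqI

variable {I : Set ℝ} {f g h : ℝ → ℝ → ℂ}

theorem EqI.symm (hfg : EqI I f g) : EqI I g f := fun t ht x => (hfg t ht x).symm

theorem EqI.trans (hfg : EqI I f g) (hgh : EqI I g h) : EqI I f h :=
  fun t ht x => (hfg t ht x).trans (hgh t ht x)

theorem EqI.slice (hfg : EqI I f g) {t : ℝ} (ht : t ∈ I) : f t = g t := funext (hfg t ht)

theorem EqI.eventuallyEq (hI : IsOpen I) (hfg : EqI I f g) {t : ℝ} (ht : t ∈ I) (x : ℝ) :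
    (fun s => f s x) =ᶠ[𝓝 t] fun s => g s x := by
  filter_upwards [hI.mem_nhds ht] with s hs using hfg s hs x

theorem EqI.dt (hI : IsOpen I) (hfg : EqI I f g) : EqI I (dt f) (dt g) :=
  fun _ ht x => (hfg.eventuallyEq hI ht x).deriv_eq

theorem EqI.dx (hfg : EqI I f g) : EqI I (dx f) (dx g) := by
  intro t ht x
  simp only [WaterWave.dx]
  rw [show (fun y => f t y) = fun y => g t y from hfg.slice ht]

theorem Good.congr (hI : IsOpen I) (hf : Good I f) (hfg : EqI I f g) : Good I g := by
  refine ⟨fun t ht x => ?_, fun t ht => ?_, fun t₀ ht₀ => ?_⟩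
  · exact (hf.diff_t t ht x).congr_of_eventuallyEq (hfg.symm.eventuallyEq hI ht x)
  · rw [← hfg.slice ht]; exact hf.diff_x t ht
  · obtain ⟨C, hC⟩ := hf.l2 t₀ ht₀
    refine ⟨C, ?_⟩
    filter_upwards [hC, hI.mem_nhds ht₀] with t h ht
    rwa [← hfg.slice ht]

end EqI

theorem integral_sq_le_of_eLpNorm_le {f : ℝ → ℂ} (hf : MemLp f 2) {C : ℝ≥0} (h : eLpNorm f 2 ≤ C) :
    ∫ x, ‖f x‖ ^ 2 ≤ C ^ 2 := by
  rw [eLpNorm_two_eq hf, ENNReal.ofReal_le_iff_le_toReal (by simp), ENNReal.coe_toReal,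
    Real.sqrt_le_left (by positivity)] at h
  exact h

theorem Good.memLp {I : Set ℝ} {f : ℝ → ℝ → ℂ} (hf : Good I f) {t : ℝ} (ht : t ∈ I) :
    MemLp (f t) 2 := by
  obtain ⟨C, hC⟩ := hf.l2 t ht
  exact ⟨(hf.diff_x t ht).continuous.aestronglyMeasurable, hC.self_of_nhds.trans_lt (by simp)⟩

namespace SDec

variable {I : Set ℝ} {f g : ℝ → ℝ → ℂ}

theorem good (hf : SDec I f) : Good I f := by
  obtain ⟨𝒞, h1, h2⟩ := hf
  exact (h2 f h1).1

theorem congr (hI : IsOpen I) (hf : SDec I f) (hfg : EqI I f g) : SDec I g := by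
  obtain ⟨𝒞, h1, h2⟩ := hf
  refine ⟨{g | ∃ f ∈ 𝒞, EqI I f g}, ⟨f, h1, hfg⟩, ?_⟩
  rintro g ⟨f, hf, hfg⟩
  obtain ⟨h3, ⟨k, hk, h4⟩, ⟨k', hk', h5⟩⟩ := h2 f hf
  exact ⟨h3.congr hI hfg, ⟨k, ⟨k, hk, fun _ _ _ => rfl⟩, (hfg.dt hI).symm.trans h4⟩,
    ⟨k', ⟨k', hk', fun _ _ _ => rfl⟩, hfg.dx.symm.trans h5⟩⟩

theorem dt (hI : IsOpen I) (hf : SDec I f) : SDec I (dt f) := by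
  obtain ⟨𝒞, h1, h2⟩ := hf
  obtain ⟨h3, ⟨k, hk, h4⟩, _⟩ := h2 f h1
  exact congr hI ⟨𝒞, hk, h2⟩ h4.symm

theorem dx (hI : IsOpen I) (hf : SDec I f) : SDec I (dx f) := by
  obtain ⟨𝒞, h1, h2⟩ := hf
  obtain ⟨h3, _, ⟨k, hk, h4⟩⟩ := h2 f h1
  exact congr hI ⟨𝒞, hk, h2⟩ h4.symm

/-- To prove that all members of a class are smooth it suffices to express their derivatives by
members of the class. -/
theorem of_class {𝒞 : Set (ℝ → ℝ → ℂ)} (h : ∀ g ∈ 𝒞, Good I g ∧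
    (∃ h ∈ 𝒞, EqI I (WaterWave.dt g) h) ∧ ∃ h ∈ 𝒞, EqI I (WaterWave.dx g) h) (hf : f ∈ 𝒞) :
    SDec I f := ⟨𝒞, hf, h⟩

theorem hasDerivAt_t (hf : SDec I f) {t : ℝ} (ht : t ∈ I) (x : ℝ) :
    HasDerivAt (fun s => f s x) (WaterWave.dt f t x) t := (hf.good.diff_t t ht x).hasDerivAt

theorem hasDerivAt_x (hf : SDec I f) {t : ℝ} (ht : t ∈ I) (x : ℝ) :
    HasDerivAt (f t) (WaterWave.dx f t x) x := (hf.good.diff_x t ht x).hasDerivAt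

theorem hinf (hI : IsOpen I) (hf : SDec I f) {t : ℝ} (ht : t ∈ I) : Hinf (f t) := by
  refine Hinf.of_class (𝒞 := {g | ∃ f, SDec I f ∧ g = f t}) ?_ ⟨f, hf, rfl⟩
  rintro _ ⟨f, hf, rfl⟩
  exact ⟨hf.good.diff_x t ht, hf.good.memLp ht, _, hf.dx hI, rfl⟩

theorem bounded (hI : IsOpen I) (hf : SDec I f) {t₀ : ℝ} (ht₀ : t₀ ∈ I) :
    ∃ C, ∀ᶠ t in 𝓝 t₀, ∀ x, ‖f t x‖ ≤ C := by
  obtain ⟨C, hC⟩ := hf.good.l2 t₀ ht₀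
  obtain ⟨C', hC'⟩ := (hf.dx hI).good.l2 t₀ ht₀
  refine ⟨√((C : ℝ) ^ 2 + (C' : ℝ) ^ 2), ?_⟩
  filter_upwards [hC, hC', hI.mem_nhds ht₀] with t h h' ht x
  refine Real.le_sqrt_of_sq_le ((norm_sq_le_of_L2 (hf.good.diff_x t ht) (hf.good.memLp ht)
    ((hf.dx hI).good.memLp ht) x).trans (add_le_add ?_ ?_))
  · exact integral_sq_le_of_eLpNorm_le (hf.good.memLp ht) h
  · exact integral_sq_le_of_eLpNorm_le ((hf.dx hI).good.memLp ht) h'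

theorem lipschitz_t (hI : IsOpen I) (hf : SDec I f) {t₀ : ℝ} (ht₀ : t₀ ∈ I) :
    ∃ C, ∀ᶠ t in 𝓝 t₀, ∀ x, ‖f t x - f t₀ x‖ ≤ C * |t - t₀| := by
  obtain ⟨C, hC⟩ := (hf.dt hI).bounded hI ht₀
  obtain ⟨δ, hδ, h⟩ := Metric.eventually_nhds_iff_ball.1 (hC.and (hI.mem_nhds ht₀))
  refine ⟨C, Metric.eventually_nhds_iff_ball.2 ⟨δ, hδ, fun t ht x => ?_⟩⟩
  exact (convex_ball t₀ δ).norm_image_sub_le_of_norm_hasDerivWithin_le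
    (fun s hs => (hf.hasDerivAt_t (h s hs).2 x).hasDerivWithinAt) (fun s hs => (h s hs).1 x)
    (Metric.mem_ball_self hδ) ht

theorem continuousAt (hI : IsOpen I) (hf : SDec I f) {t : ℝ} (ht : t ∈ I) (x : ℝ) :
    ContinuousAt (fun p : ℝ × ℝ => f p.1 p.2) (t, x) := by
  obtain ⟨C, hC⟩ := hf.lipschitz_t hI ht
  have h1 : Tendsto (fun p : ℝ × ℝ => f p.1 p.2 - f t p.2) (𝓝 (t, x)) (𝓝 0) := by
    refine squeeze_zero_norm' (a := fun p : ℝ × ℝ => C * |p.1 - t|) ?_ ?_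
    · have := (continuous_fst.tendsto (t, x)).eventually hC
      filter_upwards [this] with p hp using hp p.2
    · have : Continuous fun p : ℝ × ℝ => C * |p.1 - t| := by fun_prop
      simpa using this.tendsto (t, x)
  have h2 : Tendsto (fun p : ℝ × ℝ => f t p.2) (𝓝 (t, x)) (𝓝 (f t x)) :=
    ((hf.good.diff_x t ht).continuous.comp continuous_snd).tendsto (t, x)
  simpa [ContinuousAt] using h1.add h2

theorem continuousOn (hI : IsOpen I) (hf : SDec I f) :
    ContinuousOn (fun p : ℝ × ℝ => f p.1 p.2) (I ×ˢ Set.univ) :=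
  fun p hp => (hf.continuousAt hI hp.1 p.2).continuousWithinAt

/-- Both partial derivatives exist near the point and are jointly continuous at it. This recovers
joint differentiability from a definition that speaks of partial derivatives only. -/
theorem hasFDerivAt (hI : IsOpen I) (hf : SDec I f) {t : ℝ} (ht : t ∈ I) (x : ℝ) :
    HasFDerivAt (fun p : ℝ × ℝ => f p.1 p.2)
      ((ContinuousLinearMap.fst ℝ ℝ ℝ).smulRight (WaterWave.dt f t x) +
        (ContinuousLinearMap.snd ℝ ℝ ℝ).smulRight (WaterWave.dx f t x)) (t, x) := by
  have hev : ∀ᶠ v : ℝ × ℝ in 𝓝 (t, x), v.1 ∈ I :=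
    (continuous_fst.tendsto (t, x)).eventually (hI.mem_nhds ht)
  have hc : Continuous fun c : ℂ => ContinuousLinearMap.toSpanSingleton ℝ c :=
    (ContinuousLinearMap.toSpanSingletonLIE ℝ ℂ).continuous
  have h := (hasStrictFDerivAt_uncurry_coprod (𝕜 := ℝ) (u := (t, x)) (f := f)
    (f₁ := fun t x => ContinuousLinearMap.toSpanSingleton ℝ (WaterWave.dt f t x))
    (f₂ := fun t x => ContinuousLinearMap.toSpanSingleton ℝ (WaterWave.dx f t x))
    (hev.mono fun v hv => (hf.hasDerivAt_t hv v.2).hasFDerivAt)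
    (hev.mono fun v hv => (hf.hasDerivAt_x hv v.2).hasFDerivAt)
    (hc.continuousAt.comp ((hf.dt hI).continuousAt hI ht x))
    (hc.continuousAt.comp ((hf.dx hI).continuousAt hI ht x))).hasFDerivAt
  convert! h using 1

/-- Time and space derivatives commute. -/
theorem dt_dx (hI : IsOpen I) (hf : SDec I f) :
    EqI I (WaterWave.dt (WaterWave.dx f)) (WaterWave.dx (WaterWave.dt f)) := by
  intro t ht x
  have hev : ∀ᶠ v : ℝ × ℝ in 𝓝 (t, x), v.1 ∈ I :=
    (continuous_fst.tendsto (t, x)).eventually (hI.mem_nhds ht)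
  have h1 := ((ContinuousLinearMap.smulRightL ℝ (ℝ × ℝ) ℂ (ContinuousLinearMap.fst ℝ ℝ ℝ)).hasFDerivAt.comp
      (t, x) ((hf.dt hI).hasFDerivAt hI ht x)).add
    ((ContinuousLinearMap.smulRightL ℝ (ℝ × ℝ) ℂ (ContinuousLinearMap.snd ℝ ℝ ℝ)).hasFDerivAt.comp
      (t, x) ((hf.dx hI).hasFDerivAt hI ht x))
  have h2 := second_derivative_symmetric_of_eventually (𝕜 := ℝ)
    (hev.mono fun v hv => hf.hasFDerivAt hI hv v.2) h1 (1, 0) (0, 1)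
  simpa using h2

/-- The algebra generated by smooth decaying functions. -/
inductive Gen (I : Set ℝ) : (ℝ → ℝ → ℂ) → Prop
  | of {f : ℝ → ℝ → ℂ} (hf : SDec I f) : Gen I f
  | smul {f : ℝ → ℝ → ℂ} (c : ℂ) (hf : Gen I f) : Gen I (fun t x => c * f t x)
  | star {f : ℝ → ℝ → ℂ} (hf : Gen I f) : Gen I (fun t x => star (f t x))
  | add {f g : ℝ → ℝ → ℂ} (hf : Gen I f) (hg : Gen I g) : Gen I (fun t x => f t x + g t x)
  | mul {f g : ℝ → ℝ → ℂ} (hf : Gen I f) (hg : Gen I g) : Gen I (fun t x => f t x * g t x)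

theorem eLpNorm_mul_le {f g : ℝ → ℂ} {C : ℝ≥0} (hC : ∀ x, ‖f x‖ ≤ C) :
    eLpNorm (fun x => f x * g x) 2 ≤ C * eLpNorm g 2 := by
  refine eLpNorm_le_nnreal_smul_eLpNorm_of_ae_le_mul (Eventually.of_forall fun x => ?_) 2
  rw [nnnorm_mul]
  gcongr
  exact hC x

theorem Gen.spec (hI : IsOpen I) (hf : Gen I f) : Good I f ∧
    (∀ t₀ ∈ I, ∃ C : ℝ≥0, ∀ᶠ t in 𝓝 t₀, ∀ x, ‖f t x‖ ≤ C) ∧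
    (∃ h, Gen I h ∧ EqI I (WaterWave.dt f) h) ∧ ∃ h, Gen I h ∧ EqI I (WaterWave.dx f) h := by
  induction hf with
  | of hf =>
    refine ⟨hf.good, fun t₀ ht₀ => ?_, ⟨_, .of (hf.dt hI), fun _ _ _ => rfl⟩,
      ⟨_, .of (hf.dx hI), fun _ _ _ => rfl⟩⟩
    obtain ⟨C, hC⟩ := hf.bounded hI ht₀
    exact ⟨C.toNNReal, hC.mono fun t h x => (h x).trans (Real.le_coe_toNNReal C)⟩
  | smul c _ ih =>
    obtain ⟨h1, h2, ⟨k, hk, h3⟩, ⟨k', hk', h3'⟩⟩ := ih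
    refine ⟨⟨fun t ht x => (h1.diff_t t ht x).const_mul c, fun t ht => (h1.diff_x t ht).const_mul c,
      fun t₀ ht₀ => ?_⟩, fun t₀ ht₀ => ?_, ⟨_, hk.smul c, fun t ht x => ?_⟩,
      ⟨_, hk'.smul c, fun t ht x => ?_⟩⟩
    · obtain ⟨C, hC⟩ := h1.l2 t₀ ht₀
      refine ⟨‖c‖₊ * C, hC.mono fun t h => ?_⟩
      refine (eLpNorm_mul_le (f := fun _ => c) (C := ‖c‖₊) fun x => le_rfl).trans ?_
      push_cast; gcongr
    · obtain ⟨C, hC⟩ := h2 t₀ ht₀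
      refine ⟨‖c‖₊ * C, hC.mono fun t h x => ?_⟩
      rw [norm_mul]; push_cast; gcongr; exact h x
    · rw [← h3 t ht x]; exact deriv_const_mul c (h1.diff_t t ht x)
    · rw [← h3' t ht x]; exact deriv_const_mul c (h1.diff_x t ht x)
  | star _ ih =>
    obtain ⟨h1, h2, ⟨k, hk, h3⟩, ⟨k', hk', h3'⟩⟩ := ih
    refine ⟨⟨fun t ht x => (h1.diff_t t ht x).star, fun t ht => (h1.diff_x t ht).star,
      fun t₀ ht₀ => ?_⟩, fun t₀ ht₀ => ?_, ⟨_, hk.star, fun t ht x => ?_⟩,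
      ⟨_, hk'.star, fun t ht x => ?_⟩⟩
    · obtain ⟨C, hC⟩ := h1.l2 t₀ ht₀
      refine ⟨C, hC.mono fun t h => le_trans (le_of_eq (eLpNorm_congr_norm_ae ?_)) h⟩
      exact Eventually.of_forall fun x => norm_star _
    · obtain ⟨C, hC⟩ := h2 t₀ ht₀
      exact ⟨C, hC.mono fun t h x => by rw [norm_star]; exact h x⟩
    · rw [← h3 t ht x]; exact deriv.star
    · rw [← h3' t ht x]; exact deriv.star
  | add _ _ ih ih' =>
    obtain ⟨h1, h2, ⟨k, hk, h3⟩, ⟨k', hk', h3'⟩⟩ := ih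
    obtain ⟨g1, g2, ⟨l, hl, g3⟩, ⟨l', hl', g3'⟩⟩ := ih'
    refine ⟨⟨fun t ht x => (h1.diff_t t ht x).add (g1.diff_t t ht x),
      fun t ht => (h1.diff_x t ht).add (g1.diff_x t ht),
      fun t₀ ht₀ => ?_⟩, fun t₀ ht₀ => ?_, ⟨_, hk.add hl, fun t ht x => ?_⟩,
      ⟨_, hk'.add hl', fun t ht x => ?_⟩⟩
    · obtain ⟨C, hC⟩ := h1.l2 t₀ ht₀
      obtain ⟨C', hC'⟩ := g1.l2 t₀ ht₀
      refine ⟨C + C', ?_⟩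
      filter_upwards [hC, hC', hI.mem_nhds ht₀] with t h h' ht
      refine (eLpNorm_add_le (h1.memLp ht).1 (g1.memLp ht).1 (by norm_num)).trans ?_
      push_cast; gcongr
    · obtain ⟨C, hC⟩ := h2 t₀ ht₀
      obtain ⟨C', hC'⟩ := g2 t₀ ht₀
      refine ⟨C + C', ?_⟩
      filter_upwards [hC, hC'] with t h h' x using norm_add_le_of_le (h x) (h' x)
    · rw [← h3 t ht x, ← g3 t ht x]; exact deriv_add (h1.diff_t t ht x) (g1.diff_t t ht x)
    · rw [← h3' t ht x, ← g3' t ht x]; exact deriv_add (h1.diff_x t ht x) (g1.diff_x t ht x)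
  | mul p q ih ih' =>
    obtain ⟨h1, h2, ⟨k, hk, h3⟩, ⟨k', hk', h3'⟩⟩ := ih
    obtain ⟨g1, g2, ⟨l, hl, g3⟩, ⟨l', hl', g3'⟩⟩ := ih'
    refine ⟨⟨fun t ht x => (h1.diff_t t ht x).mul (g1.diff_t t ht x),
      fun t ht => (h1.diff_x t ht).mul (g1.diff_x t ht),
      fun t₀ ht₀ => ?_⟩, fun t₀ ht₀ => ?_, ⟨_, (hk.mul q).add (p.mul hl), fun t ht x => ?_⟩,
      ⟨_, (hk'.mul q).add (p.mul hl'), fun t ht x => ?_⟩⟩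
    · obtain ⟨C, hC⟩ := h2 t₀ ht₀
      obtain ⟨C', hC'⟩ := g1.l2 t₀ ht₀
      refine ⟨C * C', ?_⟩
      filter_upwards [hC, hC'] with t h h'
      refine (eLpNorm_mul_le h).trans ?_
      push_cast; gcongr
    · obtain ⟨C, hC⟩ := h2 t₀ ht₀
      obtain ⟨C', hC'⟩ := g2 t₀ ht₀
      refine ⟨C * C', ?_⟩
      filter_upwards [hC, hC'] with t h h' x using norm_mul_le_of_le (h x) (h' x)
    · rw [← h3 t ht x, ← g3 t ht x]; exact deriv_mul (h1.diff_t t ht x) (g1.diff_t t ht x)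
    · rw [← h3' t ht x, ← g3' t ht x]; exact deriv_mul (h1.diff_x t ht x) (g1.diff_x t ht x)

theorem Gen.sdec (hI : IsOpen I) (hf : Gen I f) : SDec I f :=
  of_class (𝒞 := {f | Gen I f}) (fun _ hg => ⟨(hg.spec hI).1, (hg.spec hI).2.2⟩) hf

theorem smul (hI : IsOpen I) (c : ℂ) (hf : SDec I f) : SDec I (fun t x => c * f t x) :=
  ((Gen.of hf).smul c).sdec hI

protected theorem star (hI : IsOpen I) (hf : SDec I f) : SDec I (fun t x => star (f t x)) :=
  ((Gen.of hf).star).sdec hI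

theorem add (hI : IsOpen I) (hf : SDec I f) (hg : SDec I g) : SDec I (fun t x => f t x + g t x) :=
  ((Gen.of hf).add (.of hg)).sdec hI

theorem mul (hI : IsOpen I) (hf : SDec I f) (hg : SDec I g) : SDec I (fun t x => f t x * g t x) :=
  ((Gen.of hf).mul (.of hg)).sdec hI

theorem sub (hI : IsOpen I) (hf : SDec I f) (hg : SDec I g) : SDec I (fun t x => f t x - g t x) := by
  simpa [sub_eq_add_neg] using hf.add hI (hg.smul hI (-1))

end SDec

/-! ### Square integrable majorants and differentiation under the integral sign -/

namespace SDec

variable {I : Set ℝ} {f g : ℝ → ℝ → ℂ}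

/-- Locally in time a smooth decaying function is dominated by a square integrable function. -/
theorem dominated (hI : IsOpen I) (hf : SDec I f) {t₀ : ℝ} (ht₀ : t₀ ∈ I) :
    ∃ Φ : ℝ → ℝ, MemLp Φ 2 ∧ ∀ᶠ t in 𝓝 t₀, ∀ x, ‖f t x‖ ≤ Φ x := by
  have hf' := hf.dt hI
  obtain ⟨C, hC⟩ := hf.good.l2 t₀ ht₀
  obtain ⟨C', hC'⟩ := hf'.good.l2 t₀ ht₀
  obtain ⟨δ, hδ, h⟩ := Metric.nhds_basis_closedBall.eventually_iff.1
    ((hC.and hC').and (hI.mem_nhds ht₀))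
  set J := Metric.closedBall t₀ δ with hJ
  have hJI : J ⊆ I := fun t ht => (h ht).2
  have hJc : IsCompact J := isCompact_closedBall _ _
  have hJm : MeasurableSet J := hJc.measurableSet
  set G : ℝ → ℝ → ℝ := fun s x => ‖f s x‖ ^ 2 + ‖WaterWave.dt f s x‖ ^ 2 with hG
  have hGc : ContinuousOn (fun p : ℝ × ℝ => G p.1 p.2) (J ×ˢ Set.univ) :=
    (((hf.continuousOn hI).norm.pow 2).add ((hf'.continuousOn hI).norm.pow 2)).mono
      (Set.prod_mono hJI subset_rfl)
  have hμ : (volume.restrict J).prod volume =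
      (volume : Measure (ℝ × ℝ)).restrict (J ×ˢ Set.univ) := by
    rw [Measure.volume_eq_prod, ← Measure.prod_restrict, Measure.restrict_univ]
  have hm : AEStronglyMeasurable (fun p : ℝ × ℝ => G p.1 p.2) ((volume.restrict J).prod volume) := by
    rw [hμ]; exact hGc.aestronglyMeasurable (hJm.prod MeasurableSet.univ)
  have hGi : Integrable (fun p : ℝ × ℝ => G p.1 p.2) ((volume.restrict J).prod volume) := by
    rw [integrable_prod_iff hm]
    have : IsFiniteMeasure (volume.restrict J) := ⟨by simpa using hJc.measure_lt_top⟩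
    refine ⟨?_, Integrable.of_bound hm.norm.integral_prod_right' ((C : ℝ) ^ 2 + (C' : ℝ) ^ 2) ?_⟩
    · filter_upwards [self_mem_ae_restrict hJm] with s hs
      exact (integrable_normSq_of_L2 (hf.good.memLp (hJI hs))).add
        (integrable_normSq_of_L2 (hf'.good.memLp (hJI hs)))
    · filter_upwards [self_mem_ae_restrict hJm] with s hs
      have e : ∀ x, ‖G s x‖ = ‖f s x‖ ^ 2 + ‖WaterWave.dt f s x‖ ^ 2 := fun x =>
        Real.norm_of_nonneg (by positivity)
      rw [Real.norm_of_nonneg (integral_nonneg fun x => norm_nonneg _)]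
      simp only [e]
      rw [integral_add (integrable_normSq_of_L2 (hf.good.memLp (hJI hs)))
        (integrable_normSq_of_L2 (hf'.good.memLp (hJI hs)))]
      exact add_le_add (integral_sq_le_of_eLpNorm_le (hf.good.memLp (hJI hs)) (h hs).1.1)
        (integral_sq_le_of_eLpNorm_le (hf'.good.memLp (hJI hs)) (h hs).1.2)
  have hH := hGi.integral_prod_right
  have hH0 : ∀ x, 0 ≤ ∫ s in J, G s x := fun x => integral_nonneg fun s => by simp only [hG]; positivity
  have hi0 := integrable_normSq_of_L2 (hf.good.memLp ht₀)
  -- The majorant is Φ² = |f(t₀)|² + ∫_J (|f|² + |∂_t f|²) ds. It dominates |f(t)|² by the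
  -- fundamental theorem of calculus for f² in time, and it is integrable in x by Fubini, because
  -- the L² norms are bounded uniformly on the compact interval J.
  refine ⟨fun x => √(‖f t₀ x‖ ^ 2 + ∫ s in J, G s x), ?_, ?_⟩
  · have hi := hi0.add hH
    have hm' : AEStronglyMeasurable (fun x => √(‖f t₀ x‖ ^ 2 + ∫ s in J, G s x)) :=
      hi.1.aemeasurable.sqrt.aestronglyMeasurable
    rw [memLp_two_iff_integrable_sq_norm hm']
    refine hi.congr (Eventually.of_forall fun x => ?_)
    have : 0 ≤ ‖f t₀ x‖ ^ 2 + ∫ s in J, G s x := add_nonneg (by positivity) (hH0 x)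
    simp [Real.sq_sqrt this]
  · filter_upwards [Metric.closedBall_mem_nhds t₀ hδ] with t ht x
    refine Real.le_sqrt_of_sq_le ?_
    have hsub : Set.uIcc t₀ t ⊆ J := by
      rw [hJ, Real.closedBall_eq_Icc]
      rw [Real.closedBall_eq_Icc] at ht
      exact Set.uIcc_subset_Icc ⟨by linarith, by linarith⟩ ht
    have cs : ∀ {k : ℝ → ℝ → ℂ}, SDec I k → ContinuousOn (fun s => k s x) I := fun hk s hs =>
      (hk.hasDerivAt_t hs x).continuousAt.continuousWithinAt
    have h1 := intervalIntegral.integral_eq_sub_of_hasDerivAt (a := t₀) (b := t)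
      (fun s hs => (hf.hasDerivAt_t (hJI (hsub hs)) x).mul (hf.hasDerivAt_t (hJI (hsub hs)) x))
      (ContinuousOn.intervalIntegrable ((((cs hf').mul (cs hf)).add ((cs hf).mul (cs hf'))).mono
        (hsub.trans hJI)))
    have hGs : IntegrableOn (fun s => G s x) J :=
      ((((cs hf).norm.pow 2).add ((cs hf').norm.pow 2)).mono hJI).integrableOn_compact hJc
    have h2 : ‖f t x * f t x - f t₀ x * f t₀ x‖ ≤ ∫ s in J, G s x := by
      refine (le_of_eq (congrArg norm h1.symm)).trans
        (intervalIntegral.norm_integral_le_integral_norm_uIoc.trans ?_)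
      refine (integral_mono_of_nonneg (Eventually.of_forall fun _ => norm_nonneg _)
        (hGs.mono_set (Set.uIoc_subset_uIcc.trans hsub)) (Eventually.of_forall fun s => ?_)).trans
        (setIntegral_mono_set hGs (Eventually.of_forall fun s => by simp only [hG, Pi.zero_apply]; positivity)
          (Set.uIoc_subset_uIcc.trans hsub).eventuallyLE)
      refine (norm_add_le _ _).trans ?_
      simp only [norm_mul, hG]
      nlinarith [sq_nonneg (‖f s x‖ - ‖WaterWave.dt f s x‖)]
    have h3 := norm_sub_norm_le (f t x * f t x) (f t₀ x * f t₀ x)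
    simp only [norm_mul] at h3
    rw [pow_two, pow_two]
    linarith

/-- Differentiation of the pairing of two functions. -/
theorem hasDerivAt_integral (hI : IsOpen I) (hf : SDec I f) (hg : SDec I g) {t : ℝ} (ht : t ∈ I) :
    HasDerivAt (fun s => ∫ x, f s x * g s x)
      (∫ x, (WaterWave.dt f t x * g t x + f t x * WaterWave.dt g t x)) t := by
  obtain ⟨Φ₁, m1, h1⟩ := hf.dominated hI ht
  obtain ⟨Φ₂, m2, h2⟩ := hg.dominated hI ht
  obtain ⟨Φ₃, m3, h3⟩ := (hf.dt hI).dominated hI ht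
  obtain ⟨Φ₄, m4, h4⟩ := (hg.dt hI).dominated hI ht
  have hall := (h1.and h2).and ((h3.and h4).and (hI.mem_nhds ht))
  have hc : ∀ {k : ℝ → ℝ → ℂ}, SDec I k → ∀ s ∈ I, Continuous (k s) := fun hk s hs =>
    (hk.good.diff_x s hs).continuous
  refine (hasDerivAt_integral_of_dominated_loc_of_deriv_le (𝕜 := ℝ) (μ := volume)
    (F := fun s x => f s x * g s x)
    (F' := fun s x => WaterWave.dt f s x * g s x + f s x * WaterWave.dt g s x)
    (bound := fun x => Φ₃ x * Φ₂ x + Φ₁ x * Φ₄ x) hall ?_ ?_ ?_ ?_ ?_ ?_).2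
  · filter_upwards [hI.mem_nhds ht] with s hs
    exact ((hc hf s hs).mul (hc hg s hs)).aestronglyMeasurable
  · exact (hf.hinf hI ht).integrable_mul (hg.hinf hI ht)
  · exact (((hc (hf.dt hI) t ht).mul (hc hg t ht)).add
      ((hc hf t ht).mul (hc (hg.dt hI) t ht))).aestronglyMeasurable
  · refine Eventually.of_forall fun x s hs => norm_add_le_of_le ?_ ?_
    · exact norm_mul_le_of_le (hs.2.1.1 x) (hs.1.2 x)
    · exact norm_mul_le_of_le (hs.1.1 x) (hs.2.1.2 x)
  · exact (m3.integrable_mul m2).add (m1.integrable_mul m4)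
  · exact Eventually.of_forall fun x s hs =>
      (hf.hasDerivAt_t hs.2.2 x).mul (hg.hasDerivAt_t hs.2.2 x)

/-- The Hilbert transform commutes with time derivatives. -/
theorem hasDerivAt_hilbert (hI : IsOpen I) (hf : SDec I f) {t : ℝ} (ht : t ∈ I) (x : ℝ) :
    HasDerivAt (fun s => hilbert (f s) x) (hilbert (WaterWave.dt f t) x) t := by
  obtain ⟨Φ, m, h⟩ := (hf.dt hI).dominated hI ht
  obtain ⟨C, hC⟩ := ((hf.dt hI).dx hI).bounded hI ht
  have hall := (h.and hC).and (hI.mem_nhds ht)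
  have key : HasDerivAt (fun s => ∫ u in Set.Ioi (0 : ℝ), (f s (x - u) - f s (x + u)) / (u : ℂ))
      (∫ u in Set.Ioi (0 : ℝ), (WaterWave.dt f t (x - u) - WaterWave.dt f t (x + u)) / (u : ℂ)) t := by
    refine (hasDerivAt_integral_of_dominated_loc_of_deriv_le (𝕜 := ℝ)
      (μ := volume.restrict (Set.Ioi 0)) (F := fun s u => (f s (x - u) - f s (x + u)) / (u : ℂ))
      (F' := fun s u => (WaterWave.dt f s (x - u) - WaterWave.dt f s (x + u)) / (u : ℂ))
      (bound := hilbMaj C Φ x) hall ?_ ?_ ?_ ?_ ?_ ?_).2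
    · filter_upwards [hI.mem_nhds ht] with s hs
      exact (hf.hinf hI hs).reg.measurable_symm x _
    · exact (hf.hinf hI ht).reg.integrableOn_symm x
    · exact ((hf.dt hI).hinf hI ht).reg.measurable_symm x _
    · filter_upwards [self_mem_ae_restrict measurableSet_Ioi] with u hu s hs
      exact symm_le_hilbMaj ((hf.dt hI).good.diff_x s hs.2) hs.1.2 hs.1.1 x hu
    · exact (integrable_hilbMaj m C x).integrableOn
    · exact Eventually.of_forall fun u s hs =>
        ((hf.hasDerivAt_t hs.2 _).sub (hf.hasDerivAt_t hs.2 _)).div_const _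
  rw [((hf.dt hI).hinf hI ht).reg.hilbert_eq]
  refine (key.const_mul _).congr_of_eventuallyEq ?_
  filter_upwards [hI.mem_nhds ht] with s hs
  rw [(hf.hinf hI hs).reg.hilbert_eq]

end SDec

/-! ### The Hilbert transform on functions with square integrable derivatives -/

theorem hilbert_comp_add {f : ℝ → ℂ} (hf : Hinf f) (s x : ℝ) (hs : Hinf (fun y => f (s + y))) :
    hilbert (fun y => f (s + y)) x = hilbert f (s + x) := by
  rw [hf.reg.hilbert_eq, hs.reg.hilbert_eq]
  simp only [add_sub_assoc, add_assoc]

theorem Hinf.sdec_translate {f : ℝ → ℂ} (hf : Hinf f) :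
    SDec Set.univ (fun s y => f (s + y)) := by
  refine SDec.of_class (𝒞 := {F | ∃ f, Hinf f ∧ F = fun s y => f (s + y)}) ?_ ⟨f, hf, rfl⟩
  rintro _ ⟨f, hf, rfl⟩
  have h1 : ∀ s y, HasDerivAt (fun s => f (s + y)) (_root_.deriv f (s + y)) s := fun s y =>
    (hf.hasDerivAt (s + y)).comp_add_const s y
  have h2 : ∀ s y, HasDerivAt (fun y => f (s + y)) (_root_.deriv f (s + y)) y := fun s y =>
    (hf.hasDerivAt (s + y)).comp_const_add s y
  refine ⟨⟨fun s _ y => (h1 s y).differentiableAt, fun s _ y => (h2 s y).differentiableAt,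
    fun s _ => ⟨(eLpNorm f 2).toNNReal, Eventually.of_forall fun s => ?_⟩⟩,
    ⟨_, ⟨_, hf.deriv, rfl⟩, fun s _ y => (h1 s y).deriv⟩,
    ⟨_, ⟨_, hf.deriv, rfl⟩, fun s _ y => (h2 s y).deriv⟩⟩
  rw [ENNReal.coe_toNNReal hf.memLp.2.ne]
  exact (eLpNorm_comp_measurePreserving hf.memLp.1
    (measurePreserving_add_left volume s)).le

namespace Hinf

variable {f g : ℝ → ℂ}

/-- The translates f(s + y) depend on s as on a time, so differentiation in x is the time derivative
at s = 0 and the result for time derivatives applies. -/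
theorem hasDerivAt_hilbert (hf : Hinf f) (x : ℝ) :
    HasDerivAt (WaterWave.hilbert f) (WaterWave.hilbert (_root_.deriv f) x) x := by
  have h := hf.sdec_translate.hasDerivAt_hilbert isOpen_univ (Set.mem_univ 0) x
  have hs : ∀ s, Hinf (fun y => f (s + y)) := fun s => hf.sdec_translate.hinf isOpen_univ (Set.mem_univ s)
  simp only [fun s => hilbert_comp_add hf s x (hs s)] at h
  have e : WaterWave.dt (fun s y => f (s + y)) 0 = _root_.deriv f := by
    ext y
    simp only [WaterWave.dt]
    simpa using ((hf.hasDerivAt (0 + y)).comp_add_const 0 y).deriv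
  rw [e] at h
  have h' := HasDerivAt.comp_sub_const x x (by simpa using h)
  simpa using h'

protected theorem hilbert (hf : Hinf f) : Hinf (hilbert f) := by
  refine of_class (𝒞 := {g | ∃ f, Hinf f ∧ g = WaterWave.hilbert f}) ?_ ⟨f, hf, rfl⟩
  rintro _ ⟨f, hf, rfl⟩
  exact ⟨fun x => (hf.hasDerivAt_hilbert x).differentiableAt, hf.reg.memLp_hilbert,
    _, hf.deriv, funext fun x => (hf.hasDerivAt_hilbert x).deriv⟩

theorem deriv_hilbert (hf : Hinf f) (x : ℝ) :
    _root_.deriv (WaterWave.hilbert f) x = WaterWave.hilbert (_root_.deriv f) x :=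
  (hf.hasDerivAt_hilbert x).deriv

/-- Tested against k: skew-adjointness, followed by ∫ ℍf ℍk = −∫ f k. -/
theorem hilbert_hilbert (hf : Hinf f) (x : ℝ) :
    WaterWave.hilbert (WaterWave.hilbert f) x = f x := by
  refine hf.hilbert.hilbert.eq_of_integral_mul_eq hf (fun k hk => ?_) x
  rw [hf.hilbert.reg.integral_hilbert_mul hk.reg, hf.reg.integral_hilbert_mul_hilbert hk.reg, neg_neg]

theorem hilbert_add (hf : Hinf f) (hg : Hinf g) (x : ℝ) :
    WaterWave.hilbert (fun x => f x + g x) x = WaterWave.hilbert f x + WaterWave.hilbert g x :=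
  hf.reg.hilbert_add' hg.reg x

theorem hilbert_sub (hf : Hinf f) (hg : Hinf g) (x : ℝ) :
    WaterWave.hilbert (fun x => f x - g x) x = WaterWave.hilbert f x - WaterWave.hilbert g x :=
  hf.reg.hilbert_sub hg.reg x

theorem hilbert_smul (c : ℂ) (hf : Hinf f) (x : ℝ) :
    WaterWave.hilbert (fun x => c * f x) x = c * WaterWave.hilbert f x :=
  hf.reg.hilbert_smul c (hf.reg.smul c) x

theorem hilbert_star (hf : Hinf f) (x : ℝ) :
    WaterWave.hilbert (fun x => star (f x)) x = -star (WaterWave.hilbert f x) :=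
  hf.reg.hilbert_star hf.reg.star x

end Hinf

namespace SDec

variable {I : Set ℝ} {f g : ℝ → ℝ → ℂ}

theorem hilbert (hI : IsOpen I) (hf : SDec I f) : SDec I (fun t x => hilbert (f t) x) := by
  refine of_class (𝒞 := {F | ∃ f, SDec I f ∧ F = fun t x => WaterWave.hilbert (f t) x}) ?_ ⟨f, hf, rfl⟩
  rintro _ ⟨f, hf, rfl⟩
  refine ⟨⟨fun t ht x => (hf.hasDerivAt_hilbert hI ht x).differentiableAt,
    fun t ht x => ((hf.hinf hI ht).hasDerivAt_hilbert x).differentiableAt, fun t₀ ht₀ => ?_⟩,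
    ⟨_, ⟨_, hf.dt hI, rfl⟩, fun t ht x => (hf.hasDerivAt_hilbert hI ht x).deriv⟩,
    ⟨_, ⟨_, hf.dx hI, rfl⟩, fun t ht x => ((hf.hinf hI ht).hasDerivAt_hilbert x).deriv⟩⟩
  obtain ⟨C, hC⟩ := hf.good.l2 t₀ ht₀
  refine ⟨C, ?_⟩
  filter_upwards [hC, hI.mem_nhds ht₀] with t h ht
  exact (hf.hinf hI ht).reg.eLpNorm_hilbert_le.trans h

theorem dt_hilbert (hI : IsOpen I) (hf : SDec I f) {t : ℝ} (ht : t ∈ I) (x : ℝ) :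
    WaterWave.dt (fun t x => WaterWave.hilbert (f t) x) t x = WaterWave.hilbert (WaterWave.dt f t) x :=
  (hf.hasDerivAt_hilbert hI ht x).deriv

end SDec

/-! ### Comparison with the definition -/

/-- Smooth functions on `I × ℝ`. -/
def Smooth (I : Set ℝ) (f : ℝ → ℝ → ℂ) : Prop :=
  ContDiffOn ℝ ∞ (fun p : ℝ × ℝ => f p.1 p.2) (I ×ˢ Set.univ)

namespace Smooth

variable {I : Set ℝ} {f : ℝ → ℝ → ℂ}

theorem differentiableAt (hI : IsOpen I) (hf : Smooth I f) {t : ℝ} (ht : t ∈ I) (x : ℝ) :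
    DifferentiableAt ℝ (fun p : ℝ × ℝ => f p.1 p.2) (t, x) :=
  (ContDiffOn.differentiableOn hf (by simp)).differentiableAt
    ((hI.prod isOpen_univ).mem_nhds ⟨ht, Set.mem_univ _⟩)

theorem hasDerivAt_t (hI : IsOpen I) (hf : Smooth I f) {t : ℝ} (ht : t ∈ I) (x : ℝ) :
    HasDerivAt (fun s => f s x) (fderiv ℝ (fun p : ℝ × ℝ => f p.1 p.2) (t, x) (1, 0)) t :=
  HasFDerivAt.comp_hasDerivAt (f := fun s : ℝ => (s, x)) t
    (hf.differentiableAt hI ht x).hasFDerivAt ((hasDerivAt_id t).prodMk (hasDerivAt_const t x))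

theorem hasDerivAt_x (hI : IsOpen I) (hf : Smooth I f) {t : ℝ} (ht : t ∈ I) (x : ℝ) :
    HasDerivAt (f t) (fderiv ℝ (fun p : ℝ × ℝ => f p.1 p.2) (t, x) (0, 1)) x :=
  HasFDerivAt.comp_hasDerivAt (f := fun y : ℝ => (t, y)) x
    (hf.differentiableAt hI ht x).hasFDerivAt ((hasDerivAt_const x t).prodMk (hasDerivAt_id x))

theorem fderiv_apply (hI : IsOpen I) (hf : Smooth I f) (v : ℝ × ℝ) :
    Smooth I (fun t x => fderiv ℝ (fun p : ℝ × ℝ => f p.1 p.2) (t, x) v) :=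
  (ContDiffOn.fderiv_of_isOpen hf (hI.prod isOpen_univ) (by simp)).clm_apply contDiffOn_const

theorem dt (hI : IsOpen I) (hf : Smooth I f) : Smooth I (dt f) :=
  (hf.fderiv_apply hI (1, 0)).congr fun p hp => (hf.hasDerivAt_t hI hp.1 p.2).deriv

theorem dx (hI : IsOpen I) (hf : Smooth I f) : Smooth I (dx f) :=
  (hf.fderiv_apply hI (0, 1)).congr fun p hp => (hf.hasDerivAt_x hI hp.1 p.2).deriv

theorem dx_dt (hI : IsOpen I) (hf : Smooth I f) :
    EqI I (WaterWave.dx (WaterWave.dt f)) (WaterWave.dt (WaterWave.dx f)) := by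
  intro t ht x
  have hU : I ×ˢ (Set.univ : Set ℝ) ∈ 𝓝 (t, x) := (hI.prod isOpen_univ).mem_nhds ⟨ht, Set.mem_univ _⟩
  have hs := (ContDiffOn.contDiffAt hf hU).isSymmSndFDerivAt (by
    rw [minSmoothness_of_isRCLikeNormedField]
    exact WithTop.coe_le_coe.2 (le_top : (2 : ℕ∞) ≤ ⊤)) (0, 1) (1, 0)
  have hd : DifferentiableAt ℝ (fderiv ℝ (fun p : ℝ × ℝ => f p.1 p.2)) (t, x) :=
    (ContDiffOn.differentiableOn (ContDiffOn.fderiv_of_isOpen hf (hI.prod isOpen_univ)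
      (m := ∞) (by simp)) (by simp)).differentiableAt hU
  have e1 : EqI I (WaterWave.dt f) (fun t x => fderiv ℝ (fun p : ℝ × ℝ => f p.1 p.2) (t, x) (1, 0)) :=
    fun t ht x => (hf.hasDerivAt_t hI ht x).deriv
  have e2 : EqI I (WaterWave.dx f) (fun t x => fderiv ℝ (fun p : ℝ × ℝ => f p.1 p.2) (t, x) (0, 1)) :=
    fun t ht x => (hf.hasDerivAt_x hI ht x).deriv
  have hv : ∀ v, HasFDerivAt (fun p : ℝ × ℝ => fderiv ℝ (fun p : ℝ × ℝ => f p.1 p.2) p v)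
      ((ContinuousLinearMap.apply ℝ ℂ v).comp
        (fderiv ℝ (fderiv ℝ (fun p : ℝ × ℝ => f p.1 p.2)) (t, x))) (t, x) := fun v =>
    (ContinuousLinearMap.apply ℝ ℂ v).hasFDerivAt.comp _ hd.hasFDerivAt
  rw [e1.dx t ht x, e2.dt hI t ht x]
  have h1 := HasFDerivAt.comp_hasDerivAt (f := fun y : ℝ => (t, y)) x (hv (1, 0))
    ((hasDerivAt_const x t).prodMk (hasDerivAt_id x))
  have h2 := HasFDerivAt.comp_hasDerivAt (f := fun s : ℝ => (s, x)) t (hv (0, 1))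
    ((hasDerivAt_id t).prodMk (hasDerivAt_const t x))
  exact h1.deriv.trans (Eq.trans (by simpa using hs) h2.deriv.symm)

theorem iterate_dt (hI : IsOpen I) (hf : Smooth I f) (k : ℕ) : Smooth I (WaterWave.dt^[k] f) := by
  induction k with
  | zero => exact hf
  | succ k ih => rw [Function.iterate_succ_apply']; exact ih.dt hI

theorem iterate_dx (hI : IsOpen I) (hf : Smooth I f) (k : ℕ) : Smooth I (WaterWave.dx^[k] f) := by
  induction k with
  | zero => exact hf
  | succ k ih => rw [Function.iterate_succ_apply']; exact ih.dx hI

theorem dx_iterate_dt (hI : IsOpen I) (hf : Smooth I f) (k : ℕ) :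
    EqI I (WaterWave.dx (WaterWave.dt^[k] f)) (WaterWave.dt^[k] (WaterWave.dx f)) := by
  induction k with
  | zero => exact fun _ _ _ => rfl
  | succ k ih =>
    rw [Function.iterate_succ_apply', Function.iterate_succ_apply']
    exact ((hf.iterate_dt hI k).dx_dt hI).trans (ih.dt hI)

end Smooth

/-- The class of all ∂_t^k ∂_x^m f is closed under both derivatives; for ∂_x this requires commuting
it past ∂_t^k, where joint smoothness enters. -/
theorem SmoothDecaying.sdec {I : Set ℝ} (hI : IsOpen I) {f : ℝ → ℝ → ℂ}
    (hf : SmoothDecaying I f) : SDec I f := by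
  have hs : ∀ k m, Smooth I (dt^[k] (dx^[m] f)) := fun k m =>
    Smooth.iterate_dt hI (Smooth.iterate_dx hI hf.1 m) k
  refine SDec.of_class (𝒞 := Set.range fun p : ℕ × ℕ => dt^[p.1] (dx^[p.2] f)) ?_ ⟨(0, 0), rfl⟩
  rintro _ ⟨⟨k, m⟩, rfl⟩
  refine ⟨⟨fun t ht x => ((hs k m).hasDerivAt_t hI ht x).differentiableAt,
    fun t ht x => ((hs k m).hasDerivAt_x hI ht x).differentiableAt, fun t₀ ht₀ => ?_⟩,
    ⟨_, ⟨(k + 1, m), rfl⟩, ?_⟩, ⟨_, ⟨(k, m + 1), rfl⟩, ?_⟩⟩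
  · obtain ⟨δ, hδ, h⟩ := Metric.nhds_basis_closedBall.mem_iff.1 (hI.mem_nhds ht₀)
    obtain ⟨C, hC⟩ := hf.2 k m _ h (isCompact_closedBall _ _)
    exact ⟨C, Filter.mem_of_superset (Metric.closedBall_mem_nhds t₀ hδ) hC⟩
  · simp only [Function.iterate_succ_apply']
    exact fun _ _ _ => rfl
  · simp only [Function.iterate_succ_apply']
    exact (Smooth.iterate_dx hI hf.1 m).dx_iterate_dt hI k

/-! ### The algebra `H^∞` and its operators -/

/-- The algebra of functions all of whose derivatives are square integrable. -/
def HInf : NonUnitalSubalgebra ℂ (ℝ → ℂ) where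
  carrier := {f | Hinf f}
  add_mem' hf hg := hf.add hg
  mul_mem' hf hg := hf.mul hg
  zero_mem' := Hinf.zero
  smul_mem' c _ hf := hf.smul c

namespace HInf

instance : CoeFun HInf fun _ => ℝ → ℂ := ⟨fun f => f.1⟩

@[ext] theorem ext {f g : HInf} (h : ∀ x, f x = g x) : f = g := Subtype.ext (funext h)

@[simp] theorem add_apply (f g : HInf) (x : ℝ) : (f + g) x = f x + g x := rfl
@[simp] theorem sub_apply (f g : HInf) (x : ℝ) : (f - g) x = f x - g x := rfl
@[simp] theorem neg_apply (f : HInf) (x : ℝ) : (-f) x = -f x := rfl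
@[simp] theorem mul_apply (f g : HInf) (x : ℝ) : (f * g) x = f x * g x := rfl
@[simp] theorem smul_apply (c : ℂ) (f : HInf) (x : ℝ) : (c • f) x = c * f x := rfl
@[simp] theorem zero_apply (x : ℝ) : (0 : HInf) x = 0 := rfl
@[simp] theorem mk_apply {f : ℝ → ℂ} (hf : f ∈ HInf) (x : ℝ) : (⟨f, hf⟩ : HInf) x = f x := rfl

/-- The Hilbert transform. -/
def H : HInf →ₗ[ℂ] HInf where
  toFun f := ⟨hilbert f, f.2.hilbert⟩
  map_add' f g := ext fun x => f.2.hilbert_add g.2 x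
  map_smul' c f := ext fun x => f.2.hilbert_smul c x

/-- The derivative. -/
def d : HInf →ₗ[ℂ] HInf where
  toFun f := ⟨deriv f, f.2.deriv⟩
  map_add' f g := ext fun x => deriv_add (f.2.differentiable x) (g.2.differentiable x)
  map_smul' c f := ext fun x => deriv_const_mul c (f.2.differentiable x)

/-- Complex conjugation. -/
def conj (f : HInf) : HInf := ⟨fun x => star (f x), f.2.star⟩

/-- The projection onto boundary values of holomorphic functions. -/
def PH : HInf →ₗ[ℂ] HInf := (1 / 2 : ℂ) • (LinearMap.id + H)

/-- The projection onto conjugates of boundary values of holomorphic functions. -/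
def PA : HInf →ₗ[ℂ] HInf := (1 / 2 : ℂ) • (LinearMap.id - H)

/-- Boundary values of holomorphic functions. -/
def Hol (f : HInf) : Prop := H f = f

/-- Conjugates of boundary values of holomorphic functions. -/
def Anti (f : HInf) : Prop := H f = -f

variable {f g h : HInf}

theorem H_apply (f : HInf) (x : ℝ) : H f x = hilbert f x := rfl

theorem d_apply (f : HInf) (x : ℝ) : d f x = deriv f x := rfl

@[simp] theorem conj_apply (f : HInf) (x : ℝ) : conj f x = star (f x) := rfl

theorem PH_apply (f : HInf) (x : ℝ) : PH f x = (f x + hilbert f x) / 2 := by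
  simp only [PH, LinearMap.smul_apply, LinearMap.add_apply, smul_apply, add_apply, H_apply,
    LinearMap.id_apply]
  ring

theorem PA_apply (f : HInf) (x : ℝ) : PA f x = (f x - hilbert f x) / 2 := by
  simp only [PA, LinearMap.smul_apply, LinearMap.sub_apply, smul_apply, sub_apply, H_apply,
    LinearMap.id_apply]
  ring

theorem H_H (f : HInf) : H (H f) = f := ext fun x => f.2.hilbert_hilbert x

theorem d_H (f : HInf) : d (H f) = H (d f) := ext fun x => f.2.deriv_hilbert x

theorem d_mul (f g : HInf) : d (f * g) = d f * g + f * d g :=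
  ext fun x => deriv_mul (f.2.differentiable x) (g.2.differentiable x)

theorem conj_conj (f : HInf) : conj (conj f) = f := ext fun _ => star_star _

theorem conj_mul (f g : HInf) : conj (f * g) = conj f * conj g := ext fun x => by simp

theorem conj_add (f g : HInf) : conj (f + g) = conj f + conj g := ext fun x => by simp

theorem conj_sub (f g : HInf) : conj (f - g) = conj f - conj g := ext fun x => by simp

theorem conj_neg (f : HInf) : conj (-f) = -conj f := ext fun x => by simp

theorem d_conj (f : HInf) : d (conj f) = conj (d f) := ext fun _ => deriv.star

theorem H_conj (f : HInf) : H (conj f) = -conj (H f) := ext fun x => f.2.hilbert_star x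

theorem PA_add_PH (f : HInf) : PA f + PH f = f := by
  ext x; simp only [add_apply, PA_apply, PH_apply]; ring

theorem PA_eq (f : HInf) : PA f = f - PH f := eq_sub_of_add_eq (PA_add_PH f)

theorem H_eq (f : HInf) : H f = f - (2 : ℂ) • PA f := by
  ext x; simp only [sub_apply, smul_apply, PA_apply, H_apply]; ring

theorem d_PH (f : HInf) : d (PH f) = PH (d f) := by
  simp [PH, d_H]

theorem d_PA (f : HInf) : d (PA f) = PA (d f) := by
  simp [PA, d_H]

theorem hol_PH (f : HInf) : Hol (PH f) := by
  simp only [Hol, PH, LinearMap.smul_apply, LinearMap.add_apply, map_smul, map_add, H_H,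
    LinearMap.id_apply]
  rw [add_comm]

theorem anti_PA (f : HInf) : Anti (PA f) := by
  simp only [Anti, PA, LinearMap.smul_apply, LinearMap.sub_apply, map_smul, map_sub, H_H,
    LinearMap.id_apply]
  rw [← smul_neg, neg_sub]

theorem Hol.PH_eq (hf : Hol f) : PH f = f := by
  ext x
  rw [PH_apply, ← H_apply, hf]; ring

theorem Hol.PA_eq (hf : Hol f) : PA f = 0 := by
  rw [HInf.PA_eq, hf.PH_eq, sub_self]

theorem Anti.PA_eq (hf : Anti f) : PA f = f := by
  ext x
  rw [PA_apply, ← H_apply, hf]; simp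

theorem Anti.PH_eq (hf : Anti f) : PH f = 0 := by
  have := PA_add_PH f
  rwa [hf.PA_eq, add_eq_left] at this

theorem Hol.conj (hf : Hol f) : Anti (conj f) := by rw [Anti, H_conj, hf]

theorem Anti.conj (hf : Anti f) : Hol (conj f) := by rw [Hol, H_conj, hf, conj_neg, neg_neg]

theorem Hol.d (hf : Hol f) : Hol (d f) := by rw [Hol, ← d_H, hf]

theorem Anti.d (hf : Anti f) : Anti (d f) := by rw [Anti, ← d_H, hf, map_neg]

theorem Hol.add (hf : Hol f) (hg : Hol g) : Hol (f + g) := by rw [Hol, map_add, hf, hg]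

theorem Hol.smul (c : ℂ) (hf : Hol f) : Hol (c • f) := by rw [Hol, map_smul, hf]

theorem Anti.add (hf : Anti f) (hg : Anti g) : Anti (f + g) := by
  rw [Anti, map_add, hf, hg, neg_add]

theorem Hol.mul (hf : Hol f) (hg : Hol g) : Hol (f * g) :=
  ext fun x => f.2.hilbert_mul_of_hol g.2 (fun x => congrArg (fun k : HInf => k x) hf)
    (fun x => congrArg (fun k : HInf => k x) hg) x

theorem Anti.mul (hf : Anti f) (hg : Anti g) : Anti (f * g) := by
  have := (hf.conj.mul hg.conj).conj
  rwa [← conj_mul, conj_conj] at this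

theorem conj_PA (f : HInf) : conj (PA f) = PH (conj f) := by
  ext x
  rw [conj_apply, PA_apply, PH_apply, ← H_apply (conj f), H_conj]
  simp [H_apply, sub_eq_add_neg]

theorem conj_PH (f : HInf) : conj (PH f) = PA (conj f) := by
  ext x
  rw [conj_apply, PA_apply, PH_apply, ← H_apply (conj f), H_conj]
  simp [H_apply]

theorem integral_d_mul (f g : HInf) : ∫ x, d f x * g x = -∫ x, f x * d g x :=
  f.2.integral_deriv_mul g.2

theorem integrable_mul (f g : HInf) : Integrable fun x => f x * g x := f.2.integrable_mul g.2

theorem integral_hol_mul_hol (hf : Hol f) (hg : Hol g) : ∫ x, f x * g x = 0 :=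
  f.2.reg.integral_mul_of_hol g.2.reg (fun x => congrArg (fun k : HInf => k x) hf)
    (fun x => congrArg (fun k : HInf => k x) hg)

theorem integral_anti_mul_anti (hf : Anti f) (hg : Anti g) : ∫ x, f x * g x = 0 := by
  have h := integral_hol_mul_hol hf.conj hg.conj
  have e : ∫ x, star (f x * g x) = star (∫ x, f x * g x) := integral_conj
  simp only [star_mul'] at e
  simp only [conj_apply, e] at h
  exact star_eq_zero.1 h

/-- The difference pairs f with `PA g`, and a product of two antiholomorphic functions has integral
zero. -/
theorem integral_anti_mul_PH (hf : Anti f) (g : HInf) : ∫ x, f x * PH g x = ∫ x, f x * g x := by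
  have h := integral_anti_mul_anti hf (anti_PA g)
  have e : ∀ x, f x * g x = f x * PA g x + f x * PH g x := fun x => by
    rw [← mul_add, ← add_apply, PA_add_PH]
  simp only [e]
  rw [integral_add (integrable_mul _ _) (integrable_mul _ _), h, zero_add]

theorem integral_hol_mul_PA (hf : Hol f) (g : HInf) : ∫ x, f x * PA g x = ∫ x, f x * g x := by
  have h := integral_hol_mul_hol hf (hol_PH g)
  have e : ∀ x, f x * g x = f x * PA g x + f x * PH g x := fun x => by
    rw [← mul_add, ← add_apply, PA_add_PH]
  simp only [e]
  rw [integral_add (integrable_mul _ _) (integrable_mul _ _), h, add_zero]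

end HInf

/-! ### Reciprocals -/

/-- At t₀ the function 1 + ζ tends to 1 at infinity and has no zero, so it is bounded below by
compactness. The Lipschitz bound in time, uniform in x, keeps half of the bound at nearby times. -/
theorem SDec.exists_lower_bound {I : Set ℝ} (hI : IsOpen I) {ζ : ℝ → ℝ → ℂ} (hζ : SDec I ζ)
    (h0 : ∀ t ∈ I, ∀ x, 1 + ζ t x ≠ 0) {t₀ : ℝ} (ht₀ : t₀ ∈ I) :
    ∃ c > 0, ∀ᶠ t in 𝓝 t₀, ∀ x, c ≤ ‖1 + ζ t x‖ := by
  have hf := hζ.hinf hI ht₀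
  have hfix : ∃ c > 0, ∀ x, c ≤ ‖1 + ζ t₀ x‖ := by
    have hc : Continuous fun x => ‖1 + ζ t₀ x‖ := (continuous_const.add hf.continuous).norm
    have hlim : ∀ᶠ x in cocompact ℝ, 1 / 2 ≤ ‖1 + ζ t₀ x‖ := by
      have h : Tendsto (fun x => ‖1 + ζ t₀ x‖) (cocompact ℝ) (𝓝 1) := by
        have : Tendsto (ζ t₀) (cocompact ℝ) (𝓝 0) := by
          rw [cocompact_eq_atBot_atTop]
          exact tendsto_sup.2 hf.tendsto_zero
        simpa using (tendsto_const_nhds (x := (1 : ℂ))).add this |>.norm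
      exact h.eventually (eventually_ge_nhds (by norm_num))
    obtain ⟨K, hK, hKs⟩ := mem_cocompact.1 hlim
    rcases K.eq_empty_or_nonempty with rfl | hne
    · exact ⟨1 / 2, by norm_num, fun x => hKs (by simp)⟩
    · obtain ⟨y, -, hy⟩ := hK.exists_isMinOn hne hc.continuousOn
      refine ⟨min (1 / 2) ‖1 + ζ t₀ y‖, lt_min (by norm_num) (norm_pos_iff.2 (h0 t₀ ht₀ y)), fun x => ?_⟩
      by_cases hx : x ∈ K
      · exact (min_le_right _ _).trans (hy hx)
      · exact (min_le_left _ _).trans (hKs hx)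
  obtain ⟨c, hc, hcx⟩ := hfix
  obtain ⟨C, hC⟩ := hζ.lipschitz_t hI ht₀
  have hsmall : ∀ᶠ t in 𝓝 t₀, C * |t - t₀| < c / 2 := by
    have : Tendsto (fun t => C * |t - t₀|) (𝓝 t₀) (𝓝 (C * |t₀ - t₀|)) :=
      (Continuous.tendsto (by fun_prop) t₀)
    rw [sub_self, abs_zero, mul_zero] at this
    exact this.eventually (gt_mem_nhds (by positivity))
  refine ⟨c / 2, by positivity, ?_⟩
  filter_upwards [hC, hsmall] with t h1 h2 x
  have h3 := norm_sub_norm_le (1 + ζ t₀ x) (1 + ζ t x)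
  have h4 : ‖1 + ζ t₀ x - (1 + ζ t x)‖ = ‖ζ t x - ζ t₀ x‖ := by
    rw [← norm_neg]; congr 1; ring
  linarith [h1 x, hcx x]

/-- All powers n are treated together because each derivative raises the exponent by one. -/
theorem SDec.mul_inv_pow {I : Set ℝ} (hI : IsOpen I) {ζ f : ℝ → ℝ → ℂ} (hζ : SDec I ζ)
    (h0 : ∀ t ∈ I, ∀ x, 1 + ζ t x ≠ 0) (hf : SDec I f) (n : ℕ) :
    SDec I (fun t x => f t x * (1 + ζ t x)⁻¹ ^ n) := by
  refine SDec.of_class (𝒞 := {F | ∃ f n, SDec I f ∧ F = fun t x => f t x * (1 + ζ t x)⁻¹ ^ n}) ?_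
    ⟨f, n, hf, rfl⟩
  rintro _ ⟨f, n, hf, rfl⟩
  have key : ∀ {y z : ℝ → ℂ} {y' z' : ℂ} {s : ℝ}, HasDerivAt y y' s → HasDerivAt z z' s →
      1 + z s ≠ 0 → HasDerivAt (fun s => y s * (1 + z s)⁻¹ ^ n)
        ((y' + y' * z s + -n * (y s * z')) * (1 + z s)⁻¹ ^ (n + 1)) s := by
    intro y z y' z' s hy hz h
    have h1 := hy.mul (((hz.const_add 1).inv h).pow n)
    convert! h1 using 1
    rcases n with _ | n
    · simp; field_simp
    · simp only [Nat.add_sub_cancel, Pi.pow_apply, Pi.inv_apply]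
      push_cast
      rw [div_eq_mul_inv, ← inv_pow]
      have hq : (1 + z s) * (1 + z s)⁻¹ = 1 := mul_inv_cancel₀ h
      linear_combination (y' * (1 + z s)⁻¹ ^ (n + 1)) * hq
  have ht : ∀ t ∈ I, ∀ x, HasDerivAt (fun s => f s x * (1 + ζ s x)⁻¹ ^ n) _ t := fun t ht x =>
    key (hf.hasDerivAt_t ht x) (hζ.hasDerivAt_t ht x) (h0 t ht x)
  have hx : ∀ t ∈ I, ∀ x, HasDerivAt (fun y => f t y * (1 + ζ t y)⁻¹ ^ n) _ x := fun t ht x =>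
    key (hf.hasDerivAt_x ht x) (hζ.hasDerivAt_x ht x) (h0 t ht x)
  refine ⟨⟨fun t h x => (ht t h x).differentiableAt, fun t h x => (hx t h x).differentiableAt,
    fun t₀ ht₀ => ?_⟩, ⟨_, ⟨_, n + 1, ?_, rfl⟩, fun t h x => (ht t h x).deriv⟩,
    ⟨_, ⟨_, n + 1, ?_, rfl⟩, fun t h x => (hx t h x).deriv⟩⟩
  · obtain ⟨c, hc, h⟩ := hζ.exists_lower_bound hI h0 ht₀
    obtain ⟨C, hC⟩ := hf.good.l2 t₀ ht₀
    refine ⟨Real.toNNReal (c⁻¹ ^ n) * C, ?_⟩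
    filter_upwards [h, hC] with t h hC
    have e : (fun x => f t x * (1 + ζ t x)⁻¹ ^ n) = fun x => (1 + ζ t x)⁻¹ ^ n * f t x :=
      funext fun x => mul_comm _ _
    rw [e]
    refine (SDec.eLpNorm_mul_le (C := Real.toNNReal (c⁻¹ ^ n)) fun x => ?_).trans ?_
    · rw [norm_pow, norm_inv]
      refine le_trans ?_ (Real.le_coe_toNNReal _)
      gcongr; exact h x
    · push_cast; gcongr
  · exact ((hf.dt hI).add hI ((hf.dt hI).mul hI hζ)).add hI ((hf.mul hI (hζ.dt hI)).smul hI _)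
  · exact ((hf.dx hI).add hI ((hf.dx hI).mul hI hζ)).add hI ((hf.mul hI (hζ.dx hI)).smul hI _)

/-! ### Slices at a fixed time, projections, and the quantities attached to a solution -/

/-- The value at a fixed time of a smooth decaying function, as an element of `H^∞`. -/
def SDec.at {I : Set ℝ} {f : ℝ → ℝ → ℂ} (hf : SDec I f) (hI : IsOpen I) {t : ℝ} (ht : t ∈ I) :
    HInf := ⟨f t, hf.hinf hI ht⟩

@[simp] theorem SDec.at_apply {I : Set ℝ} {f : ℝ → ℝ → ℂ} (hf : SDec I f) (hI : IsOpen I) {t : ℝ}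
    (ht : t ∈ I) (x : ℝ) : hf.at hI ht x = f t x := rfl

/-- `(I - ℍ) / 2`. -/
def projA (f : ℝ → ℝ → ℂ) (t x : ℝ) : ℂ := (f t x - hilbert (f t) x) / 2

theorem EqI.projH {I : Set ℝ} {f g : ℝ → ℝ → ℂ} (h : EqI I f g) : EqI I (projH f) (projH g) :=
  fun t ht x => by simp only [WaterWave.projH, h.slice ht]

theorem SDec.projH {I : Set ℝ} (hI : IsOpen I) {f : ℝ → ℝ → ℂ} (hf : SDec I f) :
    SDec I (projH f) :=
  ((hf.add hI (hf.hilbert hI)).smul hI (1 / 2)).congr hI fun t _ x => by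
    simp only [WaterWave.projH]; ring

theorem SDec.projA {I : Set ℝ} (hI : IsOpen I) {f : ℝ → ℝ → ℂ} (hf : SDec I f) :
    SDec I (projA f) :=
  ((hf.sub hI (hf.hilbert hI)).smul hI (1 / 2)).congr hI fun t _ x => by
    simp only [WaterWave.projA]; ring

theorem SDec.at_projH {I : Set ℝ} (hI : IsOpen I) {f : ℝ → ℝ → ℂ} (hf : SDec I f)
    {t : ℝ} (ht : t ∈ I) : (hf.projH hI).at hI ht = HInf.PH (hf.at hI ht) :=
  HInf.ext fun x => (HInf.PH_apply (hf.at hI ht) x).symm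

theorem SDec.at_projA {I : Set ℝ} (hI : IsOpen I) {f : ℝ → ℝ → ℂ} (hf : SDec I f)
    {t : ℝ} (ht : t ∈ I) : (hf.projA hI).at hI ht = HInf.PA (hf.at hI ht) :=
  HInf.ext fun x => (HInf.PA_apply (hf.at hI ht) x).symm

theorem SDec.hol_dt {I : Set ℝ} (hI : IsOpen I) {f : ℝ → ℝ → ℂ} (hf : SDec I f)
    (h : ∀ t (ht : t ∈ I), HInf.Hol (hf.at hI ht)) {t : ℝ} (ht : t ∈ I) :
    HInf.Hol ((hf.dt hI).at hI ht) := by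
  ext x
  have e : EqI I (fun t x => WaterWave.hilbert (f t) x) f := fun t ht x =>
    congrArg (fun k : HInf => k x) (h t ht)
  have h1 := e.dt hI t ht x
  rw [hf.dt_hilbert hI ht x] at h1
  exact h1

theorem SDec.at_dt_projH {I : Set ℝ} (hI : IsOpen I) {f : ℝ → ℝ → ℂ} (hf : SDec I f)
    {t : ℝ} (ht : t ∈ I) : ((hf.projH hI).dt hI).at hI ht = HInf.PH ((hf.dt hI).at hI ht) := by
  ext x
  rw [HInf.PH_apply]
  exact (((hf.hasDerivAt_t ht x).add (hf.hasDerivAt_hilbert hI ht x)).div_const 2).deriv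

/-- A solution of the water wave system on some open set of times. -/
structure Sol where
  S : Wave
  I : Set ℝ
  isOpen : IsOpen I
  sol : S.IsSolution I

namespace Wave

variable (S : Wave)

/-- `Z_α - 1`. -/
def ζ (t x : ℝ) : ℂ := dx S.Z t x - 1

/-- The velocity `b` as a complex-valued function. -/
def bC (t x : ℝ) : ℂ := S.b t x

/-- `A₁ - 1` as a complex-valued function. -/
def AC (t x : ℝ) : ℂ := S.A₁ t x - 1

/-- `Z_t / Z_α`. -/
def X (t x : ℝ) : ℂ := S.V t x * (1 + S.W t x)

/-- `conj Z_t`. -/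
def Vb (t x : ℝ) : ℂ := star (S.V t x)

/-- `∂ Θ^{(n)} / Z_α`. -/
def phi : ℕ → ℝ → ℝ → ℂ
  | 0 => S.Vb
  | n + 1 => fun t x => S.D (phi n) t x + (1 + S.W t x) * (dx S.V t x * phi n t x) -
      (1 + S.W t x) * dx (projA fun t x => S.V t x * phi n t x) t x

end Wave

/-! ### Regularity of the quantities attached to a solution -/

namespace Sol

variable (s : Sol) {t : ℝ} {f g : ℝ → ℝ → ℂ}

theorem sdec_V : SDec s.I s.S.V := s.sol.smooth_V.sdec s.isOpen

theorem sdec_Vb : SDec s.I s.S.Vb := s.sdec_V.star s.isOpen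

theorem sdec_Z : SDec s.I (fun t x => s.S.Z t x - x) := s.sol.smooth_Z.sdec s.isOpen

theorem sdec_ψ : SDec s.I (fun t x => (s.S.ψ t x : ℂ)) := s.sol.smooth_ψ.sdec s.isOpen

theorem hasDerivAt_Z_x (ht : t ∈ s.I) (x : ℝ) :
    HasDerivAt (s.S.Z t) (dx (fun t x => s.S.Z t x - x) t x + 1) x := by
  have h := (s.sdec_Z.hasDerivAt_x ht x).add (Complex.ofRealCLM.hasDerivAt (x := x))
  refine (h.congr_of_eventuallyEq (Eventually.of_forall fun y => ?_)).congr_deriv ?_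
  · simp
  · simp

theorem hasDerivAt_Z_t (ht : t ∈ s.I) (x : ℝ) :
    HasDerivAt (fun s' => s.S.Z s' x) (dt (fun t x => s.S.Z t x - x) t x) t := by
  have h := (s.sdec_Z.hasDerivAt_t ht x).add_const (x : ℂ)
  exact h.congr_of_eventuallyEq (Eventually.of_forall fun y => by simp)

theorem sdec_ζ : SDec s.I s.S.ζ :=
  (s.sdec_Z.dx s.isOpen).congr s.isOpen fun t ht x => by
    rw [Wave.ζ, show dx s.S.Z t x = _ from (s.hasDerivAt_Z_x ht x).deriv, add_sub_cancel_right]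

theorem dx_Z (t x : ℝ) : dx s.S.Z t x = 1 + s.S.ζ t x := by rw [Wave.ζ]; ring

theorem one_add_ζ_ne (ht : t ∈ s.I) (x : ℝ) : 1 + s.S.ζ t x ≠ 0 := by
  rw [← dx_Z]; exact s.sol.regular t ht x

theorem one_add_W (t x : ℝ) : 1 + s.S.W t x = (1 + s.S.ζ t x)⁻¹ := by
  rw [Wave.W, dx_Z]; ring

theorem one_add_W_mul (ht : t ∈ s.I) (x : ℝ) : (1 + s.S.W t x) * (1 + s.S.ζ t x) = 1 := by
  rw [one_add_W, inv_mul_cancel₀ (s.one_add_ζ_ne ht x)]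

theorem sdec_W : SDec s.I s.S.W :=
  (s.sdec_ζ.mul_inv_pow s.isOpen (fun t ht => s.one_add_ζ_ne ht) s.sdec_ζ 1 |>.smul s.isOpen
    (-1)).congr s.isOpen fun t ht x => by
      rw [pow_one, ← one_add_W]
      linear_combination -s.one_add_W_mul ht x

theorem mul_one_add_W (hf : SDec s.I f) : SDec s.I (fun t x => f t x * (1 + s.S.W t x)) :=
  (hf.add s.isOpen (hf.mul s.isOpen s.sdec_W)).congr s.isOpen fun t _ x => by ring

theorem sdec_X : SDec s.I s.S.X := s.mul_one_add_W s.sdec_V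

theorem bC_eq : EqI s.I s.S.bC (fun t x => (1 / 2 : ℂ) * ((s.S.X t x - hilbert (s.S.X t) x) +
    star (s.S.X t x - hilbert (s.S.X t) x))) := by
  intro t ht x
  have e : (fun y => s.S.V t y / dx s.S.Z t y) = s.S.X t := by
    ext y; rw [Wave.X, one_add_W, dx_Z, div_eq_mul_inv]
  rw [Wave.bC, Wave.b, e, show s.S.V t x / dx s.S.Z t x = _ from congrFun e x,
    Complex.re_eq_add_conj]
  simp only [starRingEnd_apply]; ring

theorem sdec_b : SDec s.I s.S.bC :=
  have h := s.sdec_X.sub s.isOpen (s.sdec_X.hilbert s.isOpen)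
  ((h.add s.isOpen (h.star s.isOpen)).smul s.isOpen (1 / 2)).congr s.isOpen s.bC_eq.symm

theorem star_bC (t x : ℝ) : star (s.S.bC t x) = s.S.bC t x := Complex.conj_ofReal _

theorem hasDerivAt_b (ht : t ∈ s.I) (x : ℝ) : HasDerivAt (s.S.b t) (dx s.S.bC t x).re x :=
  Complex.reCLM.hasFDerivAt.comp_hasDerivAt x (s.sdec_b.hasDerivAt_x ht x)

theorem dx_bC (ht : t ∈ s.I) (x : ℝ) : dx s.S.bC t x = (deriv (s.S.b t) x : ℝ) :=
  (HasDerivAt.ofReal_comp (s.hasDerivAt_b ht x).differentiableAt.hasDerivAt).deriv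

theorem AC_eq : EqI s.I s.S.AC (fun t x => (Complex.I / 2) *
    ((s.S.V t x * hilbert (dx s.S.Vb t) x - hilbert (fun y => s.S.V t y * dx s.S.Vb t y) x) -
      star (s.S.V t x * hilbert (dx s.S.Vb t) x -
        hilbert (fun y => s.S.V t y * dx s.S.Vb t y) x))) := by
  intro t ht x
  rw [Wave.AC, Wave.A₁]
  push_cast
  rw [show (star s.S.V : ℝ → ℝ → ℂ) = s.S.Vb from rfl, Complex.im_eq_sub_conj]
  simp only [starRingEnd_apply]
  field_simp
  rw [Complex.I_sq]; ring

theorem sdec_A : SDec s.I s.S.AC :=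
  have hI := s.isOpen
  have h1 := s.sdec_Vb.dx hI
  have h := (s.sdec_V.mul hI (h1.hilbert hI)).sub hI ((s.sdec_V.mul hI h1).hilbert hI)
  ((h.sub hI (h.star hI)).smul hI (Complex.I / 2)).congr hI s.AC_eq.symm

/-! ### The material derivative -/

theorem D_eq (f : ℝ → ℝ → ℂ) (t x : ℝ) : s.S.D f t x = dt f t x + s.S.bC t x * dx f t x := rfl

theorem sdec_D (hf : SDec s.I f) : SDec s.I (s.S.D f) :=
  (hf.dt s.isOpen).add s.isOpen (s.sdec_b.mul s.isOpen (hf.dx s.isOpen))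

theorem D_congr (h : EqI s.I f g) : EqI s.I (s.S.D f) (s.S.D g) := fun t ht x => by
  rw [D_eq, D_eq, h.dt s.isOpen t ht x, h.dx t ht x]

theorem at_D (hf : SDec s.I f) (ht : t ∈ s.I) : (s.sdec_D hf).at s.isOpen ht =
    (hf.dt s.isOpen).at s.isOpen ht + s.sdec_b.at s.isOpen ht * HInf.d (hf.at s.isOpen ht) := rfl

theorem D_add (hf : SDec s.I f) (hg : SDec s.I g) : EqI s.I (s.S.D fun t x => f t x + g t x)
    (fun t x => s.S.D f t x + s.S.D g t x) := fun t ht x => by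
  have h1 : dt (fun t x => f t x + g t x) t x = _ :=
    ((hf.hasDerivAt_t ht x).add (hg.hasDerivAt_t ht x)).deriv
  have h2 : dx (fun t x => f t x + g t x) t x = _ :=
    ((hf.hasDerivAt_x ht x).add (hg.hasDerivAt_x ht x)).deriv
  simp only [D_eq, h1, h2]; ring

theorem D_smul (c : ℂ) (hf : SDec s.I f) : EqI s.I (s.S.D fun t x => c * f t x)
    (fun t x => c * s.S.D f t x) := fun t ht x => by
  have h1 : dt (fun t x => c * f t x) t x = _ := ((hf.hasDerivAt_t ht x).const_mul c).deriv
  have h2 : dx (fun t x => c * f t x) t x = _ := ((hf.hasDerivAt_x ht x).const_mul c).deriv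
  simp only [D_eq, h1, h2]; ring

theorem D_mul (hf : SDec s.I f) (hg : SDec s.I g) : EqI s.I (s.S.D fun t x => f t x * g t x)
    (fun t x => s.S.D f t x * g t x + f t x * s.S.D g t x) := fun t ht x => by
  have h1 : dt (fun t x => f t x * g t x) t x = _ :=
    ((hf.hasDerivAt_t ht x).mul (hg.hasDerivAt_t ht x)).deriv
  have h2 : dx (fun t x => f t x * g t x) t x = _ :=
    ((hf.hasDerivAt_x ht x).mul (hg.hasDerivAt_x ht x)).deriv
  simp only [D_eq, h1, h2]; ring

theorem D_star (f : ℝ → ℝ → ℂ) (t x : ℝ) :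
    s.S.D (fun t x => star (f t x)) t x = star (s.S.D f t x) := by
  have h1 : dt (fun t x => star (f t x)) t x = star (dt f t x) := deriv.star
  have h2 : dx (fun t x => star (f t x)) t x = star (dx f t x) := deriv.star
  simp only [D_eq, h1, h2, star_add, star_mul', star_bC]

theorem D_dx (hf : SDec s.I f) : EqI s.I (s.S.D (dx f))
    (fun t x => dx (s.S.D f) t x - dx s.S.bC t x * dx f t x) := fun t ht x => by
  have hI := s.isOpen
  have h2 : dx (s.S.D f) t x = _ := (((hf.dt hI).hasDerivAt_x ht x).add
    ((s.sdec_b.hasDerivAt_x ht x).mul ((hf.dx hI).hasDerivAt_x ht x))).deriv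
  simp only [D_eq, h2, hf.dt_dx hI t ht x]; ring

theorem D_hilbert (hf : SDec s.I f) : EqI s.I (s.S.D fun t x => hilbert (f t) x)
    (fun t x => hilbert (s.S.D f t) x - hilbert (fun y => s.S.bC t y * dx f t y) x +
      s.S.bC t x * hilbert (dx f t) x) := fun t ht x => by
  have hI := s.isOpen
  have h1 : hilbert (s.S.D f t) x = _ := ((hf.dt hI).hinf hI ht).hilbert_add
    ((s.sdec_b.mul hI (hf.dx hI)).hinf hI ht) x
  have h2 : dx (fun t x => hilbert (f t) x) t x = _ := (hf.hinf hI ht).deriv_hilbert x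
  rw [D_eq]
  beta_reduce
  rw [h1, h2, hf.dt_hilbert hI ht, show deriv (f t) = dx f t from rfl]
  ring

/-! ### Consequences of the equations -/

theorem D_V : EqI s.I (s.S.D s.S.Vb)
    (fun t x => -Complex.I * (s.S.W t x + s.S.AC t x * (1 + s.S.W t x))) := fun t ht x => by
  have h := s.sol.momentum t ht x
  rw [dx_Z, div_eq_mul_inv, ← one_add_W] at h
  have h1 : s.S.D s.S.Vb t x = star (s.S.D s.S.V t x) := s.D_star _ t x
  rw [h1]
  simp only [Wave.AC]
  linear_combination h

theorem dt_Z (ht : t ∈ s.I) (x : ℝ) : dt (fun t x => s.S.Z t x - x) t x =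
    s.S.V t x - s.S.bC t x * (1 + s.S.ζ t x) := by
  have h := s.sol.velocity t ht x
  rw [D_eq, dx_Z, show dt s.S.Z t x = _ from (s.hasDerivAt_Z_t ht x).deriv] at h
  linear_combination h

/-- This is Z_t = D_t Z differentiated in α. -/
theorem D_ζ : EqI s.I (s.S.D s.S.ζ)
    (fun t x => dx s.S.V t x - dx s.S.bC t x * (1 + s.S.ζ t x)) := fun t ht x => by
  have hI := s.isOpen
  have e : EqI s.I (dt fun t x => s.S.Z t x - x) (fun t x =>
    s.S.V t x - s.S.bC t x * (1 + s.S.ζ t x)) := fun t ht x => s.dt_Z ht x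
  have e' : EqI s.I s.S.ζ (dx fun t x => s.S.Z t x - x) := fun t ht x => by
    rw [Wave.ζ, show dx s.S.Z t x = _ from (s.hasDerivAt_Z_x ht x).deriv, add_sub_cancel_right]
  have h1 := (e'.dt hI).trans ((s.sdec_Z.dt_dx hI).trans e.dx) t ht x
  have h2 : dx (fun t x => s.S.V t x - s.S.bC t x * (1 + s.S.ζ t x)) t x = _ :=
    ((s.sdec_V.hasDerivAt_x ht x).sub ((s.sdec_b.hasDerivAt_x ht x).mul
      ((s.sdec_ζ.hasDerivAt_x ht x).const_add 1))).deriv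
  rw [D_eq, h1, h2]; ring

/-- Apply D_t to (1/Z_α) Z_α = 1. Together with the momentum equation it allows all material
derivatives to be eliminated. -/
theorem D_W : EqI s.I (s.S.D s.S.W) (fun t x => (dx s.S.bC t x -
    dx s.S.V t x * (1 + s.S.W t x)) * (1 + s.S.W t x)) := fun t ht x => by
  have e : EqI s.I (fun t x => s.S.W t x + s.S.ζ t x + s.S.W t x * s.S.ζ t x) (fun t x => 0) :=
    fun t ht x => by linear_combination s.one_add_W_mul ht x
  have h1 := s.D_congr e t ht x
  rw [s.D_add (s.sdec_W.add s.isOpen s.sdec_ζ) (s.sdec_W.mul s.isOpen s.sdec_ζ) t ht x] at h1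
  beta_reduce at h1
  rw [s.D_add s.sdec_W s.sdec_ζ t ht x, s.D_mul s.sdec_W s.sdec_ζ t ht x] at h1
  beta_reduce at h1
  rw [s.D_ζ t ht x] at h1
  have h0 : s.S.D (fun t x => 0) t x = 0 := by simp [D_eq, dt, dx]
  rw [h0] at h1
  have h2 := s.one_add_W_mul ht x
  linear_combination (1 + s.S.W t x) * h1 - (s.S.D s.S.W t x - (1 + s.S.W t x) * dx s.S.bC t x) * h2

/-! ### Holomorphic quantities -/

theorem hol_Vb (ht : t ∈ s.I) : HInf.Hol (s.sdec_Vb.at s.isOpen ht) :=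
  HInf.ext fun x => (s.sol.hol_V t ht x).symm

theorem anti_V (ht : t ∈ s.I) : HInf.Anti (s.sdec_V.at s.isOpen ht) := by
  have := (s.hol_Vb ht).conj
  rwa [show HInf.conj (s.sdec_Vb.at s.isOpen ht) = s.sdec_V.at s.isOpen ht from
    HInf.ext fun x => star_star _] at this

theorem hol_W (ht : t ∈ s.I) : HInf.Hol (s.sdec_W.at s.isOpen ht) :=
  HInf.ext fun x => (s.sol.hol_W t ht x).symm

theorem hol_Z (ht : t ∈ s.I) : HInf.Hol (s.sdec_Z.at s.isOpen ht) :=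
  HInf.ext fun x => (s.sol.hol_Z t ht x).symm

theorem hol_Zt (ht : t ∈ s.I) : HInf.Hol ((s.sdec_Z.dt s.isOpen).at s.isOpen ht) :=
  s.sdec_Z.hol_dt s.isOpen (fun _ ht => s.hol_Z ht) ht

theorem hol_ζ (ht : t ∈ s.I) : HInf.Hol (s.sdec_ζ.at s.isOpen ht) := by
  have h := (s.hol_Z ht).d
  rwa [show HInf.d (s.sdec_Z.at s.isOpen ht) = s.sdec_ζ.at s.isOpen ht from HInf.ext fun x => ?_] at h
  change dx (fun t x => s.S.Z t x - x) t x = s.S.ζ t x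
  rw [Wave.ζ, show dx s.S.Z t x = _ from (s.hasDerivAt_Z_x ht x).deriv, add_sub_cancel_right]

/-- Re (I − ℍ)X is ℙ_A X plus its conjugate, and conjugation exchanges ℙ_A and ℙ_H. -/
theorem at_b (ht : t ∈ s.I) : s.sdec_b.at s.isOpen ht =
    HInf.PA (s.sdec_X.at s.isOpen ht) + HInf.PH (HInf.conj (s.sdec_X.at s.isOpen ht)) := by
  rw [← HInf.conj_PA]
  ext x
  rw [HInf.add_apply, HInf.conj_apply, HInf.PA_apply]
  refine (s.bC_eq t ht x).trans ?_
  simp only [SDec.at_apply, star_div₀, star_ofNat]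
  rw [show hilbert ↑(s.sdec_X.at s.isOpen ht) = hilbert (s.S.X t) from rfl]
  ring

end Sol

namespace Sol

open HInf

variable (s : Sol) {t : ℝ} {f g : ℝ → ℝ → ℂ}

/-! ### The functions `Θ^{(n)}` -/

theorem sdec_Q : SDec s.I s.S.Q := s.sdec_ψ.add s.isOpen (s.sdec_ψ.hilbert s.isOpen)

theorem hol_Q (ht : t ∈ s.I) : Hol (s.sdec_Q.at s.isOpen ht) := by
  have e : s.sdec_Q.at s.isOpen ht = s.sdec_ψ.at s.isOpen ht + H (s.sdec_ψ.at s.isOpen ht) := rfl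
  rw [Hol, e, map_add, H_H, add_comm]

/-- The relation b Z_α = Z_t − ∂_t Z. As ∂_t Z is holomorphic, it lets b Z_α be replaced by Z_t
under ℙ_A after multiplication by a holomorphic function. -/
theorem b_mul_at (ht : t ∈ s.I) : s.sdec_b.at s.isOpen ht +
    s.sdec_b.at s.isOpen ht * s.sdec_ζ.at s.isOpen ht =
      s.sdec_V.at s.isOpen ht - (s.sdec_Z.dt s.isOpen).at s.isOpen ht := by
  ext x
  simp only [HInf.add_apply, HInf.mul_apply, SDec.at_apply, HInf.sub_apply, s.dt_Z ht x]
  ring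

/-- Y = Z̄_t Z_α is holomorphic and ψ_α = Re Y; the operator I + ℍ doubles Y/2 and annihilates Ȳ/2.
-/
theorem dx_Q : EqI s.I (dx s.S.Q) (fun t x => s.S.Vb t x * (1 + s.S.ζ t x)) := fun t ht x => by
  have hI := s.isOpen
  set Y := s.sdec_Vb.at hI ht + s.sdec_Vb.at hI ht * s.sdec_ζ.at hI ht with hY
  have hol : Hol Y := (s.hol_Vb ht).add ((s.hol_Vb ht).mul (s.hol_ζ ht))
  have e : d (s.sdec_ψ.at hI ht) = (1 / 2 : ℂ) • (Y + conj Y) := by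
    ext x
    have hd : Differentiable ℝ (s.S.ψ t) := fun x => by
      have h := Complex.reCLM.hasFDerivAt.comp_hasDerivAt x (s.sdec_ψ.hasDerivAt_x ht x)
      exact h.differentiableAt
    have h1 : dx (fun t x => (s.S.ψ t x : ℂ)) t x = _ := ((hd x).hasDerivAt.ofReal_comp).deriv
    have h2 := s.sol.potential t ht x
    rw [dx_Z] at h2
    change dx (fun t x => (s.S.ψ t x : ℂ)) t x = _
    rw [h1, h2, Complex.re_eq_add_conj]
    simp only [HInf.smul_apply, HInf.add_apply, conj_apply, hY, HInf.mul_apply, SDec.at_apply, starRingEnd_apply,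
      Wave.Vb, star_mul', star_add, star_one]
    ring
  have e1 : d (s.sdec_Q.at hI ht) = Y := by
    rw [show s.sdec_Q.at s.isOpen ht = s.sdec_ψ.at hI ht + H (s.sdec_ψ.at hI ht) from rfl,
      map_add, d_H, e, map_smul, map_add, hol, hol.conj]
    ext x
    simp only [HInf.smul_apply, HInf.add_apply, HInf.neg_apply]; ring
  have e2 := congrArg (fun k : HInf => k x) e1
  refine e2.trans ?_
  simp only [hY, HInf.add_apply, HInf.mul_apply, SDec.at_apply]; ring

theorem Θ_succ (n : ℕ) : s.S.Θ (n + 1) = projH (s.S.D (s.S.Θ n)) :=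
  Function.iterate_succ_apply' _ _ _

theorem sdec_Θ (n : ℕ) : SDec s.I (s.S.Θ n) := by
  induction n with
  | zero => exact s.sdec_Q
  | succ n ih => rw [Θ_succ]; exact (s.sdec_D ih).projH s.isOpen

theorem hol_Θ (n : ℕ) (ht : t ∈ s.I) : Hol ((s.sdec_Θ n).at s.isOpen ht) := by
  cases n with
  | zero => exact s.hol_Q ht
  | succ n =>
    have h := hol_PH ((s.sdec_D (s.sdec_Θ n)).at s.isOpen ht)
    rw [← SDec.at_projH] at h
    convert! h using 2
    exact s.Θ_succ n

theorem sdec_phi (n : ℕ) : SDec s.I (s.S.phi n) := by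
  have hI := s.isOpen
  induction n with
  | zero => exact s.sdec_Vb
  | succ n ih =>
    have h1 := s.mul_one_add_W ((s.sdec_V.dx hI).mul hI ih)
    have h2 := s.mul_one_add_W (((s.sdec_V.mul hI ih).projA hI).dx hI)
    exact (((s.sdec_D ih).add hI h1).sub hI h2).congr hI fun t _ x => by
      simp only [Wave.phi]; ring

/-- `ℙ_A (b ∂Θ) = ℙ_A (Z_t φ)` for `∂Θ = φ Z_α` with `φ` holomorphic. -/
theorem PA_b_mul (ht : t ∈ s.I) {θ φ : HInf} (hθ : θ = φ + φ * s.sdec_ζ.at s.isOpen ht)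
    (hφ : Hol φ) : PA (s.sdec_b.at s.isOpen ht * θ) = PA (s.sdec_V.at s.isOpen ht * φ) := by
  have e : s.sdec_b.at s.isOpen ht * θ =
      s.sdec_V.at s.isOpen ht * φ - (s.sdec_Z.dt s.isOpen).at s.isOpen ht * φ := by
    rw [← sub_mul, ← s.b_mul_at ht, hθ]
    ext x; simp only [HInf.mul_apply, HInf.add_apply]; ring
  rw [e, map_sub, ((s.hol_Zt ht).mul hφ).PA_eq, sub_zero]

theorem hol_phi_of_dx (n : ℕ) (h : EqI s.I (dx (s.S.Θ n)) (fun t x => s.S.phi n t x * (1 + s.S.ζ t x)))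
    (ht : t ∈ s.I) : Hol ((s.sdec_phi n).at s.isOpen ht) := by
  have e : (s.sdec_phi n).at s.isOpen ht = d ((s.sdec_Θ n).at s.isOpen ht) +
      d ((s.sdec_Θ n).at s.isOpen ht) * s.sdec_W.at s.isOpen ht := by
    ext x
    have h1 := h t ht x
    rw [dx] at h1
    simp only [HInf.add_apply, HInf.mul_apply, d_apply, SDec.at_apply]
    rw [show deriv (((s.sdec_Θ n).at s.isOpen ht : HInf) : ℝ → ℂ) x = _ from h1]
    linear_combination -s.S.phi n t x * s.one_add_W_mul ht x
  rw [e]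
  exact (s.hol_Θ n ht).d.add ((s.hol_Θ n ht).d.mul (s.hol_W ht))

/-- Θ^{(n)} stays holomorphic in time, so ℙ_A D_tΘ^{(n)} = ℙ_A(b ∂Θ^{(n)}), which `PA_b_mul` turns
into ℙ_A(Z_t φ_n). The hypothesis is the induction hypothesis of `dx_Θ`. -/
theorem Θ_succ_eq (n : ℕ)
    (h : EqI s.I (dx (s.S.Θ n)) (fun t x => s.S.phi n t x * (1 + s.S.ζ t x))) :
    EqI s.I (s.S.Θ (n + 1)) (fun t x => s.S.D (s.S.Θ n) t x -
      projA (fun t x => s.S.V t x * s.S.phi n t x) t x) := fun t ht x => by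
  have hI := s.isOpen
  have hφ := s.hol_phi_of_dx n h ht
  have h1 : PA ((s.sdec_D (s.sdec_Θ n)).at hI ht) =
      PA (s.sdec_V.at hI ht * (s.sdec_phi n).at hI ht) := by
    rw [s.at_D (s.sdec_Θ n) ht, map_add, (SDec.hol_dt hI (s.sdec_Θ n) (fun _ ht => s.hol_Θ n ht) ht).PA_eq, zero_add]
    refine s.PA_b_mul ht (HInf.ext fun x => (h t ht x).trans ?_) hφ
    simp only [HInf.add_apply, HInf.mul_apply, SDec.at_apply]; ring
  have h2 := congrArg (fun k : HInf => k x) (PA_add_PH ((s.sdec_D (s.sdec_Θ n)).at hI ht))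
  rw [h1] at h2
  simp only [HInf.add_apply, PA_apply, PH_apply] at h2
  rw [Θ_succ]
  simp only [projH, projA]
  exact eq_sub_of_add_eq' h2

/-- The recursion defining `phi` is designed for this: differentiate Θ^{(n+1)} = D_tΘ^{(n)} −
ℙ_A(Z_t φ_n), commute ∂_α with D_t, insert the equation for D_t Z_α, and divide by Z_α. The terms in
b_α cancel. -/
theorem dx_Θ (n : ℕ) : EqI s.I (dx (s.S.Θ n)) (fun t x => s.S.phi n t x * (1 + s.S.ζ t x)) := by
  have hI := s.isOpen
  induction n with
  | zero => exact s.dx_Q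
  | succ n ih =>
    intro t ht x
    rw [(s.Θ_succ_eq n ih).dx t ht x]
    have h1 : dx (fun t x => s.S.D (s.S.Θ n) t x -
      projA (fun t x => s.S.V t x * s.S.phi n t x) t x) t x = _ :=
      (((s.sdec_D (s.sdec_Θ n)).hasDerivAt_x ht x).sub
        (((s.sdec_V.mul hI (s.sdec_phi n)).projA hI).hasDerivAt_x ht x)).deriv
    have h2 := s.D_dx (s.sdec_Θ n) t ht x
    have e : EqI s.I (dx (s.S.Θ n)) (fun t x => s.S.phi n t x + s.S.phi n t x * s.S.ζ t x) :=
      ih.trans fun t _ x => by ring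
    have h3 := s.D_congr e t ht x
    rw [s.D_add (s.sdec_phi n) ((s.sdec_phi n).mul hI s.sdec_ζ) t ht x] at h3
    beta_reduce at h3
    rw [s.D_mul (s.sdec_phi n) s.sdec_ζ t ht x] at h3
    beta_reduce at h3 h2
    rw [s.D_ζ t ht x] at h3
    have h4 := ih t ht x
    beta_reduce at h4 h3
    rw [h1]
    simp only [Wave.phi]
    have h5 := s.one_add_W_mul ht x
    rw [h3, h4] at h2
    linear_combination -h2 + (dx (projA fun t x => s.S.V t x * s.S.phi n t x) t x -
      dx s.S.V t x * s.S.phi n t x) * h5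

theorem hol_phi (n : ℕ) (ht : t ∈ s.I) : Hol ((s.sdec_phi n).at s.isOpen ht) :=
  s.hol_phi_of_dx n (s.dx_Θ n) ht

/-- By the definition of A₁, the nonlinear terms of the recursion combine: Z_{tα} Z̄_t − ∂ℙ_A(Z_t
Z̄_t) = i(A₁ − 1). Multiplied by 1/Z_α they cancel the A₁ − 1 part of the momentum equation. -/
theorem phi_one : EqI s.I (s.S.phi 1) (fun t x => -Complex.I * s.S.W t x) := fun t ht x => by
  have hI := s.isOpen
  set V := s.sdec_V.at hI ht with hV
  set Vb := s.sdec_Vb.at hI ht with hVb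
  have hc : conj V = Vb := rfl
  have hc' : conj Vb = V := by rw [← hc, conj_conj]
  have e1 : s.sdec_A.at hI ht = (Complex.I / 2) •
      ((V * H (d Vb) - H (V * d Vb)) - conj (V * H (d Vb) - H (V * d Vb))) :=
    HInf.ext fun x => s.AC_eq t ht x
  rw [show H (d Vb) = d Vb from (s.hol_Vb ht).d, conj_sub, conj_mul, ← neg_neg (conj (H _)), ← H_conj,
    conj_mul, hc, ← d_conj, hc'] at e1
  have e2 : d V * Vb - d (PA (V * Vb)) = Complex.I • s.sdec_A.at hI ht := by
    rw [e1, PA]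
    simp only [LinearMap.smul_apply, LinearMap.sub_apply, LinearMap.id_apply, map_smul, map_sub,
      d_H, d_mul, map_add]
    ext x
    simp only [HInf.sub_apply, HInf.smul_apply, HInf.mul_apply, HInf.add_apply, HInf.neg_apply, mul_comm (Vb) (d V)]
    linear_combination (-1 / 2 : ℂ) * ((V x * (d Vb) x - H (V * d Vb) x -
      ((d V) x * Vb x + H (d V * Vb) x))) * Complex.I_sq
  have e3 := congrArg (fun k : HInf => k x) e2
  have e4 : dx s.S.V t x * s.S.Vb t x - dx (projA fun t x => s.S.V t x * s.S.Vb t x) t x =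
      Complex.I * s.S.AC t x := by
    refine Eq.trans ?_ e3
    rw [show V * Vb = (s.sdec_V.mul hI s.sdec_Vb).at hI ht from rfl, ← SDec.at_projA]
    rfl
  simp only [Wave.phi]
  rw [s.D_V t ht x]
  linear_combination (1 + s.S.W t x) * e4

/-- Both sides have the derivative i(Z_α − 1), and a decaying function with zero derivative
vanishes. -/
theorem Θ_one : EqI s.I (s.S.Θ 1) (fun t x => Complex.I * (s.S.Z t x - x)) := fun t ht x => by
  have hI := s.isOpen
  refine sub_eq_zero.1 (((s.sdec_Θ 1).sub hI (s.sdec_Z.smul hI Complex.I)).hinf hI ht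
    |>.eq_zero_of_deriv (fun y => ?_) x)
  have h := ((s.sdec_Θ 1).hasDerivAt_x ht y).sub ((s.sdec_Z.smul hI Complex.I).hasDerivAt_x ht y)
  have h1 : dx (fun t x => Complex.I * (s.S.Z t x - x)) t y = Complex.I * s.S.ζ t y := by
    have h2 := ((s.sdec_Z.hasDerivAt_x ht y).const_mul Complex.I).deriv
    refine h2.trans ?_
    rw [Wave.ζ, show dx s.S.Z t y = _ from (s.hasDerivAt_Z_x ht y).deriv, add_sub_cancel_right]
  refine h.deriv.trans ?_
  rw [h1, s.dx_Θ 1 t ht y]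
  beta_reduce
  rw [s.phi_one t ht y]
  linear_combination -Complex.I * s.one_add_W_mul ht y

/-! ### The functions `G^{(n)}` -/

theorem inv_normSq (t x : ℝ) : (1 / (‖dx s.S.Z t x‖ : ℂ) ^ 2) =
    (1 + s.S.W t x) * (1 + star (s.S.W t x)) := by
  have h : (1 : ℂ) + star (s.S.W t x) = star (1 + s.S.W t x) := by simp
  rw [h, one_add_W, ← dx_Z, ← Complex.mul_conj', starRingEnd_apply, star_inv₀, one_div, mul_inv]

theorem normSq_mul_dx_Θ (n : ℕ) (ht : t ∈ s.I) (x : ℝ) :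
    (1 / (‖dx s.S.Z t x‖ : ℂ) ^ 2) * dx (s.S.Θ n) t x =
      s.S.phi n t x + star (s.S.W t x) * s.S.phi n t x := by
  rw [s.inv_normSq, s.dx_Θ n t ht x]
  linear_combination (1 + star (s.S.W t x)) * s.S.phi n t x * s.one_add_W_mul ht x

/-- `Θ_α^{(n)} / |Z_α|²`. -/
def _root_.WaterWave.Wave.mΘ (S : Wave) (n : ℕ) (t x : ℝ) : ℂ :=
  S.phi n t x + star (S.W t x) * S.phi n t x

theorem sdec_mΘ (n : ℕ) : SDec s.I (s.S.mΘ n) :=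
  (s.sdec_phi n).add s.isOpen ((s.sdec_W.star s.isOpen).mul s.isOpen (s.sdec_phi n))

theorem G_eq (n : ℕ) : EqI s.I (s.S.G n) (fun t x => s.S.D (s.S.Θ (n + 1)) t x +
    Complex.I * s.S.mΘ n t x) := fun t ht x => by
  rw [Wave.G, mul_assoc, s.normSq_mul_dx_Θ n ht x, ← Θ_succ]
  rfl

theorem sdec_G (n : ℕ) : SDec s.I (s.S.G n) :=
  ((s.sdec_D (s.sdec_Θ (n + 1))).add s.isOpen ((s.sdec_mΘ n).smul s.isOpen _)).congr s.isOpen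
    (s.G_eq n).symm

theorem projH_add (hf : SDec s.I f) (hg : SDec s.I g) :
    EqI s.I (projH fun t x => f t x + g t x) (fun t x => projH f t x + projH g t x) :=
  fun t ht x => by
    simp only [projH]
    rw [(hf.hinf s.isOpen ht).hilbert_add (hg.hinf s.isOpen ht)]; ring

theorem projH_smul (c : ℂ) (hf : SDec s.I f) :
    EqI s.I (projH fun t x => c * f t x) (fun t x => c * projH f t x) := fun t ht x => by
  simp only [projH]
  rw [(hf.hinf s.isOpen ht).hilbert_smul c]; ring

theorem projH_G (n : ℕ) : EqI s.I (projH (s.S.G n)) (fun t x => s.S.Θ (n + 2) t x +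
    Complex.I * projH (s.S.mΘ n) t x) := by
  refine (s.G_eq n).projH.trans ((s.projH_add (s.sdec_D (s.sdec_Θ (n + 1)))
    ((s.sdec_mΘ n).smul s.isOpen _)).trans fun t ht x => ?_)
  beta_reduce
  rw [s.projH_smul _ (s.sdec_mΘ n) t ht x, s.Θ_succ (n + 1)]

/-- By `Θ_one`, G^{(0)} = i(Z_t − b + X̄) with X = Z_t/Z_α. Here Z_t is antiholomorphic, while b and
X̄ have the same holomorphic part. This is the start of the recursion for ℙ_H G^{(n)}. -/
theorem projH_G_zero : EqI s.I (projH (s.S.G 0)) (fun _ _ => 0) := by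
  intro t ht x
  have hI := s.isOpen
  have h1 : (s.sdec_G 0).at hI ht = Complex.I • (s.sdec_V.at hI ht - s.sdec_b.at hI ht +
      (s.sdec_Vb.at hI ht + conj (s.sdec_W.at hI ht) * s.sdec_Vb.at hI ht)) := by
    ext x
    have h2 := s.D_congr s.Θ_one t ht x
    rw [s.D_smul _ s.sdec_Z t ht x] at h2
    beta_reduce at h2
    have h3 : dx (fun t x => s.S.Z t x - x) t x = s.S.ζ t x := by
      rw [Wave.ζ, show dx s.S.Z t x = _ from (s.hasDerivAt_Z_x ht x).deriv, add_sub_cancel_right]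
    rw [s.D_eq (fun t x => s.S.Z t x - x), s.dt_Z ht x, h3] at h2
    simp only [SDec.at_apply, HInf.smul_apply, HInf.add_apply, HInf.sub_apply, HInf.mul_apply, conj_apply]
    rw [s.G_eq 0 t ht x]
    beta_reduce
    rw [h2]
    simp only [Wave.mΘ, Wave.phi]
    ring
  have h2 : conj (s.sdec_X.at hI ht) =
      s.sdec_Vb.at hI ht + conj (s.sdec_W.at hI ht) * s.sdec_Vb.at hI ht := by
    ext x
    simp only [conj_apply, SDec.at_apply, Wave.X, Wave.Vb, HInf.add_apply, HInf.mul_apply, star_mul', star_add,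
      star_one]
    ring
  have h3 : PH ((s.sdec_G 0).at hI ht) = 0 := by
    rw [h1, ← h2, map_smul, map_add, map_sub, (s.anti_V ht).PH_eq, s.at_b ht, map_add,
      (anti_PA _).PH_eq, (hol_PH _).PH_eq]
    simp
  have h4 := congrArg (fun k : HInf => k x) h3
  simp only [PH_apply] at h4
  exact h4

end Sol

/-! ### The sesquilinear form and the evolution of the energy -/

theorem star_I : star Complex.I = -Complex.I := Complex.conj_I

namespace HInf

variable {f g h : HInf}

/-- The sesquilinear form `∫ i f' conj g`. -/
def pr (f g : HInf) : ℂ := ∫ x, Complex.I * d f x * star (g x)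

theorem integrable_pr (f g : HInf) : Integrable fun x => Complex.I * d f x * star (g x) :=
  integrable_mul (Complex.I • d f) (conj g)

theorem pr_add_left (f g h : HInf) : pr (f + g) h = pr f h + pr g h := by
  rw [pr, pr, pr, ← integral_add (integrable_pr f h) (integrable_pr g h)]
  refine integral_congr_ae (Eventually.of_forall fun x => ?_)
  simp only [map_add, HInf.add_apply]; ring

theorem pr_add_right (f g h : HInf) : pr f (g + h) = pr f g + pr f h := by
  rw [pr, pr, pr, ← integral_add (integrable_pr f g) (integrable_pr f h)]
  refine integral_congr_ae (Eventually.of_forall fun x => ?_)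
  simp only [star_add, HInf.add_apply]; ring

theorem pr_sub_right (f g h : HInf) : pr f (g - h) = pr f g - pr f h := by
  rw [pr, pr, pr, ← integral_sub (integrable_pr f g) (integrable_pr f h)]
  refine integral_congr_ae (Eventually.of_forall fun x => ?_)
  simp only [star_sub, HInf.sub_apply]; ring

theorem star_integral (f : ℝ → ℂ) : star (∫ x, f x) = ∫ x, star (f x) := integral_conj.symm

theorem re_integral_star (f : ℝ → ℂ) : (∫ x, star (f x)).re = (∫ x, f x).re := by
  rw [← star_integral]; rfl

/-- Integration by parts changes the sign, and so does conjugating the factor i. -/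
theorem star_pr (f g : HInf) : star (pr f g) = pr g f := by
  have h := integral_d_mul g (conj f)
  rw [pr, star_integral, pr]
  have e1 : ∀ x, star (Complex.I * d f x * star (g x)) = -Complex.I * (g x * d (conj f) x) := by
    intro x
    simp only [star_mul', star_star, star_I, d_conj, conj_apply]; ring
  have e2 : ∀ x, Complex.I * d g x * star (f x) = Complex.I * (d g x * conj f x) := fun x => by
    rw [conj_apply]; ring
  simp only [e1, e2, integral_const_mul, h]; ring

/-- The conjugate of ℙ_A g is holomorphic, hence it integrates to zero against the holomorphic
function f_α. -/
theorem pr_PH (hf : Hol f) (g : HInf) : pr f (PH g) = pr f g := by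
  have h := integral_hol_mul_PA (f := Complex.I • d f) ((hf.d).smul _) (conj g)
  rw [← conj_PH] at h
  exact h

end HInf

namespace Sol

open HInf

variable (s : Sol) {t : ℝ} {f g : ℝ → ℝ → ℂ}

theorem sdec_HD (hf : SDec s.I f) : SDec s.I (s.S.HD f) := (s.sdec_D hf).projH s.isOpen

theorem hol_HD (hf : SDec s.I f) (ht : t ∈ s.I) : Hol ((s.sdec_HD hf).at s.isOpen ht) := by
  have h := hol_PH ((s.sdec_D hf).at s.isOpen ht)
  rwa [← SDec.at_projH] at h

theorem conj_b (ht : t ∈ s.I) : conj (s.sdec_b.at s.isOpen ht) = s.sdec_b.at s.isOpen ht :=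
  HInf.ext fun x => s.star_bC t x

theorem at_HD (hf : SDec s.I f) (hol : ∀ t (ht : t ∈ s.I), Hol (hf.at s.isOpen ht)) (ht : t ∈ s.I) :
    (s.sdec_HD hf).at s.isOpen ht = (hf.dt s.isOpen).at s.isOpen ht +
      PH (s.sdec_b.at s.isOpen ht * d (hf.at s.isOpen ht)) := by
  have h : (s.sdec_HD hf).at s.isOpen ht = PH ((s.sdec_D hf).at s.isOpen ht) :=
    (s.sdec_D hf).at_projH s.isOpen ht
  rw [h, s.at_D hf ht, map_add, (SDec.hol_dt s.isOpen hf hol ht).PH_eq]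

/-- For holomorphic f, ℙ_H D_t f = ∂_t f + ℙ_H(b f_α). After the projections are dropped by `pr_PH`,
the two corrections are ∫ i b f_α ḡ_α with opposite signs, because b is real. -/
theorem hasDerivAt_pr (hf : SDec s.I f) (hol : ∀ t (ht : t ∈ s.I), Hol (hf.at s.isOpen ht))
    (hg : SDec s.I g) (hol' : ∀ t (ht : t ∈ s.I), Hol (hg.at s.isOpen ht)) (ht : t ∈ s.I) :
    HasDerivAt (fun t => ∫ x, Complex.I * dx f t x * star (g t x))
      (pr ((s.sdec_HD hf).at s.isOpen ht) (hg.at s.isOpen ht) +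
        pr (hf.at s.isOpen ht) ((s.sdec_HD hg).at s.isOpen ht)) t := by
  have hI := s.isOpen
  have h := ((hf.dx hI).smul hI Complex.I).hasDerivAt_integral hI (hg.star hI) ht
  refine h.congr_deriv ?_
  rw [s.at_HD hf hol, s.at_HD hg hol', pr_add_left, pr_add_right]
  have e1 : ∫ x, (dt (fun t x => Complex.I * dx f t x) t x * star (g t x) +
      Complex.I * dx f t x * dt (fun t x => star (g t x)) t x) =
      pr ((hf.dt hI).at hI ht) (hg.at hI ht) + pr (hf.at hI ht) ((hg.dt hI).at hI ht) := by
    rw [pr, pr, ← integral_add (integrable_pr _ _) (integrable_pr _ _)]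
    refine integral_congr_ae (Eventually.of_forall fun x => ?_)
    have h1 : dt (fun t x => Complex.I * dx f t x) t x = Complex.I * dx (dt f) t x := by
      rw [← hf.dt_dx hI t ht x]
      exact (((hf.dx hI).hasDerivAt_t ht x).const_mul Complex.I).deriv
    have h2 : dt (fun t x => star (g t x)) t x = star (dt g t x) := deriv.star
    beta_reduce
    rw [h1, h2]
    rfl
  have e2 : pr (PH (s.sdec_b.at hI ht * d (hf.at hI ht))) (hg.at hI ht) = -
      pr (hf.at hI ht) (PH (s.sdec_b.at hI ht * d (hg.at hI ht))) := by
    rw [pr_PH (hol t ht), ← star_pr, pr_PH (hol' t ht), pr, pr, star_integral, ← integral_neg]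
    refine integral_congr_ae (Eventually.of_forall fun x => ?_)
    simp only [HInf.mul_apply, star_mul', star_star, SDec.at_apply, s.star_bC, star_I]
    ring
  rw [e1, e2]; ring

/-! ### The energy identity -/

theorem sdec_projH_G (n : ℕ) : SDec s.I (projH (s.S.G n)) := (s.sdec_G n).projH s.isOpen

theorem hol_projH (hf : SDec s.I f) (ht : t ∈ s.I) : Hol ((hf.projH s.isOpen).at s.isOpen ht) := by
  rw [hf.at_projH s.isOpen ht]; exact hol_PH _

theorem projH_sub (hf : SDec s.I f) (hg : SDec s.I g) :
    EqI s.I (projH (f - g)) (fun t x => projH f t x - projH g t x) := fun t ht x => by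
  simp only [projH]
  rw [show hilbert ((f - g) t) x = hilbert (f t) x - hilbert (g t) x from
    (hf.hinf s.isOpen ht).hilbert_sub (hg.hinf s.isOpen ht) x]
  simp only [Pi.sub_apply]; ring

theorem sdec_K (n : ℕ) : SDec s.I (s.S.K n) :=
  ((s.sdec_G (n + 1)).sub s.isOpen (s.sdec_D (s.sdec_projH_G n))).projH s.isOpen

theorem projH_G_succ (n : ℕ) : EqI s.I (projH (s.S.G (n + 1)))
    (fun t x => s.S.K n t x + s.S.HD (projH (s.S.G n)) t x) := fun t ht x => by
  have h := s.projH_sub (s.sdec_G (n + 1)) (s.sdec_D (s.sdec_projH_G n)) t ht x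
  simp only [Wave.K, h, Wave.HD]; ring

theorem HD_congr (h : EqI s.I f g) : EqI s.I (s.S.HD f) (s.S.HD g) := (s.D_congr h).projH

theorem HD_add (hf : SDec s.I f) (hg : SDec s.I g) : EqI s.I (s.S.HD fun t x => f t x + g t x)
    (fun t x => s.S.HD f t x + s.S.HD g t x) :=
  (s.D_add hf hg).projH.trans (s.projH_add (s.sdec_D hf) (s.sdec_D hg))

theorem HD_zero : EqI s.I (s.S.HD fun _ _ => 0) (fun _ _ => 0) := by
  have h0 : SDec s.I (fun _ _ => (0 : ℂ)) := (s.sdec_V.smul s.isOpen 0).congr s.isOpen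
    fun t _ x => by ring
  intro t ht x
  have h := s.HD_add h0 h0 t ht x
  simp only [add_zero] at h
  exact left_eq_add.1 h

theorem sdec_iterate_HD (hf : SDec s.I f) (n : ℕ) : SDec s.I (s.S.HD^[n] f) := by
  induction n with
  | zero => exact hf
  | succ n ih => rw [Function.iterate_succ_apply']; exact s.sdec_HD ih

theorem sdec_sum {ι : Type*} (A : Finset ι) {F : ι → ℝ → ℝ → ℂ} (h : ∀ i ∈ A, SDec s.I (F i)) :
    SDec s.I (fun t x => ∑ i ∈ A, F i t x) := by
  classical
  induction A using Finset.induction_on with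
  | empty => exact (s.sdec_V.smul s.isOpen 0).congr s.isOpen fun t _ x => by simp
  | insert a A ha ih =>
    simp only [Finset.sum_insert ha]
    exact (h a (Finset.mem_insert_self _ _)).add s.isOpen
      (ih fun i hi => h i (Finset.mem_insert_of_mem hi))

theorem HD_sum {ι : Type*} (A : Finset ι) {F : ι → ℝ → ℝ → ℂ} (h : ∀ i ∈ A, SDec s.I (F i)) :
    EqI s.I (s.S.HD fun t x => ∑ i ∈ A, F i t x) (fun t x => ∑ i ∈ A, s.S.HD (F i) t x) := by
  classical
  induction A using Finset.induction_on with
  | empty => simpa using s.HD_zero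
  | insert a A ha ih =>
    simp only [Finset.sum_insert ha]
    have hA : ∀ i ∈ A, SDec s.I (F i) := fun i hi => h i (Finset.mem_insert_of_mem hi)
    refine (s.HD_add (h a (Finset.mem_insert_self _ _)) (s.sdec_sum A hA)).trans fun t ht x => ?_
    beta_reduce
    rw [ih hA t ht x]

/-- Iterate ℙ_H G^{(n+1)} = K_n + ℙ_H D_t ℙ_H G^{(n)} down to ℙ_H G^{(0)} = 0. -/
theorem HD_projH_G (n : ℕ) : EqI s.I (s.S.HD (projH (s.S.G n)))
    (fun t x => ∑ l ∈ Finset.range n, (s.S.HD^[l + 1] (s.S.K (n - 1 - l))) t x) := by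
  induction n with
  | zero => simpa using (s.HD_congr s.projH_G_zero).trans s.HD_zero
  | succ n ih =>
    have hs : ∀ l ∈ Finset.range n, SDec s.I (s.S.HD^[l + 1] (s.S.K (n - 1 - l))) := fun l _ =>
      s.sdec_iterate_HD (s.sdec_K _) _
    have h1 := (s.HD_congr (s.projH_G_succ n)).trans (s.HD_add (s.sdec_K n)
      (s.sdec_HD (s.sdec_projH_G n)))
    have h2 := (s.HD_congr ih).trans (s.HD_sum _ hs)
    intro t ht x
    rw [h1 t ht x]
    beta_reduce
    rw [h2 t ht x, Finset.sum_range_succ', add_comm]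
    congr 1
    · refine Finset.sum_congr rfl fun l _ => ?_
      rw [Function.iterate_succ_apply' s.S.HD (l + 1), show n + 1 - 1 - (l + 1) = n - 1 - l by omega]

/-- In the pairing of Θ^{(n)} with iℙ_H(φ_m/Z̄_α) the projection may be dropped, and ∂Θ^{(n)} = φ_n
Z_α cancels the remaining factor 1/Z_α. The resulting ∫ φ_n φ̄_m is Hermitian in (n, m), which is
what makes the quadratic terms disappear. -/
theorem pr_Θ (n m : ℕ) (ht : t ∈ s.I) :
    pr ((s.sdec_Θ n).at s.isOpen ht) ((s.sdec_Θ (m + 2)).at s.isOpen ht) =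
      pr ((s.sdec_Θ n).at s.isOpen ht) ((s.sdec_projH_G m).at s.isOpen ht) -
        ∫ x, (s.sdec_phi n).at s.isOpen ht x * conj ((s.sdec_phi m).at s.isOpen ht) x := by
  have hI := s.isOpen
  have e : (s.sdec_Θ (m + 2)).at hI ht = (s.sdec_projH_G m).at hI ht -
      PH (Complex.I • (s.sdec_mΘ m).at hI ht) := by
    rw [map_smul, ← SDec.at_projH]
    ext x
    simp only [HInf.sub_apply, HInf.smul_apply, SDec.at_apply]
    rw [s.projH_G m t ht x]; ring
  rw [e, pr_sub_right, pr_PH (s.hol_Θ n ht)]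
  congr 1
  refine integral_congr_ae (Eventually.of_forall fun x => ?_)
  have h1 : d ((s.sdec_Θ n).at hI ht) x = _ := s.dx_Θ n t ht x
  beta_reduce
  rw [h1]
  simp only [HInf.smul_apply, SDec.at_apply, conj_apply, Wave.mΘ, star_add, star_mul', star_star,
    star_I]
  have h2 := s.one_add_W_mul ht x
  have h3 := Complex.I_sq
  linear_combination (-(s.S.phi n t x * star (s.S.phi m t x) * (1 + s.S.W t x) *
    (1 + s.S.ζ t x))) * h3 + (s.S.phi n t x * star (s.S.phi m t x)) * h2

/-- Up to real parts, dE_j/dt is pr(Θ^{(j+1)}, Θ^{(j+2)}) − pr(Θ^{(j)}, Θ^{(j+3)}), which `pr_Θ`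
turns into pr(Θ^{(j+1)}, ℙ_H G^{(j)}) − pr(Θ^{(j)}, ℙ_H G^{(j+1)}). Subtracting the derivative of
pr(Θ^{(j)}, ℙ_H G^{(j)}) removes the first term and doubles the contribution of ℙ_H D_t ℙ_H G^{(j)}
to the second. -/
theorem hasDerivAt_energy (j : ℕ) (ht : t ∈ s.I) :
    HasDerivAt (fun t => s.S.E j t -
        (∫ x, Complex.I * dx (s.S.Θ j) t x * star (projH (s.S.G j) t x)).re)
      (2 * (∑ l ∈ Finset.range j, ∫ x, Complex.I * dx (star (s.S.Θ j)) t x *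
          (s.S.HD^[l + 1] (s.S.K (j - 1 - l))) t x).re +
        (∫ x, Complex.I * dx (star (s.S.Θ j)) t x * s.S.K j t x).re) t := by
  have hI := s.isOpen
  have hH : ∀ n t (ht : t ∈ s.I), Hol ((s.sdec_Θ n).at hI ht) := fun n t ht => s.hol_Θ n ht
  have h1 := s.hasDerivAt_pr (s.sdec_Θ (j + 1)) (hH _) (s.sdec_Θ (j + 1)) (hH _) ht
  have h2 := s.hasDerivAt_pr (s.sdec_Θ j) (hH _) (s.sdec_Θ (j + 2)) (hH _) ht
  have h3 := s.hasDerivAt_pr (s.sdec_Θ j) (hH _) (s.sdec_projH_G j)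
    (fun t ht => s.hol_projH (s.sdec_G j) ht) ht
  have re : ∀ {F : ℝ → ℂ} {F' : ℂ}, HasDerivAt F F' t → HasDerivAt (fun t => (F t).re) F'.re t :=
    fun h => Complex.reCLM.hasFDerivAt.comp_hasDerivAt t h
  refine ((re (h1.sub h2)).sub (re h3)).congr_deriv ?_
  have eΘ : ∀ n, (s.sdec_HD (s.sdec_Θ n)).at hI ht = (s.sdec_Θ (n + 1)).at hI ht := fun n =>
    HInf.ext fun x => by simp only [SDec.at_apply, Θ_succ]; rfl
  have eG : (s.sdec_projH_G (j + 1)).at hI ht =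
      (s.sdec_K j).at hI ht + (s.sdec_HD (s.sdec_projH_G j)).at hI ht :=
    HInf.ext fun x => s.projH_G_succ j t ht x
  have hre : ∀ f g : HInf, (pr f g).re = (pr g f).re := fun f g => by
    rw [← star_pr f g]; rfl
  have hneg : ∀ {f : ℝ → ℝ → ℂ} (hf : SDec s.I f), (∫ x, Complex.I * dx (star (s.S.Θ j)) t x *
      f t x).re = -(pr ((s.sdec_Θ j).at hI ht) (hf.at hI ht)).re := by
    intro f hf
    rw [← Complex.neg_re, pr, ← integral_neg, ← re_integral_star]
    congr 2
    ext x
    have e : dx (star (s.S.Θ j)) t x = star (dx (s.S.Θ j) t x) := deriv.star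
    rw [e]
    simp only [star_mul', star_star, star_I]
    simp only [SDec.at_apply]
    rw [show d ((s.sdec_Θ j).at hI ht) x = dx (s.S.Θ j) t x from rfl]
    ring
  have hsum : ∑ l ∈ Finset.range j, ∫ x, Complex.I * dx (star (s.S.Θ j)) t x *
      (s.S.HD^[l + 1] (s.S.K (j - 1 - l))) t x = ∫ x, Complex.I * dx (star (s.S.Θ j)) t x *
      s.S.HD (projH (s.S.G j)) t x := by
    rw [← integral_finsetSum]
    · refine integral_congr_ae (Eventually.of_forall fun x => ?_)
      beta_reduce
      rw [s.HD_projH_G j t ht x, Finset.mul_sum]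
    · intro l _
      exact integrable_mul (((s.sdec_Θ j).star hI |>.dx hI |>.smul hI Complex.I).at hI ht)
        ((s.sdec_iterate_HD (s.sdec_K (j - 1 - l)) (l + 1)).at hI ht)
  rw [hsum, hneg (s.sdec_HD (s.sdec_projH_G j)), hneg (s.sdec_K j)]
  rw [eΘ, eΘ, eΘ]
  have p1 := congrArg Complex.re (s.pr_Θ (j + 1) j ht)
  have p2 := congrArg Complex.re (s.pr_Θ j (j + 1) ht)
  -- The quadratic terms left over by `p1` and `p2` are conjugate to each other, so they cancel in
  -- the real part of the difference.
  have p3 : (∫ x, (s.sdec_phi (j + 1)).at hI ht x * conj ((s.sdec_phi j).at hI ht) x).re =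
      (∫ x, (s.sdec_phi j).at hI ht x * conj ((s.sdec_phi (j + 1)).at hI ht) x).re := by
    rw [← re_integral_star]
    congr 2
    ext x
    simp only [star_mul', conj_apply, star_star]; ring
  rw [eG, pr_add_right] at p2
  simp only [Complex.sub_re, Complex.add_re] at p1 p2 ⊢
  have p4 := hre ((s.sdec_Θ (j + 2)).at hI ht) ((s.sdec_Θ (j + 1)).at hI ht)
  linarith

end Sol

/-! ### The trilinear singular integral and the cubic structure of the commutators `K n` -/

namespace HInf

variable {f g h : HInf}

theorem PH_eq_sub (f : HInf) : PH f = f - PA f := (sub_eq_of_eq_add' (PA_add_PH f).symm).symm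

/-- The trilinear singular integral `(1 / π i) ∫ δf δg δh / (x - y)² dy`. -/
def tri (f g h : HInf) : HInf :=
  H (d (f * g * h)) - f * H (d (g * h)) - g * H (d (f * h)) - h * H (d (f * g)) +
    f * g * H (d h) + f * h * H (d g) + g * h * H (d f)

/-- ℍ is ±I on the derivatives of the single factors and of f h. Only the products containing both
types leave a projection ℙ_A behind. -/
theorem tri_eq (hf : Hol f) (hg : Anti g) (hh : Hol h) : tri f g h =
    (2 : ℂ) • (f * PA (d (g * h)) + h * PA (d (f * g)) - f * h * d g - PA (d (f * g * h))) := by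
  rw [tri, show H (d (f * h)) = d (f * h) from (hf.mul hh).d, show H (d h) = d h from hh.d,
    show H (d f) = d f from hf.d, show H (d g) = -d g from hg.d, H_eq (d (f * g * h)),
    H_eq (d (g * h)), H_eq (d (f * g))]
  generalize PA (d (f * g * h)) = p1
  generalize PA (d (g * h)) = p2
  generalize PA (d (f * g)) = p3
  simp only [d_mul]
  ext x
  simp only [HInf.add_apply, HInf.sub_apply, HInf.mul_apply, HInf.smul_apply, HInf.neg_apply]
  ring

end HInf

/-- `ℙ_H (conj Z_α f)`. -/
def Wave.sharp (S : Wave) (f : ℝ → ℝ → ℂ) : ℝ → ℝ → ℂ :=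
  projH fun t x => f t x + star (S.ζ t x) * f t x

namespace Sol

open HInf

variable (s : Sol) {t : ℝ} {f g : ℝ → ℝ → ℂ}

theorem sdec_sharp_aux (hf : SDec s.I f) : SDec s.I (fun t x => f t x + star (s.S.ζ t x) * f t x) :=
  hf.add s.isOpen ((s.sdec_ζ.star s.isOpen).mul s.isOpen hf)

theorem sdec_sharp (hf : SDec s.I f) : SDec s.I (s.S.sharp f) :=
  (s.sdec_sharp_aux hf).projH s.isOpen

theorem at_sharp (hf : SDec s.I f) (ht : t ∈ s.I) : (s.sdec_sharp hf).at s.isOpen ht =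
    PH (hf.at s.isOpen ht + conj (s.sdec_ζ.at s.isOpen ht) * hf.at s.isOpen ht) :=
  (s.sdec_sharp_aux hf).at_projH s.isOpen ht

theorem anti_Wb (ht : t ∈ s.I) : Anti (conj (s.sdec_W.at s.isOpen ht)) := (s.hol_W ht).conj

theorem conj_one_add_W_mul (ht : t ∈ s.I) (x : ℝ) :
    (1 + star (s.S.W t x)) * (1 + star (s.S.ζ t x)) = 1 := by
  have h := congrArg star (s.one_add_W_mul ht x)
  simpa using h

/-- A holomorphic function is recovered from its image under `sharp`. -/
theorem eq_PH_sharp (hf : SDec s.I f) (ht : t ∈ s.I) (hol : Hol (hf.at s.isOpen ht)) :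
    hf.at s.isOpen ht = PH ((s.sdec_sharp hf).at s.isOpen ht +
      conj (s.sdec_W.at s.isOpen ht) * (s.sdec_sharp hf).at s.isOpen ht) := by
  rw [s.at_sharp hf ht]
  set F := hf.at s.isOpen ht with hF
  set Y := F + conj (s.sdec_ζ.at s.isOpen ht) * F with hY
  have e : F = Y + conj (s.sdec_W.at s.isOpen ht) * Y := by
    ext x
    simp only [hY, HInf.add_apply, HInf.mul_apply, conj_apply, SDec.at_apply]
    linear_combination -F x * s.conj_one_add_W_mul ht x
  -- Multiplication by 1/Z̄_α preserves antiholomorphic functions, so the ℙ_A part of Y = Z̄_α f is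
  -- lost under the final ℙ_H and only its ℙ_H part counts.
  have e2 : F = (PA Y + conj (s.sdec_W.at s.isOpen ht) * PA Y) +
      (PH Y + conj (s.sdec_W.at s.isOpen ht) * PH Y) := by
    have h := PA_add_PH Y
    calc F = (PA Y + PH Y) + conj (s.sdec_W.at s.isOpen ht) * (PA Y + PH Y) := by rw [h]; exact e
      _ = _ := by rw [mul_add]; abel
  calc F = PH F := hol.PH_eq.symm
    _ = _ := by
      conv_lhs => rw [e2]
      rw [map_add, ((anti_PA Y).add ((s.anti_Wb ht).mul (anti_PA Y))).PH_eq, zero_add]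

/-- The derivative of the conjugate of Θ^{(j)} is φ̄_j Z̄_α with φ̄_j antiholomorphic, so Z̄_α f may
be replaced by its projection. This is the reason for introducing `sharp`. -/
theorem integral_dx_Θ_mul (j : ℕ) (hf : SDec s.I f) (ht : t ∈ s.I) :
    ∫ x, Complex.I * dx (star (s.S.Θ j)) t x * f t x =
      ∫ x, Complex.I * (star (s.S.phi j t x) * s.S.sharp f t x) := by
  have h := integral_anti_mul_PH ((s.hol_phi j ht).conj)
    (hf.at s.isOpen ht + conj (s.sdec_ζ.at s.isOpen ht) * hf.at s.isOpen ht)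
  rw [← at_sharp] at h
  rw [integral_const_mul]
  have e : ∀ x, Complex.I * dx (star (s.S.Θ j)) t x * f t x = Complex.I *
      (conj ((s.sdec_phi j).at s.isOpen ht) x * (hf.at s.isOpen ht +
        conj (s.sdec_ζ.at s.isOpen ht) * hf.at s.isOpen ht) x) := fun x => by
    have e1 : dx (star (s.S.Θ j)) t x = star (dx (s.S.Θ j) t x) := deriv.star
    rw [e1, s.dx_Θ j t ht x]
    simp only [HInf.add_apply, HInf.mul_apply, conj_apply, SDec.at_apply, star_mul', star_add,
      star_one]
    ring
  simp only [e, integral_const_mul]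
  rw [← h]
  rfl

theorem at_dt_sharp (hf : SDec s.I f) (ht : t ∈ s.I) :
    ((s.sdec_sharp hf).dt s.isOpen).at s.isOpen ht =
    PH ((hf.dt s.isOpen).at s.isOpen ht +
      (conj (d ((s.sdec_Z.dt s.isOpen).at s.isOpen ht)) * hf.at s.isOpen ht +
        conj (s.sdec_ζ.at s.isOpen ht) * (hf.dt s.isOpen).at s.isOpen ht)) := by
  have hI := s.isOpen
  refine ((s.sdec_sharp_aux hf).at_dt_projH hI ht).trans (congrArg PH (HInf.ext fun x => ?_))
  have e' : EqI s.I s.S.ζ (dx fun t x => s.S.Z t x - x) := fun t ht x => by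
    rw [Wave.ζ, show dx s.S.Z t x = _ from (s.hasDerivAt_Z_x ht x).deriv, add_sub_cancel_right]
  have h1 := (e'.dt hI).trans (s.sdec_Z.dt_dx hI) t ht x
  have h2 := ((hf.hasDerivAt_t ht x).add
    (((s.sdec_ζ.hasDerivAt_t ht x).star).mul (hf.hasDerivAt_t ht x))).deriv
  rw [h1] at h2
  exact h2

/-- Under ℙ_H(Z̄_α ·) the inner projection of ℙ_H D_t f may be omitted, and b Z̄_α is Z̄_t minus the
conjugate of ∂_t Z. Then f is expressed through `sharp f` by `eq_PH_sharp`. Apart from the time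
derivative, every term carries an extra factor Z̄_t or b. -/
theorem sharp_HD (hf : SDec s.I f) (hol : ∀ t (ht : t ∈ s.I), Hol (hf.at s.isOpen ht)) :
    EqI s.I (s.S.sharp (s.S.HD f)) (fun t x => dt (s.S.sharp f) t x +
      s.S.Vb t x * dx (projH fun t x => s.S.sharp f t x + star (s.S.W t x) * s.S.sharp f t x) t x -
      dx (projH fun t x => (s.S.Vb t x + s.S.Vb t x * star (s.S.W t x) - s.S.bC t x) *
        s.S.sharp f t x) t x) := by
  intro t ht x
  have hI := s.isOpen
  have hP := s.sdec_sharp hf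
  have hQ1 : SDec s.I (fun t x => s.S.sharp f t x + star (s.S.W t x) * s.S.sharp f t x) :=
    hP.add hI ((s.sdec_W.star hI).mul hI hP)
  have hQ2 : SDec s.I (fun t x => (s.S.Vb t x + s.S.Vb t x * star (s.S.W t x) - s.S.bC t x) *
      s.S.sharp f t x) :=
    ((s.sdec_Vb.add hI (s.sdec_Vb.mul hI (s.sdec_W.star hI))).sub hI s.sdec_b).mul hI hP
  have main : (s.sdec_sharp (s.sdec_HD hf)).at hI ht = (hP.dt hI).at hI ht +
      s.sdec_Vb.at hI ht * d ((hQ1.projH hI).at hI ht) - d ((hQ2.projH hI).at hI ht) := by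
    rw [s.at_sharp (s.sdec_HD hf) ht, s.at_HD hf hol ht, s.at_dt_sharp hf ht]
    have eF := s.eq_PH_sharp hf ht (hol t ht)
    rw [SDec.at_projH hI hQ1, SDec.at_projH hI hQ2]
    have e1 : hQ1.at hI ht = (s.sdec_sharp hf).at hI ht +
      conj (s.sdec_W.at hI ht) * (s.sdec_sharp hf).at hI ht := rfl
    rw [e1, ← eF]
    set F := hf.at hI ht with hF
    set Ft := (hf.dt hI).at hI ht
    set b := s.sdec_b.at hI ht
    set zb := conj (s.sdec_ζ.at hI ht) with hzb
    set Zt := (s.sdec_Z.dt hI).at hI ht with hZt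
    set P := (s.sdec_sharp hf).at hI ht with hPd
    set Vb := s.sdec_Vb.at hI ht with hVb
    set Wb := conj (s.sdec_W.at hI ht) with hWb
    have az : Anti zb := (s.hol_ζ ht).conj
    have aZ : Anti (conj Zt) := (s.hol_Zt ht).conj
    have hbz : b + b * zb = Vb - conj Zt := by
      have h := congrArg conj (s.b_mul_at ht)
      rw [conj_add, conj_mul, conj_sub, s.conj_b ht] at h
      exact h
    -- the projected product with `conj Z_t`
    have eZ : PH (conj Zt * F) = PH (hQ2.at hI ht) := by
      set Y := F + zb * F with hY
      have hPY : P = PH Y := s.at_sharp hf ht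
      have e : conj Zt * F = (conj Zt * PA Y + conj Zt * Wb * PA Y) + hQ2.at hI ht := by
        have h := PA_add_PH Y
        rw [← hPY] at h
        ext x
        have h' := congrArg (fun k : HInf => k x) h
        have hb' := congrArg (fun k : HInf => k x) hbz
        have h1 := s.conj_one_add_W_mul ht x
        simp only [hY, HInf.add_apply, HInf.mul_apply, HInf.sub_apply] at h' hb' ⊢
        have e1 : zb x = star (s.S.ζ t x) := rfl
        have e2 : Wb x = star (s.S.W t x) := rfl
        have e3 : hQ2.at hI ht x = (Vb x + Vb x * Wb x - b x) * P x := rfl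
        rw [← e1, ← e2] at h1
        rw [e3]
        linear_combination -(conj Zt x * (1 + Wb x)) * h' - conj Zt x * F x * h1 +
          P x * (1 + Wb x) * hb' - b x * P x * h1
      conv_lhs => rw [e]
      rw [map_add, ((aZ.mul (anti_PA Y)).add ((aZ.mul (s.anti_Wb ht)).mul (anti_PA Y))).PH_eq,
        zero_add]
    rw [← eZ]
    have hFt : Hol Ft := hf.hol_dt hI hol ht
    have e2 : PH (PH (b * d F) + zb * PH (b * d F)) = PH (b * d F + zb * (b * d F)) := by
      have h := PA_add_PH (b * d F)
      have e : b * d F + zb * (b * d F) = (PA (b * d F) + zb * PA (b * d F)) +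
          (PH (b * d F) + zb * PH (b * d F)) := by
        conv_lhs => rw [← h]
        rw [mul_add]; abel
      conv_rhs => rw [e, map_add, ((anti_PA _).add (az.mul (anti_PA _))).PH_eq, zero_add]
    have e3 : b * d F + zb * (b * d F) = Vb * d F - conj Zt * d F := by
      rw [← sub_mul, ← hbz]
      ext x; simp only [HInf.mul_apply, HInf.add_apply]; ring
    have e4 : Ft + PH (b * d F) + zb * (Ft + PH (b * d F)) =
      (Ft + zb * Ft) + (PH (b * d F) + zb * PH (b * d F)) := by rw [mul_add]; abel
    rw [e4, map_add, e2, e3, map_sub, ((s.hol_Vb ht).mul (hol t ht).d).PH_eq, d_PH, d_mul, d_conj,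
      map_add, map_add, map_add, map_add]
    abel
  have h := congrArg (fun k : HInf => k x) main
  exact h

/-- `Θ_α / |Z_α|²` projected has image `φ` under `sharp`. -/
theorem sharp_mΘ (n : ℕ) : EqI s.I (s.S.sharp (projH (s.S.mΘ n))) (s.S.phi n) := by
  intro t ht x
  have hI := s.isOpen
  have main : (s.sdec_sharp ((s.sdec_mΘ n).projH hI)).at hI ht = (s.sdec_phi n).at hI ht := by
    rw [s.at_sharp ((s.sdec_mΘ n).projH hI) ht, (s.sdec_mΘ n).at_projH hI ht]
    set M := (s.sdec_mΘ n).at hI ht with hM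
    set zb := conj (s.sdec_ζ.at hI ht)
    have az : Anti zb := (s.hol_ζ ht).conj
    have h := PA_add_PH M
    have e : (s.sdec_phi n).at hI ht = (PA M + zb * PA M) + (PH M + zb * PH M) := by
      have e1 : (s.sdec_phi n).at hI ht = M + zb * M := by
        ext x
        simp only [hM, HInf.add_apply, HInf.mul_apply, SDec.at_apply, Wave.mΘ]
        have e1 : zb x = star (s.S.ζ t x) := rfl
        rw [e1]
        linear_combination -s.S.phi n t x * s.conj_one_add_W_mul ht x
      rw [e1]
      conv_lhs => rw [← h]
      rw [mul_add]; abel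
    rw [← (s.hol_phi n ht).PH_eq]
    conv_rhs => rw [e, map_add, ((anti_PA M).add (az.mul (anti_PA M))).PH_eq, zero_add]
  exact congrArg (fun k : HInf => k x) main

theorem sharp_congr (h : EqI s.I f g) : EqI s.I (s.S.sharp f) (s.S.sharp g) :=
  EqI.projH fun t ht x => by rw [h t ht x]

theorem sharp_add (hf : SDec s.I f) (hg : SDec s.I g) : EqI s.I (s.S.sharp fun t x => f t x + g t x)
    (fun t x => s.S.sharp f t x + s.S.sharp g t x) :=
  EqI.trans (EqI.projH fun t ht x => by ring)
    (s.projH_add (s.sdec_sharp_aux hf) (s.sdec_sharp_aux hg))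

theorem sharp_smul (c : ℂ) (hf : SDec s.I f) : EqI s.I (s.S.sharp fun t x => c * f t x)
    (fun t x => c * s.S.sharp f t x) :=
  EqI.trans (EqI.projH fun t ht x => by ring) (s.projH_smul c (s.sdec_sharp_aux hf))

/-- The Θ parts of ℙ_H G^{(n+1)} and ℙ_H D_t ℙ_H G^{(n)} are Θ^{(n+3)} and ℙ_H D_tΘ^{(n+2)}, which
are equal. -/
theorem K_eq (n : ℕ) : EqI s.I (s.S.K n) (fun t x => Complex.I * projH (s.S.mΘ (n + 1)) t x +
    -Complex.I * s.S.HD (projH (s.S.mΘ n)) t x) := by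
  have hI := s.isOpen
  intro t ht x
  have h1 := s.projH_G_succ n t ht x
  have h2 := s.HD_congr (s.projH_G n) t ht x
  rw [s.HD_add (s.sdec_Θ _) (((s.sdec_mΘ n).projH hI).smul hI _) t ht x] at h2
  have h3 : s.S.HD (fun t x => Complex.I * projH (s.S.mΘ n) t x) t x =
      Complex.I * s.S.HD (projH (s.S.mΘ n)) t x :=
    (s.D_smul Complex.I ((s.sdec_mΘ n).projH hI)).projH.trans
      (s.projH_smul _ (s.sdec_D ((s.sdec_mΘ n).projH hI))) t ht x
  beta_reduce at h1 h2
  rw [h3] at h2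
  rw [s.projH_G (n + 1) t ht x, h2, s.Θ_succ (n + 2), Wave.HD] at h1
  linear_combination -h1

theorem dx_b_at (ht : t ∈ s.I) : d (s.sdec_b.at s.isOpen ht) =
    d (s.sdec_V.at s.isOpen ht) + PA (d (s.sdec_W.at s.isOpen ht * s.sdec_V.at s.isOpen ht)) +
      d (s.sdec_Vb.at s.isOpen ht) +
      d (s.sdec_Vb.at s.isOpen ht * conj (s.sdec_W.at s.isOpen ht)) -
      PA (d (s.sdec_Vb.at s.isOpen ht * conj (s.sdec_W.at s.isOpen ht))) := by
  have hI := s.isOpen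
  have e1 : s.sdec_X.at hI ht = s.sdec_V.at hI ht + s.sdec_W.at hI ht * s.sdec_V.at hI ht := by
    ext x; simp only [SDec.at_apply, HInf.add_apply, HInf.mul_apply, Wave.X]; ring
  have e2 : conj (s.sdec_X.at hI ht) =
      s.sdec_Vb.at hI ht + s.sdec_Vb.at hI ht * conj (s.sdec_W.at hI ht) := by
    rw [e1, conj_add, conj_mul, mul_comm]; rfl
  rw [s.at_b ht, map_add, e2, e1, map_add, map_add, map_add, map_add, (s.anti_V ht).PA_eq,
    (s.hol_Vb ht).PH_eq, d_PA, d_PH, ← sub_eq_of_eq_add' (PA_add_PH (d (s.sdec_Vb.at hI ht *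
      conj (s.sdec_W.at hI ht)))).symm]
  abel

/-- The leading part of the commutator terms. -/
theorem sharp_K (n : ℕ) (ht : t ∈ s.I) : Complex.I • (s.sdec_sharp (s.sdec_K n)).at s.isOpen ht =
    PH ((1 / 2 : ℂ) • (tri (s.sdec_W.at s.isOpen ht) (s.sdec_V.at s.isOpen ht)
        ((s.sdec_phi n).at s.isOpen ht) -
      tri (s.sdec_Vb.at s.isOpen ht) (conj (s.sdec_W.at s.isOpen ht))
        ((s.sdec_phi n).at s.isOpen ht))) := by
  have hI := s.isOpen
  set W := s.sdec_W.at hI ht with hW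
  set V := s.sdec_V.at hI ht with hV
  set Vb := s.sdec_Vb.at hI ht with hVb
  set b := s.sdec_b.at hI ht with hb
  set φ := (s.sdec_phi n).at hI ht with hφ
  have hm := s.sdec_mΘ n
  have hEq := (s.sharp_HD (hm.projH hI) (fun t ht => s.hol_projH hm ht)) t ht
  have hsdt := (s.sharp_mΘ n).dt hI t ht
  have hQ1 : SDec s.I (fun t x => s.S.phi n t x + star (s.S.W t x) * s.S.phi n t x) := hm
  have hQ2 : SDec s.I (fun t x => (s.S.Vb t x + s.S.Vb t x * star (s.S.W t x) - s.S.bC t x) *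
      s.S.phi n t x) :=
    ((s.sdec_Vb.add hI (s.sdec_Vb.mul hI (s.sdec_W.star hI))).sub hI s.sdec_b).mul hI (s.sdec_phi n)
  have hc1 : EqI s.I (fun t x => s.S.sharp (projH (s.S.mΘ n)) t x +
      star (s.S.W t x) * s.S.sharp (projH (s.S.mΘ n)) t x)
      (fun t x => s.S.phi n t x + star (s.S.W t x) * s.S.phi n t x) := fun t ht x => by
    beta_reduce
    rw [s.sharp_mΘ n t ht x]
  have hc2 : EqI s.I (fun t x => (s.S.Vb t x + s.S.Vb t x * star (s.S.W t x) - s.S.bC t x) *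
      s.S.sharp (projH (s.S.mΘ n)) t x) (fun t x => (s.S.Vb t x + s.S.Vb t x * star (s.S.W t x) -
      s.S.bC t x) * s.S.phi n t x) := fun t ht x => by
    beta_reduce
    rw [s.sharp_mΘ n t ht x]
  have hd1 := hc1.projH.dx t ht
  have hd2 := hc2.projH.dx t ht
  have hK : ∀ x, s.S.sharp (s.S.K n) t x = Complex.I * s.S.phi (n + 1) t x +
      -Complex.I * s.S.sharp (s.S.HD (projH (s.S.mΘ n))) t x := fun x => by
    rw [s.sharp_congr (s.K_eq n) t ht x, s.sharp_add (((s.sdec_mΘ (n + 1)).projH hI).smul hI _)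
      ((s.sdec_HD (hm.projH hI)).smul hI _) t ht x]
    beta_reduce
    rw [s.sharp_smul _ ((s.sdec_mΘ (n + 1)).projH hI) t ht x,
      s.sharp_smul _ (s.sdec_HD (hm.projH hI)) t ht x]
    beta_reduce
    rw [s.sharp_mΘ (n + 1) t ht x]
  have aWb : Anti (conj W) := s.anti_Wb ht
  -- the explicit form of the left side
  have e1 : Complex.I • (s.sdec_sharp (s.sdec_K n)).at hI ht =
      -(b * d φ + d V * φ + W * (d V * φ) - PA (d (V * φ)) - W * PA (d (V * φ)) -
        Vb * d (PH (φ + conj W * φ)) + d (PH ((Vb + Vb * conj W - b) * φ))) := by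
    ext x
    have p1 : d (PH (φ + conj W * φ)) x = dx (projH fun t x =>
        s.S.phi n t x + star (s.S.W t x) * s.S.phi n t x) t x := by
      rw [show φ + conj W * φ = hQ1.at hI ht from rfl, ← SDec.at_projH]; rfl
    have p2 : d (PH ((Vb + Vb * conj W - b) * φ)) x = dx (projH fun t x =>
        (s.S.Vb t x + s.S.Vb t x * star (s.S.W t x) - s.S.bC t x) * s.S.phi n t x) t x := by
      rw [show (Vb + Vb * conj W - b) * φ = hQ2.at hI ht from rfl, ← SDec.at_projH]; rfl
    have p3 : PA (d (V * φ)) x = dx (projA fun t x => s.S.V t x * s.S.phi n t x) t x := by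
      rw [← d_PA, show V * φ = (s.sdec_V.mul hI (s.sdec_phi n)).at hI ht from rfl, ← SDec.at_projA]
      rfl
    have p4 := hEq x
    beta_reduce at p4
    rw [hsdt x, hd1 x, hd2 x] at p4
    simp only [HInf.add_apply, HInf.sub_apply, HInf.mul_apply, HInf.smul_apply, HInf.neg_apply, p1,
      p2, p3]
    simp only [SDec.at_apply]
    rw [hK, p4]
    have p5 : s.S.phi (n + 1) t x = s.S.D (s.S.phi n) t x +
      (1 + s.S.W t x) * (dx s.S.V t x * s.S.phi n t x) -
      (1 + s.S.W t x) * dx (projA fun t x => s.S.V t x * s.S.phi n t x) t x := rfl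
    rw [p5, D_eq]
    have q1 : d φ x = dx (s.S.phi n) t x := rfl
    have q2 : d V x = dx s.S.V t x := rfl
    rw [q1, q2]
    simp only [hW, hVb, hb, hφ, SDec.at_apply]
    have hI2 := Complex.I_sq
    ring_nf
    rw [hI2]
    ring
  -- The left side is in the range of ℙ_H, so it is enough that the arguments of the two projections
  -- differ by something of the form ℙ_A(·).
  have e0 : PH ((s.sdec_sharp (s.sdec_K n)).at hI ht) = (s.sdec_sharp (s.sdec_K n)).at hI ht := by
    rw [s.at_sharp (s.sdec_K n) ht, (hol_PH _).PH_eq]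
  rw [← e0, ← map_smul, e1, ← sub_eq_zero, ← map_sub]
  have e2 : -(b * d φ + d V * φ + W * (d V * φ) - PA (d (V * φ)) - W * PA (d (V * φ)) -
        Vb * d (PH (φ + conj W * φ)) + d (PH ((Vb + Vb * conj W - b) * φ))) -
      (1 / 2 : ℂ) • (tri W V φ - tri Vb (conj W) φ) =
      PA (d (V * φ) + d ((Vb + Vb * conj W - b) * φ) + d (W * V * φ) - d (Vb * conj W * φ)) := by
    rw [tri_eq (s.hol_W ht) (s.anti_V ht) (s.hol_phi n ht), tri_eq (s.hol_Vb ht) aWb (s.hol_phi n ht),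
      map_add PH φ, (s.hol_phi n ht).PH_eq, map_add d φ, d_PH, d_PH,
      PH_eq_sub (d ((Vb + Vb * conj W - b) * φ)), PH_eq_sub (d (conj W * φ)), map_sub PA, map_add PA,
      map_add PA]
    have hdb := s.dx_b_at ht
    rw [← hV, ← hVb, ← hW, ← hb] at hdb
    rw [← hV, ← hVb, ← hW, ← hφ]
    -- With the projections treated as unknown functions the identity is polynomial, and the formula
    -- for b_α is the only relation needed.
    generalize PA (d (V * φ)) = a1
    generalize PA (d ((Vb + Vb * conj W - b) * φ)) = a2
    generalize PA (d (W * V * φ)) = a3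
    generalize PA (d (Vb * conj W * φ)) = a4
    generalize PA (d (conj W * φ)) = a5
    generalize PA (d (W * V)) = a6 at *
    generalize PA (d (Vb * conj W)) = a7 at *
    simp only [d_mul, map_add, map_sub] at hdb ⊢
    ext x
    have hx := congrArg (fun k : HInf => k x) hdb
    simp only [HInf.add_apply, HInf.sub_apply, HInf.mul_apply, HInf.smul_apply, HInf.neg_apply] at hx ⊢
    linear_combination φ x * hx
  rw [e2, (anti_PA _).PH_eq]

end Sol

/-! ### Functions attached to solutions, and their degree -/

/-- Equality for all solutions. -/
def EqS (X Y : Wave → ℝ → ℝ → ℂ) : Prop := ∀ s : Sol, EqI s.I (X s.S) (Y s.S)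

/-- `Deg n X`: for solutions, `X` is a sum of terms of degree at least `n` in `Z_t`, `1 / Z_α - 1`
and their derivatives. -/
inductive Deg : ℕ → (Wave → ℝ → ℝ → ℂ) → Prop
  | V : Deg 1 (fun S => S.V)
  | W : Deg 1 (fun S => S.W)
  | smul {n : ℕ} {X : Wave → ℝ → ℝ → ℂ} (c : ℂ) (hX : Deg n X) : Deg n (fun S t x => c * X S t x)
  | add {n : ℕ} {X Y : Wave → ℝ → ℝ → ℂ} (hX : Deg n X) (hY : Deg n Y) :
      Deg n (fun S t x => X S t x + Y S t x)
  | mul {m n : ℕ} {X Y : Wave → ℝ → ℝ → ℂ} (hX : Deg m X) (hY : Deg n Y) :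
      Deg (m + n) (fun S t x => X S t x * Y S t x)
  | conj {n : ℕ} {X : Wave → ℝ → ℝ → ℂ} (hX : Deg n X) : Deg n (fun S t x => star (X S t x))
  | dx {n : ℕ} {X : Wave → ℝ → ℝ → ℂ} (hX : Deg n X) : Deg n (fun S => dx (X S))
  | hilbert {n : ℕ} {X : Wave → ℝ → ℝ → ℂ} (hX : Deg n X) : Deg n (fun S t x => hilbert (X S t) x)
  | mono {m n : ℕ} {X : Wave → ℝ → ℝ → ℂ} (hX : Deg n X) (h : m ≤ n) : Deg m X
  | congr {n : ℕ} {X Y : Wave → ℝ → ℝ → ℂ} (hX : Deg n X) (h : EqS X Y) : Deg n Y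

namespace Deg

variable {m n : ℕ} {X Y : Wave → ℝ → ℝ → ℂ}

theorem sdec (hX : Deg n X) (s : Sol) : SDec s.I (X s.S) := by
  induction hX with
  | V => exact s.sdec_V
  | W => exact s.sdec_W
  | smul c _ ih => exact ih.smul s.isOpen c
  | add _ _ ih ih' => exact ih.add s.isOpen ih'
  | mul _ _ ih ih' => exact ih.mul s.isOpen ih'
  | conj _ ih => exact ih.star s.isOpen
  | dx _ ih => exact ih.dx s.isOpen
  | hilbert _ ih => exact ih.hilbert s.isOpen
  | mono _ _ ih => exact ih
  | congr _ h ih => exact ih.congr s.isOpen (h s)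

theorem sub (hX : Deg n X) (hY : Deg n Y) : Deg n (fun S t x => X S t x - Y S t x) :=
  (hX.add (hY.smul (-1))).congr fun _ _ _ _ => by ring

theorem neg (hX : Deg n X) : Deg n (fun S t x => -X S t x) :=
  (hX.smul (-1)).congr fun _ _ _ _ => by ring

theorem zero (n : ℕ) : Deg n (fun _ _ _ => 0) := by
  have h : ∃ X, Deg n X := by
    induction n with
    | zero => exact ⟨_, Deg.V.mono (Nat.zero_le 1)⟩
    | succ n ih => obtain ⟨X, hX⟩ := ih; exact ⟨_, hX.mul .V⟩
  obtain ⟨X, hX⟩ := h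
  exact (hX.smul 0).congr fun _ _ _ _ => by ring

theorem mul_left (hX : Deg m X) (hY : Deg n Y) : Deg n (fun S t x => X S t x * Y S t x) :=
  (hX.mul hY).mono (Nat.le_add_left _ _)

theorem projH (hX : Deg n X) : Deg n (fun S => projH (X S)) :=
  ((hX.add hX.hilbert).smul (1 / 2)).congr fun _ _ _ _ => by simp only [WaterWave.projH]; ring

theorem projA (hX : Deg n X) : Deg n (fun S => projA (X S)) :=
  ((hX.sub hX.hilbert).smul (1 / 2)).congr fun _ _ _ _ => by simp only [WaterWave.projA]; ring

theorem mul_one_add_W (hX : Deg n X) : Deg n (fun S t x => X S t x * (1 + S.W t x)) :=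
  (hX.add ((hX.mul .W).mono (Nat.le_succ n))).congr fun _ _ _ _ => by ring

theorem mul_one_add_Wb (hX : Deg n X) : Deg n (fun S t x => X S t x * (1 + star (S.W t x))) :=
  (hX.add ((hX.mul (.conj .W)).mono (Nat.le_succ n))).congr fun _ _ _ _ => by ring

theorem Vb : Deg 1 (fun S => S.Vb) := .conj .V

theorem velocity : Deg 1 (fun S => S.X) := mul_one_add_W .V

theorem bC : Deg 1 (fun S => S.bC) :=
  ((((velocity.sub velocity.hilbert).add (velocity.sub velocity.hilbert).conj).smul (1 / 2))).congr fun s => s.bC_eq.symm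

theorem AC : Deg 2 (fun S => S.AC) :=
  have h := (Deg.V.mul (m := 1) (n := 1) Vb.dx.hilbert).sub (Deg.V.mul (m := 1) Vb.dx).hilbert
  ((h.sub h.conj).smul (Complex.I / 2)).congr fun s => s.AC_eq.symm

/-- The momentum equation and `Sol.D_W` express D_t Z_t and D_t(1/Z_α) without time derivatives and
without loss of degree. The commutators of D_t with ∂_α and ℍ contain the factor b of degree one.
This is why D_t is not among the generators of `Deg`. -/
theorem D (hX : Deg n X) : Deg n (fun S => S.D (X S)) := by
  induction hX with
  | V =>
    have h := ((Deg.W.add (AC.mul_one_add_W.mono one_le_two)).smul (-Complex.I)).conj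
    refine h.congr fun s t ht x => ?_
    have h1 := s.D_V t ht x
    beta_reduce at h1 ⊢
    rw [← h1, ← s.D_star]
    simp only [Wave.Vb, star_star]
  | W => exact ((bC.dx.sub (Deg.V.dx.mul_one_add_W)).mul_one_add_W).congr fun s => (s.D_W).symm
  | smul c h ih => exact (ih.smul c).congr fun s => (s.D_smul c (h.sdec s)).symm
  | add h h' ih ih' => exact (ih.add ih').congr fun s => (s.D_add (h.sdec s) (h'.sdec s)).symm
  | mul h h' ih ih' =>
    exact ((ih.mul h').add (h.mul ih')).congr fun s => (s.D_mul (h.sdec s) (h'.sdec s)).symm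
  | conj _ ih => exact ih.conj.congr fun s t _ x => (s.D_star _ t x).symm
  | dx h ih =>
    exact (ih.dx.sub (bC.dx.mul_left h.dx)).congr fun s => (s.D_dx (h.sdec s)).symm
  | hilbert h ih =>
    exact ((ih.hilbert.sub (bC.mul_left h.dx).hilbert).add (bC.mul_left h.dx.hilbert)).congr
      fun s => (s.D_hilbert (h.sdec s)).symm
  | mono _ h ih => exact ih.mono h
  | congr _ h ih => exact ih.congr fun s => s.D_congr (h s)

theorem iterate_D (hX : Deg n X) (k : ℕ) : Deg n (fun S => S.D^[k] (X S)) := by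
  induction k with
  | zero => exact hX
  | succ k ih => simp only [Function.iterate_succ_apply']; exact ih.D

theorem phi (k : ℕ) : Deg 1 (fun S => S.phi k) := by
  induction k with
  | zero => exact Vb
  | succ k ih =>
    have h1 := ((Deg.V.dx.mul_left ih).mul_one_add_W)
    have h2 := ((Deg.V.mul_left ih).projA.dx).mul_one_add_W
    exact ((ih.D.add h1).sub h2).congr fun s t _ x => by simp only [Wave.phi]; ring

/-- To leading order, `Θ_α^{(k)} / Z_α` is `D_t^k (conj Z_t)`. -/
theorem phi_sub (k : ℕ) : Deg 2 (fun S t x => S.phi k t x - (S.D^[k] S.Vb) t x) := by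
  induction k with
  | zero => exact (zero 2).congr fun s t _ x => by simp [Wave.phi]
  | succ k ih =>
    have h1 := ((Deg.V.dx.mul (n := 1) (phi k)).mul_one_add_W)
    have h2 := ((Deg.V.mul (n := 1) (phi k)).projA.dx).mul_one_add_W
    refine ((ih.D.add h1).sub h2).congr fun s t ht x => ?_
    have hk : Deg 1 (fun S => S.D^[k] S.Vb) := Vb.iterate_D k
    have h3 := s.D_add (s.sdec_phi k) ((hk.sdec s).smul s.isOpen (-1)) t ht x
    beta_reduce at h3
    rw [s.D_smul _ (hk.sdec s) t ht x] at h3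
    have h4 : EqI s.I (fun t x => s.S.phi k t x - (s.S.D^[k] s.S.Vb) t x)
      (fun t x => s.S.phi k t x + -1 * (s.S.D^[k] s.S.Vb) t x) := fun t _ x => by ring
    beta_reduce
    rw [s.D_congr h4 t ht x, h3, Function.iterate_succ_apply']
    simp only [Wave.phi]
    ring

/-- This is the momentum equation with the quadratic quantity A₁ − 1 discarded. -/
theorem W_sub : Deg 2 (fun S t x => S.W t x - Complex.I * S.D S.Vb t x) :=
  AC.mul_one_add_W.neg.congr fun s t ht x => by
    rw [s.D_V t ht x]
    linear_combination -(s.S.W t x + s.S.AC t x * (1 + s.S.W t x)) * Complex.I_sq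

/-- Time derivatives commute with ℙ_H, so only the commutator of b∂_α with ℙ_H is left. -/
theorem D_projH_sub (hX : Deg n X) :
    Deg (n + 1) (fun S t x => S.D (WaterWave.projH (X S)) t x - WaterWave.projH (S.D (X S)) t x) := by
  have h := (bC.mul hX.projH.dx).sub (bC.mul hX.dx).projH
  rw [add_comm n 1]
  refine h.congr fun s t ht x => ?_
  have hI := s.isOpen
  have h1 := congrArg (fun k : HInf => k x) ((hX.sdec s).at_dt_projH hI ht)
  have h2 := s.projH_add ((hX.sdec s).dt hI) (s.sdec_b.mul hI ((hX.sdec s).dx hI)) t ht x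
  have h3 : WaterWave.dt (WaterWave.projH (X s.S)) t x = WaterWave.projH (WaterWave.dt (X s.S)) t x :=
    h1.trans (HInf.PH_apply _ _)
  have h4 : WaterWave.projH (s.S.D (X s.S)) t x = _ := h2
  rw [s.D_eq, h3, h4]
  ring

end Deg

/-- `A₁ / |Z_α|² - 1`. -/
def Wave.aC (S : Wave) (t x : ℝ) : ℂ := S.a t x - 1

theorem Sol.aC_eq (s : Sol) (t x : ℝ) : s.S.aC t x =
    s.S.AC t x * (1 + s.S.W t x) * (1 + star (s.S.W t x)) +
      (s.S.W t x + star (s.S.W t x) * (1 + s.S.W t x)) := by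
  have h := s.inv_normSq t x
  rw [Wave.aC, Wave.a, Wave.AC]
  push_cast
  rw [div_eq_mul_one_div, h]
  ring

theorem Deg.aC : Deg 1 (fun S => S.aC) :=
  ((AC.mul_one_add_W.mul_one_add_Wb.mono one_le_two).add
    (Deg.W.add (Deg.W.conj.mul_one_add_W))).congr fun s t _ x => (s.aC_eq t x).symm

/-! ### Extraction of forms -/

/-- Finite sums of forms of degree at least `n` which, for solutions, lie in `H^∞`. -/
inductive SumForm : ℕ → ((ℝ → ℂ) → (ℝ → ℂ) → ℝ → ℂ) → Prop
  | form {m n : ℕ} {F : (ℝ → ℂ) → (ℝ → ℂ) → ℝ → ℂ} (h : IsForm m F) (hn : n ≤ m)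
      (hF : ∀ s : Sol, ∀ t ∈ s.I, Hinf (F (s.S.V t) (s.S.W t))) : SumForm n F
  | add {n : ℕ} {F G : (ℝ → ℂ) → (ℝ → ℂ) → ℝ → ℂ} (hF : SumForm n F) (hG : SumForm n G) :
      SumForm n (fun v w x => F v w x + G v w x)

namespace SumForm

variable {m n : ℕ} {F G : (ℝ → ℂ) → (ℝ → ℂ) → ℝ → ℂ}

/-- Equality for all solutions. -/
def Eqv (F G : (ℝ → ℂ) → (ℝ → ℂ) → ℝ → ℂ) : Prop :=
  ∀ s : Sol, ∀ t ∈ s.I, F (s.S.V t) (s.S.W t) = G (s.S.V t) (s.S.W t)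

theorem hinf (hF : SumForm n F) (s : Sol) {t : ℝ} (ht : t ∈ s.I) : Hinf (F (s.S.V t) (s.S.W t)) := by
  induction hF with
  | form _ _ hF => exact hF s t ht
  | add _ _ ih ih' => exact ih.add ih'

theorem mono (hF : SumForm n F) (h : m ≤ n) : SumForm m F := by
  induction hF with
  | form h1 h2 h3 => exact .form h1 (h.trans h2) h3
  | add _ _ ih ih' => exact (ih h).add (ih' h)

theorem smul (c : ℂ) (hF : SumForm n F) : ∃ G, SumForm n G ∧ Eqv G (fun v w x => c * F v w x) := by
  induction hF with
  | form h1 h2 h3 => exact ⟨_, .form (h1.smul c) h2 fun s t ht => (h3 s t ht).smul c, fun _ _ _ => rfl⟩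
  | add _ _ ih ih' =>
    obtain ⟨A, hA, eA⟩ := ih
    obtain ⟨B, hB, eB⟩ := ih'
    refine ⟨_, hA.add hB, fun s t ht => ?_⟩
    ext x
    simp only [eA s t ht, eB s t ht]; ring

theorem conj (hF : SumForm n F) : ∃ G, SumForm n G ∧ Eqv G (fun v w x => star (F v w x)) := by
  induction hF with
  | form h1 h2 h3 => exact ⟨_, .form h1.conj h2 fun s t ht => (h3 s t ht).star, fun _ _ _ => rfl⟩
  | add _ _ ih ih' =>
    obtain ⟨A, hA, eA⟩ := ih
    obtain ⟨B, hB, eB⟩ := ih'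
    refine ⟨_, hA.add hB, fun s t ht => ?_⟩
    ext x
    simp only [eA s t ht, eB s t ht, star_add]

theorem diff (hF : SumForm n F) : ∃ G, SumForm n G ∧ Eqv G (fun v w x => deriv (F v w) x) := by
  induction hF with
  | form h1 h2 h3 => exact ⟨_, .form h1.diff h2 fun s t ht => (h3 s t ht).deriv, fun _ _ _ => rfl⟩
  | add h h' ih ih' =>
    obtain ⟨A, hA, eA⟩ := ih
    obtain ⟨B, hB, eB⟩ := ih'
    refine ⟨_, hA.add hB, fun s t ht => ?_⟩
    ext x
    simp only [eA s t ht, eB s t ht]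
    exact (deriv_add ((h.hinf s ht).differentiable x) ((h'.hinf s ht).differentiable x)).symm

theorem hilb (hF : SumForm n F) : ∃ G, SumForm n G ∧ Eqv G (fun v w x => hilbert (F v w) x) := by
  induction hF with
  | form h1 h2 h3 => exact ⟨_, .form h1.hilb h2 fun s t ht => (h3 s t ht).hilbert, fun _ _ _ => rfl⟩
  | add h h' ih ih' =>
    obtain ⟨A, hA, eA⟩ := ih
    obtain ⟨B, hB, eB⟩ := ih'
    refine ⟨_, hA.add hB, fun s t ht => ?_⟩
    ext x
    simp only [eA s t ht, eB s t ht]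
    exact ((h.hinf s ht).hilbert_add (h'.hinf s ht) x).symm

theorem mul (hF : SumForm m F) (hG : SumForm n G) :
    ∃ K, SumForm (m + n) K ∧ Eqv K (fun v w x => F v w x * G v w x) := by
  induction hF with
  | form h1 h2 h3 =>
    induction hG with
    | form k1 k2 k3 =>
      exact ⟨_, .form (h1.mul k1) (Nat.add_le_add h2 k2) fun s t ht => (h3 s t ht).mul (k3 s t ht),
        fun _ _ _ => rfl⟩
    | add _ _ ih ih' =>
      obtain ⟨A, hA, eA⟩ := ih
      obtain ⟨B, hB, eB⟩ := ih'
      refine ⟨_, hA.add hB, fun s t ht => ?_⟩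
      ext x
      simp only [eA s t ht, eB s t ht]; ring
  | add _ _ ih ih' =>
    obtain ⟨A, hA, eA⟩ := ih
    obtain ⟨B, hB, eB⟩ := ih'
    refine ⟨_, hA.add hB, fun s t ht => ?_⟩
    ext x
    simp only [eA s t ht, eB s t ht]; ring

end SumForm

/-- Degree at least n becomes a finite sum of homogeneous forms. Each summand must lie in `Hinf` on
solutions, since differentiation and ℍ are distributed over the sum. The equations used in `congr`
are absorbed by comparing values on solutions only. -/
theorem Deg.exists_sumForm {n : ℕ} {X : Wave → ℝ → ℝ → ℂ} (hX : Deg n X) :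
    ∃ F, SumForm n F ∧ ∀ s : Sol, ∀ t ∈ s.I, X s.S t = F (s.S.V t) (s.S.W t) := by
  induction hX with
  | V => exact ⟨_, .form .fst le_rfl fun s t ht => s.sdec_V.hinf s.isOpen ht, fun _ _ _ => rfl⟩
  | W => exact ⟨_, .form .snd le_rfl fun s t ht => s.sdec_W.hinf s.isOpen ht, fun _ _ _ => rfl⟩
  | smul c _ ih =>
    obtain ⟨F, hF, e⟩ := ih
    obtain ⟨G, hG, e'⟩ := hF.smul c
    exact ⟨G, hG, fun s t ht => by rw [e' s t ht]; beta_reduce; rw [e s t ht]⟩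
  | add _ _ ih ih' =>
    obtain ⟨F, hF, e⟩ := ih
    obtain ⟨G, hG, e'⟩ := ih'
    exact ⟨_, hF.add hG, fun s t ht => by beta_reduce; rw [e' s t ht, e s t ht]⟩
  | mul _ _ ih ih' =>
    obtain ⟨F, hF, e⟩ := ih
    obtain ⟨G, hG, e'⟩ := ih'
    obtain ⟨K, hK, e''⟩ := hF.mul hG
    exact ⟨K, hK, fun s t ht => by rw [e'' s t ht]; beta_reduce; rw [e' s t ht, e s t ht]⟩
  | conj _ ih =>
    obtain ⟨F, hF, e⟩ := ih
    obtain ⟨G, hG, e'⟩ := hF.conj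
    exact ⟨G, hG, fun s t ht => by rw [e' s t ht]; beta_reduce; rw [e s t ht]⟩
  | dx _ ih =>
    obtain ⟨F, hF, e⟩ := ih
    obtain ⟨G, hG, e'⟩ := hF.diff
    exact ⟨G, hG, fun s t ht => by rw [e' s t ht]; beta_reduce; rw [← e s t ht]; rfl⟩
  | hilbert _ ih =>
    obtain ⟨F, hF, e⟩ := ih
    obtain ⟨G, hG, e'⟩ := hF.hilb
    exact ⟨G, hG, fun s t ht => by rw [e' s t ht]; beta_reduce; rw [← e s t ht]⟩
  | mono _ h ih =>
    obtain ⟨F, hF, e⟩ := ih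
    exact ⟨F, hF.mono h, e⟩
  | congr _ h ih =>
    obtain ⟨F, hF, e⟩ := ih
    exact ⟨F, hF, fun s t ht => by rw [← e s t ht]; exact ((h s).slice ht).symm⟩

namespace IsQuintic

variable {X Y : Wave → ℝ → ℝ}

theorem congr (hX : IsQuintic X) (h : ∀ s : Sol, ∀ t ∈ s.I, Y s.S t = X s.S t) : IsQuintic Y := by
  obtain ⟨N, d, F, h1, h2⟩ := hX
  exact ⟨N, d, F, h1, fun S I hI hS t ht =>
    ⟨(h2 S I hI hS t ht).1, (h ⟨S, I, hI, hS⟩ t ht).trans (h2 S I hI hS t ht).2⟩⟩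

theorem add (hX : IsQuintic X) (hY : IsQuintic Y) : IsQuintic (fun S t => X S t + Y S t) := by
  obtain ⟨N, d, F, h1, h2⟩ := hX
  obtain ⟨N', d', F', h1', h2'⟩ := hY
  refine ⟨N + N', Fin.append d d', Fin.append F F', fun i => ?_, fun S I hI hS t ht => ⟨fun i => ?_, ?_⟩⟩
  · refine Fin.addCases (fun i => ?_) (fun i => ?_) i
    · simpa using h1 i
    · simpa using h1' i
  · refine Fin.addCases (fun i => ?_) (fun i => ?_) i
    · simpa using (h2 S I hI hS t ht).1 i
    · simpa using (h2' S I hI hS t ht).1 i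
  · beta_reduce
    rw [Fin.sum_univ_add, (h2 S I hI hS t ht).2, (h2' S I hI hS t ht).2]
    simp

theorem smul (c : ℝ) (hX : IsQuintic X) : IsQuintic (fun S t => c * X S t) := by
  obtain ⟨N, d, F, h1, h2⟩ := hX
  refine ⟨N, d, fun i v w x => c * F i v w x, fun i => ⟨(h1 i).1, (h1 i).2.smul c⟩,
    fun S I hI hS t ht => ⟨fun i => ((h2 S I hI hS t ht).1 i).const_mul _, ?_⟩⟩
  beta_reduce
  rw [(h2 S I hI hS t ht).2, Finset.mul_sum]
  refine Finset.sum_congr rfl fun i _ => ?_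
  rw [integral_const_mul, Complex.re_ofReal_mul]

theorem zero : IsQuintic (fun _ _ => 0) :=
  ⟨0, Fin.elim0, fun i => i.elim0, fun i => i.elim0, fun _ _ _ _ _ _ => ⟨fun i => i.elim0, by simp⟩⟩

theorem neg (hX : IsQuintic X) : IsQuintic (fun S t => -X S t) :=
  (hX.smul (-1)).congr fun _ _ _ => by ring

theorem sub (hX : IsQuintic X) (hY : IsQuintic Y) : IsQuintic (fun S t => X S t - Y S t) :=
  (hX.add hY.neg).congr fun _ _ _ => by ring

theorem sum {ι : Type*} (A : Finset ι) {X : ι → Wave → ℝ → ℝ} (h : ∀ i ∈ A, IsQuintic (X i)) :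
    IsQuintic (fun S t => ∑ i ∈ A, X i S t) := by
  classical
  induction A using Finset.induction_on with
  | empty => simpa using zero
  | insert a A ha ih =>
    simp only [Finset.sum_insert ha]
    exact (h a (Finset.mem_insert_self _ _)).add (ih fun i hi => h i (Finset.mem_insert_of_mem hi))

end IsQuintic

theorem isQuintic_of_form {m : ℕ} {F : (ℝ → ℂ) → (ℝ → ℂ) → ℝ → ℂ} (hm : 5 ≤ m) (hF : IsForm m F)
    (h : ∀ s : Sol, ∀ t ∈ s.I, Integrable (F (s.S.V t) (s.S.W t))) :
    IsQuintic (fun S t => (∫ x, F (S.V t) (S.W t) x).re) :=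
  ⟨1, fun _ => m, fun _ => F, fun _ => ⟨hm, hF⟩, fun S I hI hS t ht =>
    ⟨fun _ => h ⟨S, I, hI, hS⟩ t ht, by simp⟩⟩

theorem SumForm.isQuintic {m n : ℕ} {F G : (ℝ → ℂ) → (ℝ → ℂ) → ℝ → ℂ} (hF : SumForm m F)
    (hG : SumForm n G) (h : 5 ≤ m + n) :
    IsQuintic (fun S t => (∫ x, F (S.V t) (S.W t) x * G (S.V t) (S.W t) x).re) := by
  induction hF with
  | form h1 h2 h3 =>
    induction hG with
    | form k1 k2 k3 =>
      exact isQuintic_of_form (h.trans (Nat.add_le_add h2 k2)) (h1.mul k1)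
        fun s t ht => (h3 s t ht).integrable_mul (k3 s t ht)
    | add k k' ih ih' =>
      refine ((ih h).add (ih' h)).congr fun s t ht => ?_
      simp only [mul_add]
      rw [integral_add ((h3 s t ht).integrable_mul (k.hinf s ht))
        ((h3 s t ht).integrable_mul (k'.hinf s ht)), Complex.add_re]
  | add k k' ih ih' =>
    refine ((ih h).add (ih' h)).congr fun s t ht => ?_
    simp only [add_mul]
    rw [integral_add ((k.hinf s ht).integrable_mul (hG.hinf s ht))
        ((k'.hinf s ht).integrable_mul (hG.hinf s ht)), Complex.add_re]

theorem Deg.isQuintic {m n : ℕ} {X Y : Wave → ℝ → ℝ → ℂ} (hX : Deg m X) (hY : Deg n Y)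
    (h : 5 ≤ m + n) : IsQuintic (fun S t => (∫ x, X S t x * Y S t x).re) := by
  obtain ⟨F, hF, eF⟩ := hX.exists_sumForm
  obtain ⟨G, hG, eG⟩ := hY.exists_sumForm
  exact (hF.isQuintic hG h).congr fun s t ht => by rw [eF s t ht, eG s t ht]

/-! ### Products of three differences -/

/-- Bounded Lipschitz functions. -/
structure Lip (M : ℝ) (f : ℝ → ℂ) : Prop where
  bdd : ∀ x, ‖f x‖ ≤ M
  lip : ∀ x y, ‖f x - f y‖ ≤ M * |x - y|

theorem Lip.nonneg {M : ℝ} {f : ℝ → ℂ} (hf : Lip M f) : 0 ≤ M := (norm_nonneg _).trans (hf.bdd 0)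

theorem Lip.sub_le {M : ℝ} {f : ℝ → ℂ} (hf : Lip M f) (x y : ℝ) : ‖f x - f y‖ ≤ 2 * M :=
  (norm_sub_le _ _).trans (by linarith [hf.bdd x, hf.bdd y])

theorem Lip.div_le {M : ℝ} {f : ℝ → ℂ} (hf : Lip M f) (x y : ℝ) :
    ‖(f x - f y) / ((x : ℂ) - y)‖ ≤ M := by
  rw [norm_div, show ‖((x : ℂ) - y)‖ = |x - y| by rw [← Complex.ofReal_sub, Complex.norm_real,
    Real.norm_eq_abs]]
  exact div_le_of_le_mul₀ (abs_nonneg _) hf.nonneg (hf.lip x y)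

/-- The kernel dominating products of difference quotients. -/
def ker (u : ℝ) : ℝ := (1 + u ^ 2)⁻¹

theorem ker_nonneg (u : ℝ) : 0 ≤ ker u := by unfold ker; positivity

theorem integrable_ker : Integrable ker := integrable_inv_one_add_sq

theorem norm_ofReal_sub (x y : ℝ) : ‖((x : ℂ) - y)‖ = |x - y| := by
  rw [← Complex.ofReal_sub, Complex.norm_real, Real.norm_eq_abs]

/-- |δf δg| is at most MN(x−y)² and also at most 4MN, so |δf δg|(1 + (x−y)²) ≤ 5MN(x−y)². Two
differences thus absorb the singularity and provide integrability at infinity. -/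
theorem norm_two_div_le {M N : ℝ} {f g : ℝ → ℂ} (hf : Lip M f) (hg : Lip N g) (x y : ℝ) :
    ‖(f x - f y) * (g x - g y) / ((x : ℂ) - y) ^ 2‖ ≤ 5 * (M * N) * ker (x - y) := by
  have hM := hf.nonneg
  have hN := hg.nonneg
  rw [norm_div, norm_pow, norm_ofReal_sub, sq_abs, norm_mul, ker]
  have h1 : ‖f x - f y‖ * ‖g x - g y‖ ≤ (M * N) * (x - y) ^ 2 := by
    calc _ ≤ (M * |x - y|) * (N * |x - y|) := by
            gcongr
            · exact hf.lip x y
            · exact hg.lip x y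
      _ = (M * N) * |x - y| ^ 2 := by ring
      _ = _ := by rw [sq_abs]
  have h2 : ‖f x - f y‖ * ‖g x - g y‖ ≤ 4 * (M * N) := by
    calc _ ≤ (2 * M) * (2 * N) := by
            gcongr
            · exact hf.sub_le x y
            · exact hg.sub_le x y
      _ = _ := by ring
  refine div_le_of_le_mul₀ (sq_nonneg _) (by positivity) ?_
  have h3 : 0 < 1 + (x - y) ^ 2 := by positivity
  rw [show 5 * (M * N) * (1 + (x - y) ^ 2)⁻¹ * (x - y) ^ 2 =
    (5 * (M * N) * (x - y) ^ 2) / (1 + (x - y) ^ 2) by rw [div_eq_mul_inv]; ring, le_div_iff₀ h3]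
  nlinarith [sq_nonneg (x - y)]

/-- `δf δg δh`. -/
def dprod (f g h : ℝ → ℂ) (x y : ℝ) : ℂ := (f x - f y) * (g x - g y) * (h x - h y)

theorem dprod_swap (f g h : ℝ → ℂ) (x y : ℝ) : dprod f g h y x = -dprod f g h x y := by
  unfold dprod; ring

theorem norm_dprod_div_le {M N L : ℝ} {f g h : ℝ → ℂ} (hf : Lip M f) (hg : Lip N g)
    {x y : ℝ} (hh : ‖h x - h y‖ ≤ L) :
    ‖dprod f g h x y / ((x : ℂ) - y) ^ 2‖ ≤ 5 * (M * N) * L * ker (x - y) := by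
  rw [dprod, mul_div_right_comm, norm_mul]
  have h1 := norm_two_div_le hf hg x y
  have hM := hf.nonneg
  have hN := hg.nonneg
  calc _ ≤ (5 * (M * N) * ker (x - y)) * L :=
        mul_le_mul h1 hh (norm_nonneg _) (mul_nonneg (by positivity) (ker_nonneg _))
    _ = _ := by ring

theorem norm_dprod_div_cube_le {M N L : ℝ} {f g h : ℝ → ℂ} (hf : Lip M f) (hg : Lip N g)
    (hh : Lip L h) (x y : ℝ) :
    ‖dprod f g h x y / ((x : ℂ) - y) ^ 3‖ ≤ 5 * (M * N) * L * ker (x - y) := by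
  rw [dprod, pow_succ, mul_div_mul_comm, norm_mul]
  have hM := hf.nonneg
  have hN := hg.nonneg
  calc _ ≤ (5 * (M * N) * ker (x - y)) * L :=
        mul_le_mul (norm_two_div_le hf hg x y) (hh.div_le x y) (norm_nonneg _)
          (mul_nonneg (by positivity) (ker_nonneg _))
    _ = _ := by ring

theorem Hinf.lip {f : ℝ → ℂ} (hf : Hinf f) : ∃ M, Lip M f := by
  obtain ⟨A, hA⟩ := hf.bounded
  obtain ⟨B, hB⟩ := hf.deriv.bounded
  refine ⟨max A B, fun x => (hA x).trans (le_max_left _ _), fun x y => ?_⟩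
  refine (lipschitz_of_deriv_bound hf.differentiable hB x y).trans ?_
  gcongr
  exact le_max_right _ _

/-! ### Integrable majorants -/

theorem integrable_ker_mul_snd {ψ : ℝ → ℝ} (hψ : Integrable ψ) :
    Integrable (fun p : ℝ × ℝ => ψ p.2 * ker (p.1 - p.2)) :=
  hψ.convolution_integrand (ContinuousLinearMap.mul ℝ ℝ) integrable_ker

theorem integrable_ker_mul_fst {ψ : ℝ → ℝ} (hψ : Integrable ψ) :
    Integrable (fun p : ℝ × ℝ => ψ p.1 * ker (p.1 - p.2)) := by
  have h := (integrable_ker_mul_snd hψ).swap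
  refine h.congr (Eventually.of_forall fun p => ?_)
  simp only [Function.comp_apply, Prod.fst_swap, Prod.snd_swap, ker]
  congr 2; ring

theorem integrable_maj {φ χ : ℝ → ℝ} (hφ : MemLp φ 2) (hχ : MemLp χ 2) (C : ℝ) :
    Integrable (fun p : ℝ × ℝ => C * (φ p.1 ^ 2 + χ p.1 ^ 2 + χ p.2 ^ 2) * ker (p.1 - p.2)) := by
  have h1 := integrable_ker_mul_fst hφ.integrable_sq
  have h2 := integrable_ker_mul_fst hχ.integrable_sq
  have h3 := integrable_ker_mul_snd hχ.integrable_sq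
  refine (((h1.add h2).add h3).const_mul C).congr (Eventually.of_forall fun p => ?_)
  simp only [Pi.add_apply]; ring

/-- Two differences give the integrable kernel; v times the third difference is bounded by squares
of v and h, integrable against `ker (x - y)` in the plane. -/
theorem norm_quad_le {M N A B B' : ℝ} {v f g h : ℝ → ℂ} (hf : Lip M f) (hg : Lip N g) {x y : ℝ}
    (hv : ‖v x‖ ≤ A) (hh : ‖h x‖ ≤ B) (hh' : ‖h y‖ ≤ B') :
    ‖v x * dprod f g h x y / ((x : ℂ) - y) ^ 2‖ ≤
      5 * (M * N) * (A ^ 2 + B ^ 2 + B' ^ 2) * ker (x - y) := by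
  have hM := hf.nonneg
  have hN := hg.nonneg
  have hA := (norm_nonneg _).trans hv
  have h1 : ‖h x - h y‖ ≤ B + B' := (norm_sub_le _ _).trans (add_le_add hh hh')
  have hB := (norm_nonneg _).trans h1
  rw [mul_div_assoc, norm_mul]
  calc _ ≤ A * (5 * (M * N) * (B + B') * ker (x - y)) :=
        mul_le_mul hv (norm_dprod_div_le hf hg h1) (norm_nonneg _) hA
    _ = (5 * (M * N) * ker (x - y)) * (A * (B + B')) := by ring
    _ ≤ (5 * (M * N) * ker (x - y)) * (A ^ 2 + B ^ 2 + B' ^ 2) := by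
        refine mul_le_mul_of_nonneg_left ?_ (mul_nonneg (by positivity) (ker_nonneg _))
        nlinarith [sq_nonneg (A - B), sq_nonneg (A - B'), sq_nonneg B, sq_nonneg B', sq_nonneg A]
    _ = _ := by ring

theorem measurable_dprod_div {f g h : ℝ → ℂ} (hf : Continuous f) (hg : Continuous g)
    (hh : Continuous h) (n : ℕ) :
    Measurable (fun p : ℝ × ℝ => dprod f g h p.1 p.2 / ((p.1 : ℂ) - p.2) ^ n) := by
  unfold dprod
  refine Measurable.div (Continuous.measurable (by fun_prop)) (Continuous.measurable (by fun_prop))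

/-! ### The one-dimensional singular integral -/

/-- `∫ M(x, y) / (x - y)² dy`. -/
def rowInt (M : ℝ → ℝ → ℂ) (x : ℝ) : ℂ := ∫ y, M x y / ((x : ℂ) - y) ^ 2

theorem integrable_ker_comp (x : ℝ) : Integrable (fun y => ker (x - y)) :=
  integrable_ker.comp_sub_left x

theorem integrable_dprod_row {f g h : ℝ → ℂ} (hf : Hinf f) (hg : Hinf g) (hh : Hinf h) (x : ℝ) :
    Integrable (fun y => dprod f g h x y / ((x : ℂ) - y) ^ 2) := by
  obtain ⟨M, hM⟩ := hf.lip
  obtain ⟨N, hN⟩ := hg.lip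
  obtain ⟨L, hL⟩ := hh.lip
  refine ((integrable_ker_comp x).const_mul (5 * (M * N) * (2 * L))).mono' ?_
    (Eventually.of_forall fun y => norm_dprod_div_le hM hN (hL.sub_le x y))
  exact ((measurable_dprod_div hf.continuous hg.continuous hh.continuous 2).comp
    measurable_prodMk_left).aestronglyMeasurable

/-- Every term is a function of x times the increment of a single function, the shape required by
`integral_second_diff`. -/
theorem dprod_expand (f g h : ℝ → ℂ) (x y : ℝ) : dprod f g h x y =
    (f x * g x * h x - f y * g y * h y) - f x * (g x * h x - g y * h y) -
      g x * (f x * h x - f y * h y) - h x * (f x * g x - f y * g y) +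
      f x * g x * (h x - h y) + f x * h x * (g x - g y) + g x * h x * (f x - f y) := by
  unfold dprod; ring

/-- The second difference quotient integrates to the Hilbert transform of the derivative. -/
theorem integral_second_diff (f : HInf) (x : ℝ) :
    IntegrableOn (fun u : ℝ => (2 * f x - f (x - u) - f (x + u)) / (u : ℂ) ^ 2) (Set.Ioi 0) ∧
    ∫ u in Set.Ioi (0 : ℝ), (2 * f x - f (x - u) - f (x + u)) / (u : ℂ) ^ 2 =
      Real.pi * Complex.I * HInf.H (HInf.d f) x := by
  set p : ℝ → ℂ := fun u => 2 * f x - f (x - u) - f (x + u) with hp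
  set p' : ℝ → ℂ := fun u => HInf.d f (x - u) - HInf.d f (x + u) with hp'
  have hpd : ∀ u, HasDerivAt p (p' u) u := by
    intro u
    have h1 := (f.2.hasDerivAt (x - u)).comp_const_sub x u
    have h2 := (f.2.hasDerivAt (x + u)).comp_const_add x u
    refine ((h1.const_sub (2 * f x)).sub h2).congr_deriv ?_
    simp only [hp', HInf.d_apply]; ring
  obtain ⟨M, hM⟩ := f.2.lip
  obtain ⟨N, hN⟩ := (HInf.d f).2.lip
  have hb1 : ∀ u, ‖p u‖ ≤ 4 * M := fun u => by
    have : p u = (f x - f (x - u)) + (f x - f (x + u)) := by simp only [hp]; ring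
    rw [this]
    exact (norm_add_le _ _).trans (by linarith [hM.sub_le x (x - u), hM.sub_le x (x + u)])
  have hb2 : ∀ u, ‖p' u‖ ≤ 2 * N * |u| := fun u => by
    refine (hN.lip _ _).trans (le_of_eq ?_)
    rw [show x - u - (x + u) = -(2 * u) by ring, abs_neg, abs_mul, abs_two]; ring
  have hp0 : p 0 = 0 := by simp only [hp, sub_zero, add_zero]; ring
  have hb3 : ∀ u, 0 ≤ u → ‖p u‖ ≤ 2 * N * u ^ 2 := by
    intro u hu
    have h := (convex_Icc 0 u).norm_image_sub_le_of_norm_hasDerivWithin_le (f := p) (f' := p')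
      (C := 2 * N * u) (x := 0) (y := u) (fun w hw => (hpd w).hasDerivWithinAt) (fun w hw => by
        refine (hb2 w).trans ?_
        rw [abs_of_nonneg hw.1]
        have := hN.nonneg
        have := hw.2
        gcongr) (Set.left_mem_Icc.2 hu) (Set.right_mem_Icc.2 hu)
    rw [hp0, sub_zero, sub_zero, Real.norm_of_nonneg hu] at h
    linarith [h]
  have hN0 := hN.nonneg
  have hM0 := hM.nonneg
  have hpc : Continuous p := continuous_iff_continuousAt.2 fun u => (hpd u).continuousAt
  have hint : IntegrableOn (fun u : ℝ => p u / (u : ℂ) ^ 2) (Set.Ioi 0) := by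
    refine ((integrable_ker.const_mul (2 * N + 4 * M)).integrableOn).mono' ?_ ?_
    · exact (hpc.measurable.div (Continuous.measurable (by fun_prop))).aestronglyMeasurable
    · filter_upwards [self_mem_ae_restrict measurableSet_Ioi] with u hu
      have hu' : (0 : ℝ) < u := hu
      rw [norm_div, norm_pow, Complex.norm_real, Real.norm_eq_abs, sq_abs, ker]
      rw [div_le_iff₀ (by positivity), mul_assoc, mul_comm _ (u ^ 2), ← mul_assoc,
        ← div_eq_mul_inv, le_div_iff₀ (by positivity)]
      nlinarith [hb1 u, hb3 u hu'.le, sq_nonneg u]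
  refine ⟨hint, ?_⟩
  have hint' : IntegrableOn (fun u : ℝ => p' u / (u : ℂ)) (Set.Ioi 0) :=
    (HInf.d f).2.reg.integrableOn_symm x
  -- Integration by parts through the primitive p/u: its derivative is the difference of the two
  -- integrands. It vanishes at 0 because p = O(u²), and at infinity because p is bounded.
  have hq : ∀ u ∈ Set.Ioi (0 : ℝ), HasDerivAt (fun u : ℝ => p u / (u : ℂ))
      (p' u / (u : ℂ) - p u / (u : ℂ) ^ 2) u := by
    intro u hu
    have hu' : (u : ℂ) ≠ 0 := Complex.ofReal_ne_zero.2 (ne_of_gt hu)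
    refine ((hpd u).div (Complex.ofRealCLM.hasDerivAt (x := u)) hu').congr_deriv ?_
    simp only [Complex.ofRealCLM_apply, Complex.ofReal_one]
    field_simp
  have h0 : Tendsto (fun u : ℝ => p u / (u : ℂ)) (𝓝[>] 0) (𝓝 0) := by
    refine squeeze_zero_norm' (a := fun u => 2 * N * u) ?_ ?_
    · filter_upwards [self_mem_nhdsWithin] with u hu
      have hu' : (0 : ℝ) < u := hu
      rw [norm_div, Complex.norm_real, Real.norm_of_nonneg hu'.le, div_le_iff₀ hu']
      calc _ ≤ _ := hb3 u hu'.le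
        _ = _ := by ring
    · have : Tendsto (fun u : ℝ => 2 * N * u) (𝓝 0) (𝓝 (2 * N * 0)) :=
        (continuous_const.mul continuous_id).tendsto 0
      rw [mul_zero] at this
      exact this.mono_left nhdsWithin_le_nhds
  have hinf : Tendsto (fun u : ℝ => p u / (u : ℂ)) atTop (𝓝 0) := by
    refine squeeze_zero_norm' (a := fun u => 4 * M * u⁻¹) ?_ ?_
    · filter_upwards [eventually_gt_atTop 0] with u hu
      rw [norm_div, Complex.norm_real, Real.norm_of_nonneg hu.le, div_eq_mul_inv]
      have := hb1 u
      gcongr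
    · simpa using (tendsto_inv_atTop_zero (𝕜 := ℝ)).const_mul (4 * M)
  have hmain := integral_Ioi_of_hasDerivAt_of_tendsto (a := (0 : ℝ)) (m := 0)
    (f := fun u : ℝ => p u / (u : ℂ)) (f' := fun u => p' u / (u : ℂ) - p u / (u : ℂ) ^ 2)
    (by
      refine continuousWithinAt_Ioi_iff_Ici.1 ?_
      simpa [ContinuousWithinAt] using h0)
    hq (hint'.sub hint) hinf
  rw [integral_sub hint' hint] at hmain
  have hH : HInf.H (HInf.d f) x = 1 / (Real.pi * Complex.I) *
      ∫ u in Set.Ioi (0 : ℝ), p' u / (u : ℂ) := (HInf.d f).2.reg.hilbert_eq x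
  rw [hH]
  have hpi : (Real.pi : ℂ) * Complex.I ≠ 0 :=
    mul_ne_zero (Complex.ofReal_ne_zero.2 Real.pi_ne_zero) Complex.I_ne_zero
  rw [← mul_assoc, mul_one_div_cancel hpi, one_mul]
  simp only [Complex.ofReal_zero, div_zero, sub_zero] at hmain
  exact (sub_eq_zero.1 hmain).symm

/-- A single increment over (x−y)² need not be integrable at the diagonal, so the row is folded at y
= x before expanding. Each of the seven increments then becomes a second difference. -/
theorem rowInt_dprod (f g h : HInf) (x : ℝ) :
    rowInt (dprod f g h) x = Real.pi * Complex.I * HInf.tri f g h x := by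
  have hint := integrable_dprod_row f.2 g.2 h.2 x
  rw [rowInt, ← integral_sub_left_eq_self _ volume x, integral_eq_half_line (hint.comp_sub_left x)]
  have e : ∀ u : ℝ, dprod f g h x (x - u) / ((x : ℂ) - (x - u : ℝ)) ^ 2 +
      dprod f g h x (x - -u) / ((x : ℂ) - (x - -u : ℝ)) ^ 2 =
      (2 * (f * g * h) x - (f * g * h) (x - u) - (f * g * h) (x + u)) / (u : ℂ) ^ 2
      - f x * ((2 * (g * h) x - (g * h) (x - u) - (g * h) (x + u)) / (u : ℂ) ^ 2)
      - g x * ((2 * (f * h) x - (f * h) (x - u) - (f * h) (x + u)) / (u : ℂ) ^ 2)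
      - h x * ((2 * (f * g) x - (f * g) (x - u) - (f * g) (x + u)) / (u : ℂ) ^ 2)
      + f x * g x * ((2 * h x - h (x - u) - h (x + u)) / (u : ℂ) ^ 2)
      + f x * h x * ((2 * g x - g (x - u) - g (x + u)) / (u : ℂ) ^ 2)
      + g x * h x * ((2 * f x - f (x - u) - f (x + u)) / (u : ℂ) ^ 2) := by
    intro u
    rw [sub_neg_eq_add]
    simp only [dprod_expand, HInf.mul_apply]
    push_cast
    rw [show (x : ℂ) - (x - u) = u by ring, show (x : ℂ) - (x + u) = -u by ring, neg_sq]
    ring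
  simp only [e]
  have i1 := (integral_second_diff (f * g * h) x)
  have i2 := (integral_second_diff (g * h) x)
  have i3 := (integral_second_diff (f * h) x)
  have i4 := (integral_second_diff (f * g) x)
  have i5 := (integral_second_diff h x)
  have i6 := (integral_second_diff g x)
  have i7 := (integral_second_diff f x)
  have hadd : ∀ {p q : ℝ → ℂ} {A B : ℂ},
      (IntegrableOn p (Set.Ioi 0) ∧ ∫ u in Set.Ioi (0 : ℝ), p u = A) →
      (IntegrableOn q (Set.Ioi 0) ∧ ∫ u in Set.Ioi (0 : ℝ), q u = B) →
      (IntegrableOn (fun u => p u + q u) (Set.Ioi 0) ∧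
        ∫ u in Set.Ioi (0 : ℝ), (p u + q u) = A + B) := fun hp hq =>
    ⟨hp.1.add hq.1, by rw [integral_add hp.1 hq.1, hp.2, hq.2]⟩
  have hsub : ∀ {p q : ℝ → ℂ} {A B : ℂ},
      (IntegrableOn p (Set.Ioi 0) ∧ ∫ u in Set.Ioi (0 : ℝ), p u = A) →
      (IntegrableOn q (Set.Ioi 0) ∧ ∫ u in Set.Ioi (0 : ℝ), q u = B) →
      (IntegrableOn (fun u => p u - q u) (Set.Ioi 0) ∧
        ∫ u in Set.Ioi (0 : ℝ), (p u - q u) = A - B) := fun hp hq =>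
    ⟨hp.1.sub hq.1, by rw [integral_sub hp.1 hq.1, hp.2, hq.2]⟩
  have hmul : ∀ (c : ℂ) {p : ℝ → ℂ} {A : ℂ},
      (IntegrableOn p (Set.Ioi 0) ∧ ∫ u in Set.Ioi (0 : ℝ), p u = A) →
      (IntegrableOn (fun u => c * p u) (Set.Ioi 0) ∧
        ∫ u in Set.Ioi (0 : ℝ), c * p u = c * A) := fun c _ _ hp =>
    ⟨hp.1.const_mul c, by rw [integral_const_mul, hp.2]⟩
  rw [(hadd (hadd (hadd (hsub (hsub (hsub i1 (hmul _ i2)) (hmul _ i3)) (hmul _ i4))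
    (hmul _ i5)) (hmul _ i6)) (hmul _ i7)).2]
  simp only [HInf.tri, HInf.add_apply, HInf.sub_apply, HInf.mul_apply]
  ring

/-! ### Integration by parts against the kernel `(x - y)⁻²` -/

/-- The `x`-derivative of `m δf δg δh / (x - y)²`, off the diagonal. -/
def kerDeriv (m f g h : ℝ → ℂ) (x y : ℝ) : ℂ :=
  (deriv m x * dprod f g h x y + m x * (deriv f x * ((g x - g y) * (h x - h y)) +
    deriv g x * ((h x - h y) * (f x - f y)) + deriv h x * ((f x - f y) * (g x - g y)))) /
      ((x : ℂ) - y) ^ 2 - 2 * m x * (dprod f g h x y / ((x : ℂ) - y) ^ 3)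

/-- The constant does not depend on the multiplier m, which later is c·v in one variable and c alone
in the other. -/
theorem norm_kerDeriv_le {f g h : ℝ → ℂ} (hf : Hinf f) (hg : Hinf g) (hh : Hinf h) :
    ∃ C, 0 ≤ C ∧ ∀ (m : ℝ → ℂ) (x y : ℝ),
      ‖kerDeriv m f g h x y‖ ≤ C * (‖m x‖ + ‖deriv m x‖) * ker (x - y) := by
  obtain ⟨M, hM⟩ := hf.lip
  obtain ⟨N, hN⟩ := hg.lip
  obtain ⟨L, hL⟩ := hh.lip
  obtain ⟨M', hM'⟩ := hf.deriv.lip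
  obtain ⟨N', hN'⟩ := hg.deriv.lip
  obtain ⟨L', hL'⟩ := hh.deriv.lip
  have a1 := hM.nonneg
  have a2 := hN.nonneg
  have a3 := hL.nonneg
  have b1 := hM'.nonneg
  have b2 := hN'.nonneg
  have b3 := hL'.nonneg
  set c0 : ℝ := 5 * (M * N) * (2 * L) with hc0
  set c1 : ℝ := M' * (5 * (N * L)) + N' * (5 * (L * M)) + L' * (5 * (M * N)) with hc1
  set c2 : ℝ := 5 * (M * N) * L with hc2
  have p0 : 0 ≤ c0 := by positivity
  have p1 : 0 ≤ c1 := by positivity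
  have p2 : 0 ≤ c2 := by positivity
  refine ⟨c0 + c1 + 2 * c2, by positivity, fun m x y => ?_⟩
  have hk := ker_nonneg (x - y)
  have e0 := norm_dprod_div_le hM hN (hL.sub_le x y)
  have e2 := norm_dprod_div_cube_le hM hN hL x y
  have aux : ∀ {d p q : ℝ → ℂ} {D P Q : ℝ}, Lip D d → Lip P p → Lip Q q →
      ‖d x * ((p x - p y) * (q x - q y) / ((x : ℂ) - y) ^ 2)‖ ≤
        D * (5 * (P * Q)) * ker (x - y) := by
    intro d p q D P Q hd hp hq
    rw [norm_mul, mul_assoc]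
    exact mul_le_mul (hd.bdd x) (norm_two_div_le hp hq x y) (norm_nonneg _) hd.nonneg
  have e1 : ‖(deriv f x * ((g x - g y) * (h x - h y)) +
      deriv g x * ((h x - h y) * (f x - f y)) + deriv h x * ((f x - f y) * (g x - g y))) /
        ((x : ℂ) - y) ^ 2‖ ≤ c1 * ker (x - y) := by
    rw [add_div, add_div, mul_div_assoc (deriv f x), mul_div_assoc (deriv g x),
      mul_div_assoc (deriv h x)]
    refine (norm_add₃_le).trans ?_
    have := aux hM' hN hL
    have := aux hN' hL hM
    have := aux hL' hM hN
    rw [hc1]; linarith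
  have e : kerDeriv m f g h x y = deriv m x * (dprod f g h x y / ((x : ℂ) - y) ^ 2) +
      m x * ((deriv f x * ((g x - g y) * (h x - h y)) +
      deriv g x * ((h x - h y) * (f x - f y)) + deriv h x * ((f x - f y) * (g x - g y))) /
        ((x : ℂ) - y) ^ 2) + (-2) * (m x * (dprod f g h x y / ((x : ℂ) - y) ^ 3)) := by
    unfold kerDeriv; ring
  rw [e]
  refine (norm_add₃_le).trans ?_
  rw [norm_mul, norm_mul, norm_mul, norm_mul, norm_neg, Complex.norm_ofNat]
  have q0 := mul_le_mul_of_nonneg_left e0 (norm_nonneg (deriv m x))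
  have q1 := mul_le_mul_of_nonneg_left e1 (norm_nonneg (m x))
  have q2 := mul_le_mul_of_nonneg_left e2 (norm_nonneg (m x))
  rw [← hc0] at q0
  rw [← hc2] at q2
  have r : ∀ {z c : ℝ}, 0 ≤ z → 0 ≤ c → 0 ≤ z * c * ker (x - y) := fun hz hc =>
    mul_nonneg (mul_nonneg hz hc) hk
  have r1 := r (norm_nonneg (m x)) p0
  have r2 := r (norm_nonneg (deriv m x)) p1
  have r3 := r (norm_nonneg (deriv m x)) p2
  nlinarith [q0, q1, q2, r1, r2, r3]

theorem measurable_kerDeriv {m f g h : ℝ → ℂ} (hm : Hinf m) (hf : Hinf f) (hg : Hinf g)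
    (hh : Hinf h) : Measurable fun p : ℝ × ℝ => kerDeriv m f g h p.1 p.2 := by
  have := hm.continuous
  have := hf.continuous
  have := hg.continuous
  have := hh.continuous
  have := hm.deriv.continuous
  have := hf.deriv.continuous
  have := hg.deriv.continuous
  have := hh.deriv.continuous
  unfold kerDeriv dprod
  refine Measurable.sub (Measurable.div (Continuous.measurable (by fun_prop))
    (Continuous.measurable (by fun_prop))) (Measurable.mul (Continuous.measurable (by fun_prop))
    (Measurable.div (Continuous.measurable (by fun_prop))
    (Continuous.measurable (by fun_prop))))

theorem hasDerivAt_dprod_div {m f g h : ℝ → ℂ} (hm : Hinf m) (hf : Hinf f) (hg : Hinf g)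
    (hh : Hinf h) {x y : ℝ} (hxy : x ≠ y) :
    HasDerivAt (fun x : ℝ => m x * dprod f g h x y / ((x : ℂ) - y) ^ 2)
      (kerDeriv m f g h x y) x := by
  have hne : (x : ℂ) - y ≠ 0 := sub_ne_zero.2 fun e => hxy (Complex.ofReal_injective e)
  have h1 := ((hf.hasDerivAt x).sub_const (f y)).mul ((hg.hasDerivAt x).sub_const (g y))
  have h2 := (hm.hasDerivAt x).mul (h1.mul ((hh.hasDerivAt x).sub_const (h y)))
  have h3 := (((Complex.ofRealCLM.hasDerivAt (x := x)).sub_const (y : ℂ))).pow 2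
  refine (h2.div h3 (pow_ne_zero 2 hne)).congr_deriv ?_
  simp only [Complex.ofRealCLM_apply, Complex.ofReal_one, Pi.mul_apply, Pi.pow_apply, kerDeriv,
    dprod]
  field_simp
  ring

/-- With the convention 0/0 = 0 the function vanishes at x = y, and its difference quotient is m δf
δg δh/(x−y)³. So there is no boundary term at the diagonal. -/
theorem hasDerivAt_dprod_div_diag {m f g h : ℝ → ℂ} (hm : Hinf m) (hf : Hinf f) (hg : Hinf g)
    (hh : Hinf h) (y : ℝ) :
    HasDerivAt (fun x : ℝ => m x * dprod f g h x y / ((x : ℂ) - y) ^ 2)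
      (m y * (deriv f y * deriv g y * deriv h y)) y := by
  rw [hasDerivAt_iff_tendsto_slope]
  have h1 := (((hasDerivAt_iff_tendsto_slope.1 (hf.hasDerivAt y)).mul
    (hasDerivAt_iff_tendsto_slope.1 (hg.hasDerivAt y))).mul
    (hasDerivAt_iff_tendsto_slope.1 (hh.hasDerivAt y)))
  have h2 := ((hm.continuous.tendsto y).mono_left nhdsWithin_le_nhds).mul h1
  refine h2.congr' ?_
  filter_upwards [self_mem_nhdsWithin] with x hx
  have hne : (x : ℂ) - y ≠ 0 := sub_ne_zero.2 fun e => hx (Complex.ofReal_injective e)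
  simp only [slope_def_module, Complex.real_smul, Complex.ofReal_inv, Complex.ofReal_sub, dprod,
    sub_self, mul_zero, zero_div, sub_zero]
  field_simp

theorem integral_kerDeriv {m f g h : ℝ → ℂ} (hm : Hinf m) (hf : Hinf f) (hg : Hinf g)
    (hh : Hinf h) (y : ℝ) : ∫ x, kerDeriv m f g h x y = 0 := by
  set G : ℝ → ℂ := fun x => m x * dprod f g h x y / ((x : ℂ) - y) ^ 2 with hG
  have hd : ∀ x, DifferentiableAt ℝ G x := fun x => by
    by_cases hxy : x = y
    · subst hxy; exact (hasDerivAt_dprod_div_diag hm hf hg hh x).differentiableAt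
    · exact (hasDerivAt_dprod_div hm hf hg hh hxy).differentiableAt
  have hae : deriv G =ᵐ[volume] fun x => kerDeriv m f g h x y := by
    filter_upwards [compl_mem_ae_iff.2 (measure_singleton y)] with x hx
    exact (hasDerivAt_dprod_div hm hf hg hh hx).deriv
  have hker : Integrable fun x => ker (x - y) := integrable_ker.comp_sub_right y
  obtain ⟨A, hA⟩ := hm.bounded
  obtain ⟨B, hB⟩ := hm.deriv.bounded
  have hi1 : Integrable fun x => kerDeriv m f g h x y := by
    obtain ⟨C, hC, hle⟩ := norm_kerDeriv_le hf hg hh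
    refine (hker.const_mul (C * (A + B))).mono' ?_ (Eventually.of_forall fun x => ?_)
    · exact ((measurable_kerDeriv hm hf hg hh).comp measurable_prodMk_right).aestronglyMeasurable
    · refine (hle m x y).trans ?_
      have := ker_nonneg (x - y)
      gcongr
      · exact hA x
      · exact hB x
  have hi2 : Integrable G := by
    obtain ⟨M, hM⟩ := hf.lip
    obtain ⟨N, hN⟩ := hg.lip
    obtain ⟨L, hL⟩ := hh.lip
    refine (hker.const_mul (A * (5 * (M * N) * (2 * L)))).mono' ?_
      (Eventually.of_forall fun x => ?_)
    · exact (continuous_iff_continuousAt.2 fun x => (hd x).continuousAt).aestronglyMeasurable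
    · rw [hG]; dsimp only
      rw [mul_div_assoc, norm_mul, mul_assoc]
      exact mul_le_mul (hA x) (norm_dprod_div_le hM hN (hL.sub_le x y)) (norm_nonneg _)
        ((norm_nonneg _).trans (hA x))
  rw [← integral_congr_ae hae]
  exact integral_eq_zero_of_hasDerivAt_of_integrable (fun x => (hd x).hasDerivAt)
    (hi1.congr hae.symm) hi2

/-! ### Quadruple products -/

theorem integrable_quad {v f g h : ℝ → ℂ} (hv : Hinf v) (hf : Hinf f) (hg : Hinf g)
    (hh : Hinf h) :
    Integrable fun p : ℝ × ℝ => v p.1 * dprod f g h p.1 p.2 / ((p.1 : ℂ) - p.2) ^ 2 := by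
  obtain ⟨M, hM⟩ := hf.lip
  obtain ⟨N, hN⟩ := hg.lip
  refine (integrable_maj hv.memLp.norm hh.memLp.norm (5 * (M * N))).mono' ?_
    (Eventually.of_forall fun p => ?_)
  · simp only [mul_div_assoc]
    exact ((hv.continuous.measurable.comp measurable_fst).mul (measurable_dprod_div
      hf.continuous hg.continuous hh.continuous 2)).aestronglyMeasurable
  · exact norm_quad_le hM hN le_rfl le_rfl le_rfl

theorem integral_quad {v f g h : ℝ → ℂ} (hv : Hinf v) (hf : Hinf f) (hg : Hinf g)
    (hh : Hinf h) :
    ∫ p : ℝ × ℝ, v p.1 * dprod f g h p.1 p.2 / ((p.1 : ℂ) - p.2) ^ 2 =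
      ∫ x, v x * rowInt (dprod f g h) x := by
  have h := integral_prod _ (integrable_quad hv hf hg hh)
  rw [← Measure.volume_eq_prod] at h
  rw [h]
  refine integral_congr_ae (Eventually.of_forall fun x => ?_)
  dsimp only
  simp only [mul_div_assoc]
  rw [integral_const_mul, rowInt]

/-- `c'(x) + c'(y) - 2 (c(x) - c(y)) / (x - y)`. -/
def kap (c : ℝ → ℂ) (x y : ℝ) : ℂ :=
  deriv c x + deriv c y - 2 * ((c x - c y) / ((x : ℂ) - y))

/-- The divergence of (c(x), c(y)) F/(x−y)² is the transported term plus κ[c]F/(x−y)², and it has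
integral zero. The x-part is `kerDeriv` with multiplier c v. In the y-part v(x) is constant, and
reversing the antisymmetric triple product explains the minus sign. -/
theorem integrable_kap_quad {c v f g h : ℝ → ℂ} (hc : Hinf c) (hv : Hinf v) (hf : Hinf f)
    (hg : Hinf g) (hh : Hinf h) :
    Integrable (fun p : ℝ × ℝ => kap c p.1 p.2 * (v p.1 * dprod f g h p.1 p.2) /
      ((p.1 : ℂ) - p.2) ^ 2) ∧
    ∫ p : ℝ × ℝ, kap c p.1 p.2 * (v p.1 * dprod f g h p.1 p.2) / ((p.1 : ℂ) - p.2) ^ 2 =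
      -∫ p : ℝ × ℝ, (c p.1 * deriv v p.1 * dprod f g h p.1 p.2 + v p.1 *
        (dprod (fun x => c x * deriv f x) g h p.1 p.2 +
          dprod f (fun x => c x * deriv g x) h p.1 p.2 +
          dprod f g (fun x => c x * deriv h x) p.1 p.2)) / ((p.1 : ℂ) - p.2) ^ 2 := by
  obtain ⟨C, hC, hle⟩ := norm_kerDeriv_le hf hg hh
  have hcv := hc.mul hv
  have i1 : Integrable fun p : ℝ × ℝ => kerDeriv (fun x => c x * v x) f g h p.1 p.2 := by
    have hm : Integrable fun x => ‖c x * v x‖ + ‖deriv (fun x => c x * v x) x‖ := by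
      refine (hc.integrable_mul hv).norm.add (Integrable.norm ?_)
      refine ((hc.deriv.integrable_mul hv).add (hc.integrable_mul hv.deriv)).congr
        (Eventually.of_forall fun x => ?_)
      exact ((hc.hasDerivAt x).mul (hv.hasDerivAt x)).deriv.symm
    refine ((integrable_ker_mul_fst hm).const_mul C).mono'
      (measurable_kerDeriv hcv hf hg hh).aestronglyMeasurable
      (Eventually.of_forall fun p => (hle _ _ _).trans (le_of_eq ?_))
    ring
  have i2 : Integrable fun p : ℝ × ℝ => v p.1 * kerDeriv c f g h p.2 p.1 := by
    have hm1 := integrable_ker_mul_fst hv.memLp.norm.integrable_sq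
    have hm2 := integrable_ker_mul_snd hc.memLp.norm.integrable_sq
    have hm3 := integrable_ker_mul_snd hc.deriv.memLp.norm.integrable_sq
    refine (((hm1.add hm2).add hm3).const_mul C).mono' ?_ (Eventually.of_forall fun p => ?_)
    · exact ((hv.continuous.measurable.comp measurable_fst).mul
        ((measurable_kerDeriv hc hf hg hh).comp measurable_swap)).aestronglyMeasurable
    · rw [norm_mul]
      have hk : ker (p.2 - p.1) = ker (p.1 - p.2) := by unfold ker; congr 2; ring
      have h1 := mul_le_mul_of_nonneg_left (hle c p.2 p.1) (norm_nonneg (v p.1))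
      rw [hk] at h1
      refine h1.trans ?_
      have hk0 := mul_nonneg hC (ker_nonneg (p.1 - p.2))
      simp only [Pi.add_apply]
      have h2 : ‖v p.1‖ * (‖c p.2‖ + ‖deriv c p.2‖) ≤
          ‖v p.1‖ ^ 2 + ‖c p.2‖ ^ 2 + ‖deriv c p.2‖ ^ 2 := by
        nlinarith [sq_nonneg (‖v p.1‖ - ‖c p.2‖), sq_nonneg (‖v p.1‖ - ‖deriv c p.2‖),
          sq_nonneg ‖c p.2‖, sq_nonneg ‖deriv c p.2‖]
      nlinarith [mul_le_mul_of_nonneg_left h2 hk0]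
  have z1 : ∫ p : ℝ × ℝ, kerDeriv (fun x => c x * v x) f g h p.1 p.2 = 0 := by
    have h := integral_prod_symm _ i1
    rw [← Measure.volume_eq_prod] at h
    rw [h]
    simp only [integral_kerDeriv hcv hf hg hh, integral_zero]
  have z2 : ∫ p : ℝ × ℝ, v p.1 * kerDeriv c f g h p.2 p.1 = 0 := by
    have h := integral_prod _ i2
    rw [← Measure.volume_eq_prod] at h
    rw [h]
    simp only [integral_const_mul, integral_kerDeriv hc hf hg hh, mul_zero, integral_zero]
  have i3 : Integrable fun p : ℝ × ℝ => (c p.1 * deriv v p.1 * dprod f g h p.1 p.2 + v p.1 *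
        (dprod (fun x => c x * deriv f x) g h p.1 p.2 +
          dprod f (fun x => c x * deriv g x) h p.1 p.2 +
          dprod f g (fun x => c x * deriv h x) p.1 p.2)) / ((p.1 : ℂ) - p.2) ^ 2 := by
    refine ((((integrable_quad (hc.mul hv.deriv) hf hg hh).add
      (integrable_quad hv (hc.mul hf.deriv) hg hh)).add
      (integrable_quad hv hf (hc.mul hg.deriv) hh)).add
      (integrable_quad hv hf hg (hc.mul hh.deriv))).congr (Eventually.of_forall fun p => ?_)
    simp only [Pi.add_apply]
    ring
  have e : ∀ p : ℝ × ℝ, kap c p.1 p.2 * (v p.1 * dprod f g h p.1 p.2) / ((p.1 : ℂ) - p.2) ^ 2 =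
      kerDeriv (fun x => c x * v x) f g h p.1 p.2 - v p.1 * kerDeriv c f g h p.2 p.1 -
      (c p.1 * deriv v p.1 * dprod f g h p.1 p.2 + v p.1 *
        (dprod (fun x => c x * deriv f x) g h p.1 p.2 +
          dprod f (fun x => c x * deriv g x) h p.1 p.2 +
          dprod f g (fun x => c x * deriv h x) p.1 p.2)) / ((p.1 : ℂ) - p.2) ^ 2 := by
    rintro ⟨x, y⟩
    have hd : deriv (fun x => c x * v x) x = deriv c x * v x + c x * deriv v x :=
      ((hc.hasDerivAt x).mul (hv.hasDerivAt x)).deriv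
    by_cases hxy : x = y
    · subst hxy; simp [kerDeriv, dprod]
    have hne : (x : ℂ) - y ≠ 0 := sub_ne_zero.2 fun e => hxy (Complex.ofReal_injective e)
    have hne' : (y : ℂ) - x ≠ 0 := sub_ne_zero.2 fun e => hxy (Complex.ofReal_injective e).symm
    simp only [kap, kerDeriv, hd, dprod]
    rw [← neg_sub (x : ℂ) y]
    generalize (x : ℂ) - y = z at *
    field_simp
    ring
  constructor
  · exact ((i1.sub i2).sub i3).congr (Eventually.of_forall fun p => (e p).symm)
  · have h12 : Integrable fun p : ℝ × ℝ => kerDeriv (fun x => c x * v x) f g h p.1 p.2 -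
        v p.1 * kerDeriv c f g h p.2 p.1 := i1.sub i2
    simp only [e]
    rw [integral_sub h12 i3, integral_sub i1 i2, z1, z2, sub_zero, zero_sub]

/-! ### Derivations in two space variables -/

/-- Equality at all times of `I`. -/
def EqJ (I : Set ℝ) (F G : ℝ → ℝ → ℝ → ℂ) : Prop := ∀ t ∈ I, ∀ α β, F t α β = G t α β

/-- The vector field `τ ∂_t + c(α) ∂_α + c(β) ∂_β`. -/
def vf (τ : ℂ) (c : ℝ → ℝ → ℂ) (F : ℝ → ℝ → ℝ → ℂ) (t α β : ℝ) : ℂ :=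
  τ * deriv (fun s => F s α β) t + c t α * deriv (fun x => F t x β) α +
    c t β * deriv (fun y => F t α y) β

/-- The vector field `τ ∂_t + c ∂_x`. -/
def vf₁ (τ : ℂ) (c f : ℝ → ℝ → ℂ) (t x : ℝ) : ℂ := τ * dt f t x + c t x * dx f t x

/-- Multipliers of smooth decaying functions. -/
def Mult (I : Set ℝ) (c : ℝ → ℝ → ℂ) : Prop :=
  ∀ f, SDec I f → SDec I (fun t x => c t x * f t x)

/-- Sums of products of functions of `(t, α)` and functions of `(t, β)`. -/
inductive Two (I : Set ℝ) : (ℝ → ℝ → ℝ → ℂ) → Prop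
  | left {f : ℝ → ℝ → ℂ} (hf : SDec I f) : Two I (fun t α _ => f t α)
  | right {f : ℝ → ℝ → ℂ} (hf : SDec I f) : Two I (fun t _ β => f t β)
  | smul {F : ℝ → ℝ → ℝ → ℂ} (c : ℂ) (hF : Two I F) : Two I (fun t α β => c * F t α β)
  | add {F G : ℝ → ℝ → ℝ → ℂ} (hF : Two I F) (hG : Two I G) :
      Two I (fun t α β => F t α β + G t α β)
  | mul {F G : ℝ → ℝ → ℝ → ℂ} (hF : Two I F) (hG : Two I G) :
      Two I (fun t α β => F t α β * G t α β)
  | congr {F G : ℝ → ℝ → ℝ → ℂ} (hF : Two I F) (h : EqJ I F G) : Two I G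

section

variable {I : Set ℝ} {F G H : ℝ → ℝ → ℝ → ℂ}

theorem EqJ.symm (h : EqJ I F G) : EqJ I G F := fun t ht α β => (h t ht α β).symm

theorem EqJ.trans (h : EqJ I F G) (h' : EqJ I G H) : EqJ I F H :=
  fun t ht α β => (h t ht α β).trans (h' t ht α β)

theorem EqJ.vf (hI : IsOpen I) (h : EqJ I F G) (τ : ℂ) (c : ℝ → ℝ → ℂ) :
    EqJ I (vf τ c F) (vf τ c G) := fun t ht α β => by
  have h1 : (fun s => F s α β) =ᶠ[𝓝 t] fun s => G s α β := by
    filter_upwards [hI.mem_nhds ht] with s hs using h s hs α β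
  have h2 : (fun x => F t x β) = fun x => G t x β := funext fun x => h t ht x β
  have h3 : (fun y => F t α y) = fun y => G t α y := funext fun y => h t ht α y
  rw [WaterWave.vf, WaterWave.vf, h1.deriv_eq, h2, h3]

theorem Mult.of_sdec (hI : IsOpen I) {c : ℝ → ℝ → ℂ} (hc : SDec I c) : Mult I c :=
  fun _ hf => hc.mul hI hf

theorem Mult.const (hI : IsOpen I) (c : ℂ) : Mult I (fun _ _ => c) := fun _ hf => hf.smul hI c

theorem Mult.vf₁ (hI : IsOpen I) {c f : ℝ → ℝ → ℂ} (hc : Mult I c) (τ : ℂ) (hf : SDec I f) :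
    SDec I (vf₁ τ c f) := ((hf.dt hI).smul hI τ).add hI (hc _ (hf.dx hI))

namespace Two

theorem differentiableAt (hI : IsOpen I) (hF : Two I F) {t : ℝ} (ht : t ∈ I) (α β : ℝ) :
    DifferentiableAt ℝ (fun s => F s α β) t ∧ DifferentiableAt ℝ (fun x => F t x β) α ∧
      DifferentiableAt ℝ (fun y => F t α y) β := by
  induction hF with
  | left hf =>
    exact ⟨(hf.hasDerivAt_t ht α).differentiableAt, (hf.hasDerivAt_x ht α).differentiableAt,
      differentiableAt_const _⟩
  | right hf =>
    exact ⟨(hf.hasDerivAt_t ht β).differentiableAt, differentiableAt_const _,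
      (hf.hasDerivAt_x ht β).differentiableAt⟩
  | smul c _ ih => exact ⟨ih.1.const_mul c, ih.2.1.const_mul c, ih.2.2.const_mul c⟩
  | add _ _ ih ih' => exact ⟨ih.1.add ih'.1, ih.2.1.add ih'.2.1, ih.2.2.add ih'.2.2⟩
  | mul _ _ ih ih' => exact ⟨ih.1.mul ih'.1, ih.2.1.mul ih'.2.1, ih.2.2.mul ih'.2.2⟩
  | @congr F G _ h ih =>
    refine ⟨ih.1.congr_of_eventuallyEq ?_, ?_, ?_⟩
    · filter_upwards [hI.mem_nhds ht] with s hs using (h s hs α β).symm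
    · rw [show (fun x => G t x β) = fun x => F t x β from funext fun x => (h t ht x β).symm]
      exact ih.2.1
    · rw [show (fun y => G t α y) = fun y => F t α y from funext fun y => (h t ht α y).symm]
      exact ih.2.2

theorem neg (hF : Two I F) : Two I (fun t α β => -F t α β) :=
  (hF.smul (-1)).congr fun _ _ _ _ => by ring

theorem sub (hF : Two I F) (hG : Two I G) : Two I (fun t α β => F t α β - G t α β) :=
  (hF.add hG.neg).congr fun _ _ _ _ => by ring

theorem del {f : ℝ → ℝ → ℂ} (hf : SDec I f) : Two I (fun t α β => f t α - f t β) :=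
  (left hf).sub (right hf)

end Two

section vf

variable (hI : IsOpen I) (τ : ℂ) (c : ℝ → ℝ → ℂ)
include hI

theorem vf_add (hF : Two I F) (hG : Two I G) : ∀ t ∈ I, ∀ α β,
    vf τ c (fun t α β => F t α β + G t α β) t α β = vf τ c F t α β + vf τ c G t α β := fun t ht α β => by
  obtain ⟨a1, a2, a3⟩ := hF.differentiableAt hI ht α β
  obtain ⟨b1, b2, b3⟩ := hG.differentiableAt hI ht α β
  simp only [vf, deriv_fun_add a1 b1, deriv_fun_add a2 b2, deriv_fun_add a3 b3]
  ring

theorem vf_mul (hF : Two I F) (hG : Two I G) : ∀ t ∈ I, ∀ α β,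
    vf τ c (fun t α β => F t α β * G t α β) t α β =
      vf τ c F t α β * G t α β + F t α β * vf τ c G t α β := fun t ht α β => by
  obtain ⟨a1, a2, a3⟩ := hF.differentiableAt hI ht α β
  obtain ⟨b1, b2, b3⟩ := hG.differentiableAt hI ht α β
  simp only [vf, deriv_fun_mul a1 b1, deriv_fun_mul a2 b2, deriv_fun_mul a3 b3]
  ring

omit hI in
theorem vf_smul (k : ℂ) (F : ℝ → ℝ → ℝ → ℂ) (t α β : ℝ) :
    vf τ c (fun t α β => k * F t α β) t α β = k * vf τ c F t α β := by
  simp only [vf, deriv_const_mul_field]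
  ring

theorem vf_sub (hF : Two I F) (hG : Two I G) : ∀ t ∈ I, ∀ α β,
    vf τ c (fun t α β => F t α β - G t α β) t α β = vf τ c F t α β - vf τ c G t α β := fun t ht α β => by
  obtain ⟨a1, a2, a3⟩ := hF.differentiableAt hI ht α β
  obtain ⟨b1, b2, b3⟩ := hG.differentiableAt hI ht α β
  simp only [vf, deriv_fun_sub a1 b1, deriv_fun_sub a2 b2, deriv_fun_sub a3 b3]
  ring

omit hI in
theorem vf_left (f : ℝ → ℝ → ℂ) (t α β : ℝ) :
    vf τ c (fun t α _ => f t α) t α β = vf₁ τ c f t α := by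
  simp only [vf, vf₁, deriv_const, dt, dx]; ring

omit hI in
theorem vf_right (f : ℝ → ℝ → ℂ) (t α β : ℝ) :
    vf τ c (fun t _ β => f t β) t α β = vf₁ τ c f t β := by
  simp only [vf, vf₁, deriv_const, dt, dx]; ring

omit hI in
theorem vf_star (hτ : star τ = τ) (hc : ∀ t x, star (c t x) = c t x) (F : ℝ → ℝ → ℝ → ℂ)
    (t α β : ℝ) : vf τ c (fun t α β => star (F t α β)) t α β = star (vf τ c F t α β) := by
  have h1 : deriv (fun s => star (F s α β)) t = star (deriv (fun s => F s α β) t) := deriv.star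
  have h2 : deriv (fun x => star (F t x β)) α = star (deriv (fun x => F t x β) α) := deriv.star
  have h3 : deriv (fun y => star (F t α y)) β = star (deriv (fun y => F t α y) β) := deriv.star
  simp only [vf, h1, h2, h3, star_add, star_mul', hτ, hc]

theorem vf_del {f : ℝ → ℝ → ℂ} (hf : SDec I f) : ∀ t ∈ I, ∀ α β,
    vf τ c (fun t α β => f t α - f t β) t α β = vf₁ τ c f t α - vf₁ τ c f t β := fun t ht α β => by
  rw [vf_sub hI τ c (.left hf) (.right hf) t ht, vf_left, vf_right]

theorem vf_dprod {f g h : ℝ → ℝ → ℂ} (hf : SDec I f) (hg : SDec I g) (hh : SDec I h) :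
    ∀ t ∈ I, ∀ α β, vf τ c (fun t α β => dprod (f t) (g t) (h t) α β) t α β =
      dprod (vf₁ τ c f t) (g t) (h t) α β + dprod (f t) (vf₁ τ c g t) (h t) α β +
        dprod (f t) (g t) (vf₁ τ c h t) α β := fun t ht α β => by
  unfold dprod
  rw [vf_mul hI τ c ((Two.del hf).mul (.del hg)) (.del hh) t ht,
    vf_mul hI τ c (.del hf) (.del hg) t ht, vf_del hI τ c hf t ht, vf_del hI τ c hg t ht,
    vf_del hI τ c hh t ht]
  ring

end vf

theorem Two.dprod {f g h : ℝ → ℝ → ℂ} (hf : SDec I f) (hg : SDec I g) (hh : SDec I h) :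
    Two I (fun t α β => dprod (f t) (g t) (h t) α β) := ((Two.del hf).mul (.del hg)).mul (.del hh)

theorem Two.vf (hI : IsOpen I) {c : ℝ → ℝ → ℂ} (hc : Mult I c) (τ : ℂ) (hF : Two I F) :
    Two I (vf τ c F) := by
  induction hF with
  | left hf => exact (left (hc.vf₁ hI τ hf)).congr fun t _ α β => (vf_left τ c _ t α β).symm
  | right hf => exact (right (hc.vf₁ hI τ hf)).congr fun t _ α β => (vf_right τ c _ t α β).symm
  | smul k hF ih => exact (ih.smul k).congr fun t _ α β => (vf_smul τ c k _ t α β).symm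
  | add hF hG ih ih' => exact (ih.add ih').congr (EqJ.symm (vf_add hI τ c hF hG))
  | mul hF hG ih ih' => exact ((ih.mul hG).add (hF.mul ih')).congr (EqJ.symm (vf_mul hI τ c hF hG))
  | congr hF h ih => exact ih.congr (h.vf hI τ c)

theorem Two.star (hI : IsOpen I) (hF : Two I F) : Two I (fun t α β => star (F t α β)) := by
  induction hF with
  | left hf => exact .left (hf.star hI)
  | right hf => exact .right (hf.star hI)
  | smul k hF ih => exact (ih.smul (Star.star k)).congr fun t _ α β => by rw [star_mul']
  | add hF hG ih ih' => exact (ih.add ih').congr fun t _ α β => by rw [star_add]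
  | mul hF hG ih ih' => exact (ih.mul ih').congr fun t _ α β => by rw [star_mul']
  | congr hF h ih => exact ih.congr fun t ht α β => by beta_reduce; rw [h t ht]

/-- Sums of products of three differences. -/
inductive Tri3 (I : Set ℝ) : (ℝ → ℝ → ℝ → ℂ) → Prop
  | mk {f g h : ℝ → ℝ → ℂ} (hf : SDec I f) (hg : SDec I g) (hh : SDec I h) :
      Tri3 I (fun t α β => dprod (f t) (g t) (h t) α β)
  | smul {F : ℝ → ℝ → ℝ → ℂ} (c : ℂ) (hF : Tri3 I F) : Tri3 I (fun t α β => c * F t α β)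
  | add {F G : ℝ → ℝ → ℝ → ℂ} (hF : Tri3 I F) (hG : Tri3 I G) :
      Tri3 I (fun t α β => F t α β + G t α β)
  | congr {F G : ℝ → ℝ → ℝ → ℂ} (hF : Tri3 I F) (h : EqJ I F G) : Tri3 I G

namespace Tri3

theorem two (hF : Tri3 I F) : Two I F := by
  induction hF with
  | mk hf hg hh => exact .dprod hf hg hh
  | smul k _ ih => exact ih.smul k
  | add _ _ ih ih' => exact ih.add ih'
  | congr _ h ih => exact ih.congr h

theorem vf (hI : IsOpen I) {c : ℝ → ℝ → ℂ} (hc : Mult I c) (τ : ℂ) (hF : Tri3 I F) :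
    Tri3 I (vf τ c F) := by
  induction hF with
  | mk hf hg hh =>
    exact (((mk (hc.vf₁ hI τ hf) hg hh).add (mk hf (hc.vf₁ hI τ hg) hh)).add
      (mk hf hg (hc.vf₁ hI τ hh))).congr (EqJ.symm (vf_dprod hI τ c hf hg hh))
  | smul k hF ih => exact (ih.smul k).congr fun t _ α β => (vf_smul τ c k _ t α β).symm
  | add hF hG ih ih' => exact (ih.add ih').congr (EqJ.symm (vf_add hI τ c hF.two hG.two))
  | congr hF h ih => exact ih.congr (h.vf hI τ c)

theorem swap (hF : Tri3 I F) : ∀ t ∈ I, ∀ α β, F t β α = -F t α β := by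
  induction hF with
  | mk hf hg hh => exact fun t _ α β => dprod_swap _ _ _ _ _
  | smul k hF ih => exact fun t ht α β => by beta_reduce; rw [ih t ht]; ring
  | add hF hG ih ih' => exact fun t ht α β => by beta_reduce; rw [ih t ht, ih' t ht]; ring
  | congr hF h ih => exact fun t ht α β => by rw [← h t ht, ← h t ht, ih t ht]

theorem neg (hF : Tri3 I F) : Tri3 I (fun t α β => -F t α β) :=
  (hF.smul (-1)).congr fun _ _ _ _ => by ring

theorem sub (hF : Tri3 I F) (hG : Tri3 I G) : Tri3 I (fun t α β => F t α β - G t α β) :=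
  (hF.add hG.neg).congr fun _ _ _ _ => by ring

end Tri3

/-- Sums of products of a function of `(t, α)` and three differences. -/
inductive Quad4 (I : Set ℝ) : (ℝ → ℝ → ℝ → ℂ) → Prop
  | mk {v f g h : ℝ → ℝ → ℂ} (hv : SDec I v) (hf : SDec I f) (hg : SDec I g) (hh : SDec I h) :
      Quad4 I (fun t α β => v t α * dprod (f t) (g t) (h t) α β)
  | smul {F : ℝ → ℝ → ℝ → ℂ} (c : ℂ) (hF : Quad4 I F) : Quad4 I (fun t α β => c * F t α β)
  | add {F G : ℝ → ℝ → ℝ → ℂ} (hF : Quad4 I F) (hG : Quad4 I G) :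
      Quad4 I (fun t α β => F t α β + G t α β)
  | congr {F G : ℝ → ℝ → ℝ → ℂ} (hF : Quad4 I F) (h : EqJ I F G) : Quad4 I G

theorem Tri3.left_mul {v : ℝ → ℝ → ℂ} (hv : SDec I v) (hF : Tri3 I F) :
    Quad4 I (fun t α β => v t α * F t α β) := by
  induction hF with
  | mk hf hg hh => exact .mk hv hf hg hh
  | smul k hF ih => exact (ih.smul k).congr fun t _ α β => by ring
  | add hF hG ih ih' => exact (ih.add ih').congr fun t _ α β => by ring
  | congr hF h ih => exact ih.congr fun t ht α β => by beta_reduce; rw [h t ht]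

namespace Quad4

theorem neg (hF : Quad4 I F) : Quad4 I (fun t α β => -F t α β) :=
  (hF.smul (-1)).congr fun _ _ _ _ => by ring

theorem sub (hF : Quad4 I F) (hG : Quad4 I G) : Quad4 I (fun t α β => F t α β - G t α β) :=
  (hF.add hG.neg).congr fun _ _ _ _ => by ring

theorem two (hF : Quad4 I F) : Two I F := by
  induction hF with
  | mk hv hf hg hh => exact (Two.left hv).mul (.dprod hf hg hh)
  | smul k _ ih => exact ih.smul k
  | add _ _ ih ih' => exact ih.add ih'
  | congr _ h ih => exact ih.congr h

end Quad4

theorem vf_quad (hI : IsOpen I) (τ : ℂ) (c : ℝ → ℝ → ℂ) {v f g h : ℝ → ℝ → ℂ} (hv : SDec I v)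
    (hf : SDec I f) (hg : SDec I g) (hh : SDec I h) :
    ∀ t ∈ I, ∀ α β, vf τ c (fun t α β => v t α * dprod (f t) (g t) (h t) α β) t α β =
      vf₁ τ c v t α * dprod (f t) (g t) (h t) α β + v t α *
      (dprod (vf₁ τ c f t) (g t) (h t) α β + dprod (f t) (vf₁ τ c g t) (h t) α β +
        dprod (f t) (g t) (vf₁ τ c h t) α β) := fun t ht α β => by
  rw [vf_mul hI τ c (.left hv) (.dprod hf hg hh) t ht, vf_left,
    vf_dprod hI τ c hf hg hh t ht]

theorem Quad4.vf (hI : IsOpen I) {c : ℝ → ℝ → ℂ} (hc : Mult I c) (τ : ℂ) (hF : Quad4 I F) :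
    Quad4 I (vf τ c F) := by
  induction hF with
  | mk hv hf hg hh =>
    exact ((mk (hc.vf₁ hI τ hv) hf hg hh).add (((mk hv (hc.vf₁ hI τ hf) hg hh).add
      (mk hv hf (hc.vf₁ hI τ hg) hh)).add (mk hv hf hg (hc.vf₁ hI τ hh)))).congr fun t ht α β => by
        beta_reduce; rw [vf_quad hI τ c hv hf hg hh t ht]; ring
  | smul k hF ih => exact (ih.smul k).congr fun t _ α β => (vf_smul τ c k _ t α β).symm
  | add hF hG ih ih' => exact (ih.add ih').congr (EqJ.symm (vf_add hI τ c hF.two hG.two))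
  | congr hF h ih => exact ih.congr (h.vf hI τ c)

/-! ### Integrals of quadruple products -/

theorem pairInt_congr (h : EqJ I F G) {t : ℝ} (ht : t ∈ I) : pairInt F t = pairInt G t := by
  simp only [pairInt, h t ht]

theorem Quad4.integrable (hI : IsOpen I) (hF : Quad4 I F) {t : ℝ} (ht : t ∈ I) :
    Integrable fun p : ℝ × ℝ => F t p.1 p.2 / ((p.1 : ℂ) - p.2) ^ 2 := by
  induction hF with
  | mk hv hf hg hh => exact integrable_quad (hv.hinf hI ht) (hf.hinf hI ht) (hg.hinf hI ht) (hh.hinf hI ht)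
  | smul k _ ih => simpa only [mul_div_assoc] using ih.const_mul k
  | add _ _ ih ih' => simp only [add_div]; exact ih.add ih'
  | congr _ h ih => simpa only [← h t ht] using ih

theorem pairInt_smul (c : ℂ) (F : ℝ → ℝ → ℝ → ℂ) (t : ℝ) :
    pairInt (fun t α β => c * F t α β) t = c * pairInt F t := by
  simp only [pairInt, mul_div_assoc, integral_const_mul]

theorem pairInt_star (F : ℝ → ℝ → ℝ → ℂ) (t : ℝ) :
    pairInt (fun t α β => star (F t α β)) t = star (pairInt F t) := by
  rw [pairInt, pairInt, Complex.star_def, ← integral_conj]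
  congr 1; ext p
  simp only [map_div₀, map_pow, map_sub, Complex.conj_ofReal]

section

variable (hI : IsOpen I) {t : ℝ} (ht : t ∈ I)
include hI ht

theorem pairInt_add (hF : Quad4 I F) (hG : Quad4 I G) :
    pairInt (fun t α β => F t α β + G t α β) t = pairInt F t + pairInt G t := by
  simp only [pairInt, add_div]
  exact integral_add (hF.integrable hI ht) (hG.integrable hI ht)

theorem pairInt_sub (hF : Quad4 I F) (hG : Quad4 I G) :
    pairInt (fun t α β => F t α β - G t α β) t = pairInt F t - pairInt G t := by
  simp only [pairInt, sub_div]
  exact integral_sub (hF.integrable hI ht) (hG.integrable hI ht)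

/-- Integrability is proved together with the identity, because splitting the integral of κ[c](F +
G) needs it. -/
theorem Quad4.integrable_kap (hF : Quad4 I F) {c : ℝ → ℝ → ℂ} (hc : SDec I c) :
    Integrable (fun p : ℝ × ℝ => kap (c t) p.1 p.2 * F t p.1 p.2 / ((p.1 : ℂ) - p.2) ^ 2) ∧
    pairInt (fun t α β => kap (c t) α β * F t α β) t = -pairInt (WaterWave.vf 0 c F) t := by
  induction hF with
  | mk hv hf hg hh =>
    have h := integrable_kap_quad (hc.hinf hI ht) (hv.hinf hI ht) (hf.hinf hI ht) (hg.hinf hI ht)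
      (hh.hinf hI ht)
    refine ⟨h.1, ?_⟩
    rw [pairInt_congr (vf_quad hI 0 c hv hf hg hh) ht, pairInt, h.2, pairInt]
    have e : ∀ f : ℝ → ℝ → ℂ, vf₁ 0 c f t = fun x => c t x * deriv (f t) x := fun f => by
      ext x; simp only [vf₁, zero_mul, zero_add, dx]
    simp only [e]
  | @smul F k hF ih =>
    constructor
    · refine (ih.1.const_mul k).congr (Eventually.of_forall fun p => ?_)
      dsimp only; ring
    · rw [pairInt_congr (I := I) (G := fun t α β => k * (kap (c t) α β * F t α β))
        (fun t _ α β => by ring) ht, pairInt_smul, ih.2,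
        pairInt_congr (I := I) (fun t _ α β => vf_smul 0 c k F t α β) ht, pairInt_smul]
      ring
  | @add F G hF hG ih ih' =>
    have e : ∀ p : ℝ × ℝ, kap (c t) p.1 p.2 * (F t p.1 p.2 + G t p.1 p.2) /
        ((p.1 : ℂ) - p.2) ^ 2 = kap (c t) p.1 p.2 * F t p.1 p.2 / ((p.1 : ℂ) - p.2) ^ 2 +
          kap (c t) p.1 p.2 * G t p.1 p.2 / ((p.1 : ℂ) - p.2) ^ 2 := fun p => by ring
    constructor
    · simp only [e]; exact ih.1.add ih'.1
    · rw [pairInt_congr (vf_add hI 0 c hF.two hG.two) ht,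
        pairInt_add hI ht (hF.vf hI (.of_sdec hI hc) 0) (hG.vf hI (.of_sdec hI hc) 0), neg_add,
        ← ih.2, ← ih'.2, pairInt]
      simp only [e]
      exact integral_add ih.1 ih'.1
  | @congr F G hF h ih =>
    constructor
    · simpa only [← h t ht] using ih.1
    · rw [← pairInt_congr (h.vf hI 0 c) ht, ← ih.2]
      exact pairInt_congr (I := I) (fun t ht α β => by rw [h t ht]) ht

end

end

/-! ### Differentiation of quadruple integrals -/

namespace HInf

/-- The singular integral is multilinear and commutes with translations; algebraically, d is a
derivation commuting with H. -/
theorem d_tri (f g h : HInf) : d (tri f g h) = tri (d f) g h + tri f (d g) h + tri f g (d h) := by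
  have e3 : ∀ f g h : HInf, d (f * g * h) = d f * g * h + f * d g * h + f * g * d h := fun f g h => by
    rw [d_mul, d_mul, add_mul]
  have p3 : ∀ f g h : HInf, d (d (f * g * h)) =
      d (d f * g * h) + d (f * d g * h) + d (f * g * d h) := fun f g h => by
    rw [e3 f g h, map_add, map_add]
  have p2 : ∀ f g : HInf, d (d (f * g)) = d (d f * g) + d (f * d g) := fun f g => by
    rw [d_mul f g, map_add]
  rw [tri, map_add, map_add, map_add, map_sub, map_sub, map_sub, d_mul f (H (d (g * h))),
    d_mul g (H (d (f * h))), d_mul h (H (d (f * g))), e3 f g (H (d h)), e3 f h (H (d g)),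
    e3 g h (H (d f)), d_H, d_H, d_H, d_H, d_H, d_H, d_H, p3, p2, p2, p2]
  ext x
  simp only [tri, d_mul, map_add, add_apply, sub_apply, mul_apply]
  ring

end HInf

section

variable {I : Set ℝ} (hI : IsOpen I) {f g h k v : ℝ → ℝ → ℂ}
include hI

/-- `tri` for functions depending on time. -/
theorem SDec.hasDerivAt_hilbert_dx (hk : SDec I k) {t : ℝ} (ht : t ∈ I) (x : ℝ) :
    HasDerivAt (fun s => WaterWave.hilbert (WaterWave.dx k s) x)
      (HInf.H (HInf.d ((hk.dt hI).at hI ht)) x) t := by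
  refine (SDec.hasDerivAt_hilbert hI (hk.dx hI) ht x).congr_deriv ?_
  rw [HInf.H_apply]
  congr 1
  ext y
  exact hk.dt_dx hI t ht y

omit hI in
/-- `∫ δf δg δh / (x - y)² dy`, up to the factor `π i`, for functions depending on time. -/
def tri₂ (f g h : ℝ → ℝ → ℂ) (t x : ℝ) : ℂ :=
  hilbert (dx (fun t x => f t x * g t x * h t x) t) x
    - f t x * hilbert (dx (fun t x => g t x * h t x) t) x
    - g t x * hilbert (dx (fun t x => f t x * h t x) t) x
    - h t x * hilbert (dx (fun t x => f t x * g t x) t) x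
    + f t x * g t x * hilbert (dx h t) x + f t x * h t x * hilbert (dx g t) x
    + g t x * h t x * hilbert (dx f t) x

theorem SDec.tri₂ (hf : SDec I f) (hg : SDec I g) (hh : SDec I h) : SDec I (tri₂ f g h) := by
  have hH : ∀ {k : ℝ → ℝ → ℂ}, SDec I k → SDec I fun t x => WaterWave.hilbert (WaterWave.dx k t) x :=
    fun hk => (hk.dx hI).hilbert hI
  exact ((((((hH ((hf.mul hI hg).mul hI hh)).sub hI (hf.mul hI (hH (hg.mul hI hh)))).sub hI
    (hg.mul hI (hH (hf.mul hI hh)))).sub hI (hh.mul hI (hH (hf.mul hI hg)))).add hI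
    ((hf.mul hI hg).mul hI (hH hh))).add hI ((hf.mul hI hh).mul hI (hH hg))).add hI
    ((hg.mul hI hh).mul hI (hH hf))

theorem SDec.tri₂_eq (hf : SDec I f) (hg : SDec I g) (hh : SDec I h) {t : ℝ} (ht : t ∈ I) (x : ℝ) :
    WaterWave.tri₂ f g h t x = HInf.tri (hf.at hI ht) (hg.at hI ht) (hh.at hI ht) x := rfl

theorem SDec.rowInt_eq (hf : SDec I f) (hg : SDec I g) (hh : SDec I h) {t : ℝ} (ht : t ∈ I)
    (x : ℝ) : rowInt (dprod (f t) (g t) (h t)) x =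
      Real.pi * Complex.I * WaterWave.tri₂ f g h t x := by
  rw [hf.tri₂_eq hI hg hh ht]
  exact rowInt_dprod (hf.at hI ht) (hg.at hI ht) (hh.at hI ht) x

theorem SDec.pairInt_eq (hv : SDec I v) (hf : SDec I f) (hg : SDec I g) (hh : SDec I h) {t : ℝ}
    (ht : t ∈ I) : pairInt (fun t α β => v t α * dprod (f t) (g t) (h t) α β) t =
      Real.pi * Complex.I * ∫ x, v t x * WaterWave.tri₂ f g h t x := by
  rw [pairInt, integral_quad (hv.hinf hI ht) (hf.hinf hI ht) (hg.hinf hI ht) (hh.hinf hI ht),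
    ← integral_const_mul]
  simp only [hf.rowInt_eq hI hg hh ht]
  congr 1; ext x; ring

theorem SDec.dt_tri₂ (hf : SDec I f) (hg : SDec I g) (hh : SDec I h) {t : ℝ} (ht : t ∈ I) (x : ℝ) :
    WaterWave.dt (WaterWave.tri₂ f g h) t x = WaterWave.tri₂ (WaterWave.dt f) g h t x +
      WaterWave.tri₂ f (WaterWave.dt g) h t x + WaterWave.tri₂ f g (WaterWave.dt h) t x := by
  have e2 : ∀ {p q : ℝ → ℝ → ℂ} (hp : SDec I p) (hq : SDec I q),
      ((hp.mul hI hq).dt hI).at hI ht = (hp.dt hI).at hI ht * hq.at hI ht +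
        hp.at hI ht * (hq.dt hI).at hI ht := fun hp hq => HInf.ext fun y =>
    ((hp.hasDerivAt_t ht y).mul (hq.hasDerivAt_t ht y)).deriv
  have e3 : ∀ {p q r : ℝ → ℝ → ℂ} (hp : SDec I p) (hq : SDec I q) (hr : SDec I r),
      (((hp.mul hI hq).mul hI hr).dt hI).at hI ht =
        (hp.dt hI).at hI ht * hq.at hI ht * hr.at hI ht +
        hp.at hI ht * (hq.dt hI).at hI ht * hr.at hI ht +
        hp.at hI ht * hq.at hI ht * (hr.dt hI).at hI ht := fun hp hq hr => by
    rw [e2 (hp.mul hI hq) hr, e2 hp hq, add_mul]; rfl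
  have p := SDec.hasDerivAt_hilbert_dx hI ((hf.mul hI hg).mul hI hh) ht x
  have p1 := SDec.hasDerivAt_hilbert_dx hI (hg.mul hI hh) ht x
  have p2 := SDec.hasDerivAt_hilbert_dx hI (hf.mul hI hh) ht x
  have p3 := SDec.hasDerivAt_hilbert_dx hI (hf.mul hI hg) ht x
  have q1 := SDec.hasDerivAt_hilbert_dx hI hf ht x
  have q2 := SDec.hasDerivAt_hilbert_dx hI hg ht x
  have q3 := SDec.hasDerivAt_hilbert_dx hI hh ht x
  have hf' := hf.hasDerivAt_t ht x
  have hg' := hg.hasDerivAt_t ht x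
  have hh' := hh.hasDerivAt_t ht x
  have hd := ((((((p.sub (hf'.mul p1)).sub (hg'.mul p2)).sub (hh'.mul p3)).add
    ((hf'.mul hg').mul q3)).add ((hf'.mul hh').mul q2)).add ((hg'.mul hh').mul q1)).deriv
  refine hd.trans ?_
  rw [(hf.dt hI).tri₂_eq hI hg hh ht, hf.tri₂_eq hI (hg.dt hI) hh ht,
    hf.tri₂_eq hI hg (hh.dt hI) ht, e3 hf hg hh, e2 hg hh, e2 hf hh, e2 hf hg]
  have r : ∀ {k : ℝ → ℝ → ℂ} (hk : SDec I k), WaterWave.hilbert (WaterWave.dx k t) x =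
    HInf.H (HInf.d (hk.at hI ht)) x := fun hk => rfl
  have r2 : ∀ {p q : ℝ → ℝ → ℂ} (hp : SDec I p) (hq : SDec I q),
      WaterWave.hilbert (WaterWave.dx (fun t x => p t x * q t x) t) x =
      HInf.H (HInf.d (hp.at hI ht * hq.at hI ht)) x := fun hp hq => rfl
  rw [r hf, r hg, r hh, r2 hf hg, r2 hf hh, r2 hg hh]
  simp only [HInf.tri, map_add, HInf.add_apply, HInf.sub_apply, HInf.mul_apply,
    SDec.at_apply, Pi.mul_apply]
  ring

/-- Carrying out the inner integral leaves π i ∫ v · `tri₂`, a pairing of two smooth decaying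
functions of one variable. No majorant in the plane is needed. -/
theorem Quad4.hasDerivAt_dt {F : ℝ → ℝ → ℝ → ℂ} (hF : Quad4 I F) {t : ℝ} (ht : t ∈ I) :
    HasDerivAt (pairInt F) (pairInt (WaterWave.vf 1 (fun _ _ => 0) F) t) t := by
  have h0 : Mult I fun _ _ => 0 := .const hI 0
  induction hF with
  | @mk v f g h hv hf hg hh =>
    have e : (pairInt fun t α β => v t α * dprod (f t) (g t) (h t) α β) =ᶠ[𝓝 t] fun s =>
        Real.pi * Complex.I * ∫ x, v s x * WaterWave.tri₂ f g h s x := by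
      filter_upwards [hI.mem_nhds ht] with s hs using hv.pairInt_eq hI hf hg hh hs
    refine (((hv.hasDerivAt_integral hI (hf.tri₂ hI hg hh) ht).const_mul
      (Real.pi * Complex.I : ℂ)).congr_of_eventuallyEq e).congr_deriv ?_
    rw [pairInt_congr (vf_quad hI 1 (fun _ _ => 0) hv hf hg hh) ht]
    have e1 : ∀ f : ℝ → ℝ → ℂ, vf₁ 1 (fun _ _ => 0) f = dt f := fun f => by
      ext t x; simp [vf₁]
    simp only [e1, mul_add]
    have i1 := Quad4.mk (hv.dt hI) hf hg hh
    have i2 := Quad4.mk hv (hf.dt hI) hg hh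
    have i3 := Quad4.mk hv hf (hg.dt hI) hh
    have i4 := Quad4.mk hv hf hg (hh.dt hI)
    rw [pairInt_add hI ht i1 ((i2.add i3).add i4), pairInt_add hI ht (i2.add i3) i4,
      pairInt_add hI ht i2 i3, (hv.dt hI).pairInt_eq hI hf hg hh ht,
      hv.pairInt_eq hI (hf.dt hI) hg hh ht, hv.pairInt_eq hI hf (hg.dt hI) hh ht,
      hv.pairInt_eq hI hf hg (hh.dt hI) ht, ← mul_add, ← mul_add, ← mul_add]
    congr 1
    have hadd : ∀ {p q : ℝ → ℂ}, Integrable p → Integrable q →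
        (∫ x, p x) + ∫ x, q x = ∫ x, (p x + q x) := fun hp hq => (integral_add hp hq).symm
    have hia : ∀ {p q : ℝ → ℂ}, Integrable p → Integrable q → Integrable fun x => p x + q x :=
      fun hp hq => hp.add hq
    have hi : ∀ {p q : ℝ → ℝ → ℂ}, SDec I p → SDec I q → Integrable fun x => p t x * q t x :=
      fun hp hq => (hp.hinf hI ht).integrable_mul (hq.hinf hI ht)
    have t1 := (hf.dt hI).tri₂ hI hg hh
    have t2 := hf.tri₂ hI (hg.dt hI) hh
    have t3 := hf.tri₂ hI hg (hh.dt hI)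
    rw [hadd (hi hv t1) (hi hv t2), hadd (hia (hi hv t1) (hi hv t2)) (hi hv t3),
      hadd (hi (hv.dt hI) (hf.tri₂ hI hg hh)) (hia (hia (hi hv t1) (hi hv t2)) (hi hv t3))]
    congr 1; ext x
    rw [hf.dt_tri₂ hI hg hh ht]
    ring
  | @smul F c hF ih =>
    have e : pairInt (fun t α β => c * F t α β) = fun s => c * pairInt F s :=
      funext fun s => pairInt_smul c F s
    rw [e]
    refine (ih.const_mul c).congr_deriv ?_
    rw [pairInt_congr (I := I) (fun t _ α β => vf_smul 1 _ c F t α β) ht, pairInt_smul]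
  | @add F G hF hG ih ih' =>
    have e : pairInt (fun t α β => F t α β + G t α β) =ᶠ[𝓝 t] fun s => pairInt F s + pairInt G s := by
      filter_upwards [hI.mem_nhds ht] with s hs using pairInt_add hI hs hF hG
    refine ((ih.add ih').congr_of_eventuallyEq e).congr_deriv ?_
    rw [pairInt_congr (vf_add hI 1 _ hF.two hG.two) ht, pairInt_add hI ht (hF.vf hI h0 1)
      (hG.vf hI h0 1)]
  | @congr F G hF h ih =>
    have e : pairInt G =ᶠ[𝓝 t] pairInt F := by
      filter_upwards [hI.mem_nhds ht] with s hs using (pairInt_congr h hs).symm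
    exact (ih.congr_of_eventuallyEq e).congr_deriv (pairInt_congr (h.vf hI 1 _) ht)

/-- Translation invariance. It supplies the constant part of a = A₁/|Z_α|² = 1 + (a − 1); the
integration by parts with κ covers only the decaying a − 1. -/
theorem Quad4.pairInt_vf_one {F : ℝ → ℝ → ℝ → ℂ} (hF : Quad4 I F) {t : ℝ} (ht : t ∈ I) :
    pairInt (WaterWave.vf 0 (fun _ _ => 1) F) t = 0 := by
  have h1 : Mult I fun _ _ => 1 := .const hI 1
  induction hF with
  | @mk v f g h hv hf hg hh =>
    rw [pairInt_congr (vf_quad hI 0 (fun _ _ => 1) hv hf hg hh) ht]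
    have e1 : ∀ f : ℝ → ℝ → ℂ, vf₁ 0 (fun _ _ => 1) f = dx f := fun f => by
      ext t x; simp [vf₁]
    simp only [e1, mul_add]
    have i1 := Quad4.mk (hv.dx hI) hf hg hh
    have i2 := Quad4.mk hv (hf.dx hI) hg hh
    have i3 := Quad4.mk hv hf (hg.dx hI) hh
    have i4 := Quad4.mk hv hf hg (hh.dx hI)
    rw [pairInt_add hI ht i1 ((i2.add i3).add i4), pairInt_add hI ht (i2.add i3) i4,
      pairInt_add hI ht i2 i3, (hv.dx hI).pairInt_eq hI hf hg hh ht,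
      hv.pairInt_eq hI (hf.dx hI) hg hh ht, hv.pairInt_eq hI hf (hg.dx hI) hh ht,
      hv.pairInt_eq hI hf hg (hh.dx hI) ht, ← mul_add, ← mul_add, ← mul_add]
    refine mul_eq_zero_of_right _ ?_
    have key := HInf.integral_d_mul (hv.at hI ht)
      (HInf.tri (hf.at hI ht) (hg.at hI ht) (hh.at hI ht))
    rw [HInf.d_tri] at key
    have hadd : ∀ {p q : ℝ → ℂ}, Integrable p → Integrable q →
        (∫ x, p x) + ∫ x, q x = ∫ x, (p x + q x) := fun hp hq => (integral_add hp hq).symm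
    have hia : ∀ {p q : ℝ → ℂ}, Integrable p → Integrable q → Integrable fun x => p x + q x :=
      fun hp hq => hp.add hq
    have hi : ∀ {p q : ℝ → ℝ → ℂ}, SDec I p → SDec I q → Integrable fun x => p t x * q t x :=
      fun hp hq => (hp.hinf hI ht).integrable_mul (hq.hinf hI ht)
    have t1 := (hf.dx hI).tri₂ hI hg hh
    have t2 := hf.tri₂ hI (hg.dx hI) hh
    have t3 := hf.tri₂ hI hg (hh.dx hI)
    rw [hadd (hi hv t1) (hi hv t2), hadd (hia (hi hv t1) (hi hv t2)) (hi hv t3), add_eq_zero_iff_eq_neg]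
    refine key.trans (congrArg Neg.neg ?_)
    congr 1; ext x
    simp only [HInf.add_apply, mul_add]
    rfl
  | @smul F c hF ih =>
    rw [pairInt_congr (I := I) (fun t _ α β => vf_smul 0 _ c F t α β) ht, pairInt_smul, ih, mul_zero]
  | @add F G hF hG ih ih' =>
    rw [pairInt_congr (vf_add hI 0 _ hF.two hG.two) ht, pairInt_add hI ht (hF.vf hI h1 0)
      (hG.vf hI h1 0), ih, ih', add_zero]
  | @congr F G hF h ih => rw [← pairInt_congr (h.vf hI 0 _) ht]; exact ih

end

/-! ### The operators `𝔇_t` and `𝒫` -/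

/-- `A₁ / |Z_α|²` as a complex-valued function. -/
def Wave.aF (S : Wave) (t x : ℝ) : ℂ := S.a t x

theorem Wave.DD_eq (S : Wave) (F : ℝ → ℝ → ℝ → ℂ) : S.DD F = vf 1 S.bC F := by
  ext t α β
  simp only [Wave.DD, vf, one_mul, Wave.bC]

theorem Wave.P_eq (S : Wave) (F : ℝ → ℝ → ℝ → ℂ) (t α β : ℝ) :
    S.P F t α β = S.DD (S.DD F) t α β + Complex.I * vf 0 S.aF F t α β := by
  simp only [Wave.P, vf, Wave.aF, zero_mul, zero_add]
  ring

theorem Wave.D_eq_vf (S : Wave) (f : ℝ → ℝ → ℂ) : S.D f = vf₁ 1 S.bC f := by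
  ext t x
  simp only [Wave.D, vf₁, one_mul, Wave.bC]

namespace Sol

variable (s : Sol) {F G H : ℝ → ℝ → ℝ → ℂ}

theorem sdec_aC : SDec s.I s.S.aC := Deg.aC.sdec s

theorem mult_b : Mult s.I s.S.bC := .of_sdec s.isOpen s.sdec_b

theorem mult_a : Mult s.I s.S.aF := fun f hf =>
  (hf.add s.isOpen (s.sdec_aC.mul s.isOpen hf)).congr s.isOpen fun t _ x => by
    simp only [Wave.aC, Wave.aF]; ring

theorem κb_eq {t : ℝ} (ht : t ∈ s.I) (α β : ℝ) : s.S.κb t α β = kap (s.S.bC t) α β := by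
  have h := s.dx_bC ht
  simp only [dx] at h
  rw [Wave.κb, kap, show deriv (s.S.bC t) α = _ from h α, show deriv (s.S.bC t) β = _ from h β]
  simp only [Wave.bC]
  push_cast
  ring

theorem κa_eq {t : ℝ} (ht : t ∈ s.I) (α β : ℝ) : s.S.κa t α β = kap (s.S.aC t) α β := by
  have h : ∀ x, deriv (s.S.aC t) x = (deriv (s.S.a t) x : ℝ) := fun x => by
    have h1 := (s.sdec_aC.hinf s.isOpen ht).hasDerivAt x
    have h2 := (Complex.reCLM.hasFDerivAt.comp_hasDerivAt x h1).add_const (1 : ℝ)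
    have e : (fun y => (Complex.reCLM ∘ s.S.aC t) y + 1) = s.S.a t := by
      ext y; simp [Wave.aC]
    rw [e] at h2
    exact ((h2.differentiableAt.hasDerivAt.ofReal_comp).sub_const (1 : ℂ)).deriv
  rw [Wave.κa, kap, h α, h β]
  simp only [Wave.aC]
  push_cast
  ring

theorem DD_congr (h : EqJ s.I F G) : EqJ s.I (s.S.DD F) (s.S.DD G) := by
  rw [Wave.DD_eq, Wave.DD_eq]; exact h.vf s.isOpen 1 _

theorem iterate_DD_congr (h : EqJ s.I F G) (m : ℕ) : EqJ s.I (s.S.DD^[m] F) (s.S.DD^[m] G) := by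
  induction m with
  | zero => exact h
  | succ m ih => simp only [Function.iterate_succ_apply']; exact s.DD_congr ih

theorem DD_add (hF : Two s.I F) (hG : Two s.I G) : ∀ t ∈ s.I, ∀ α β,
    s.S.DD (fun t α β => F t α β + G t α β) t α β = s.S.DD F t α β + s.S.DD G t α β := by
  simp only [Wave.DD_eq]; exact vf_add s.isOpen 1 _ hF hG

theorem DD_sub (hF : Two s.I F) (hG : Two s.I G) : ∀ t ∈ s.I, ∀ α β,
    s.S.DD (fun t α β => F t α β - G t α β) t α β = s.S.DD F t α β - s.S.DD G t α β := by
  simp only [Wave.DD_eq]; exact vf_sub s.isOpen 1 _ hF hG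

theorem DD_mul (hF : Two s.I F) (hG : Two s.I G) : ∀ t ∈ s.I, ∀ α β,
    s.S.DD (fun t α β => F t α β * G t α β) t α β =
      s.S.DD F t α β * G t α β + F t α β * s.S.DD G t α β := by
  simp only [Wave.DD_eq]; exact vf_mul s.isOpen 1 _ hF hG

theorem DD_smul (k : ℂ) (F : ℝ → ℝ → ℝ → ℂ) (t α β : ℝ) :
    s.S.DD (fun t α β => k * F t α β) t α β = k * s.S.DD F t α β := by
  simp only [Wave.DD_eq]; exact vf_smul 1 _ k F t α β

theorem DD_star (F : ℝ → ℝ → ℝ → ℂ) (t α β : ℝ) :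
    s.S.DD (fun t α β => star (F t α β)) t α β = star (s.S.DD F t α β) := by
  simp only [Wave.DD_eq]; exact vf_star 1 _ (star_one _) s.star_bC F t α β

theorem DD_left (f : ℝ → ℝ → ℂ) (t α β : ℝ) :
    s.S.DD (fun t α _ => f t α) t α β = s.S.D f t α := by
  simp only [Wave.DD_eq, Wave.D_eq_vf]; exact vf_left 1 _ f t α β

theorem DD_del {f : ℝ → ℝ → ℂ} (hf : SDec s.I f) : EqJ s.I
    (s.S.DD fun t α β => f t α - f t β) (fun t α β => s.S.D f t α - s.S.D f t β) := by
  simp only [Wave.DD_eq, Wave.D_eq_vf]; exact vf_del s.isOpen 1 _ hf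

theorem two_DD (hF : Two s.I F) : Two s.I (s.S.DD F) := by
  rw [Wave.DD_eq]; exact hF.vf s.isOpen s.mult_b 1

theorem tri_DD (hF : Tri3 s.I F) : Tri3 s.I (s.S.DD F) := by
  rw [Wave.DD_eq]; exact hF.vf s.isOpen s.mult_b 1

theorem tri_iterate_DD (hF : Tri3 s.I F) (m : ℕ) : Tri3 s.I (s.S.DD^[m] F) := by
  induction m with
  | zero => exact hF
  | succ m ih => simp only [Function.iterate_succ_apply']; exact s.tri_DD ih

theorem quad_DD (hF : Quad4 s.I F) : Quad4 s.I (s.S.DD F) := by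
  rw [Wave.DD_eq]; exact hF.vf s.isOpen s.mult_b 1

theorem iterate_DD_add (hF : Tri3 s.I F) (hG : Tri3 s.I G) (m : ℕ) : EqJ s.I
    (s.S.DD^[m] fun t α β => F t α β + G t α β)
    (fun t α β => (s.S.DD^[m] F) t α β + (s.S.DD^[m] G) t α β) := by
  induction m with
  | zero => exact fun _ _ _ _ => rfl
  | succ m ih =>
    simp only [Function.iterate_succ_apply']
    exact (s.DD_congr ih).trans
      (s.DD_add (s.tri_iterate_DD hF m).two (s.tri_iterate_DD hG m).two)

theorem iterate_DD_smul (k : ℂ) (F : ℝ → ℝ → ℝ → ℂ) (m : ℕ) : EqJ s.I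
    (s.S.DD^[m] fun t α β => k * F t α β) (fun t α β => k * (s.S.DD^[m] F) t α β) := by
  induction m with
  | zero => exact fun _ _ _ _ => rfl
  | succ m ih =>
    simp only [Function.iterate_succ_apply']
    exact (s.DD_congr ih).trans fun t _ α β => s.DD_smul k _ t α β

theorem tri_P (hF : Tri3 s.I F) : Tri3 s.I (s.S.P F) :=
  ((s.tri_DD (s.tri_DD hF)).add ((hF.vf s.isOpen s.mult_a 0).smul Complex.I)).congr
    fun t _ α β => (s.S.P_eq F t α β).symm

theorem star_aF (t x : ℝ) : star (s.S.aF t x) = s.S.aF t x := Complex.conj_ofReal _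

/-- Leibniz' rule for `𝒫`. -/
theorem P_mul_mul {f g h : ℝ → ℝ → ℝ → ℂ} (hf : Two s.I f) (hg : Two s.I g) (hh : Two s.I h) :
    ∀ t ∈ s.I, ∀ α β, s.S.P (fun t α β => f t α β * star (g t α β) * h t α β) t α β =
      s.S.P f t α β * star (g t α β) * h t α β - f t α β * star (s.S.P g t α β) * h t α β
      + f t α β * star (g t α β) * s.S.P h t α β
      + 2 * (s.S.DD (fun t α β => f t α β * star (s.S.DD g t α β) * h t α β) t α β +
        s.S.DD f t α β * star (g t α β) * s.S.DD h t α β) := fun t ht α β => by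
  have hI := s.isOpen
  have hg' := hg.star hI
  have hDg' := (s.two_DD hg).star hI
  have e1 : EqJ s.I (s.S.DD fun t α β => f t α β * star (g t α β) * h t α β) (fun t α β =>
      s.S.DD f t α β * star (g t α β) * h t α β + f t α β * star (s.S.DD g t α β) * h t α β +
      f t α β * star (g t α β) * s.S.DD h t α β) := fun t ht α β => by
    rw [s.DD_mul (hf.mul hg') hh t ht, s.DD_mul hf hg' t ht, s.DD_star]; ring
  have e2 : ∀ {p q r : ℝ → ℝ → ℝ → ℂ}, Two s.I p → Two s.I q → Two s.I r →
      s.S.DD (fun t α β => p t α β * q t α β * r t α β) t α β =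
      s.S.DD p t α β * q t α β * r t α β + p t α β * s.S.DD q t α β * r t α β +
      p t α β * q t α β * s.S.DD r t α β := fun hp hq hr => by
    rw [s.DD_mul (hp.mul hq) hr t ht, s.DD_mul hp hq t ht]; ring
  have t1 := ((s.two_DD hf).mul hg').mul hh
  have t2 := (hf.mul hDg').mul hh
  have t3 := (hf.mul hg').mul (s.two_DD hh)
  have l1 : vf 0 s.S.aF (fun t α β => f t α β * star (g t α β) * h t α β) t α β =
      vf 0 s.S.aF f t α β * star (g t α β) * h t α β +
      f t α β * star (vf 0 s.S.aF g t α β) * h t α β +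
      f t α β * star (g t α β) * vf 0 s.S.aF h t α β := by
    rw [vf_mul hI 0 _ (hf.mul hg') hh t ht, vf_mul hI 0 _ hf hg' t ht,
      vf_star 0 _ (star_zero _) s.star_aF]
    ring
  -- Conjugation reverses the sign of i a∂, hence the minus sign before the conjugate of 𝒫g. The
  -- second derivative of ḡ is then counted with the wrong sign, and this excess joins the mixed
  -- terms in 𝔇_t(f · conj(𝔇_t g) · h).
  rw [Wave.P_eq, Wave.P_eq, Wave.P_eq, Wave.P_eq, l1, s.DD_congr e1 t ht,
    s.DD_add (t1.add t2) t3 t ht, s.DD_add t1 t2 t ht, e2 (s.two_DD hf) hg' hh, e2 hf hDg' hh,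
    e2 hf hg' (s.two_DD hh), s.DD_star, s.DD_star]
  simp only [star_add, star_mul', Complex.star_def, Complex.conj_I]
  ring

/-! ### Quadruple integrals of solutions -/

variable {t : ℝ}

theorem pairInt_κb (hF : Quad4 s.I F) (ht : t ∈ s.I) :
    pairInt (fun t α β => s.S.κb t α β * F t α β) t = -pairInt (vf 0 s.S.bC F) t := by
  rw [← (hF.integrable_kap s.isOpen ht s.sdec_b).2]
  exact pairInt_congr (I := s.I) (fun t ht α β => by rw [s.κb_eq ht]) ht

theorem pairInt_κa (hF : Quad4 s.I F) (ht : t ∈ s.I) :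
    pairInt (fun t α β => s.S.κa t α β * F t α β) t = -pairInt (vf 0 s.S.aC F) t := by
  rw [← (hF.integrable_kap s.isOpen ht s.sdec_aC).2]
  exact pairInt_congr (I := s.I) (fun t ht α β => by rw [s.κa_eq ht]) ht

theorem pairInt_vf_aF (hF : Quad4 s.I F) (ht : t ∈ s.I) :
    pairInt (vf 0 s.S.aF F) t = pairInt (vf 0 s.S.aC F) t := by
  have e : EqJ s.I (vf 0 s.S.aF F)
      (fun t α β => vf 0 (fun _ _ => 1) F t α β + vf 0 s.S.aC F t α β) := fun t _ α β => by
    simp only [vf, Wave.aC, Wave.aF]; ring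
  rw [pairInt_congr e ht, pairInt_add s.isOpen ht (hF.vf s.isOpen (.const s.isOpen 1) 0)
    (hF.vf s.isOpen (.of_sdec s.isOpen s.sdec_aC) 0), hF.pairInt_vf_one s.isOpen ht, zero_add]

/-- Write ∂_t = 𝔇_t − b∂_α − b∂_β; the last two terms integrate by parts to κ[b]. -/
theorem hasDerivAt_pairInt (hF : Quad4 s.I F) (ht : t ∈ s.I) : HasDerivAt (pairInt F)
    (pairInt (s.S.DD F) t + pairInt (fun t α β => s.S.κb t α β * F t α β) t) t := by
  refine (hF.hasDerivAt_dt s.isOpen ht).congr_deriv ?_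
  have e : EqJ s.I (vf 1 (fun _ _ => 0) F)
      (fun t α β => s.S.DD F t α β - vf 0 s.S.bC F t α β) := fun t _ α β => by
    simp only [Wave.DD_eq, vf]; ring
  rw [pairInt_congr e ht, pairInt_sub s.isOpen ht (s.quad_DD hF)
    (hF.vf s.isOpen s.mult_b 0), s.pairInt_κb hF ht, sub_eq_add_neg]

end Sol

/-! ### The functionals `⟨v_j 𝔇_t^m (θ_l θ̄_i θ_k)⟩` -/

/-- `θ_l θ̄_i θ_k`. -/
def Wave.T (S : Wave) (l i k : ℕ) : ℝ → ℝ → ℝ → ℂ :=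
  fun t α β => S.θD l t α β * star (S.θD i t α β) * S.θD k t α β

namespace Sol

variable (s : Sol) {F G : ℝ → ℝ → ℝ → ℂ} {t : ℝ}

theorem sdec_iterate_Vb (k : ℕ) : SDec s.I (s.S.D^[k] s.S.Vb) := (Deg.Vb.iterate_D k).sdec s

theorem sdec_iterate_V (k : ℕ) : SDec s.I (s.S.D^[k] s.S.V) := (Deg.V.iterate_D k).sdec s

theorem iterate_D_Vb (k : ℕ) (t x : ℝ) : (s.S.D^[k] s.S.Vb) t x = star ((s.S.D^[k] s.S.V) t x) := by
  induction k generalizing t x with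
  | zero => rfl
  | succ k ih =>
    simp only [Function.iterate_succ_apply']
    rw [← s.D_star]
    congr 1
    ext t x
    exact ih t x

theorem θD_eq (k : ℕ) : EqJ s.I (s.S.θD k)
    (fun t α β => (s.S.D^[k] s.S.Vb) t α - (s.S.D^[k] s.S.Vb) t β) := by
  induction k with
  | zero => exact fun _ _ _ _ => rfl
  | succ k ih =>
    simp only [Wave.θD, Function.iterate_succ_apply'] at ih ⊢
    exact (s.DD_congr ih).trans (s.DD_del (s.sdec_iterate_Vb k))

theorem two_θD (k : ℕ) : Two s.I (s.S.θD k) :=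
  (Two.del (s.sdec_iterate_Vb k)).congr (s.θD_eq k).symm

theorem DD_θD (k : ℕ) : s.S.DD (s.S.θD k) = s.S.θD (k + 1) :=
  (Function.iterate_succ_apply' _ _ _).symm

theorem θbarD_eq (k : ℕ) (t α β : ℝ) : s.S.θbarD k t α β = star (s.S.θD k t α β) := by
  induction k generalizing t α β with
  | zero => rfl
  | succ k ih =>
    simp only [Wave.θD, Wave.θbarD, Function.iterate_succ_apply'] at ih ⊢
    rw [← s.DD_star]
    congr 1
    ext t α β
    exact ih t α β

theorem DD_VD (k : ℕ) : s.S.DD (s.S.VD k) = s.S.VD (k + 1) := by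
  ext t α β
  rw [show s.S.VD k = fun t α _ => (s.S.D^[k] s.S.V) t α from rfl, s.DD_left, Wave.VD,
    Function.iterate_succ_apply']

theorem T_eq (l i k : ℕ) : s.S.T l i k = s.S.θD l * s.S.θbarD i * s.S.θD k := by
  ext t α β
  simp only [Wave.T, Pi.mul_apply, s.θbarD_eq]

theorem T_eq_dprod (l i k : ℕ) : EqJ s.I (s.S.T l i k) (fun t α β =>
    dprod ((s.S.D^[l] s.S.Vb) t) ((s.S.D^[i] s.S.V) t) ((s.S.D^[k] s.S.Vb) t) α β) :=
  fun t ht α β => by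
    simp only [Wave.T, s.θD_eq _ t ht, dprod, star_sub, iterate_D_Vb, star_star]

theorem tri_T (l i k : ℕ) : Tri3 s.I (s.S.T l i k) :=
  (Tri3.mk (s.sdec_iterate_Vb l) (s.sdec_iterate_V i) (s.sdec_iterate_Vb k)).congr
    (s.T_eq_dprod l i k).symm

theorem quad_VD (j : ℕ) (hF : Tri3 s.I F) : Quad4 s.I (fun t α β => s.S.VD j t α β * F t α β) :=
  hF.left_mul (s.sdec_iterate_V j)

theorem DD_T (l i k : ℕ) : EqJ s.I (s.S.DD (s.S.T l i k)) (fun t α β =>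
    s.S.T (l + 1) i k t α β + s.S.T l (i + 1) k t α β + s.S.T l i (k + 1) t α β) :=
  fun t ht α β => by
    have h1 := (s.two_θD i).star s.isOpen
    unfold Wave.T
    rw [s.DD_mul ((s.two_θD l).mul h1) (s.two_θD k) t ht, s.DD_mul (s.two_θD l) h1 t ht,
      s.DD_star, DD_θD, DD_θD, DD_θD]
    ring

theorem quad_skew (j : ℕ) (hF : Tri3 s.I F) :
    Quad4 s.I (s.S.skew (s.S.VD j) (s.S.VD (j + 1)) F) :=
  (s.quad_VD j (s.tri_DD hF)).sub (s.quad_VD (j + 1) hF)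

/-- Integration by parts in time. -/
theorem hasDerivAt_skew (j m l i k : ℕ) (ht : t ∈ s.I) :
    HasDerivAt (pairInt (s.S.skew (s.S.VD j) (s.S.VD (j + 1)) (s.S.DD^[m] (s.S.T l i k))))
      (s.S.R m j l i k t + 2 * (pairInt (s.S.VD j * s.S.DD^[m + 1] (s.S.T l (i + 1) k)) t +
        pairInt (s.S.VD j * s.S.DD^[m] (s.S.T (l + 1) i (k + 1))) t)) t := by
  have hI := s.isOpen
  set X := s.S.DD^[m] (s.S.T l i k) with hX
  have tX : Tri3 s.I X := s.tri_iterate_DD (s.tri_T l i k) m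
  refine (s.hasDerivAt_pairInt (s.quad_skew j tX) ht).congr_deriv ?_
  -- the two sides of Leibniz' rule
  set B : ℝ → ℝ → ℝ → ℂ := fun t α β =>
    s.S.P (s.S.θD l) t α β * s.S.θbarD i t α β * s.S.θD k t α β
      - s.S.θD l t α β * star (s.S.P (s.S.θD i) t α β) * s.S.θD k t α β
      + s.S.θD l t α β * s.S.θbarD i t α β * s.S.P (s.S.θD k) t α β with hB
  set U : ℝ → ℝ → ℝ → ℂ := fun t α β =>
    s.S.DD (s.S.T l (i + 1) k) t α β + s.S.T (l + 1) i (k + 1) t α β with hU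
  have tU : Tri3 s.I U := (s.tri_DD (s.tri_T l (i + 1) k)).add (s.tri_T (l + 1) i (k + 1))
  have eP : EqJ s.I (s.S.P (s.S.T l i k)) (fun t α β => B t α β + 2 * U t α β) :=
    fun t ht α β => by
      have h := s.P_mul_mul (s.two_θD l) (s.two_θD i) (s.two_θD k) t ht α β
      simp only [DD_θD] at h
      simp only [hB, hU, θbarD_eq]
      exact h
  have tP := s.tri_P (s.tri_T l i k)
  have tB : Tri3 s.I B := (tP.sub (tU.smul 2)).congr fun t ht α β => by
    beta_reduce; rw [eP t ht]; ring
  have eDP : EqJ s.I (s.S.DD^[m] (s.S.P (s.S.T l i k)))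
      (fun t α β => (s.S.DD^[m] B) t α β + 2 * (s.S.DD^[m] U) t α β) :=
    ((s.iterate_DD_congr eP m).trans (s.iterate_DD_add tB (tU.smul 2) m)).trans
      fun t ht α β => by beta_reduce; rw [s.iterate_DD_smul 2 U m t ht]
  have eU : EqJ s.I (s.S.DD^[m] U) (fun t α β => (s.S.DD^[m + 1] (s.S.T l (i + 1) k)) t α β +
      (s.S.DD^[m] (s.S.T (l + 1) i (k + 1))) t α β) :=
    s.iterate_DD_add (s.tri_DD (s.tri_T l (i + 1) k)) (s.tri_T (l + 1) i (k + 1)) m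
  have q : ∀ {F}, Tri3 s.I F → Quad4 s.I (fun t α β => s.S.VD j t α β * F t α β) :=
    fun hF => s.quad_VD j hF
  -- the pieces
  have p1 : pairInt (s.S.VD j * (s.S.P X - s.S.DD^[m] (s.S.P (s.S.T l i k)))) t =
      pairInt (fun t α β => s.S.VD j t α β * s.S.P X t α β) t -
      (pairInt (fun t α β => s.S.VD j t α β * (s.S.DD^[m] B) t α β) t +
        2 * pairInt (fun t α β => s.S.VD j t α β * (s.S.DD^[m] U) t α β) t) := by
    rw [← pairInt_smul, ← pairInt_add hI ht (q (s.tri_iterate_DD tB m))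
      ((q (s.tri_iterate_DD tU m)).smul 2),
      ← pairInt_sub hI ht (q (s.tri_P tX)) ((q (s.tri_iterate_DD tB m)).add
        ((q (s.tri_iterate_DD tU m)).smul 2))]
    refine pairInt_congr (I := s.I) (fun t ht α β => ?_) ht
    simp only [Pi.mul_apply, Pi.sub_apply]
    rw [eDP t ht]; ring
  have p2 : pairInt (fun t α β => s.S.VD j t α β * (s.S.DD^[m] U) t α β) t =
      pairInt (s.S.VD j * s.S.DD^[m + 1] (s.S.T l (i + 1) k)) t +
        pairInt (s.S.VD j * s.S.DD^[m] (s.S.T (l + 1) i (k + 1))) t := by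
    refine Eq.trans ?_ (pairInt_add hI ht (q (s.tri_iterate_DD (s.tri_T l (i + 1) k) (m + 1)))
      (q (s.tri_iterate_DD (s.tri_T (l + 1) i (k + 1)) m)))
    refine pairInt_congr (I := s.I) (fun t ht α β => ?_) ht
    rw [eU t ht]; simp only [Pi.mul_apply]; ring
  -- 𝔇_t of the skew expression is v_j 𝔇_t²X − v_{j+2}X. Trading the second derivatives of X and of
  -- v̄_j for 𝒫 leaves first-order terms, which combine to −i a∂(v_j X) in both variables and
  -- integrate to iκ[a]v_j X.
  have qv : Quad4 s.I (fun t α β => vf₁ 0 s.S.aF (s.S.D^[j] s.S.V) t α * X t α β) :=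
    tX.left_mul (s.mult_a.vf₁ hI 0 (s.sdec_iterate_V j))
  have qX := q tX
  have eS : ∀ t α β, star (s.S.P (star (s.S.VD j)) t α β) =
      s.S.VD (j + 2) t α β - Complex.I * vf₁ 0 s.S.aF (s.S.D^[j] s.S.V) t α := fun t α β => by
    have h1 : s.S.DD (star (s.S.VD j)) = star (s.S.VD (j + 1)) := by
      ext t α β
      rw [← s.DD_VD j]
      exact s.DD_star _ t α β
    have h2 : s.S.DD (star (s.S.VD (j + 1))) t α β = star (s.S.VD (j + 2) t α β) := by
      rw [show j + 2 = j + 1 + 1 from rfl, ← s.DD_VD (j + 1)]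
      exact s.DD_star _ t α β
    have h3 : vf 0 s.S.aF (star (s.S.VD j)) t α β =
        star (vf₁ 0 s.S.aF (s.S.D^[j] s.S.V) t α) := by
      rw [← vf_left 0 s.S.aF (s.S.D^[j] s.S.V) t α β]
      exact vf_star 0 _ (star_zero _) s.star_aF (s.S.VD j) t α β
    rw [Wave.P_eq, h1, h2, h3]
    simp only [star_add, star_mul', Complex.star_def, Complex.conj_I, Complex.conj_conj]
    ring
  have p3 : pairInt (star (s.S.P (star (s.S.VD j))) * X) t =
      pairInt (fun t α β => s.S.VD (j + 2) t α β * X t α β) t -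
      Complex.I * pairInt (fun t α β => vf₁ 0 s.S.aF (s.S.D^[j] s.S.V) t α * X t α β) t := by
    rw [← pairInt_smul, ← pairInt_sub hI ht (s.quad_VD (j + 2) tX) (qv.smul Complex.I)]
    refine pairInt_congr (I := s.I) (fun t ht α β => ?_) ht
    simp only [Pi.mul_apply, Pi.star_apply]
    rw [eS]; ring
  have qL := q (tX.vf hI s.mult_a 0)
  have p5 : pairInt (s.S.κa * (s.S.VD j * X)) t =
      -(pairInt (fun t α β => vf₁ 0 s.S.aF (s.S.D^[j] s.S.V) t α * X t α β) t +
        pairInt (fun t α β => s.S.VD j t α β * vf 0 s.S.aF X t α β) t) := by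
    rw [← pairInt_add hI ht qv qL]
    refine (s.pairInt_κa qX ht).trans ?_
    rw [← s.pairInt_vf_aF qX ht]
    congr 1
    refine pairInt_congr (I := s.I) (fun t ht α β => ?_) ht
    have h1 : Two s.I (s.S.VD j) := .left (s.sdec_iterate_V j)
    rw [vf_mul hI 0 _ h1 tX.two t ht, ← vf_left 0 s.S.aF (s.S.D^[j] s.S.V) t α β]
    rfl
  have p6 : pairInt (fun t α β => s.S.VD j t α β * s.S.P X t α β) t =
      pairInt (fun t α β => s.S.VD j t α β * s.S.DD (s.S.DD X) t α β) t +
      Complex.I * pairInt (fun t α β => s.S.VD j t α β * vf 0 s.S.aF X t α β) t := by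
    rw [← pairInt_smul, ← pairInt_add hI ht (q (s.tri_DD (s.tri_DD tX))) (qL.smul Complex.I)]
    refine pairInt_congr (I := s.I) (fun t ht α β => ?_) ht
    rw [Wave.P_eq]; ring
  have p7 : pairInt (s.S.DD (s.S.skew (s.S.VD j) (s.S.VD (j + 1)) X)) t =
      pairInt (fun t α β => s.S.VD j t α β * s.S.DD (s.S.DD X) t α β) t -
      pairInt (fun t α β => s.S.VD (j + 2) t α β * X t α β) t := by
    rw [← pairInt_sub hI ht (q (s.tri_DD (s.tri_DD tX))) (s.quad_VD (j + 2) tX)]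
    refine pairInt_congr (I := s.I) (fun t ht α β => ?_) ht
    have h1 : Two s.I (s.S.VD j) := .left (s.sdec_iterate_V j)
    have h2 : Two s.I (s.S.VD (j + 1)) := .left (s.sdec_iterate_V (j + 1))
    refine (s.DD_sub (h1.mul (s.tri_DD tX).two) (h2.mul tX.two) t ht α β).trans ?_
    rw [s.DD_mul h1 (s.tri_DD tX).two t ht, s.DD_mul h2 tX.two t ht, DD_VD, DD_VD]
    ring
  have eB : B = s.S.P (s.S.θD l) * s.S.θbarD i * s.S.θD k
      - s.S.θD l * star (s.S.P (s.S.θD i)) * s.S.θD k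
      + s.S.θD l * s.S.θbarD i * s.S.P (s.S.θD k) := rfl
  rw [Wave.R, ← eB, DD_VD, ← T_eq, ← hX, p1, p2, p3, p5, p6, p7]
  have p4 : pairInt (s.S.κb * s.S.skew (s.S.VD j) (s.S.VD (j + 1)) X) t =
    pairInt (fun t α β => s.S.κb t α β * s.S.skew (s.S.VD j) (s.S.VD (j + 1)) X t α β) t := rfl
  have p8 : pairInt (s.S.VD j * s.S.DD^[m] B) t =
    pairInt (fun t α β => s.S.VD j t α β * (s.S.DD^[m] B) t α β) t := rfl
  rw [p4, p8]
  ring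

end Sol

/-! ### A summation identity -/

theorem sum_alternating (g : ℕ → ℝ) (K : ℕ) :
    ∑ k ∈ Finset.range K, (-1) ^ k * (g k + g (k + 1)) = g 0 - (-1) ^ K * g K := by
  induction K with
  | zero => simp
  | succ K ih => rw [Finset.sum_range_succ, ih, pow_succ]; ring

/-- The algebraic properties of `Re ⟨v_c 𝔇_t^m (θ_l θ̄_i θ_k)⟩`, as a function of `(c, m, l, i, k)`. -/
structure Pairing (τ : ℕ → ℕ → ℕ → ℕ → ℕ → ℝ) : Prop where
  leibniz : ∀ c m l i k,
    τ c (m + 1) l i k = τ c m (l + 1) i k + τ c m l (i + 1) k + τ c m l i (k + 1)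
  symm : ∀ c m l i k, τ c m l i k = τ c m k i l
  exch : ∀ c l i k, τ c 0 l i k = τ i 0 l c k
  conj : ∀ c l i k, τ c 0 l i k = τ k 0 i l c

namespace Pairing

variable {τ : ℕ → ℕ → ℕ → ℕ → ℕ → ℝ} (h : Pairing τ)
include h

/-- By Leibniz' rule each summand is p(k) − p(k+1), with p(k) carrying k derivatives on the first
factor and the others outside. -/
theorem sum_first (c l n : ℕ) :
    ∑ k ∈ Finset.range (l + 1), (τ c (l - k + 1) k 1 n + τ c (l - k) (k + 1) 0 (n + 1)) =
      τ c (l + 2) 0 0 n - τ c (l + 1) 0 0 (n + 1) + (τ c 0 (l + 1) 0 (n + 1) - τ c 1 (l + 1) 0 n) := by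
  set p : ℕ → ℝ := fun k => τ c (l + 2 - k) k 0 n - τ c (l + 1 - k) k 0 (n + 1) with hp
  have e : ∀ k ∈ Finset.range (l + 1),
      τ c (l - k + 1) k 1 n + τ c (l - k) (k + 1) 0 (n + 1) = p k - p (k + 1) := by
    intro k hk
    obtain ⟨d, rfl⟩ := Nat.exists_eq_add_of_le (Nat.lt_succ_iff.1 (Finset.mem_range.1 hk))
    simp only [hp]
    rw [show k + d - k = d by omega, show k + d + 2 - k = d + 1 + 1 by omega,
      show k + d + 1 - k = d + 1 by omega, show k + d + 2 - (k + 1) = d + 1 by omega,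
      show k + d + 1 - (k + 1) = d by omega, h.leibniz c (d + 1) k 0 n]
    ring
  rw [Finset.sum_congr rfl e, Finset.sum_range_sub']
  simp only [hp, Nat.sub_zero, show l + 2 - (l + 1) = 1 by omega, Nat.sub_self]
  ring

/-- Here j = l + K + 1. Leibniz' rule turns each summand into (−1)^k(g(k) + g(k+1)), so only the
endpoints remain. The endpoint k = K vanishes by the conjugation symmetry, and the exchange symmetry
rewrites the one at k = 0. -/
theorem sum_second (l K : ℕ) :
    ∑ k ∈ Finset.range K, (-1) ^ k *
      (τ (l + K + 1) 1 (1 + l) (k + 1) (l + K + 1 - l - 2 - k) +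
        τ (l + K + 1) 0 (2 + l) k (l + K + 1 - l - 1 - k)
      - (τ 0 1 (l + K + 1 - l - 1) (l + K + 1 - k) (l + k + 1) +
        τ 0 0 (l + K + 1 - l) (l + K + 1 - k - 1) (l + k + 2))) =
      τ (l + K + 1) 0 (2 + l) 0 K + τ (l + K + 1) 0 (1 + l) 1 K -
      (τ (l + K + 1) 0 (K + 1) 0 (l + 1) + τ (l + K + 2) 0 K 0 (l + 1)) := by
  set g : ℕ → ℝ := fun k => τ (l + K + 1) 0 (2 + l) k (K - k) + τ (l + K + 1) 0 (1 + l) (k + 1) (K - k)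
    - (τ 0 0 (K + 1) (l + K + 1 - k) (l + k + 1) + τ 0 0 K (l + K + 2 - k) (l + k + 1)) with hg
  have e : ∀ k ∈ Finset.range K, (-1) ^ k *
      (τ (l + K + 1) 1 (1 + l) (k + 1) (l + K + 1 - l - 2 - k) +
        τ (l + K + 1) 0 (2 + l) k (l + K + 1 - l - 1 - k)
      - (τ 0 1 (l + K + 1 - l - 1) (l + K + 1 - k) (l + k + 1) +
        τ 0 0 (l + K + 1 - l) (l + K + 1 - k - 1) (l + k + 2))) =
      (-1) ^ k * (g k + g (k + 1)) := by
    intro k hk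
    obtain ⟨d, rfl⟩ := Nat.exists_eq_add_of_lt (Finset.mem_range.1 hk)
    simp only [hg]
    rw [show l + (k + d + 1) + 1 - l - 2 - k = d by omega,
      show l + (k + d + 1) + 1 - l - 1 - k = d + 1 by omega,
      show l + (k + d + 1) + 1 - l - 1 = k + d + 1 by omega,
      show l + (k + d + 1) + 1 - k = l + d + 2 by omega,
      show l + (k + d + 1) + 1 - l = k + d + 2 by omega,
      show l + d + 2 - 1 = l + d + 1 by omega, show k + d + 1 - k = d + 1 by omega,
      show k + d + 1 - (k + 1) = d by omega, show l + (k + d + 1) + 2 - k = l + d + 3 by omega,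
      show l + (k + d + 1) + 1 - (k + 1) = l + d + 1 by omega,
      show l + (k + d + 1) + 2 - (k + 1) = l + d + 2 by omega, show l + (k + 1) + 1 = l + k + 2 by omega,
      h.leibniz _ 0 (1 + l), h.leibniz 0 0 (k + d + 1), show 1 + l + 1 = 2 + l by omega,
      show k + d + 1 + 1 = k + d + 2 by omega, show l + k + 1 + 1 = l + k + 2 by omega,
      show l + d + 2 + 1 = l + d + 3 by omega]
    ring
  rw [Finset.sum_congr rfl e, sum_alternating]
  have hK : g K = 0 := by
    simp only [hg]
    rw [Nat.sub_self, show l + K + 1 - K = l + 1 by omega, show l + K + 2 - K = l + 2 by omega,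
      h.conj (l + K + 1) (2 + l) K 0, h.conj (l + K + 1) (1 + l) (K + 1) 0, add_comm 2 l, add_comm 1 l]
    ring
  rw [hK]
  simp only [hg, Nat.sub_zero, Nat.add_zero, Nat.zero_add]
  rw [h.exch 0 (K + 1), h.exch 0 K]
  ring

/-- Again an alternating telescoping sum. Its endpoint k = j has no reason to vanish; the last term
of C_{2,j}, whose derivative appears here with (−1)^j, is there to cancel it. -/
theorem sum_third (j : ℕ) :
    2 * ∑ k ∈ Finset.range j, (-1) ^ k * (τ j 1 0 (k + 1) (j - k - 1) + τ j 0 1 k (j - k)) +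
      (-1) ^ j * (τ (j + 1) 0 0 j 0 + τ j 1 0 j 0) = 2 * (τ j 0 1 0 j + τ j 0 0 1 j) := by
  set g : ℕ → ℝ := fun k => τ j 0 0 (k + 1) (j - k) + τ j 0 1 k (j - k) with hg
  have e : ∀ k ∈ Finset.range j, (-1) ^ k * (τ j 1 0 (k + 1) (j - k - 1) + τ j 0 1 k (j - k)) =
      (-1) ^ k * (g k + g (k + 1)) := by
    intro k hk
    obtain ⟨d, hd⟩ := Nat.exists_eq_add_of_lt (Finset.mem_range.1 hk)
    simp only [hg]
    rw [show j - k - 1 = d by omega, show j - k = d + 1 by omega, show j - (k + 1) = d by omega,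
      h.leibniz j 0 0 (k + 1) d]
    ring
  rw [Finset.sum_congr rfl e, sum_alternating, h.leibniz j 0 0 j 0, h.exch (j + 1) 0 j 0,
    h.symm j 0 (0 + 1) j 0]
  simp only [hg, Nat.sub_self, Nat.sub_zero, Nat.zero_add]
  rw [h.symm j 0 1 j 0]
  ring

/-- Times 1/(4π), the left side is what the derivative of C_{1,j} + C_{2,j} leaves after the R and
κ[b] terms are removed, and the right side is I_{1,j} + I_{2,j}. The first three sums are matched
for each l separately; the rest is `sum_third`. -/
theorem sum_identity (j : ℕ) :
    4 * ∑ l ∈ Finset.range j, ∑ k ∈ Finset.range (l + 1),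
        (τ j (l - k + 1) k 1 (j - l - 1) + τ j (l - k) (k + 1) 0 (j - l - 1 + 1))
      + 2 * ∑ l ∈ Finset.range (j - 1), ∑ k ∈ Finset.range (j - l - 1), (-1) ^ k *
        (τ j 1 (1 + l) (k + 1) (j - l - 2 - k) + τ j 0 (2 + l) k (j - l - 1 - k)
        - (τ 0 1 (j - l - 1) (j - k) (l + k + 1) + τ 0 0 (j - l) (j - k - 1) (l + k + 2)))
      + 2 * ∑ l ∈ Finset.range j, (τ (j + 1) 0 (j - l - 1) 0 (1 + l) + τ j 1 (j - l - 1) 0 (1 + l))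
      + (2 * ∑ k ∈ Finset.range j, (-1) ^ k * (τ j 1 0 (k + 1) (j - k - 1) + τ j 0 1 k (j - k)) +
      (-1) ^ j * (τ (j + 1) 0 0 j 0 + τ j 1 0 j 0)) =
    4 * ∑ l ∈ Finset.range j, (τ j (l + 1) 1 0 (j - l - 1) + τ j (l + 1) 0 1 (j - l - 1)) +
      2 * (τ j 0 1 0 j + τ j 0 0 1 j) := by
  rw [h.sum_third j]
  congr 1
  -- Adding l = j − 1 adds an empty inner sum, so all sums over l acquire the same range.
  have ext : ∑ l ∈ Finset.range (j - 1), ∑ k ∈ Finset.range (j - l - 1), (-1) ^ k *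
        (τ j 1 (1 + l) (k + 1) (j - l - 2 - k) + τ j 0 (2 + l) k (j - l - 1 - k)
        - (τ 0 1 (j - l - 1) (j - k) (l + k + 1) + τ 0 0 (j - l) (j - k - 1) (l + k + 2))) =
      ∑ l ∈ Finset.range j, ∑ k ∈ Finset.range (j - l - 1), (-1) ^ k *
        (τ j 1 (1 + l) (k + 1) (j - l - 2 - k) + τ j 0 (2 + l) k (j - l - 1 - k)
        - (τ 0 1 (j - l - 1) (j - k) (l + k + 1) + τ 0 0 (j - l) (j - k - 1) (l + k + 2))) := by
    cases j with
    | zero => rfl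
    | succ n =>
      rw [Finset.sum_range_succ, Nat.add_sub_cancel, show n + 1 - n - 1 = 0 by omega,
        Finset.sum_range_zero, add_zero]
  rw [ext, Finset.mul_sum, Finset.mul_sum, Finset.mul_sum, Finset.mul_sum,
    ← Finset.sum_add_distrib, ← Finset.sum_add_distrib]
  refine Finset.sum_congr rfl fun l hl => ?_
  obtain ⟨n, rfl⟩ := Nat.exists_eq_add_of_lt (Finset.mem_range.1 hl)
  rw [show l + n + 1 - l - 1 = n by omega, h.sum_first]
  have h2 := h.sum_second l n
  rw [show l + n + 1 - l - 1 = n by omega] at h2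
  rw [h2, h.leibniz _ (l + 1) 0 0 n, h.leibniz _ 0 (l + 1) 0 n, h.leibniz _ 0 n 0 (1 + l)]
  simp only [Nat.zero_add, add_comm 1 l, add_comm 2 l]
  rw [show l + 1 + 1 = l + 2 from rfl, h.symm _ 0 (l + 2) 0 n, h.symm _ 0 (l + 1) 1 n,
    show l + n + 1 + 1 = l + n + 2 from rfl, h.symm _ 0 (n + 1) 0 (l + 1)]
  ring

end Pairing

/-! ### Symmetrization and the derivative of the correcting functionals -/

theorem pairInt_del_mul {I : Set ℝ} (hI : IsOpen I) {v : ℝ → ℝ → ℂ} (hv : SDec I v)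
    {F : ℝ → ℝ → ℝ → ℂ} (hF : Tri3 I F) {t : ℝ} (ht : t ∈ I) :
    pairInt (fun t α β => (v t α - v t β) * F t α β) t =
      2 * pairInt (fun t α β => v t α * F t α β) t := by
  have h1 := (hF.left_mul hv).integrable hI ht
  have h2 := h1.swap
  have e : ∀ p : ℝ × ℝ, (v t p.1 - v t p.2) * F t p.1 p.2 / ((p.1 : ℂ) - p.2) ^ 2 =
      v t p.1 * F t p.1 p.2 / ((p.1 : ℂ) - p.2) ^ 2 +
      ((fun p : ℝ × ℝ => v t p.1 * F t p.1 p.2 / ((p.1 : ℂ) - p.2) ^ 2) ∘ Prod.swap) p := by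
    intro p
    simp only [Function.comp_apply, Prod.fst_swap, Prod.snd_swap, hF.swap t ht p.1 p.2]
    rw [← neg_sub (p.1 : ℂ), neg_sq]
    ring
  have h3 := integral_prod_swap (μ := (volume : Measure ℝ)) (ν := (volume : Measure ℝ))
    (fun p : ℝ × ℝ => v t p.1 * F t p.1 p.2 / ((p.1 : ℂ) - p.2) ^ 2)
  rw [← Measure.volume_eq_prod] at h3
  rw [pairInt]
  simp only [e]
  rw [integral_add h1 h2]
  simp only [Function.comp_def]
  rw [h3, pairInt, two_mul]

namespace Sol

variable (s : Sol) {t : ℝ}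

/-- `Re ⟨v_c 𝔇_t^m (θ_l θ̄_i θ_k)⟩`. -/
def τ (t : ℝ) (c m l i k : ℕ) : ℝ := (pairInt (s.S.VD c * s.S.DD^[m] (s.S.T l i k)) t).re

/-- The triple product is odd under α ↔ β, so 2v_c(α) may be replaced by v_c(α) − v_c(β), the
conjugate of θ_c. Then two conjugated and two unconjugated factors stand on an equal footing, which
yields the symmetries `exch` and `conj`. -/
theorem τ_zero (ht : t ∈ s.I) (c l i k : ℕ) : 2 * s.τ t c 0 l i k = (pairInt (fun t α β =>
    star (s.S.θD c t α β) * (s.S.θD l t α β * star (s.S.θD i t α β) * s.S.θD k t α β)) t).re := by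
  have h := pairInt_del_mul s.isOpen (s.sdec_iterate_V c) (s.tri_T l i k) ht
  have e : pairInt (fun t α β => star (s.S.θD c t α β) *
      (s.S.θD l t α β * star (s.S.θD i t α β) * s.S.θD k t α β)) t = 2 * pairInt (s.S.VD c *
        s.S.DD^[0] (s.S.T l i k)) t := by
    refine Eq.trans (pairInt_congr (I := s.I) (fun t ht α β => ?_) ht) h
    rw [s.θD_eq c t ht]
    simp only [star_sub, iterate_D_Vb, star_star]
    rfl
  rw [e, τ]
  simp

theorem pairing (ht : t ∈ s.I) : Pairing (s.τ t) where
  leibniz c m l i k := by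
    have e : EqJ s.I (s.S.VD c * s.S.DD^[m + 1] (s.S.T l i k)) (fun t α β =>
        s.S.VD c t α β * (s.S.DD^[m] (s.S.T (l + 1) i k)) t α β +
        s.S.VD c t α β * (s.S.DD^[m] (s.S.T l (i + 1) k)) t α β +
        s.S.VD c t α β * (s.S.DD^[m] (s.S.T l i (k + 1))) t α β) := fun t ht α β => by
      have h1 := s.iterate_DD_congr (s.DD_T l i k) m t ht α β
      rw [s.iterate_DD_add ((s.tri_T _ _ _).add (s.tri_T _ _ _)) (s.tri_T _ _ _) m t ht] at h1
      beta_reduce at h1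
      rw [s.iterate_DD_add (s.tri_T _ _ _) (s.tri_T _ _ _) m t ht] at h1
      rw [Function.iterate_succ_apply, Pi.mul_apply, Pi.mul_apply, Pi.mul_apply, h1]
      ring
    have q : ∀ l i k, Quad4 s.I (fun t α β => s.S.VD c t α β * (s.S.DD^[m] (s.S.T l i k)) t α β) :=
      fun l i k => s.quad_VD c (s.tri_iterate_DD (s.tri_T l i k) m)
    rw [τ, pairInt_congr e ht, pairInt_add s.isOpen ht ((q _ _ _).add (q _ _ _)) (q _ _ _),
      pairInt_add s.isOpen ht (q _ _ _) (q _ _ _), Complex.add_re, Complex.add_re]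
    rfl
  symm c m l i k := by
    have e : s.S.T l i k = s.S.T k i l := by
      ext t α β; simp only [Wave.T]; ring
    rw [τ, τ, e]
  exch c l i k := by
    have h1 := s.τ_zero ht c l i k
    have h2 := s.τ_zero ht i l c k
    have e : (fun t α β => star (s.S.θD c t α β) *
        (s.S.θD l t α β * star (s.S.θD i t α β) * s.S.θD k t α β)) =
        fun t α β => star (s.S.θD i t α β) *
        (s.S.θD l t α β * star (s.S.θD c t α β) * s.S.θD k t α β) := by
      ext t α β; ring
    rw [e] at h1
    linarith
  conj c l i k := by
    have h1 := s.τ_zero ht c l i k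
    have h2 := s.τ_zero ht k i l c
    have e : (fun t α β => star (s.S.θD c t α β) *
        (s.S.θD l t α β * star (s.S.θD i t α β) * s.S.θD k t α β)) =
        fun t α β => star (star (s.S.θD k t α β) *
        (s.S.θD i t α β * star (s.S.θD l t α β) * s.S.θD c t α β)) := by
      ext t α β; simp only [star_mul', star_star]; ring
    rw [e, pairInt_star] at h1
    have h3 : 2 * s.τ t c 0 l i k = 2 * s.τ t k 0 i l c := by
      rw [h1, h2]; exact Complex.conj_re _
    linarith

/-! ### The correcting functionals -/

/-- Conjugate, then replace the differences of v_0 and v_1 by twice their values at α. The factor 2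
converts the constant 1/(8π) of C_{1,j} into the 1/(4π) of R_{IC,j}. -/
theorem pairInt_skew_θ (p q r : ℕ) (ht : t ∈ s.I) :
    (pairInt (s.S.skew s.S.θ (s.S.DD s.S.θ) (s.S.θbarD p * s.S.θD q * s.S.θbarD r)) t).re =
    2 * (pairInt (s.S.skew (s.S.VD 0) (s.S.VD 1) (s.S.DD^[0] (s.S.T p q r))) t).re := by
  have hI := s.isOpen
  set M := s.S.T p q r with hM
  have tM : Tri3 s.I M := s.tri_T p q r
  have eM : s.S.θbarD p * s.S.θD q * s.S.θbarD r = fun t α β => star (M t α β) := by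
    ext t α β
    simp only [hM, Wave.T, Pi.mul_apply, s.θbarD_eq, star_mul', star_star]
  have e1 : EqJ s.I (s.S.skew s.S.θ (s.S.DD s.S.θ) (s.S.θbarD p * s.S.θD q * s.S.θbarD r))
      (fun t α β => star (((s.S.D^[0] s.S.V) t α - (s.S.D^[0] s.S.V) t β) * s.S.DD M t α β -
        ((s.S.D^[1] s.S.V) t α - (s.S.D^[1] s.S.V) t β) * M t α β)) := fun t ht α β => by
    have h0 := s.θD_eq 0 t ht α β
    have h1 := s.θD_eq 1 t ht α β
    have h2 : s.S.θ t α β = _ := h0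
    have h3 : s.S.DD s.S.θ t α β = _ := h1
    rw [eM, Wave.skew, Pi.sub_apply, Pi.sub_apply, Pi.sub_apply, Pi.mul_apply, Pi.mul_apply,
      Pi.mul_apply, Pi.mul_apply, Pi.mul_apply, Pi.mul_apply, h2, h3, s.DD_star]
    simp only [star_sub, star_mul', iterate_D_Vb]
  have q0 := tM.left_mul (s.sdec_iterate_V 1)
  have q1 := (s.tri_DD tM).left_mul (s.sdec_iterate_V 0)
  have i1 := (q1.integrable hI ht).add (q1.integrable hI ht).swap
  have key : pairInt (fun t α β => ((s.S.D^[0] s.S.V) t α - (s.S.D^[0] s.S.V) t β) * s.S.DD M t α β -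
        ((s.S.D^[1] s.S.V) t α - (s.S.D^[1] s.S.V) t β) * M t α β) t =
      2 * pairInt (s.S.skew (s.S.VD 0) (s.S.VD 1) M) t := by
    have a1 := pairInt_del_mul hI (s.sdec_iterate_V 0) (s.tri_DD tM) ht
    have a2 := pairInt_del_mul hI (s.sdec_iterate_V 1) tM ht
    have a3 : pairInt (s.S.skew (s.S.VD 0) (s.S.VD 1) M) t =
      pairInt (fun t α β => (s.S.D^[0] s.S.V) t α * s.S.DD M t α β) t -
      pairInt (fun t α β => (s.S.D^[1] s.S.V) t α * M t α β) t := pairInt_sub hI ht q1 q0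
    rw [a3, mul_sub, ← a1, ← a2]
    have sw : ∀ {v : ℝ → ℝ → ℂ} {F : ℝ → ℝ → ℝ → ℂ}, SDec s.I v → Tri3 s.I F →
        Integrable fun p : ℝ × ℝ => (v t p.1 - v t p.2) * F t p.1 p.2 / ((p.1 : ℂ) - p.2) ^ 2 := by
      intro v F hv hF
      have q := (hF.left_mul hv).integrable hI ht
      refine (q.add q.swap).congr (Eventually.of_forall fun p => ?_)
      simp only [Pi.add_apply, Function.comp_apply, Prod.fst_swap, Prod.snd_swap,
        hF.swap t ht p.1 p.2]
      rw [← neg_sub (p.1 : ℂ), neg_sq]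
      ring
    simp only [pairInt, sub_div]
    exact integral_sub (sw (s.sdec_iterate_V 0) (s.tri_DD tM)) (sw (s.sdec_iterate_V 1) tM)
  rw [pairInt_congr e1 ht, pairInt_star, Complex.star_def, Complex.conj_re, key]
  simp

theorem hasDerivAt_re {F : ℝ → ℂ} {F' : ℂ} (h : HasDerivAt F F' t) :
    HasDerivAt (fun t => (F t).re) F'.re t := Complex.reCLM.hasFDerivAt.comp_hasDerivAt t h

theorem hasDerivAt_skew_re (c m l i k : ℕ) (ht : t ∈ s.I) : HasDerivAt (fun t =>
      (pairInt (s.S.skew (s.S.VD c) (s.S.VD (c + 1)) (s.S.DD^[m] (s.S.T l i k))) t).re)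
    ((s.S.R m c l i k t).re + 2 * (s.τ t c (m + 1) l (i + 1) k + s.τ t c m (l + 1) i (k + 1))) t := by
  refine (hasDerivAt_re (s.hasDerivAt_skew c m l i k ht)).congr_deriv ?_
  simp [τ]

theorem hasDerivAt_VD_mul_re (c l i k : ℕ) (ht : t ∈ s.I) :
    HasDerivAt (fun t => (pairInt (s.S.VD c * s.S.T l i k) t).re)
    (s.τ t (c + 1) 0 l i k + s.τ t c 1 l i k +
      (pairInt (s.S.κb * (s.S.VD c * s.S.θD l * s.S.θbarD i * s.S.θD k)) t).re) t := by
  have tT := s.tri_T l i k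
  refine (hasDerivAt_re (s.hasDerivAt_pairInt (s.quad_VD c tT) ht)).congr_deriv ?_
  have e1 : EqJ s.I (s.S.DD fun t α β => s.S.VD c t α β * s.S.T l i k t α β) (fun t α β =>
      s.S.VD (c + 1) t α β * s.S.T l i k t α β + s.S.VD c t α β * s.S.DD (s.S.T l i k) t α β) :=
    fun t ht α β => by
      have h1 : Two s.I (s.S.VD c) := .left (s.sdec_iterate_V c)
      rw [s.DD_mul h1 tT.two t ht, DD_VD]
  have e2 : (fun t α β => s.S.κb t α β * (s.S.VD c t α β * s.S.T l i k t α β)) =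
      s.S.κb * (s.S.VD c * s.S.θD l * s.S.θbarD i * s.S.θD k) := by
    rw [mul_assoc (s.S.VD c), mul_assoc (s.S.VD c), ← s.T_eq]; rfl
  rw [e2, pairInt_congr e1 ht, pairInt_add s.isOpen ht (s.quad_VD (c + 1) tT)
    (s.quad_VD c (s.tri_DD tT)), Complex.add_re, Complex.add_re]
  rfl

end Sol

namespace Sol

variable (s : Sol) {t : ℝ}

theorem C₁_re (j : ℕ) (ht : t ∈ s.I) : (s.S.C₁ j t).re =
    1 / (2 * Real.pi) * ∑ l ∈ Finset.range j, ∑ k ∈ Finset.range (l + 1),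
      (pairInt (s.S.skew (s.S.VD j) (s.S.VD (j + 1)) (s.S.DD^[l - k] (s.S.T k 0 (j - l - 1)))) t).re
    + 1 / (4 * Real.pi) * ∑ l ∈ Finset.range (j - 1), ∑ k ∈ Finset.range (j - l - 1), (-1) ^ k *
      (pairInt (s.S.skew (s.S.VD j) (s.S.VD (j + 1))
        (s.S.DD^[0] (s.S.T (1 + l) k (j - l - 2 - k)))) t).re
    - 1 / (4 * Real.pi) * ∑ l ∈ Finset.range (j - 1), ∑ k ∈ Finset.range (j - l - 1), (-1) ^ k *
      (pairInt (s.S.skew (s.S.VD 0) (s.S.VD (0 + 1))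
        (s.S.DD^[0] (s.S.T (j - l - 1) (j - k - 1) (l + k + 1)))) t).re
    + 1 / (2 * Real.pi) * ∑ l ∈ Finset.range j,
      (pairInt (s.S.VD j * s.S.T (j - l - 1) 0 (1 + l)) t).re := by
  have c1 : (1 / (2 * (Real.pi : ℂ))) = ((1 / (2 * Real.pi) : ℝ) : ℂ) := by push_cast; ring
  have c2 : (1 / (4 * (Real.pi : ℂ))) = ((1 / (4 * Real.pi) : ℝ) : ℂ) := by push_cast; ring
  have c3 : (1 / (8 * (Real.pi : ℂ))) = ((1 / (8 * Real.pi) : ℝ) : ℂ) := by push_cast; ring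
  have c4 : ∀ k : ℕ, (-1 : ℂ) ^ k = (((-1) ^ k : ℝ) : ℂ) := fun k => by push_cast; ring
  have e3 : ∀ l k : ℕ, (pairInt (s.S.skew s.S.θ (s.S.DD s.S.θ)
        (s.S.θbarD (j - l - 1) * s.S.θD (j - k - 1) * s.S.θbarD (k + l + 1))) t).re =
      2 * (pairInt (s.S.skew (s.S.VD 0) (s.S.VD (0 + 1))
        (s.S.DD^[0] (s.S.T (j - l - 1) (j - k - 1) (l + k + 1)))) t).re := fun l k => by
    rw [add_comm k l]
    exact s.pairInt_skew_θ _ _ _ ht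
  rw [Wave.C₁]
  simp only [← T_eq, c1, c2, c3, c4, Complex.add_re, Complex.sub_re, Complex.re_ofReal_mul,
    Complex.re_sum, e3, Function.iterate_zero, id_eq]
  have e4 : ∀ l k : ℕ, (-1 : ℝ) ^ k * (2 * (pairInt (s.S.skew (s.S.VD 0) (s.S.VD (0 + 1))
      (s.S.T (j - l - 1) (j - k - 1) (l + k + 1))) t).re) = 2 * ((-1) ^ k *
      (pairInt (s.S.skew (s.S.VD 0) (s.S.VD (0 + 1))
      (s.S.T (j - l - 1) (j - k - 1) (l + k + 1))) t).re) := fun l k => by ring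
  simp only [e4, ← Finset.mul_sum]
  ring

theorem C₂_re (j : ℕ) : (s.S.C₂ j t).re =
    1 / (4 * Real.pi) * ∑ k ∈ Finset.range j, (-1) ^ k *
      (pairInt (s.S.skew (s.S.VD j) (s.S.VD (j + 1)) (s.S.DD^[0] (s.S.T 0 k (j - k - 1)))) t).re
    + 1 / (4 * Real.pi) * (-1) ^ j * (pairInt (s.S.VD j * s.S.T 0 j 0) t).re := by
  have c2 : (1 / (4 * (Real.pi : ℂ))) = ((1 / (4 * Real.pi) : ℝ) : ℂ) := by push_cast; ring
  have c4 : ∀ k : ℕ, (-1 : ℂ) ^ k = (((-1) ^ k : ℝ) : ℂ) := fun k => by push_cast; ring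
  have e : s.S.θ = s.S.θD 0 := rfl
  rw [Wave.C₂]
  simp only [e, ← T_eq]
  simp only [c2, c4, Complex.add_re, mul_assoc, Complex.re_ofReal_mul,
    Complex.re_sum, Function.iterate_zero, id_eq]

theorem DD_sq_mul (n : ℕ) : EqJ s.I (s.S.DD (s.S.θ * star s.S.θ) * s.S.θD n)
    (fun t α β => s.S.T 1 0 n t α β + s.S.T 0 1 n t α β) := fun t ht α β => by
  have h := s.DD_mul (s.two_θD 0) ((s.two_θD 0).star s.isOpen) t ht α β
  rw [s.DD_star, DD_θD] at h
  rw [Pi.mul_apply, Pi.mul_apply, Pi.mul_apply, show s.S.DD (s.S.θ * star s.S.θ) t α β = _ from h]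
  simp only [Wave.T]
  ring

theorem pairInt_DD_sq_mul (j m n : ℕ) (ht : t ∈ s.I) :
    (pairInt (s.S.VD j * s.S.DD^[m] (s.S.DD (s.S.θ * star s.S.θ) * s.S.θD n)) t).re =
      s.τ t j m 1 0 n + s.τ t j m 0 1 n := by
  have e1 : EqJ s.I (s.S.VD j * s.S.DD^[m] (s.S.DD (s.S.θ * star s.S.θ) * s.S.θD n)) (fun t α β =>
      s.S.VD j t α β * (s.S.DD^[m] (s.S.T 1 0 n)) t α β +
      s.S.VD j t α β * (s.S.DD^[m] (s.S.T 0 1 n)) t α β) := fun t ht α β => by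
    have h := s.iterate_DD_congr (s.DD_sq_mul n) m t ht α β
    rw [s.iterate_DD_add (s.tri_T 1 0 n) (s.tri_T 0 1 n) m t ht] at h
    rw [Pi.mul_apply, Pi.mul_apply, Pi.mul_apply, h]
    ring
  rw [pairInt_congr e1 ht, pairInt_add s.isOpen ht
    (s.quad_VD j (s.tri_iterate_DD (s.tri_T 1 0 n) m))
    (s.quad_VD j (s.tri_iterate_DD (s.tri_T 0 1 n) m)), Complex.add_re]
  rfl

theorem I₁_eq (j : ℕ) (ht : t ∈ s.I) : s.S.I₁ j t = 1 / Real.pi * ∑ l ∈ Finset.range j,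
    (s.τ t j (l + 1) 1 0 (j - l - 1) + s.τ t j (l + 1) 0 1 (j - l - 1)) := by
  rw [Wave.I₁, Complex.re_sum]
  simp only [s.pairInt_DD_sq_mul _ _ _ ht]

theorem I₂_eq (j : ℕ) (ht : t ∈ s.I) : s.S.I₂ j t =
    1 / (2 * Real.pi) * (s.τ t j 0 1 0 j + s.τ t j 0 0 1 j) := by
  rw [Wave.I₂, ← s.pairInt_DD_sq_mul j 0 j ht]
  rfl

theorem RIC_eq (j : ℕ) (t : ℝ) : s.S.RIC j t = - (1 / (2 * Real.pi)) * ∑ l ∈ Finset.range j,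
      (pairInt (s.S.κb * (s.S.VD j * s.S.θD (j - l - 1) * s.S.θbarD 0 * s.S.θD (1 + l))) t).re
    - 1 / (4 * Real.pi) * (2 * ∑ l ∈ Finset.range j, ∑ k ∈ Finset.range (l + 1),
        (s.S.R (l - k) j k 0 (j - l - 1) t).re
      + ∑ l ∈ Finset.range (j - 1), ∑ k ∈ Finset.range (j - l - 1), (-1 : ℝ) ^ k *
        ((s.S.R 0 j (1 + l) k (j - l - 2 - k) t).re - (s.S.R 0 0 (j - l - 1) (j - k - 1) (l + k + 1) t).re))
    - (-1) ^ j * (1 / (4 * Real.pi)) *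
      (pairInt (s.S.κb * (s.S.VD j * s.S.θD 0 * s.S.θbarD j * s.S.θD 0)) t).re
    - 1 / (4 * Real.pi) * ∑ k ∈ Finset.range j, (-1 : ℝ) ^ k * (s.S.R 0 j 0 k (j - k - 1) t).re := by
  have c4 : ∀ k : ℕ, (-1 : ℂ) ^ k = (((-1) ^ k : ℝ) : ℂ) := fun k => by push_cast; ring
  have c5 : ∀ z : ℂ, (star z).re = z.re := fun z => Complex.conj_re z
  rw [Wave.RIC]
  simp only [c4, Complex.add_re, Complex.sub_re, Complex.re_ofReal_mul, Complex.re_sum, c5,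
    show (2 : ℂ) = ((2 : ℝ) : ℂ) by norm_num, add_comm 1]
  rfl

/-- Term by term, the R and κ[b] contributions add up to −R_{IC,j}, and the remaining pairings are
summed by `Pairing.sum_identity`. -/
theorem hasDerivAt_C (j : ℕ) (ht : t ∈ s.I) :
    HasDerivAt (fun t => (s.S.C₁ j t + s.S.C₂ j t).re) (s.S.I₁ j t + s.S.I₂ j t - s.S.RIC j t) t := by
  have hsum : ∀ {n : ℕ} {F : ℕ → ℝ → ℝ} {F' : ℕ → ℝ}, (∀ l ∈ Finset.range n, HasDerivAt (F l) (F' l) t) →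
      HasDerivAt (fun t => ∑ l ∈ Finset.range n, F l t) (∑ l ∈ Finset.range n, F' l) t :=
    fun h => HasDerivAt.fun_sum h
  have d1 := ((hsum (n := j) fun l _ => hsum (n := l + 1) fun k _ =>
      s.hasDerivAt_skew_re j (l - k) k 0 (j - l - 1) ht).const_mul (1 / (2 * Real.pi)))
  have d2 := ((hsum (n := j - 1) fun l _ => hsum (n := j - l - 1) fun k _ =>
      (s.hasDerivAt_skew_re j 0 (1 + l) k (j - l - 2 - k) ht).const_mul ((-1) ^ k)).const_mul
        (1 / (4 * Real.pi)))
  have d3 := ((hsum (n := j - 1) fun l _ => hsum (n := j - l - 1) fun k _ =>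
      (s.hasDerivAt_skew_re 0 0 (j - l - 1) (j - k - 1) (l + k + 1) ht).const_mul ((-1) ^ k)).const_mul
        (1 / (4 * Real.pi)))
  have d4 := ((hsum (n := j) fun l _ =>
      s.hasDerivAt_VD_mul_re j (j - l - 1) 0 (1 + l) ht).const_mul (1 / (2 * Real.pi)))
  have d5 := ((hsum (n := j) fun k _ =>
      (s.hasDerivAt_skew_re j 0 0 k (j - k - 1) ht).const_mul ((-1) ^ k)).const_mul
        (1 / (4 * Real.pi)))
  have d6 := (s.hasDerivAt_VD_mul_re j 0 j 0 ht).const_mul (1 / (4 * Real.pi) * (-1) ^ j)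
  have hd := ((((d1.add d2).sub d3).add d4).add (d5.add d6))
  have ev := (s.isOpen.mem_nhds ht)
  refine (HasDerivAt.congr_of_eventuallyEq hd (f₁ := fun t => (s.S.C₁ j t + s.S.C₂ j t).re)
    (by filter_upwards [ev] with r hr; rw [Complex.add_re, s.C₁_re j hr, s.C₂_re j]; rfl)).congr_deriv ?_
  have key := (s.pairing ht).sum_identity j
  have h1 : ∑ l ∈ Finset.range j, ∑ k ∈ Finset.range (l + 1), ((s.S.R (l - k) j k 0 (j - l - 1) t).re +
        2 * (s.τ t j (l - k + 1) k (0 + 1) (j - l - 1) + s.τ t j (l - k) (k + 1) 0 (j - l - 1 + 1))) =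
      ∑ l ∈ Finset.range j, ∑ k ∈ Finset.range (l + 1), (s.S.R (l - k) j k 0 (j - l - 1) t).re +
      2 * ∑ l ∈ Finset.range j, ∑ k ∈ Finset.range (l + 1),
        (s.τ t j (l - k + 1) k 1 (j - l - 1) + s.τ t j (l - k) (k + 1) 0 (j - l - 1 + 1)) := by
    simp only [Finset.mul_sum, ← Finset.sum_add_distrib]
  have h2 : ∑ l ∈ Finset.range (j - 1), ∑ k ∈ Finset.range (j - l - 1), (-1 : ℝ) ^ k *
        ((s.S.R 0 j (1 + l) k (j - l - 2 - k) t).re + 2 * (s.τ t j (0 + 1) (1 + l) (k + 1) (j - l - 2 - k) +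
          s.τ t j 0 (1 + l + 1) k (j - l - 2 - k + 1))) -
      ∑ l ∈ Finset.range (j - 1), ∑ k ∈ Finset.range (j - l - 1), (-1 : ℝ) ^ k *
        ((s.S.R 0 0 (j - l - 1) (j - k - 1) (l + k + 1) t).re +
          2 * (s.τ t 0 (0 + 1) (j - l - 1) (j - k - 1 + 1) (l + k + 1) +
            s.τ t 0 0 (j - l - 1 + 1) (j - k - 1) (l + k + 1 + 1))) =
      ∑ l ∈ Finset.range (j - 1), ∑ k ∈ Finset.range (j - l - 1), (-1 : ℝ) ^ k *
        ((s.S.R 0 j (1 + l) k (j - l - 2 - k) t).re - (s.S.R 0 0 (j - l - 1) (j - k - 1) (l + k + 1) t).re) +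
      2 * ∑ l ∈ Finset.range (j - 1), ∑ k ∈ Finset.range (j - l - 1), (-1) ^ k *
        (s.τ t j 1 (1 + l) (k + 1) (j - l - 2 - k) + s.τ t j 0 (2 + l) k (j - l - 1 - k)
        - (s.τ t 0 1 (j - l - 1) (j - k) (l + k + 1) + s.τ t 0 0 (j - l) (j - k - 1) (l + k + 2))) := by
    simp only [Finset.mul_sum, ← Finset.sum_add_distrib, ← Finset.sum_sub_distrib]
    refine Finset.sum_congr rfl fun l hl => Finset.sum_congr rfl fun k hk => ?_
    have hl := Finset.mem_range.1 hl
    have hk := Finset.mem_range.1 hk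
    rw [show j - l - 2 - k + 1 = j - l - 1 - k by omega, show 1 + l + 1 = 2 + l by omega,
      show j - k - 1 + 1 = j - k by omega, show j - l - 1 + 1 = j - l by omega]
    ring
  have h3 : ∑ k ∈ Finset.range j, (-1 : ℝ) ^ k * ((s.S.R 0 j 0 k (j - k - 1) t).re +
        2 * (s.τ t j (0 + 1) 0 (k + 1) (j - k - 1) + s.τ t j 0 (0 + 1) k (j - k - 1 + 1))) =
      ∑ k ∈ Finset.range j, (-1 : ℝ) ^ k * (s.S.R 0 j 0 k (j - k - 1) t).re +
      2 * ∑ k ∈ Finset.range j, (-1) ^ k *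
        (s.τ t j 1 0 (k + 1) (j - k - 1) + s.τ t j 0 1 k (j - k)) := by
    simp only [Finset.mul_sum, ← Finset.sum_add_distrib]
    refine Finset.sum_congr rfl fun k hk => ?_
    have hk := Finset.mem_range.1 hk
    rw [show j - k - 1 + 1 = j - k by omega]
    ring
  rw [s.I₁_eq j ht, s.I₂_eq j ht, s.RIC_eq j t, h1, h3]
  have e1 : 1 / (2 * Real.pi) = 2 * (1 / (4 * Real.pi)) := by
    have := Real.pi_ne_zero
    field_simp; norm_num
  have e2 : 1 / Real.pi = 4 * (1 / (4 * Real.pi)) := by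
    have := Real.pi_ne_zero
    field_simp
  rw [e1, e2]
  simp only [Finset.sum_add_distrib] at key ⊢
  generalize 1 / (4 * Real.pi) = p
  linear_combination p * key + p * h2

end Sol

/-! ### Degree in two variables -/

/-- `∫ F(t, x, y) / (x - y)² dy`. -/
def row (F : ℝ → ℝ → ℝ → ℂ) (t x : ℝ) : ℂ := rowInt (F t) x

theorem row_congr {I : Set ℝ} {F G : ℝ → ℝ → ℝ → ℂ} (h : EqJ I F G) : EqI I (row F) (row G) :=
  fun t ht x => by simp only [row, rowInt, h t ht]

theorem row_smul (c : ℂ) (F : ℝ → ℝ → ℝ → ℂ) (t x : ℝ) :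
    row (fun t α β => c * F t α β) t x = c * row F t x := by
  simp only [row, rowInt, mul_div_assoc, integral_const_mul]

namespace Tri3

variable {I : Set ℝ} (hI : IsOpen I) {F G : ℝ → ℝ → ℝ → ℂ}
include hI

theorem integrable_row (hF : Tri3 I F) {t : ℝ} (ht : t ∈ I) (x : ℝ) :
    Integrable fun y => F t x y / ((x : ℂ) - y) ^ 2 := by
  induction hF with
  | mk hf hg hh => exact integrable_dprod_row (hf.hinf hI ht) (hg.hinf hI ht) (hh.hinf hI ht) x
  | smul c _ ih => simpa only [mul_div_assoc] using ih.const_mul c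
  | add _ _ ih ih' => simp only [add_div]; exact ih.add ih'
  | congr _ h ih => simpa only [h t ht] using ih

theorem row_add (hF : Tri3 I F) (hG : Tri3 I G) :
    EqI I (row fun t α β => F t α β + G t α β) (fun t x => row F t x + row G t x) :=
  fun t ht x => by
    simp only [row, rowInt, add_div]
    exact integral_add (hF.integrable_row hI ht x) (hG.integrable_row hI ht x)

theorem pairInt_eq (hF : Tri3 I F) {v : ℝ → ℝ → ℂ} (hv : SDec I v) {t : ℝ} (ht : t ∈ I) :
    pairInt (fun t α β => v t α * F t α β) t = ∫ x, v t x * row F t x := by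
  have h := integral_prod _ ((hF.left_mul hv).integrable hI ht)
  rw [← Measure.volume_eq_prod] at h
  rw [pairInt, h]
  simp only [row, rowInt, mul_div_assoc, integral_const_mul]

/-- The row of a product of three differences is π i `tri₂`; regularity in time and the product rule
are inherited from it. -/
theorem sdec_row (hF : Tri3 I F) :
    SDec I (row F) ∧ EqI I (dt (row F)) (row (WaterWave.vf 1 (fun _ _ => 0) F)) := by
  have h0 : Mult I fun _ _ => 0 := .const hI 0
  induction hF with
  | @mk f g h hf hg hh =>
    have e : EqI I (row fun t α β => dprod (f t) (g t) (h t) α β)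
        (fun t x => Real.pi * Complex.I * tri₂ f g h t x) := fun t ht x => hf.rowInt_eq hI hg hh ht x
    have hs := (hf.tri₂ hI hg hh).smul hI (Real.pi * Complex.I)
    refine ⟨hs.congr hI e.symm, fun t ht x => ?_⟩
    have e1 : ∀ f : ℝ → ℝ → ℂ, vf₁ 1 (fun _ _ => 0) f = dt f := fun f => by
      ext t x; simp [vf₁]
    rw [e.dt hI t ht x, row_congr (vf_dprod hI 1 _ hf hg hh) t ht x]
    simp only [e1]
    rw [((mk (hf.dt hI) hg hh).add (mk hf (hg.dt hI) hh)).row_add hI (mk hf hg (hh.dt hI)) t ht x]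
    beta_reduce
    rw [(mk (hf.dt hI) hg hh).row_add hI (mk hf (hg.dt hI) hh) t ht x]
    have r1 : row (fun t α β => dprod (dt f t) (g t) (h t) α β) t x = _ :=
      (hf.dt hI).rowInt_eq hI hg hh ht x
    have r2 : row (fun t α β => dprod (f t) (dt g t) (h t) α β) t x = _ :=
      hf.rowInt_eq hI (hg.dt hI) hh ht x
    have r3 : row (fun t α β => dprod (f t) (g t) (dt h t) α β) t x = _ :=
      hf.rowInt_eq hI hg (hh.dt hI) ht x
    have r4 : dt (fun t x => Real.pi * Complex.I * tri₂ f g h t x) t x =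
        Real.pi * Complex.I * dt (tri₂ f g h) t x :=
      (((hf.tri₂ hI hg hh).hasDerivAt_t ht x).const_mul _).deriv
    beta_reduce
    rw [r1, r2, r3, r4, hf.dt_tri₂ hI hg hh ht]
    ring
  | @smul F c hF ih =>
    have e : row (fun t α β => c * F t α β) = fun t x => c * row F t x := by
      ext t x; exact row_smul c F t x
    rw [e]
    refine ⟨ih.1.smul hI c, fun t ht x => ?_⟩
    have r : dt (fun t x => c * row F t x) t x = _ := ((ih.1.hasDerivAt_t ht x).const_mul c).deriv
    rw [r, ih.2 t ht x, row_congr (I := I) (fun t _ α β => vf_smul 1 _ c F t α β) t ht x, row_smul]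
  | @add F G hF hG ih ih' =>
    have e := hF.row_add hI hG
    refine ⟨(ih.1.add hI ih'.1).congr hI e.symm, fun t ht x => ?_⟩
    have r : dt (fun t x => row F t x + row G t x) t x = _ :=
      ((ih.1.hasDerivAt_t ht x).add (ih'.1.hasDerivAt_t ht x)).deriv
    rw [e.dt hI t ht x, r, ih.2 t ht x, ih'.2 t ht x,
      row_congr (vf_add hI 1 _ hF.two hG.two) t ht x, (hF.vf hI h0 1).row_add hI (hG.vf hI h0 1) t ht x]
  | @congr F G hF h ih =>
    refine ⟨ih.1.congr hI (row_congr h), fun t ht x => ?_⟩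
    rw [(row_congr h.symm).dt hI t ht x, ih.2 t ht x, row_congr (h.vf hI 1 _) t ht x]

end Tri3

theorem Deg.tri₂ {m n p : ℕ} {X Y Z : Wave → ℝ → ℝ → ℂ} (hX : Deg m X) (hY : Deg n Y) (hZ : Deg p Z) :
    Deg (m + n + p) (fun S => tri₂ (X S) (Y S) (Z S)) := by
  have hN : ∀ {k : ℕ} {U : Wave → ℝ → ℝ → ℂ}, Deg k U →
      Deg k (fun S t x => WaterWave.hilbert (WaterWave.dx (U S) t) x) := fun hU => hU.dx.hilbert
  have h1 := hN ((hX.mul hY).mul hZ)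
  have h2 := (hX.mul (hN (hY.mul hZ))).mono (show m + n + p ≤ _ by omega)
  have h3 := (hY.mul (hN (hX.mul hZ))).mono (show m + n + p ≤ _ by omega)
  have h4 := (hZ.mul (hN (hX.mul hY))).mono (show m + n + p ≤ _ by omega)
  have h5 := (hX.mul hY).mul (hN hZ)
  have h6 := ((hX.mul hZ).mul (hN hY)).mono (show m + n + p ≤ _ by omega)
  have h7 := ((hY.mul hZ).mul (hN hX)).mono (show m + n + p ≤ _ by omega)
  exact (((((h1.sub h2).sub h3).sub h4).add h5).add h6).add h7

/-- `TriDeg n X`: for solutions, `X` is a sum of products of three differences, of degree at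
least `n`. -/
inductive TriDeg : ℕ → (Wave → ℝ → ℝ → ℝ → ℂ) → Prop
  | mk {m n p : ℕ} {f g h : Wave → ℝ → ℝ → ℂ} (hf : Deg m f) (hg : Deg n g) (hh : Deg p h) :
      TriDeg (m + n + p) (fun S t α β => dprod (f S t) (g S t) (h S t) α β)
  | smul {n : ℕ} {F : Wave → ℝ → ℝ → ℝ → ℂ} (c : ℂ) (hF : TriDeg n F) :
      TriDeg n (fun S t α β => c * F S t α β)
  | add {n : ℕ} {F G : Wave → ℝ → ℝ → ℝ → ℂ} (hF : TriDeg n F) (hG : TriDeg n G) :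
      TriDeg n (fun S t α β => F S t α β + G S t α β)
  | mono {m n : ℕ} {F : Wave → ℝ → ℝ → ℝ → ℂ} (hF : TriDeg n F) (h : m ≤ n) : TriDeg m F
  | congr {n : ℕ} {F G : Wave → ℝ → ℝ → ℝ → ℂ} (hF : TriDeg n F)
      (h : ∀ s : Sol, EqJ s.I (F s.S) (G s.S)) : TriDeg n G

theorem Deg.vf₁ {k n : ℕ} {c X : Wave → ℝ → ℝ → ℂ} (hc : Deg k c) (hX : Deg n X) :
    Deg (n + k) (fun S => vf₁ 0 (c S) (X S)) :=
  ((hc.mul hX.dx).mono (Nat.add_comm n k).le).congr fun s t _ x => by simp [WaterWave.vf₁]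

namespace TriDeg

variable {m n : ℕ} {F G : Wave → ℝ → ℝ → ℝ → ℂ}

theorem sub (hF : TriDeg n F) (hG : TriDeg n G) : TriDeg n (fun S t α β => F S t α β - G S t α β) :=
  (hF.add (hG.smul (-1))).congr fun _ _ _ _ _ => by ring

theorem tri (hF : TriDeg n F) (s : Sol) : Tri3 s.I (F s.S) := by
  induction hF with
  | mk hf hg hh => exact .mk (hf.sdec s) (hg.sdec s) (hh.sdec s)
  | smul c _ ih => exact ih.smul c
  | add _ _ ih ih' => exact ih.add ih'
  | mono _ _ ih => exact ih
  | congr _ h ih => exact ih.congr (h s)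

theorem DD (hF : TriDeg n F) : TriDeg n (fun S => S.DD (F S)) := by
  induction hF with
  | mk hf hg hh =>
    refine (((mk hf.D hg hh).add (mk hf hg.D hh)).add (mk hf hg hh.D)).congr fun s t ht α β => ?_
    rw [Wave.DD_eq, vf_dprod s.isOpen 1 _ (hf.sdec s) (hg.sdec s) (hh.sdec s) t ht]
    simp only [Wave.D_eq_vf]
  | smul c hF ih => exact (ih.smul c).congr fun s t _ α β => (s.DD_smul c _ t α β).symm
  | add hF hG ih ih' =>
    exact (ih.add ih').congr fun s => EqJ.symm (s.DD_add (hF.tri s).two (hG.tri s).two)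
  | mono _ h ih => exact ih.mono h
  | congr _ h ih => exact ih.congr fun s => s.DD_congr (h s)

theorem iterate_DD (hF : TriDeg n F) (m : ℕ) : TriDeg n (fun S => S.DD^[m] (F S)) := by
  induction m with
  | zero => exact hF
  | succ m ih => simp only [Function.iterate_succ_apply']; exact ih.DD

theorem vf {k : ℕ} {c : Wave → ℝ → ℝ → ℂ} (hc : Deg k c) (hF : TriDeg n F) :
    TriDeg (n + k) (fun S => vf 0 (c S) (F S)) := by
  induction hF with
  | @mk m n p f g h hf hg hh =>
    have h1 := (mk (hc.vf₁ hf) hg hh).mono (show m + n + p + k ≤ _ by omega)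
    have h2 := (mk hf (hc.vf₁ hg) hh).mono (show m + n + p + k ≤ _ by omega)
    have h3 := (mk hf hg (hc.vf₁ hh)).mono (show m + n + p + k ≤ _ by omega)
    exact ((h1.add h2).add h3).congr fun s => EqJ.symm
      (vf_dprod s.isOpen 0 _ (hf.sdec s) (hg.sdec s) (hh.sdec s))
  | smul a hF ih => exact (ih.smul a).congr fun s t _ α β => (vf_smul 0 _ a _ t α β).symm
  | add hF hG ih ih' =>
    exact (ih.add ih').congr fun s => EqJ.symm (vf_add s.isOpen 0 _ (hF.tri s).two (hG.tri s).two)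
  | mono _ h ih => exact ih.mono (by omega)
  | congr _ h ih => exact ih.congr fun s => (h s).vf s.isOpen 0 _

theorem row (hF : TriDeg n F) : Deg n (fun S => row (F S)) := by
  induction hF with
  | mk hf hg hh =>
    exact ((hf.tri₂ hg hh).smul (Real.pi * Complex.I)).congr fun s t ht x =>
      ((hf.sdec s).rowInt_eq s.isOpen (hg.sdec s) (hh.sdec s) ht x).symm
  | smul c _ ih => exact (ih.smul c).congr fun s t _ x => (row_smul c _ t x).symm
  | add hF hG ih ih' =>
    exact (ih.add ih').congr fun s => ((hF.tri s).row_add s.isOpen (hG.tri s)).symm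
  | mono _ h ih => exact ih.mono h
  | congr _ h ih => exact ih.congr fun s => row_congr (h s)

/-- To leading order, the material derivative commutes with integration in one variable. -/
theorem D_row_sub (hF : TriDeg n F) :
    Deg (n + 1) (fun S t x => S.D (WaterWave.row (F S)) t x - WaterWave.row (S.DD (F S)) t x) := by
  have h := ((Deg.bC.mul hF.row.dx).mono (Nat.add_comm n 1).le).sub (hF.vf Deg.bC).row
  refine h.congr fun s t ht x => ?_
  have hI := s.isOpen
  have hT := hF.tri s
  have e : EqJ s.I (s.S.DD (F s.S)) (fun t α β => WaterWave.vf 1 (fun _ _ => 0) (F s.S) t α β +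
      WaterWave.vf 0 s.S.bC (F s.S) t α β) := fun t _ α β => by
    simp only [Wave.DD_eq, WaterWave.vf]; ring
  rw [row_congr e t ht x, (hT.vf hI (.const hI 0) 1).row_add hI (hT.vf hI s.mult_b 0) t ht x,
    s.D_eq, (hT.sdec_row hI).2 t ht x]
  ring

theorem iterate_D_row_sub (hF : TriDeg n F) (m : ℕ) : Deg (n + 1) (fun S t x =>
    (S.D^[m] (WaterWave.row (F S))) t x - WaterWave.row (S.DD^[m] (F S)) t x) := by
  induction m with
  -- For m = 0 there is nothing to commute; each further D_t costs one commutator of degree n + 1,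
  -- by `D_row_sub`.
  | zero => exact (Deg.zero _).congr fun _ _ _ _ => by simp
  | succ m ih =>
    refine (ih.D.add (hF.iterate_DD m).D_row_sub).congr fun s t ht x => ?_
    have h1 := (hF.row.iterate_D m).sdec s
    have h2 := (hF.iterate_DD m).row.sdec s
    have e : EqI s.I (fun t x => (s.S.D^[m] (WaterWave.row (F s.S))) t x -
        WaterWave.row (s.S.DD^[m] (F s.S)) t x) (fun t x => (s.S.D^[m] (WaterWave.row (F s.S))) t x +
        (-1) * WaterWave.row (s.S.DD^[m] (F s.S)) t x) := fun t _ x => by ring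
    beta_reduce
    rw [s.D_congr e t ht x, s.D_add h1 (h2.smul s.isOpen (-1)) t ht x]
    beta_reduce
    rw [s.D_smul (-1) h2 t ht x, Function.iterate_succ_apply', Function.iterate_succ_apply']
    ring

theorem isQuintic {v : Wave → ℝ → ℝ → ℂ} (hv : Deg m v) (hF : TriDeg n F) (h : 5 ≤ m + n) :
    IsQuintic (fun S t => (pairInt (fun t α β => v S t α * F S t α β) t).re) :=
  (hv.isQuintic hF.row h).congr fun s t ht => by
    rw [(hF.tri s).pairInt_eq s.isOpen (hv.sdec s) ht]

end TriDeg

/-! ### The remainders are quintic -/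

namespace Wave

variable (S : Wave)

/-- The commutator of `a ∂_α` and `D_t` is `ce ∂_α`. -/
def ce (t x : ℝ) : ℂ := (1 + S.aC t x) * dx S.bC t x - S.D S.aC t x

/-- `(D_t² + i a ∂_α) D_t^l (conj Z_t)`. -/
def q (l : ℕ) (t x : ℝ) : ℂ :=
  S.D (S.D (S.D^[l] S.Vb)) t x + Complex.I * vf₁ 0 S.aF (S.D^[l] S.Vb) t x

end Wave

namespace Sol

variable (s : Sol) {F G : ℝ → ℝ → ℝ → ℂ} {f : ℝ → ℝ → ℂ} {t : ℝ}

theorem vf₁_aF_D (hf : SDec s.I f) : ∀ t ∈ s.I, ∀ x, vf₁ 0 s.S.aF (s.S.D f) t x =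
    s.S.D (vf₁ 0 s.S.aF f) t x + vf₁ 0 s.S.ce f t x :=
  fun t ht x => by
    have hI := s.isOpen
    have e : EqI s.I (vf₁ 0 s.S.aF f) (fun t x => dx f t x + s.S.aC t x * dx f t x) :=
      fun t _ x => by simp only [vf₁, Wave.aF, Wave.aC]; ring
    rw [s.D_congr e t ht x, s.D_add (hf.dx hI) (s.sdec_aC.mul hI (hf.dx hI)) t ht x]
    beta_reduce
    rw [s.D_mul s.sdec_aC (hf.dx hI) t ht x]
    beta_reduce
    rw [s.D_dx hf t ht x]
    simp only [vf₁, Wave.ce, show s.S.aF t x = 1 + s.S.aC t x by simp only [Wave.aF, Wave.aC]; ring]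
    ring

theorem two_vf_aF (hF : Two s.I F) : Two s.I (vf 0 s.S.aF F) := hF.vf s.isOpen s.mult_a 0

/-- A commutator of derivations is a derivation, so the identity propagates through sums and
products from functions of one variable, where it is `vf₁_aF_D`. -/
theorem vf_aF_DD (hF : Two s.I F) : ∀ t ∈ s.I, ∀ α β, vf 0 s.S.aF (s.S.DD F) t α β =
    s.S.DD (vf 0 s.S.aF F) t α β + vf 0 s.S.ce F t α β := by
  have hI := s.isOpen
  induction hF with
  | @left f hf =>
    intro t ht α β
    have h := s.vf₁_aF_D hf t ht α
    have e1 : s.S.DD (fun t α _ => f t α) = fun t α _ => s.S.D f t α := by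
      ext t α β; exact s.DD_left f t α β
    have e2 : vf 0 s.S.aF (fun t α _ => f t α) = fun t α _ => vf₁ 0 s.S.aF f t α := by
      ext t α β; exact vf_left 0 _ f t α β
    rw [e1, e2, vf_left, vf_left, s.DD_left, h]
  | @right f hf =>
    intro t ht α β
    have h := s.vf₁_aF_D hf t ht β
    have e0 : ∀ f, s.S.DD (fun t _ β => f t β) = fun t _ β => s.S.D f t β := fun f => by
      ext t α β; rw [Wave.DD_eq, Wave.D_eq_vf]; exact vf_right 1 _ f t α β
    have e2 : vf 0 s.S.aF (fun t _ β => f t β) = fun t _ β => vf₁ 0 s.S.aF f t β := by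
      ext t α β; exact vf_right 0 _ f t α β
    rw [e0, e2, vf_right, vf_right, e0, h]
  | @smul F c hF ih =>
    intro t ht α β
    have e1 : s.S.DD (fun t α β => c * F t α β) = fun t α β => c * s.S.DD F t α β := by
      ext t α β; exact s.DD_smul c F t α β
    have e2 : vf 0 s.S.aF (fun t α β => c * F t α β) = fun t α β => c * vf 0 s.S.aF F t α β := by
      ext t α β; exact vf_smul 0 _ c F t α β
    rw [e1, e2, vf_smul, vf_smul, s.DD_smul, ih t ht]
    ring
  | @add F G hF hG ih ih' =>
    intro t ht α β
    rw [(EqJ.vf hI (s.DD_add hF hG) 0 _) t ht, vf_add hI 0 _ (s.two_DD hF) (s.two_DD hG) t ht,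
      s.DD_congr (vf_add hI 0 _ hF hG) t ht, s.DD_add (s.two_vf_aF hF) (s.two_vf_aF hG) t ht,
      vf_add hI 0 _ hF hG t ht, ih t ht, ih' t ht]
    ring
  | @mul F G hF hG ih ih' =>
    intro t ht α β
    have h1 := s.two_DD hF
    have h2 := s.two_DD hG
    have h3 := s.two_vf_aF hF
    have h4 := s.two_vf_aF hG
    rw [(EqJ.vf hI (s.DD_mul hF hG) 0 _) t ht, vf_add hI 0 _ (h1.mul hG) (hF.mul h2) t ht,
      vf_mul hI 0 _ h1 hG t ht, vf_mul hI 0 _ hF h2 t ht,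
      s.DD_congr (vf_mul hI 0 _ hF hG) t ht, s.DD_add (h3.mul hG) (hF.mul h4) t ht,
      s.DD_mul h3 hG t ht, s.DD_mul hF h4 t ht, vf_mul hI 0 _ hF hG t ht, ih t ht, ih' t ht]
    ring
  | @congr F G hF h ih =>
    intro t ht α β
    have h' := h.symm
    rw [((s.DD_congr h').vf hI 0 _) t ht, s.DD_congr (h'.vf hI 0 _) t ht, h'.vf hI 0 _ t ht, ih t ht]

theorem P_DD (hF : Tri3 s.I F) : ∀ t ∈ s.I, ∀ α β, s.S.P (s.S.DD F) t α β =
    s.S.DD (s.S.P F) t α β + Complex.I * vf 0 s.S.ce F t α β := fun t ht α β => by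
  have h2 := s.two_vf_aF hF.two
  have e : EqJ s.I (s.S.P F) _ := fun t _ α β => s.S.P_eq F t α β
  rw [Wave.P_eq, s.vf_aF_DD hF.two t ht, s.DD_congr e t ht,
    s.DD_add (s.two_DD (s.two_DD hF.two)) (h2.smul _) t ht, s.DD_smul]
  ring

theorem P_θD (l : ℕ) : EqJ s.I (s.S.P (s.S.θD l)) (fun t α β => s.S.q l t α - s.S.q l t β) :=
  fun t ht α β => by
    have hI := s.isOpen
    have hu := s.sdec_iterate_Vb l
    have e := s.θD_eq l
    rw [Wave.P_eq, s.DD_congr ((s.DD_congr e).trans (s.DD_del hu)) t ht, s.DD_del (s.sdec_D hu) t ht,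
      e.vf hI 0 _ t ht, vf_del hI 0 _ hu t ht]
    simp only [Wave.q]
    ring

theorem P_star_VD (j : ℕ) (t α β : ℝ) : s.S.P (star (s.S.VD j)) t α β = s.S.q j t α := by
  have e : star (s.S.VD j) = fun t α _ => (s.S.D^[j] s.S.Vb) t α := by
    ext t α β; exact (s.iterate_D_Vb j t α).symm
  have e1 : ∀ f, s.S.DD (fun t α _ => f t α) = fun t α _ => s.S.D f t α := fun f => by
    ext t α β; exact s.DD_left f t α β
  rw [e, Wave.P_eq, e1, e1, vf_left, Wave.q]

end Sol

theorem Deg.ce : Deg 1 (fun S => S.ce) :=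
  ((bC.dx.add (aC.mul_left bC.dx)).sub aC.D).congr fun s t _ x => by simp only [Wave.ce]; ring

/-- For l = 0 the linear parts cancel: D_t² Z̄_t is −i D_t(1/Z_α) to first order, D_t(1/Z_α) is b_α
− Z_{tα}, and b is Z_t + Z̄_t, so −i Z̄_{tα} meets i a Z̄_{tα}. The induction on l commutes the
operator with D_t at the quadratic cost i·`ce`·∂. -/
theorem Deg.q (l : ℕ) : Deg 2 (fun S => S.q l) := by
  induction l with
  | zero =>
    have hXX := V.mul W
    have h1 : Deg 2 (fun S t x => S.bC t x - S.V t x - S.Vb t x) := by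
      have h := hXX.sub hXX.hilbert
      refine ((h.add h.conj).smul (1 / 2)).congr fun s t ht x => ?_
      have hI := s.isOpen
      have e1 : WaterWave.hilbert (s.S.X t) x = -s.S.V t x + WaterWave.hilbert (fun y => s.S.V t y * s.S.W t y) x := by
        have e : s.sdec_X.at hI ht = s.sdec_V.at hI ht + s.sdec_V.at hI ht * s.sdec_W.at hI ht :=
          HInf.ext fun x => by
            simp only [HInf.add_apply, HInf.mul_apply, SDec.at_apply, Wave.X]; ring
        have h := congrArg (fun f => HInf.H f x) e
        rw [map_add, s.anti_V ht] at h
        exact h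
      rw [s.bC_eq t ht x]
      beta_reduce
      rw [e1]
      simp only [Wave.X, Wave.Vb, star_sub, star_add, star_neg, star_mul', star_one]
      ring
    have h2 := (AC.mul_one_add_W).D
    have h3 := aC.mul Vb.dx
    have h4 := ((W.mul bC.dx).sub (V.dx.mul W)).sub (((V.dx.mul W).mul_one_add_W))
    refine (((h1.dx.add h2).add h4).smul (-Complex.I) |>.add (h3.smul Complex.I)).congr
      fun s t ht x => ?_
    have hI := s.isOpen
    have e := s.D_congr s.D_V t ht x
    have hA := (AC.mul_one_add_W).sdec s
    rw [s.D_smul _ (s.sdec_W.add hI hA) t ht x] at e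
    beta_reduce at e
    rw [s.D_add s.sdec_W hA t ht x] at e
    beta_reduce at e
    rw [s.D_W t ht x] at e
    simp only [Wave.q, Function.iterate_zero, id]
    rw [e]
    have r : WaterWave.dx (fun t x => s.S.bC t x - s.S.V t x - s.S.Vb t x) t x =
        WaterWave.dx s.S.bC t x - WaterWave.dx s.S.V t x - WaterWave.dx s.S.Vb t x :=
      (((s.sdec_b.hasDerivAt_x ht x).sub (s.sdec_V.hasDerivAt_x ht x)).sub
        (s.sdec_Vb.hasDerivAt_x ht x)).deriv
    beta_reduce
    rw [r]
    simp only [WaterWave.vf₁, show s.S.aF t x = 1 + s.S.aC t x by simp only [Wave.aF, Wave.aC]; ring]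
    ring
  | succ l ih =>
    refine (ih.D.add ((ce.mul (Vb.iterate_D l).dx).smul Complex.I)).congr fun s t ht x => ?_
    have hI := s.isOpen
    have hu := s.sdec_iterate_Vb l
    have e : s.S.D (s.S.q l) t x = _ := s.D_add (s.sdec_D (s.sdec_D hu))
      ((s.mult_a.vf₁ hI 0 hu).smul hI Complex.I) t ht x
    beta_reduce at e ⊢
    rw [s.D_smul _ (s.mult_a.vf₁ hI 0 hu) t ht x] at e
    rw [e]
    have h := s.vf₁_aF_D hu t ht x
    simp only [Wave.q, Function.iterate_succ_apply']
    rw [h]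
    simp only [WaterWave.vf₁]
    ring

namespace TriDeg

variable {m n : ℕ} {F G : Wave → ℝ → ℝ → ℝ → ℂ}

theorem T (l i k : ℕ) : TriDeg 3 (fun S => S.T l i k) :=
  (mk (Deg.Vb.iterate_D l) (Deg.V.iterate_D i) (Deg.Vb.iterate_D k)).congr
    fun s => (s.T_eq_dprod l i k).symm

theorem P_iterate_DD_sub (hF : TriDeg n F) (m : ℕ) : TriDeg (n + 1) (fun S t α β =>
    S.P (S.DD^[m] (F S)) t α β - (S.DD^[m] (S.P (F S))) t α β) := by
  induction m with
  -- The commutator is zero here; zero is represented as 0 times some available expression of degree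
  -- n + 1.
  | zero => exact ((hF.vf Deg.bC).smul 0).congr fun s t ht α β => by simp
  | succ m ih =>
    refine (ih.DD.add (((hF.iterate_DD m).vf Deg.ce).smul Complex.I)).congr fun s t ht α β => ?_
    have h1 := s.tri_P ((hF.iterate_DD m).tri s)
    have h2 := s.tri_iterate_DD (s.tri_P (hF.tri s)) m
    simp only [Function.iterate_succ_apply']
    rw [s.P_DD ((hF.iterate_DD m).tri s) t ht, s.DD_sub h1.two h2.two t ht]
    ring

theorem isQuintic_vf {p k : ℕ} {v c : Wave → ℝ → ℝ → ℂ} (hv : Deg p v) (hc : Deg k c)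
    (hF : TriDeg n F) (h : 5 ≤ p + n + k) : IsQuintic (fun S t =>
      (pairInt (WaterWave.vf 0 (c S) fun t α β => v S t α * F S t α β) t).re) := by
  refine ((hF.isQuintic (hc.vf₁ hv) (by omega)).add ((hF.vf hc).isQuintic hv (by omega))).congr
    fun s t ht => ?_
  have hI := s.isOpen
  have hT := hF.tri s
  have e : EqJ s.I (WaterWave.vf 0 (c s.S) fun t α β => v s.S t α * F s.S t α β) (fun t α β =>
      WaterWave.vf₁ 0 (c s.S) (v s.S) t α * F s.S t α β +
        v s.S t α * WaterWave.vf 0 (c s.S) (F s.S) t α β) := fun t ht α β => by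
    rw [vf_mul hI 0 _ (.left (hv.sdec s)) hT.two t ht, vf_left]
  rw [pairInt_congr e ht, pairInt_add hI ht (hT.left_mul ((hc.vf₁ hv).sdec s))
    (((hF.vf hc).tri s).left_mul (hv.sdec s)), Complex.add_re]

theorem isQuintic_κb {p : ℕ} {v : Wave → ℝ → ℝ → ℂ} (hv : Deg p v) (hF : TriDeg n F)
    (h : 4 ≤ p + n) : IsQuintic (fun S t =>
      (pairInt (fun t α β => S.κb t α β * (v S t α * F S t α β)) t).re) :=
  (isQuintic_vf hv Deg.bC hF (by omega)).neg.congr fun s t ht => by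
    rw [s.pairInt_κb ((hF.tri s).left_mul (hv.sdec s)) ht, Complex.neg_re]

theorem isQuintic_κa {p : ℕ} {v : Wave → ℝ → ℝ → ℂ} (hv : Deg p v) (hF : TriDeg n F)
    (h : 4 ≤ p + n) : IsQuintic (fun S t =>
      (pairInt (fun t α β => S.κa t α β * (v S t α * F S t α β)) t).re) :=
  (isQuintic_vf hv Deg.aC hF (by omega)).neg.congr fun s t ht => by
    rw [s.pairInt_κa ((hF.tri s).left_mul (hv.sdec s)) ht, Complex.neg_re]

/-- The left side of Leibniz' rule for `𝒫`. -/
theorem P_terms (l i k : ℕ) : TriDeg 4 (fun S => S.P (S.θD l) * S.θbarD i * S.θD k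
      - S.θD l * star (S.P (S.θD i)) * S.θD k + S.θD l * S.θbarD i * S.P (S.θD k)) := by
  have u := fun l => Deg.Vb.iterate_D l
  have v := fun l => Deg.V.iterate_D l
  refine ((((mk (Deg.q l) (v i) (u k)).mono (Nat.le_refl 4)).sub
    ((mk (u l) (Deg.q i).conj (u k)).mono (Nat.le_refl 4))).add
      ((mk (u l) (v i) (Deg.q k)).mono (Nat.le_refl 4))).congr fun s t ht α β => ?_
  simp only [Pi.add_apply, Pi.sub_apply, Pi.mul_apply, Pi.star_apply, s.P_θD _ t ht, s.θbarD_eq,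
    s.θD_eq _ t ht, dprod, star_sub, s.iterate_D_Vb, star_star]

end TriDeg

/-- The underlying product v_j θ_l θ̄_i θ_k has degree four. Each of the five terms adds at least
one: a commutator of 𝒫 with 𝔇_t^m, 𝒫 acting on a single factor, or one of κ[b], κ[a]. -/
theorem IsQuintic.R (m j l i k : ℕ) : IsQuintic (fun S t => (S.R m j l i k t).re) := by
  have hv := Deg.V.iterate_D j
  have hv' := Deg.V.iterate_D (j + 1)
  have hT := TriDeg.T l i k
  have hX := hT.iterate_DD m
  have h1 := (hT.P_iterate_DD_sub m).isQuintic hv (by omega)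
  have h2 := ((TriDeg.P_terms l i k).iterate_DD m).isQuintic hv (by omega)
  have h3 := hX.isQuintic (Deg.q j).conj (by omega)
  have h4 := hX.DD.isQuintic_κb hv (by omega)
  have h4' := hX.isQuintic_κb hv' (by omega)
  have h5 := hX.isQuintic_κa (hv.smul Complex.I) (by omega)
  refine ((((h1.add h2).sub h3).add (h4.sub h4')).add h5).congr fun s t ht => ?_
  have hI := s.isOpen
  have q1 := (hX.DD.tri s).left_mul (hv.sdec s)
  have q2 := (hX.tri s).left_mul (hv'.sdec s)
  have e3 : star (s.S.P (star (s.S.VD j))) = fun t α _ => star (s.S.q j t α) := by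
    ext t α β; rw [Pi.star_apply, Pi.star_apply, Pi.star_apply, s.P_star_VD]
  have e4 : pairInt (s.S.κb * s.S.skew (s.S.VD j) (s.S.VD (j + 1)) (s.S.DD^[m] (s.S.T l i k))) t =
      pairInt (fun t α β => s.S.κb t α β *
        ((s.S.D^[j] s.S.V) t α * s.S.DD (s.S.DD^[m] (s.S.T l i k)) t α β)) t -
      pairInt (fun t α β => s.S.κb t α β *
        ((s.S.D^[j + 1] s.S.V) t α * (s.S.DD^[m] (s.S.T l i k)) t α β)) t := by
    rw [s.pairInt_κb q1 ht, s.pairInt_κb q2 ht]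
    refine (s.pairInt_κb (q1.sub q2) ht).trans ?_
    rw [pairInt_congr (vf_sub hI 0 _ q1.two q2.two) ht, pairInt_sub hI ht
      (q1.vf hI s.mult_b 0) (q2.vf hI s.mult_b 0)]
    ring
  have e5 : Complex.I * pairInt (s.S.κa * (s.S.VD j * s.S.DD^[m] (s.S.T l i k))) t =
      pairInt (fun t α β => s.S.κa t α β * (Complex.I * (s.S.D^[j] s.S.V) t α *
        (s.S.DD^[m] (s.S.T l i k)) t α β)) t := by
    rw [← pairInt_smul]
    refine pairInt_congr (I := s.I) (fun t ht α β => ?_) ht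
    simp only [Pi.mul_apply, Wave.VD]
    ring
  rw [Wave.R, ← s.T_eq, s.DD_VD, e3, e4, e5]
  simp only [Complex.add_re, Complex.sub_re]
  rfl

theorem IsQuintic.RIC (j : ℕ) : IsQuintic (fun S => S.RIC j) := by
  have hκ : ∀ l i k, IsQuintic (fun S t =>
      (pairInt (S.κb * (S.VD j * S.θD l * S.θbarD i * S.θD k)) t).re) := fun l i k =>
    ((TriDeg.T l i k).isQuintic_κb (Deg.V.iterate_D j) (by omega)).congr fun s t ht => by
      rw [s.T_eq]
      congr 2
      ext t α β
      simp only [Pi.mul_apply, Wave.VD]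
      ring
  refine (((((IsQuintic.sum _ fun l _ => hκ (j - l - 1) 0 (1 + l)).smul _).sub
    ((((IsQuintic.sum _ fun l _ => IsQuintic.sum _ fun k _ => R (l - k) j k 0 (j - l - 1)).smul 2).add
      (IsQuintic.sum _ fun l _ => IsQuintic.sum _ fun k _ => ((R 0 j (1 + l) k (j - l - 2 - k)).sub
        (R 0 0 (j - l - 1) (j - k - 1) (l + k + 1))).smul ((-1) ^ k))).smul _)).sub
    ((hκ 0 j 0).smul _)).sub
    ((IsQuintic.sum _ fun k _ => (R 0 j 0 k (j - k - 1)).smul ((-1) ^ k)).smul _)).congr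
    fun s t _ => s.RIC_eq j t

/-! ### The leading part of the remainder -/

namespace Wave

variable (S : Wave)

/-- The density in two variables of `sharp (K n)`. -/
def M (n : ℕ) (t α β : ℝ) : ℂ := 1 / (2 * Real.pi * Complex.I) *
  (dprod (S.W t) (S.V t) (S.phi n t) α β - dprod (S.Vb t) (fun x => star (S.W t x)) (S.phi n t) α β)

/-- The leading part of `M`. -/
def M₁ (n : ℕ) (t α β : ℝ) : ℂ := 1 / (2 * Real.pi) * (S.T 1 0 n t α β + S.T 0 1 n t α β)

end Wave

namespace TriDeg

theorem M (n : ℕ) : TriDeg 3 (fun S => S.M n) :=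
  (((mk .W .V (.phi n)).mono (Nat.le_refl 3)).sub ((mk .Vb (.conj .W) (.phi n)).mono (Nat.le_refl 3))).smul _

theorem M₁ (n : ℕ) : TriDeg 3 (fun S => S.M₁ n) := ((T 1 0 n).add (T 0 1 n)).smul _

/-- Replace 1/Z_α − 1 by i D_t Z̄_t and φ_n by D_t^n Z̄_t, with quadratic errors. The factors ±i
combine with 1/(2πi), and the two triple products become the two terms of 𝔇_t(θθ̄)θ_n. -/
theorem M_sub (n : ℕ) : TriDeg 4 (fun S t α β => S.M n t α β - S.M₁ n t α β) := by
  have h1 := ((mk Deg.W_sub .V (.phi n)).mono (Nat.le_refl 4)).sub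
    ((mk .Vb Deg.W_sub.conj (.phi n)).mono (Nat.le_refl 4))
  have h2 := ((mk Deg.Vb.D .V (.phi_sub n)).mono (Nat.le_refl 4)).add
    ((mk .Vb Deg.V.D (.phi_sub n)).mono (Nat.le_refl 4))
  refine ((h1.smul (1 / (2 * Real.pi * Complex.I))).add (h2.smul (1 / (2 * Real.pi)))).congr
    fun s t ht α β => ?_
  have hD : ∀ x, s.S.D s.S.Vb t x = star (s.S.D s.S.V t x) := fun x => s.iterate_D_Vb 1 t x
  have hI : (1 : ℂ) / (2 * Real.pi * Complex.I) = 1 / (2 * Real.pi) * -Complex.I := by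
    rw [one_div, mul_inv, Complex.inv_I, one_div]
  simp only [Wave.M, Wave.M₁, s.T_eq_dprod _ _ _ t ht, dprod, hI, Function.iterate_succ_apply',
    Function.iterate_zero, id, hD, star_sub, star_mul', Complex.star_def, Complex.conj_I,
    Complex.conj_conj]
  linear_combination (1 / (2 * Real.pi) : ℂ) * (((starRingEnd ℂ) (s.S.D s.S.V t α) -
    (starRingEnd ℂ) (s.S.D s.S.V t β)) * (s.S.V t α - s.S.V t β) +
    (s.S.Vb t α - s.S.Vb t β) * (s.S.D s.S.V t α - s.S.D s.S.V t β)) *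
    (s.S.phi n t α - s.S.phi n t β) * Complex.I_sq

end TriDeg

namespace Sol

variable (s : Sol) {t : ℝ}

/-- `sharp_K` rewritten with a density in two variables; `tri` is the row divided by π i, whence the
constant 1/(2πi) in `M`. -/
theorem sharp_K_eq (n : ℕ) : EqI s.I (fun t x => Complex.I * s.S.sharp (s.S.K n) t x)
    (projH (row (s.S.M n))) := fun t ht x => by
  have hI := s.isOpen
  have h := congrArg (fun f : HInf => f x) (s.sharp_K n ht)
  refine Eq.trans h ?_
  have e : row (s.S.M n) t = ((1 / 2 : ℂ) • (HInf.tri (s.sdec_W.at hI ht) (s.sdec_V.at hI ht)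
        ((s.sdec_phi n).at hI ht) - HInf.tri (s.sdec_Vb.at hI ht) (HInf.conj (s.sdec_W.at hI ht))
        ((s.sdec_phi n).at hI ht)) : HInf) := by
    ext x
    have t1 := Tri3.mk s.sdec_W s.sdec_V (s.sdec_phi n)
    have t2 := Tri3.mk s.sdec_Vb (s.sdec_W.star hI) (s.sdec_phi n)
    have e1 : EqJ s.I (s.S.M n) (fun t α β => 1 / (2 * Real.pi * Complex.I) *
      (dprod (s.S.W t) (s.S.V t) (s.S.phi n t) α β +
        (-1) * dprod (s.S.Vb t) (fun x => star (s.S.W t x)) (s.S.phi n t) α β)) :=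
      fun t _ α β => by rw [Wave.M]; ring
    have r1 : row (fun t α β => dprod (s.S.W t) (s.S.V t) (s.S.phi n t) α β) t x = _ :=
      s.sdec_W.rowInt_eq hI s.sdec_V (s.sdec_phi n) ht x
    have r2 : row (fun t α β => dprod (s.S.Vb t) (fun x => star (s.S.W t x)) (s.S.phi n t) α β) t x = _ :=
      s.sdec_Vb.rowInt_eq hI (s.sdec_W.star hI) (s.sdec_phi n) ht x
    rw [row_congr e1 t ht x, row_smul, t1.row_add hI (t2.smul (-1)) t ht x]
    beta_reduce
    rw [row_smul, r1, r2, s.sdec_W.tri₂_eq hI s.sdec_V (s.sdec_phi n) ht,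
      s.sdec_Vb.tri₂_eq hI (s.sdec_W.star hI) (s.sdec_phi n) ht]
    have hp : (Real.pi : ℂ) ≠ 0 := Complex.ofReal_ne_zero.2 Real.pi_ne_zero
    have hII := Complex.I_ne_zero
    simp only [HInf.smul_apply, HInf.sub_apply]
    rw [show HInf.conj (s.sdec_W.at hI ht) = (s.sdec_W.star hI).at hI ht from rfl]
    field_simp
    ring
  rw [projH, e, HInf.PH_apply]

theorem hol_iterate_HD_K (n m : ℕ) (ht : t ∈ s.I) :
    HInf.Hol ((s.sdec_iterate_HD (s.sdec_K n) m).at s.isOpen ht) := by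
  cases m with
  | zero => exact s.hol_projH ((s.sdec_G (n + 1)).sub s.isOpen (s.sdec_D (s.sdec_projH_G n))) ht
  | succ m =>
    have h := s.hol_HD (s.sdec_iterate_HD (s.sdec_K n) m) ht
    simp only [Function.iterate_succ_apply']
    exact h

end Sol

/-- For m = 0 the sum is exactly zero by `sharp_K_eq`. In the inductive step `sharp_HD` replaces ℙ_H
D_t by D_t up to terms with an extra factor, and these have degree four because the function they
act on is known to be cubic. For this reason both bounds are proved together. -/
theorem Deg.sharp_iterate_HD_K (n m : ℕ) : Deg 4 (fun S t x => S.sharp (S.HD^[m] (S.K n)) t x +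
    Complex.I * WaterWave.projH (S.D^[m] (row (S.M n))) t x) ∧ Deg 3 (fun S => S.sharp (S.HD^[m] (S.K n))) := by
  have hr := (TriDeg.M n).row.iterate_D
  have aux : ∀ m, Deg 4 (fun S t x => S.sharp (S.HD^[m] (S.K n)) t x +
      Complex.I * WaterWave.projH (S.D^[m] (row (S.M n))) t x) →
      Deg 3 (fun S => S.sharp (S.HD^[m] (S.K n))) := fun m h =>
    ((h.mono (by omega)).sub ((hr m).projH.smul Complex.I)).congr fun s t _ x => by ring
  suffices h : Deg 4 (fun S t x => S.sharp (S.HD^[m] (S.K n)) t x +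
      Complex.I * WaterWave.projH (S.D^[m] (row (S.M n))) t x) from ⟨h, aux m h⟩
  induction m with
  | zero =>
    refine (Deg.zero 4).congr fun s t ht x => ?_
    have h := s.sharp_K_eq n t ht x
    beta_reduce at h
    simp only [Function.iterate_zero, id]
    rw [← h]
    linear_combination -(s.S.sharp (s.S.K n) t x) * Complex.I_sq
  | succ m ih =>
    have hs := aux m ih
    have g1 := (Vb.mul ((hs.add (W.conj.mul_left hs)).projH.dx))
    have g2 := (((Vb.mul_one_add_Wb.sub bC).mul hs).projH.dx)
    have g3 := bC.mul hs.dx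
    have g4 := (hr m).D_projH_sub.smul Complex.I
    refine ((((g1.sub g2).sub g3).add ih.D).sub g4).congr fun s t ht x => ?_
    have hI := s.isOpen
    have hX := s.sdec_iterate_HD (s.sdec_K n) m
    have h := s.sharp_HD hX (fun t ht => s.hol_iterate_HD_K n m ht) t ht x
    have hP := (hr m).projH.sdec s
    have e : s.S.D (fun t x => s.S.sharp (s.S.HD^[m] (s.S.K n)) t x +
      Complex.I * WaterWave.projH (s.S.D^[m] (row (s.S.M n))) t x) t x = _ :=
      s.D_add (s.sdec_sharp hX) (hP.smul hI Complex.I) t ht x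
    beta_reduce at e ⊢
    rw [s.D_smul _ hP t ht x] at e
    simp only [Function.iterate_succ_apply']
    rw [h, e, s.D_eq (s.S.sharp _)]
    have r : (fun t x => (s.S.Vb t x * (1 + star (s.S.W t x)) - s.S.bC t x) *
        s.S.sharp (s.S.HD^[m] (s.S.K n)) t x) = fun t x => (s.S.Vb t x + s.S.Vb t x *
        star (s.S.W t x) - s.S.bC t x) * s.S.sharp (s.S.HD^[m] (s.S.K n)) t x := by
      ext t x; ring
    rw [r]
    ring

/-- Four replacements, each gaining a degree: `sharp (HD^[m] (K n))` by its leading part, D_t^m of a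
row by the row of 𝔇_t^m, M by M₁, and φ_j by D_t^j Z̄_t. The projection in the leading part
disappears against the antiholomorphic φ̄_j. -/
theorem IsQuintic.integral_iterate_HD_K (j n m : ℕ) : IsQuintic (fun S t =>
    (∫ x, Complex.I * dx (star (S.Θ j)) t x * (S.HD^[m] (S.K n)) t x).re -
    1 / (2 * Real.pi) * (pairInt (S.VD j * S.DD^[m] (S.DD (S.θ * star S.θ) * S.θD n)) t).re) := by
  have hR := (TriDeg.M n).row.iterate_D m
  have h4 := (Deg.sharp_iterate_HD_K n m).1.smul Complex.I
  have h4' := (TriDeg.M n).iterate_D_row_sub m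
  have h4'' := ((TriDeg.M_sub n).iterate_DD m).row
  have hφ := (Deg.phi j).conj
  have hv := Deg.V.iterate_D j
  have hφv := (Deg.phi_sub j).conj
  have hM := (TriDeg.M₁ n).iterate_DD m
  refine ((hφ.isQuintic ((h4.add h4').add h4'') le_rfl).add (hφv.isQuintic hM.row le_rfl)).congr
    fun s t ht => ?_
  have hI := s.isOpen
  have int : ∀ {f g : ℝ → ℝ → ℂ}, SDec s.I f → SDec s.I g → Integrable fun x => f t x * g t x :=
    fun hf hg => HInf.integrable_mul (hf.at hI ht) (hg.at hI ht)
  have e1 : row (s.S.DD^[m] (s.S.M n)) t = fun x => row (s.S.DD^[m] (s.S.M₁ n)) t x +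
      row (s.S.DD^[m] fun t α β => s.S.M n t α β - s.S.M₁ n t α β) t x := by
    ext x
    have e : EqJ s.I (s.S.M n) (fun t α β => s.S.M₁ n t α β + (s.S.M n t α β - s.S.M₁ n t α β)) :=
      fun t _ α β => by ring
    have t1 := (TriDeg.M₁ n).tri s
    have t2 := (TriDeg.M_sub n).tri s
    rw [row_congr ((s.iterate_DD_congr e m).trans (s.iterate_DD_add t1 t2 m)) t ht x,
      (s.tri_iterate_DD t1 m).row_add hI (s.tri_iterate_DD t2 m) t ht x]
  have e2 : pairInt (s.S.VD j * s.S.DD^[m] (s.S.DD (s.S.θ * star s.S.θ) * s.S.θD n)) t =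
      2 * Real.pi * ∫ x, (s.S.D^[j] s.S.V) t x * row (s.S.DD^[m] (s.S.M₁ n)) t x := by
    rw [← (hM.tri s).pairInt_eq hI (hv.sdec s) ht, ← pairInt_smul]
    have e : EqJ s.I (s.S.DD (s.S.θ * star s.S.θ) * s.S.θD n)
        (fun t α β => 2 * Real.pi * s.S.M₁ n t α β) := fun t ht α β => by
      have hp : (Real.pi : ℂ) ≠ 0 := Complex.ofReal_ne_zero.2 Real.pi_ne_zero
      rw [s.DD_sq_mul n t ht]
      simp only [Wave.M₁]
      field_simp
    refine pairInt_congr (I := s.I) (fun t ht α β => ?_) ht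
    simp only [Pi.mul_apply]
    rw [s.iterate_DD_congr e m t ht, s.iterate_DD_smul _ _ m t ht, Wave.VD]
    ring
  have e3 : (∫ x, Complex.I * dx (star (s.S.Θ j)) t x * (s.S.HD^[m] (s.S.K n)) t x) =
      (∫ x, star (s.S.phi j t x) * (Complex.I * (s.S.sharp (s.S.HD^[m] (s.S.K n)) t x +
        Complex.I * projH (s.S.D^[m] (row (s.S.M n))) t x))) +
      ∫ x, star (s.S.phi j t x) * (s.S.D^[m] (row (s.S.M n))) t x := by
    have h := HInf.integral_anti_mul_PH ((s.hol_phi j ht).conj) ((hR.sdec s).at hI ht)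
    rw [← (hR.sdec s).at_projH hI ht] at h
    have h' : ∫ x, star (s.S.phi j t x) * projH (s.S.D^[m] (row (s.S.M n))) t x = _ := h
    rw [s.integral_dx_Θ_mul j (s.sdec_iterate_HD (s.sdec_K n) m) ht]
    refine Eq.trans ?_ (congrArg _ h')
    rw [← integral_add (int (hφ.sdec s) (h4.sdec s)) (int (hφ.sdec s) (hR.projH.sdec s))]
    congr 1; ext x
    linear_combination -(star (s.S.phi j t x)) * projH (s.S.D^[m] (row (s.S.M n))) t x * Complex.I_sq
  have hE := (h4.add h4').add h4''
  have e4 : (∫ x, star (s.S.phi j t x) * (Complex.I * (s.S.sharp (s.S.HD^[m] (s.S.K n)) t x +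
        Complex.I * projH (s.S.D^[m] (row (s.S.M n))) t x))) +
      (∫ x, star (s.S.phi j t x) * (s.S.D^[m] (row (s.S.M n))) t x) = (∫ x, star (s.S.phi j t x) *
        (Complex.I * (s.S.sharp (s.S.HD^[m] (s.S.K n)) t x +
        Complex.I * projH (s.S.D^[m] (row (s.S.M n))) t x) + ((s.S.D^[m] (row (s.S.M n))) t x -
        row (s.S.DD^[m] (s.S.M n)) t x) +
        row (s.S.DD^[m] fun t α β => s.S.M n t α β - s.S.M₁ n t α β) t x)) +
      (∫ x, star (s.S.phi j t x - (s.S.D^[j] s.S.Vb) t x) * row (s.S.DD^[m] (s.S.M₁ n)) t x) +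
      ∫ x, (s.S.D^[j] s.S.V) t x * row (s.S.DD^[m] (s.S.M₁ n)) t x := by
    rw [← integral_add (int (hφ.sdec s) (h4.sdec s)) (int (hφ.sdec s) (hR.sdec s)),
      ← integral_add (int (hφ.sdec s) (hE.sdec s)) (int (hφv.sdec s) (hM.row.sdec s))]
    refine Eq.trans ?_ (integral_add ((int (hφ.sdec s) (hE.sdec s)).add
      (int (hφv.sdec s) (hM.row.sdec s))) (int (hv.sdec s) (hM.row.sdec s)))
    congr 1; ext x
    rw [e1, star_sub, s.iterate_D_Vb, star_star]
    ring
  rw [e3, e4, e2, show (2 * Real.pi : ℂ) = ((2 * Real.pi : ℝ) : ℂ) by push_cast; rfl,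
    Complex.re_ofReal_mul, ← mul_assoc, one_div_mul_cancel (by positivity), one_mul,
    Complex.add_re, Complex.add_re, add_sub_cancel_right]

/-- The terms of the sum are the case (n, m) = (j−1−l, l+1), where twice 1/(2π) is the constant 1/π
of I_{1,j}; the single term is the case (j, 0), with the constant 1/(2π) of I_{2,j}. -/
theorem IsQuintic.remainder (j : ℕ) : IsQuintic (fun S => S.remainder j) := by
  have h1 := IsQuintic.sum (Finset.range j) fun l _ => integral_iterate_HD_K j (j - 1 - l) (l + 1)
  refine (((h1.smul 2).add (integral_iterate_HD_K j j 0)).add (RIC j)).congr fun s t ht => ?_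
  rw [Wave.remainder, Wave.I₁, Wave.I₂, Finset.sum_sub_distrib, ← Finset.mul_sum, Complex.re_sum,
    Complex.re_sum]
  simp only [Nat.sub_right_comm j 1, Function.iterate_zero, id]
  have hp := Real.pi_ne_zero
  field_simp

end WaterWave

end

theorem theorem2p1 (j : ℕ) :
    (∀ (S : WaterWave.Wave) (I : Set ℝ), IsOpen I → S.IsSolution I → ∀ t ∈ I,
      HasDerivAt (S.correctedEnergy j) (S.remainder j t) t) ∧
    WaterWave.IsQuintic (fun S => S.remainder j) := by
  refine ⟨fun S I hI hS t ht => ?_, .remainder j⟩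
  let s : WaterWave.Sol := ⟨S, I, hI, hS⟩
  -- The corrections contribute −(I_{1,j} + I_{2,j} − R_{IC,j}), exactly the terms by which the
  -- remainder differs from the derivative in `hasDerivAt_energy`.
  refine ((s.hasDerivAt_energy j ht).sub (s.hasDerivAt_C j ht)).congr_of_eventuallyEq
    (Eventually.of_forall fun t => ?_) |>.congr_deriv ?_
  · simp only [WaterWave.Wave.correctedEnergy, Complex.add_re, Pi.sub_apply]
    ring
  · simp only [WaterWave.Wave.remainder]
    ring
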